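/- \textbf{Setting.} Let $(V,\|\cdot\|)$ be a separable Banach space with the Radon–Nikodým property, $V^*$ its dual with dual norm $\|\cdot\|_*$, and $T>0$. Let $\Psi:V\to[0,\infty)$ be continuous, convex, positively $1$-homogeneous, with $\Psi(v)>0$ for $v\ne0$. Let $\Phi(v)=F(\|v\|)$ with $F\in C^1([0,\infty))$ convex, $F(r)>0$ for $r>0$, $F(0)=F'(0)=0$, $F'(r)\to\infty$ as $r\to\infty$. Let $D\subset V$ and let $\mathcal E:[0,T]\times D\to\mathbb R$ be lower semicontinuous ($\mathcal E_t=+\infty$ outside $D$), and for $E>0$ put $D_E=\{u\in D:\Psi(u)+\sup_{t\in[0,T]}\mathcal E_t(u)\le E\}$. Write $\partial\Psi$ for the convex subdifferential of $\Psi$, $K^*=\{\xi\in V^*:\langle\xi,w\rangle\le\Psi(w)\ \forall w\}$, and $\partial\mathcal E_t$ for the Fréchet subdifferential. Assume: (E1) every $D_E$ is compact; (E2) for $u\in D$ the map $t\mapsto\mathcal E_t(u)$ is differentiable on $[0,T]$ with derivative $\mathcal P_t(u)$, and there is $C_P\ge0$ such that for all $(t,u)\in(0,T)\times D$ and $E>0$,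 $|\mathcal P_t(u)|\le C_P(\Psi(u)+\mathcal E_t(u))$ and $\limsup_{w\to u,\,w\in D_E}\mathcal P_t(w)\le\mathcal P_t(u)$; (E3) for every $E>0$ there is an upper semicontinuous $\omega^E:[0,T]\times D_E\times D_E\to\mathbb R$ with $\omega^E_t(u,u)=0$ such that $\mathcal E_t(v)\ge\mathcal E_t(u)+\langle\xi,v-u\rangle-\omega^E_t(u,v)\min(\Psi(v-u),\Psi(u-v))$ for all $t\in[0,T]$, $u,v\in D_E$, $\xi\in\partial\mathcal E_t(u)$. \textbf{Finsler cost.} Let $\Psi_\varepsilon(v)=\Psi(v)+\varepsilon^{-1}\Phi(\varepsilon v)$, with conjugate $\Psi_\varepsilon^*$, let $\mathfrak p(v,\xi)=\inf_{\varepsilon>0}(\Psi_\varepsilon(v)+\Psi^*_\varepsilon(\xi))$, $\mathfrak f_t(u;v)=\inf\{\mathfrak p(v,\xi):\xi\in-\partial\mathcal E_t(u)\}$, $\mathfrak e_t(u)=\inf\{\|\xi-z\|_*:\xi\in-\partial\mathcal E_t(u),z\in K^*\}$, where $\inf\emptyset=+\infty$. An admissible transition from $u_0$ to $u_1$ at time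 $t$ is a curve $\vartheta:[0,1]\to D_E$, for some $E>0$, with $\vartheta(0)=u_0$, $\vartheta(1)=u_1$, which is $\Psi$-absolutely continuous on $[0,1]$ and locally $\|\cdot\|$-absolutely continuous on $G=\{r\in[0,1]:\mathfrak e_t(\vartheta(r))>0\}$; here $\vartheta$ is $\Psi$-absolutely continuous if $\Psi(\vartheta(r_1)-\vartheta(r_0))\le\int_{r_0}^{r_1}m\,\mathrm dr$ for all $r_0<r_1$ and some $0\le m\in L^1$. Then $\Delta_{\mathfrak f_t}(u_0,u_1)\in[0,\infty]$ is the infimum, over all such $\vartheta$, of $\int_0^1 f\,\mathrm dr$, where $f(r)=\mathfrak f_t(\vartheta(r);\dot\vartheta(r))$ for $r\in G$ and $f(r)=\lim_{h\to0}\Psi((\vartheta(r+h)-\vartheta(r))/h)$ for $r\notin G$ (a.e.). \textbf{Jumps and variations.} For $u:[0,T]\to V$ let $u(t_\pm)$ be the one-sided limits, with $u(0_-)=u(0)$, $u(T_+)=u(T)$, and $\mathrm J_u=\{t\in[0,T]:u(t_-)\ne u(t)\text{ or }u(t)\neq u(t_+)\}$. For a cost $\Delta_t(x,y)$, either $\Delta_{\mathfrak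 f_t}(x,y)$ or $\Psi(y-x)$, put $\mathrm{Jmp}_\Delta(u;[a,b])=\Delta_a(u(a),u(a_+))+\Delta_b(u(b_-),u(b))+\sum_{t\in\mathrm J_u\cap(a,b)}\big(\Delta_t(u(t_-),u(t))+\Delta_t(u(t),u(t_+))\big)$. Let $\mathrm{Var}_\Psi$ be the pointwise total variation $\sup\sum_m\Psi(u(t_m)-u(t_{m-1}))$ over the partitions of the interval, and $\mathrm{Var}_{\mathfrak f}=\mathrm{Var}_\Psi-\mathrm{Jmp}_\Psi+\mathrm{Jmp}_{\mathfrak f}$. A curve $u:[0,T]\to D$ with $\mathrm{Var}_\Psi(u;[0,T])<\infty$ is a \emph{BV solution} if $K^*+\partial\mathcal E_t(u(t))\ni0$ for all $t\in[0,T]\setminus\mathrm J_u$, the function $s\mapsto\mathcal P_s(u(s))$ is integrable on $(0,T)$, and $$\mathrm{Var}_{\mathfrak f}(u;[0,t])+\mathcal E_t(u(t))=\mathcal E_0(u(0))+\int_0^t\mathcal P_s(u(s))\,\mathrm ds\qquad\text{for all }t\in(0,T].$$ \textbf{Theorem (Differential characterization of BV solutions).} Let $u\in\mathrm{BV}([0,T];V)$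 (finite total variation with respect to $\|\cdot\|$). Let $u_{\mathrm d}'=u'_{\mathscr L}+u_{\mathrm C}'$ be the diffuse part of its distributional derivative on $(0,T)$, the sum of the absolutely continuous part $u'_{\mathscr L}$ and the Cantor part $u_{\mathrm C}'$, and let $\lambda=\|u_{\mathrm C}'\|+\mathscr L^1$ on $(0,T)$, where $\|u_{\mathrm C}'\|$ is the total variation measure. Then $u$ is a BV solution if and only if $u([0,T])\subset D_E$ for some $E>0$ and the following two conditions hold: (i) $\displaystyle\partial\Psi\Big(\frac{\mathrm du_{\mathrm d}'}{\mathrm d\lambda}(t)\Big)+\partial\mathcal E_t(u(t))\ni0$ for $\lambda$-a.e. $t\in(0,T)$; (ii) for every $t\in\mathrm J_u$, $$\mathcal E_t(u(t))-\mathcal E_t(u(t_-))=-\Delta_{\mathfrak f_t}(u(t_-),u(t)),\qquad \mathcal E_t(u(t_+))-\mathcal E_t(u(t))=-\Delta_{\mathfrak f_t}(u(t),u(t_+)),$$ $$\mathcal E_t(u(t_+))-\mathcal E_t(u(t_-))=-\Delta_{\mathfrak f_t}(u(t_-),u(t_+))=-\big(\Delta_{\mathfrak f_t}(u(t_-),u(t))+\Delta_{\mathfrak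 f_t}(u(t),u(t_+))\big).$$ Moreover (i) implies that, for $\mathscr L^1$-a.e. $t\in(0,T)$, $u$ is differentiable at $t$ and $\partial\Psi(\dot u(t))+\partial\mathcal E_t(u(t))\ni0$. -/

import Mathlib

open Set Filter Topology MeasureTheory
open scoped ENNReal Pointwise

noncomputable section

namespace BalancedViscosity

/-- The Radon-Nikodym property of a Banach space: every `V`-valued measure of bounded variation
which is absolutely continuous with respect to a finite measure has a Bochner integrable density. -/
def RadonNikodymProperty (V : Type*) [NormedAddCommGroup V] [NormedSpace ℝ V] : Prop :=
  ∀ (Ω : Type) [MeasurableSpace Ω] (μ : Measure Ω) [IsFiniteMeasure μ] (m : VectorMeasure Ω V),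
    m.variation univ ≠ ∞ → (∀ s, MeasurableSet s → μ s = 0 → m s = 0) →
      ∃ g : Ω → V, Integrable g μ ∧ m = μ.withDensityᵥ g

/-! ### Absolutely continuous curves and total variation -/

section Curves

variable {V : Type*} [NormedAddCommGroup V] [NormedSpace ℝ V]

/-- Absolute continuity on `[a, b]` with respect to the (possibly asymmetric) gauge `N`. -/
def ACOn (N : V → ℝ) (c : ℝ → V) (a b : ℝ) : Prop :=
  ∃ m : ℝ → ℝ, IntegrableOn m (Icc a b) ∧ (∀ r, 0 ≤ m r) ∧
    ∀ r₀ r₁, a ≤ r₀ → r₀ < r₁ → r₁ ≤ b → N (c r₁ - c r₀) ≤ ∫ r in r₀..r₁, m r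

/-- The scalar derivative `lim_{h → 0} Ψ ((c (r + h) - c r) / h)` of a curve; the limit exists for
almost every `r` when `c` is absolutely continuous with respect to `Ψ`. -/
def scalarDeriv (Ψ : V → ℝ) (c : ℝ → V) (r : ℝ) : ℝ≥0∞ :=
  limsup (fun h : ℝ => ENNReal.ofReal (Ψ (h⁻¹ • (c (r + h) - c r)))) (𝓝[≠] 0)

/-- The pointwise total variation of `u` on `[a, b]` induced by `Ψ`. -/
def gaugeVariation (Ψ : V → ℝ) (u : ℝ → V) (a b : ℝ) : ℝ≥0∞ :=
  ⨆ (M : ℕ) (τ : ℕ → ℝ) (_ : Monotone τ) (_ : τ 0 = a) (_ : τ M = b),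
    ∑ m ∈ Finset.range M, ENNReal.ofReal (Ψ (u (τ (m + 1)) - u (τ m)))

/-- The extension of `u : [0, T] → V` to the real line by the constants `u 0` and `u T`. -/
def constExt (T : ℝ) (u : ℝ → V) (t : ℝ) : V := u (max 0 (min T t))

/-- The left limit of `u` in `[0, T]`, with the convention `u (0-) = u 0`. -/
def leftLimit (T : ℝ) (u : ℝ → V) (t : ℝ) : V := Function.leftLim (constExt T u) t

/-- The right limit of `u` in `[0, T]`, with the convention `u (T+) = u T`. -/
def rightLimit (T : ℝ) (u : ℝ → V) (t : ℝ) : V := Function.rightLim (constExt T u) t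

/-- The jump set of `u` in `[0, T]`. -/
def jumpSet (T : ℝ) (u : ℝ → V) : Set ℝ :=
  {t | t ∈ Icc 0 T ∧ (leftLimit T u t ≠ u t ∨ u t ≠ rightLimit T u t)}

/-- The jump variation of `u` on `[a, b]` for a time-dependent transition cost. -/
def jumpVariation (cost : ℝ → V → V → ℝ≥0∞) (T : ℝ) (u : ℝ → V) (a b : ℝ) : ℝ≥0∞ :=
  cost a (u a) (rightLimit T u a) + cost b (leftLimit T u b) (u b) +
    ∑' t : (jumpSet T u ∩ Ioo a b : Set ℝ),
      (cost t (leftLimit T u t) (u t) + cost t (u t) (rightLimit T u t))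

/-! ### The distributional derivative of a curve of bounded variation -/

theorem boundedVariationOn_constExt {T : ℝ} {u : ℝ → V} (hT : 0 < T)
    (hu : BoundedVariationOn u (Icc 0 T)) : BoundedVariationOn (constExt T u) univ := by
  have h : eVariationOn (u ∘ fun t : ℝ => max 0 (min T t)) univ ≤ eVariationOn u (Icc 0 T) := by
    apply eVariationOn.comp_le_of_monotoneOn
    · intro x _ y _ hxy
      exact max_le_max le_rfl (min_le_min le_rfl hxy)
    · intro x _
      exact ⟨le_max_left _ _, max_le hT.le (min_le_left _ _)⟩
  exact ne_top_of_le_ne_top hu h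

variable [CompleteSpace V]

/-- The distributional derivative of `u` on `(0, T)`, as a vector measure. -/
def distribDeriv {T : ℝ} {u : ℝ → V} (hT : 0 < T) (hu : BoundedVariationOn u (Icc 0 T)) :
    VectorMeasure ℝ V :=
  (boundedVariationOn_constExt hT hu).vectorMeasure.restrict (Ioo 0 T)

/-- The diffuse part of the distributional derivative: the (countable) jump set is removed. -/
def diffusePart {T : ℝ} {u : ℝ → V} (hT : 0 < T) (hu : BoundedVariationOn u (Icc 0 T)) :
    VectorMeasure ℝ V :=
  (distribDeriv hT hu).restrict (jumpSet T u)ᶜ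

/-- The Cantor part of the distributional derivative, i.e. the part of the diffuse part which is
singular with respect to the Lebesgue measure: the restriction of the diffuse part to a Lebesgue
null set that carries the singular part of its total variation. -/
def cantorPart {T : ℝ} {u : ℝ → V} (hT : 0 < T) (hu : BoundedVariationOn u (Icc 0 T)) :
    VectorMeasure ℝ V :=
  (diffusePart hT hu).restrict
    (Measure.mutuallySingular_singularPart (diffusePart hT hu).variation volume).nullSetᶜ

/-- The measure `‖u_C'‖ + L¹` on `(0, T)`. -/
def refMeasure {T : ℝ} {u : ℝ → V} (hT : 0 < T) (hu : BoundedVariationOn u (Icc 0 T)) :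
    Measure ℝ :=
  (cantorPart hT hu).variation + volume.restrict (Ioo 0 T)

end Curves

/-! ### Rate-independent systems -/

/-- The data of a rate-independent system with viscous regularization: the time horizon `T`, the
gauge `Ψ`, the profile `F` of the viscous potential `v ↦ F ‖v‖`, the energy domain `D`, and the
energy `E t u`, of which only the values for `t ∈ [0, T]` and `u ∈ D` matter (the energy is `+∞`
outside `D`). -/
structure RIS (V : Type*) where
  T : ℝ
  Ψ : V → ℝ
  F : ℝ → ℝ
  D : Set V
  E : ℝ → V → ℝ

namespace RIS

variable {V : Type*} [NormedAddCommGroup V] [NormedSpace ℝ V] (S : RIS V)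

/-- The subdifferential of the gauge `Ψ`. -/
def gaugeSubdiff (v : V) : Set (V →L[ℝ] ℝ) := {ξ | ∀ w, ξ (w - v) ≤ S.Ψ w - S.Ψ v}

/-- The dual stability set `K*`. -/
def stableSet : Set (V →L[ℝ] ℝ) := {ξ | ∀ w, ξ w ≤ S.Ψ w}

/-- The Fréchet subdifferential of the energy (extended by `+∞` outside `D`). -/
def energySubdiff (t : ℝ) (u : V) : Set (V →L[ℝ] ℝ) :=
  {ξ | u ∈ S.D ∧ ∀ η > 0, ∀ᶠ v in 𝓝[S.D] u, -(η * ‖v - u‖) ≤ S.E t v - S.E t u - ξ (v - u)}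

/-- The sublevel `D_e` of `u ↦ Ψ u + sup_{t ∈ [0, T]} E t u`. -/
def sublevel (e : ℝ) : Set V := {u | u ∈ S.D ∧ ∀ t ∈ Icc 0 S.T, S.Ψ u + S.E t u ≤ e}

/-- The power `∂_t E t u`. -/
def power (t : ℝ) (u : V) : ℝ := derivWithin (fun s => S.E s u) (Icc 0 S.T) t

/-- The standing assumptions on the dissipation potentials and on the energy. -/
structure Admissible : Prop where
  T_pos : 0 < S.T
  gauge_continuous : Continuous S.Ψ
  gauge_convex : ConvexOn ℝ univ S.Ψ
  gauge_pos : ∀ v, v ≠ 0 → 0 < S.Ψ v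
  gauge_homogeneous : ∀ c : ℝ, 0 ≤ c → ∀ v, S.Ψ (c • v) = c * S.Ψ v
  viscous_contDiff : ContDiffOn ℝ 1 S.F (Ici 0)
  viscous_convex : ConvexOn ℝ (Ici 0) S.F
  viscous_pos : ∀ r, 0 < r → 0 < S.F r
  viscous_zero : S.F 0 = 0
  viscous_deriv_zero : derivWithin S.F (Ici 0) 0 = 0
  viscous_superlinear : Tendsto (derivWithin S.F (Ici 0)) atTop atTop
  energy_lsc : LowerSemicontinuousOn (fun p : ℝ × V => S.E p.1 p.2) (Icc 0 S.T ×ˢ S.D)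
  coercive : ∀ e > 0, IsCompact (S.sublevel e)
  energy_differentiable : ∀ u ∈ S.D, DifferentiableOn ℝ (fun t => S.E t u) (Icc 0 S.T)
  power_bound : ∃ C, 0 ≤ C ∧ ∀ t ∈ Ioo 0 S.T, ∀ u ∈ S.D, |S.power t u| ≤ C * (S.Ψ u + S.E t u)
  power_usc : ∀ t ∈ Ioo 0 S.T, ∀ u ∈ S.D, ∀ e > 0,
    UpperSemicontinuousWithinAt (fun w => S.power t w) (S.sublevel e) u
  uniform_subdiff : ∀ e > 0, ∃ ω : ℝ → V → V → ℝ,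
    UpperSemicontinuousOn (fun p : ℝ × V × V => ω p.1 p.2.1 p.2.2)
      (Icc 0 S.T ×ˢ S.sublevel e ×ˢ S.sublevel e) ∧
    (∀ t ∈ Icc 0 S.T, ∀ u ∈ S.sublevel e, ω t u u = 0) ∧
    ∀ t ∈ Icc 0 S.T, ∀ u ∈ S.sublevel e, ∀ v ∈ S.sublevel e, ∀ ξ ∈ S.energySubdiff t u,
      S.E t u + ξ (v - u) - ω t u v * min (S.Ψ (v - u)) (S.Ψ (-(v - u))) ≤ S.E t v

/-! ### Contact potential and Finsler dissipation cost -/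

/-- The viscous potential `Ψ_ε v = Ψ v + ε⁻¹ Φ (ε v)` with `Φ v = F ‖v‖`. -/
def viscousPotential (ε : ℝ) (v : V) : ℝ := S.Ψ v + ε⁻¹ * S.F ‖ε • v‖

/-- The convex conjugate of `Ψ_ε`. Truncating the negative values does not change the supremum,
since the value at `v = 0` is `0`. -/
def viscousConjugate (ε : ℝ) (ξ : V →L[ℝ] ℝ) : ℝ≥0∞ :=
  ⨆ v : V, ENNReal.ofReal (ξ v - S.viscousPotential ε v)

/-- The vanishing-viscosity contact potential. -/
def contactPotential (v : V) (ξ : V →L[ℝ] ℝ) : ℝ≥0∞ :=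
  ⨅ (ε : ℝ) (_ : 0 < ε), (ENNReal.ofReal (S.viscousPotential ε v) + S.viscousConjugate ε ξ)

/-- The Finsler dissipation functional `𝔣_t(u; v)`. -/
def finsler (t : ℝ) (u v : V) : ℝ≥0∞ :=
  ⨅ ξ ∈ -S.energySubdiff t u, S.contactPotential v ξ

/-- The slope `𝔢_t(u)`: the dual distance of `-∂E_t(u)` from `K*`. -/
def slope (t : ℝ) (u : V) : ℝ≥0∞ :=
  ⨅ ξ ∈ -S.energySubdiff t u, ⨅ z ∈ S.stableSet, ‖ξ - z‖ₑ

/-- The set `G_t[ϑ]` of the parameters in `[0, 1]` at which `ϑ` is not stable. -/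
def unstableSet (t : ℝ) (ϑ : ℝ → V) : Set ℝ := {r | r ∈ Icc 0 1 ∧ 0 < S.slope t (ϑ r)}

/-- The class `𝒯_t(u₀, u₁)` of the admissible transition curves from `u₀` to `u₁`. -/
def transitions (t : ℝ) (u₀ u₁ : V) : Set (ℝ → V) :=
  {ϑ | (∃ e > 0, ∀ r ∈ Icc (0 : ℝ) 1, ϑ r ∈ S.sublevel e) ∧ ACOn S.Ψ ϑ 0 1 ∧
    (∀ a b, a ≤ b → Icc a b ⊆ S.unstableSet t ϑ → ACOn (fun v : V => ‖v‖) ϑ a b) ∧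
    ϑ 0 = u₀ ∧ ϑ 1 = u₁}

open Classical in
/-- The dissipation density `𝔣_t[ϑ, ϑ'](r)` along a transition curve. -/
def transitionDensity (t : ℝ) (ϑ : ℝ → V) (r : ℝ) : ℝ≥0∞ :=
  if r ∈ S.unstableSet t ϑ then S.finsler t (ϑ r) (deriv ϑ r) else scalarDeriv S.Ψ ϑ r

/-- The Finsler dissipation cost; it is `+∞` if there is no admissible transition. -/
def finslerCost (t : ℝ) (u₀ u₁ : V) : ℝ≥0∞ :=
  ⨅ ϑ ∈ S.transitions t u₀ u₁, ∫⁻ r in Icc 0 1, S.transitionDensity t ϑ r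

/-- The transition cost `Ψ (u₁ - u₀)`. -/
def gaugeCost (_t : ℝ) (u₀ u₁ : V) : ℝ≥0∞ := ENNReal.ofReal (S.Ψ (u₁ - u₀))

/-- The total variation induced by `𝔣` on `[a, b]`: in the `Ψ`-variation the contribution of the
jumps is replaced by their Finsler cost. -/
def finslerVariation (u : ℝ → V) (a b : ℝ) : ℝ≥0∞ :=
  gaugeVariation S.Ψ u a b - jumpVariation S.gaugeCost S.T u a b +
    jumpVariation S.finslerCost S.T u a b

/-! ### Balanced viscosity solutions -/

/-- Balanced viscosity (BV) solutions of the rate-independent system. -/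
structure IsBVSolution (u : ℝ → V) : Prop where
  mem_domain : ∀ t ∈ Icc 0 S.T, u t ∈ S.D
  finite_variation : gaugeVariation S.Ψ u 0 S.T ≠ ∞
  local_stability : ∀ t ∈ Icc 0 S.T \ jumpSet S.T u, 0 ∈ S.stableSet + S.energySubdiff t (u t)
  power_integrable : IntervalIntegrable (fun s => S.power s (u s)) volume 0 S.T
  energy_balance : ∀ t ∈ Ioc 0 S.T,
    (S.finslerVariation u 0 t : EReal) + (S.E t (u t) : EReal) =
      ((S.E 0 (u 0) + ∫ s in (0 : ℝ)..t, S.power s (u s) : ℝ) : EReal)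

/-- The jump conditions. A state outside `D` has infinite Finsler cost, so the equalities force
the one-sided limits to belong to `D`. -/
def JumpConditions (u : ℝ → V) : Prop :=
  ∀ t ∈ jumpSet S.T u,
    ((S.E t (u t) - S.E t (leftLimit S.T u t) : ℝ) : EReal) =
      -(S.finslerCost t (leftLimit S.T u t) (u t) : EReal) ∧
    ((S.E t (rightLimit S.T u t) - S.E t (u t) : ℝ) : EReal) =
      -(S.finslerCost t (u t) (rightLimit S.T u t) : EReal) ∧
    ((S.E t (rightLimit S.T u t) - S.E t (leftLimit S.T u t) : ℝ) : EReal) =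
      -(S.finslerCost t (leftLimit S.T u t) (rightLimit S.T u t) : EReal) ∧
    S.finslerCost t (leftLimit S.T u t) (rightLimit S.T u t) =
      S.finslerCost t (leftLimit S.T u t) (u t) + S.finslerCost t (u t) (rightLimit S.T u t)

/-- The doubly nonlinear inclusion in the BV sense: the density `g` of the diffuse part of the
derivative with respect to `λ = ‖u_C'‖ + L¹` satisfies `∂Ψ (g t) + ∂E_t (u t) ∋ 0` for
`λ`-a.e. `t`. -/
def InclusionBV [CompleteSpace V] {u : ℝ → V} (hT : 0 < S.T)
    (hu : BoundedVariationOn u (Icc 0 S.T)) : Prop :=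
  ∃ g : ℝ → V, Integrable g (refMeasure hT hu) ∧
    diffusePart hT hu = (refMeasure hT hu).withDensityᵥ g ∧
    ∀ᵐ t ∂(refMeasure hT hu), 0 ∈ S.gaugeSubdiff (g t) + S.energySubdiff t (u t)

/-- The pointwise inclusion `∂Ψ (u' t) + ∂E_t (u t) ∋ 0` for Lebesgue-a.e. `t ∈ (0, T)`. -/
def InclusionAE (u : ℝ → V) : Prop :=
  ∀ᵐ t ∂(volume.restrict (Ioo 0 S.T)),
    DifferentiableAt ℝ u t ∧ 0 ∈ S.gaugeSubdiff (deriv u t) + S.energySubdiff t (u t)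

end RIS

end BalancedViscosity

end

/-! Everything is measured against the atomless measure l = ‖u_C'‖ + L¹ on the line (`lineMeasure`).
The Radon–Nikodým property provides an l-density g of the diffuse part of u' (`exists_density`). The
distribution function of l carries l to Lebesgue measure, so the intervals with an endpoint at the
base point form a Vitali family for l, and one-sided differentiation theorems hold. The jumps of u
form a measure singular to l, hence (u(s) - u(t)) / l[t,s] tends to g(t) for l-a.e. t, and likewise
from the left (`ae_tendsto_density`). It follows that Var_Ψ is the jump variation plus ∫ Ψ(g) dl
(`gaugeVariation_eq`), and the energy balance becomes the real identity ∫ Ψ(g) dl + Jmp_f +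
E_t(u(t)) = E_0(u(0)) + ∫ P (`energy_balance_iff`).

The second ingredient is an inequality at frozen time: E_t(x) - E_t(y) ≤ Δ_f(x,y)
(`energy_sub_le_finslerCost`). The infimum over ε in the contact potential can be computed, and
f_t(u;v) = Ψ(v) + e_t(u)‖v‖ wherever the slope is finite (`finsler_eq`). By (E3), the energy drop
between nearby states is at most (1 + small) Ψ plus slope times distance. On compact unstable
intervals these estimates are summed by Riemann sums with respect to arc length; at stable
parameters the slope term disappears. Chaining the two regimes gives the bound along a whole
transition (`energy_sub_le_of_transition`).

Necessity. The balance localizes to subintervals. Dropping the jump term on (s,t), dividing by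
l[s,t] and letting s increase to t along stable times bounds the left quotients of the energy from
above; (E3) at u(s) then forces a limit subgradient ζ to satisfy -ζ ∈ K* and -ζ(g(t)) = Ψ(g(t)),
which is the inclusion (`ae_inclusion_of_left_quotient`). Shrinking intervals to a jump time bounds
the cost of each half jump by the energy drop; the static inequality gives equality, and the
triangle inequality settles the full jump (`jumpConditions`).

Sufficiency. The inclusion gives stability at a.e. time, and closedness of the subdifferential
extends it to every time outside the jump set (`stable_of_ae`). The jumps of t ↦ E_t(u(t)) are
prescribed by (ii). Its derivative with respect to l is bounded below by stability, through left
quotients, and above by the inclusion, through right quotients. Since the energy is controlled by an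
additive interval function (`exists_abs_energy_sub_le`), adding a multiple of that function makes it
monotone, and the decomposition of monotone functions turns these local bounds into bounds for
increments (`jumpSum_add_integral_le_sub`). Applied to the energy and to its negative, this yields
the balance (`energy_balance`). -/

noncomputable section

namespace BalancedViscosity

set_option linter.unusedSectionVars false

section

/-! ### One-sided differentiation of measures on the line -/

section OneSided

variable {l : Measure ℝ} [IsLocallyFiniteMeasure l] [NullSingletonClass l]

/-- The distribution function of a measure on the line, normalized to vanish at `0`. -/
def distribFun (l : Measure ℝ) (x : ℝ) : ℝ := ∫ _ in (0 : ℝ)..x, (1 : ℝ) ∂l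

theorem distribFun_sub {a b : ℝ} (h : a ≤ b) :
    distribFun l b - distribFun l a = l.real (Ioc a b) := by
  have hi : ∀ x y : ℝ, IntervalIntegrable (fun _ => (1 : ℝ)) l x y := fun x y => by simp
  rw [distribFun, distribFun, intervalIntegral.integral_interval_sub_left (hi _ _) (hi _ _),
    intervalIntegral.integral_of_le h]
  simp

theorem le_distribFun_sub (hl : volume ≤ l) {a b : ℝ} (h : a ≤ b) :
    b - a ≤ distribFun l b - distribFun l a := by
  rw [distribFun_sub h, measureReal_def]
  have := hl (Ioc a b)
  rw [Real.volume_Ioc] at this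
  exact (ENNReal.ofReal_le_iff_le_toReal measure_Ioc_lt_top.ne).1 this

theorem measure_Ioc_eq_distribFun {a b : ℝ} (h : a ≤ b) :
    l (Ioc a b) = ENNReal.ofReal (distribFun l b - distribFun l a) := by
  rw [distribFun_sub h, ofReal_measureReal measure_Ioc_lt_top.ne]

theorem distribFun_strictMono (hl : volume ≤ l) : StrictMono (distribFun l) := fun a b h => by
  have := le_distribFun_sub hl h.le
  linarith

theorem continuous_distribFun : Continuous (distribFun l) :=
  intervalIntegral.continuous_primitive (fun x y => by simp) 0

theorem distribFun_surjective (hl : volume ≤ l) : Function.Surjective (distribFun l) := by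
  have h0 : distribFun l 0 = 0 := by simp [distribFun]
  refine continuous_distribFun.surjective ?_ ?_
  · refine tendsto_atTop_mono' _ ?_ tendsto_id
    filter_upwards [eventually_ge_atTop 0] with x hx
    have := le_distribFun_sub hl hx
    simp only [id]; linarith
  · refine tendsto_atBot_mono' _ ?_ tendsto_id
    filter_upwards [eventually_le_atBot 0] with x hx
    have := le_distribFun_sub hl hx
    simp only [id]; linarith

/-- The distribution function as a homeomorphism. -/
def distribHomeo (hl : volume ≤ l) : ℝ ≃ₜ ℝ :=
  ((distribFun_strictMono hl).orderIsoOfSurjective _ (distribFun_surjective hl)).toHomeomorph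

/-- The preimage of a half-open interval is the half-open interval of the preimages of its
endpoints, and its l-measure is the increment of the distribution function, that is, the length of
the image. -/
theorem map_distribHomeo (hl : volume ≤ l) : l.map (distribHomeo hl) = volume := by
  have hle : ∀ a b, distribHomeo hl a ≤ distribHomeo hl b ↔ a ≤ b := fun a b =>
    (distribFun_strictMono hl).le_iff_le
  have hpre : ∀ a b, distribHomeo hl ⁻¹' Ioc (distribHomeo hl a) (distribHomeo hl b) = Ioc a b := by
    intro a b; ext x
    simp only [mem_preimage, mem_Ioc, hle, ← not_le]
  have hmap : ∀ c d, c < d → l.map (distribHomeo hl) (Ioc c d) = volume (Ioc c d) := by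
    intro c d hcd
    obtain ⟨a, rfl⟩ := (distribHomeo hl).surjective c
    obtain ⟨b, rfl⟩ := (distribHomeo hl).surjective d
    have hab : a ≤ b := (hle a b).1 hcd.le
    rw [Measure.map_apply (distribHomeo hl).continuous.measurable measurableSet_Ioc, hpre,
      measure_Ioc_eq_distribFun hab, Real.volume_Ioc]
    rfl
  symm
  refine Measure.ext_of_Ioc' _ _ (fun a b _ => by simp) fun a b hab => (hmap a b hab).symm

theorem volume_image_distribHomeo (hl : volume ≤ l) (s : Set ℝ) :
    volume (distribHomeo hl '' s) = l s := by
  have := (distribHomeo hl).toMeasurableEquiv.map_apply (μ := l) (distribHomeo hl '' s)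
  rw [← map_distribHomeo hl]
  refine this.trans ?_
  congr 1
  exact (distribHomeo hl).injective.preimage_image s

/-- The Vitali family of the intervals with one endpoint at the base point, for a measure without
atoms which dominates the Lebesgue measure. -/
def intervalVitali (hl : volume ≤ l) : VitaliFamily l where
  setsAt x := {s | ∃ a b, a < b ∧ (x = a ∨ x = b) ∧ s = Icc a b}
  measurableSet := by rintro x s ⟨a, b, -, -, rfl⟩; exact measurableSet_Icc
  nonempty_interior := by
    rintro x s ⟨a, b, h, -, rfl⟩; rw [interior_Icc]; exact nonempty_Ioo.2 h
  nontrivial x ε hε := ⟨Icc x (x + ε), ⟨x, x + ε, by linarith, Or.inl rfl, rfl⟩, by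
    rw [Real.closedBall_eq_Icc]; exact Icc_subset_Icc (by linarith) le_rfl⟩
  covering s f hf hfine := by
    -- The covering property is transported along H: images of intervals with an endpoint at x lie
    -- in the Vitali family of Lebesgue measure at H x, and null sets correspond because `volume (H
    -- '' s) = l s`.
    set H := distribHomeo hl with hH
    have himg : ∀ a b, H '' Icc a b = Icc (H a) (H b) := fun a b =>
      ((distribFun_strictMono hl).orderIsoOfSurjective _ (distribFun_surjective hl)).image_Icc a b
    have hlt : ∀ {a b}, a < b → H a < H b := fun h => distribFun_strictMono hl h
    have h1 : ∀ y ∈ H '' s, (fun u => H '' u) '' f (H.symm y) ⊆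
        (IsUnifLocDoublingMeasure.vitaliFamily (volume : Measure ℝ) 1).setsAt y := by
      rintro _ ⟨x, hx, rfl⟩ _ ⟨u, hu, rfl⟩
      rw [H.symm_apply_apply] at hu
      obtain ⟨a, b, hab, hxab, rfl⟩ := hf x hx hu
      simp only [himg]
      rcases hxab with rfl | rfl
      · exact Real.Icc_mem_vitaliFamily_at_right (hlt hab)
      · exact Real.Icc_mem_vitaliFamily_at_left (hlt hab)
    have h2 : ∀ y ∈ H '' s, ∀ ε > (0 : ℝ), ∃ t ∈ (fun u => H '' u) '' f (H.symm y),
        t ⊆ Metric.closedBall y ε := by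
      rintro _ ⟨x, hx, rfl⟩ ε hε
      obtain ⟨δ, hδ, hsub⟩ := Metric.continuous_iff.1 H.continuous x ε hε
      obtain ⟨u, hu, hus⟩ := hfine x hx (δ / 2) (by linarith)
      refine ⟨H '' u, ⟨u, by simpa using hu, rfl⟩, ?_⟩
      rintro _ ⟨z, hz, rfl⟩
      have := hus hz
      rw [Metric.mem_closedBall] at this ⊢
      exact (hsub z (by linarith)).le
    obtain ⟨t, ht1, ht2, ht3, ht4⟩ :=
      (IsUnifLocDoublingMeasure.vitaliFamily (volume : Measure ℝ) 1).covering (H '' s)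
        (fun y => (fun u => H '' u) '' f (H.symm y)) h1 h2
    refine ⟨(fun p : ℝ × Set ℝ => (H.symm p.1, H ⁻¹' p.2)) '' t, ?_, ?_, ?_, ?_⟩
    · rintro _ ⟨p, hp, rfl⟩
      obtain ⟨x, hx, hxp⟩ := ht1 p hp
      simpa [← hxp] using hx
    · rintro _ ⟨p, hp, rfl⟩ _ ⟨q, hq, rfl⟩ hpq
      have hne : p ≠ q := by rintro rfl; exact hpq rfl
      exact (ht2 hp hq hne).preimage H
    · rintro _ ⟨p, hp, rfl⟩
      obtain ⟨u, hu, hup⟩ := ht3 p hp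
      simp only [← hup]
      rwa [H.injective.preimage_image]
    · rw [← volume_image_distribHomeo hl, ← ht4]
      congr 1
      rw [image_sdiff H.injective]
      congr 1
      ext y
      simp only [mem_image, mem_iUnion]
      constructor
      · rintro ⟨x, ⟨_, ⟨p, hp, rfl⟩, hx⟩, rfl⟩
        exact ⟨p, hp, hx⟩
      · rintro ⟨p, hp, hy⟩
        exact ⟨H.symm y, ⟨_, ⟨p, hp, rfl⟩, by simpa using hy⟩, by simp⟩

theorem tendsto_Icc_right (hl : volume ≤ l) (x : ℝ) :
    Tendsto (fun y => Icc x y) (𝓝[>] x) ((intervalVitali hl).filterAt x) := by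
  refine (VitaliFamily.tendsto_filterAt_iff _).2 ⟨?_, ?_⟩
  · filter_upwards [self_mem_nhdsWithin] with y hy using ⟨x, y, hy, Or.inl rfl, rfl⟩
  · intro ε hε
    filter_upwards [Icc_mem_nhdsGT (show x < x + ε by linarith)] with y hy
    rw [Real.closedBall_eq_Icc]
    exact Icc_subset_Icc (by linarith) hy.2

theorem tendsto_Icc_left (hl : volume ≤ l) (x : ℝ) :
    Tendsto (fun y => Icc y x) (𝓝[<] x) ((intervalVitali hl).filterAt x) := by
  refine (VitaliFamily.tendsto_filterAt_iff _).2 ⟨?_, ?_⟩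
  · filter_upwards [self_mem_nhdsWithin] with y hy using ⟨y, x, hy, Or.inr rfl, rfl⟩
  · intro ε hε
    filter_upwards [Icc_mem_nhdsLT (show x - ε < x by linarith)] with y hy
    rw [Real.closedBall_eq_Icc]
    exact Icc_subset_Icc hy.1 (by linarith)

/-- The measure l need not be doubling, so differentiation relies on `intervalVitali` rather than on
balls. Keeping the base point at an endpoint separates the left limit from the right one. -/
theorem ae_average_oneSided {E : Type*} [NormedAddCommGroup E] (hl : volume ≤ l) {f : ℝ → E}
    (hf : LocallyIntegrable f l) : ∀ᵐ x ∂l,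
      Tendsto (fun y => ⨍ z in Icc x y, ‖f z - f x‖ ∂l) (𝓝[>] x) (𝓝 0) ∧
      Tendsto (fun y => ⨍ z in Icc y x, ‖f z - f x‖ ∂l) (𝓝[<] x) (𝓝 0) := by
  filter_upwards [(intervalVitali hl).ae_tendsto_average_norm_sub hf] with x hx
  exact ⟨hx.comp (tendsto_Icc_right hl x), hx.comp (tendsto_Icc_left hl x)⟩

theorem ae_rnDeriv_oneSided (hl : volume ≤ l) (ρ : Measure ℝ) [IsLocallyFiniteMeasure ρ] :
    ∀ᵐ x ∂l,
      Tendsto (fun y => ρ (Icc x y) / l (Icc x y)) (𝓝[>] x) (𝓝 (ρ.rnDeriv l x)) ∧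
      Tendsto (fun y => ρ (Icc y x) / l (Icc y x)) (𝓝[<] x) (𝓝 (ρ.rnDeriv l x)) := by
  filter_upwards [(intervalVitali hl).ae_tendsto_rnDeriv ρ] with x hx
  exact ⟨hx.comp (tendsto_Icc_right hl x), hx.comp (tendsto_Icc_left hl x)⟩

end OneSided

end

section

/-! ### Jump part and absolutely continuous part of a monotone function -/

/-- The contribution to `[a, b]` of left jumps `α` and right jumps `β` on the set `J`. -/
def jumpSum (J : Set ℝ) (α β : ℝ → ℝ≥0∞) (a b : ℝ) : ℝ≥0∞ :=
  β a + α b + ∑' t : (J ∩ Ioo a b : Set ℝ), (α t + β t)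

section MonotoneDecomposition

variable {l : Measure ℝ} [IsLocallyFiniteMeasure l] [NullSingletonClass l]

theorem measure_countable_eq_tsum {μ : Measure ℝ} {s : Set ℝ} (hs : s.Countable) :
    μ s = ∑' t : s, μ {(t : ℝ)} := by
  have := measure_biUnion (μ := μ) (f := fun t : ℝ => ({t} : Set ℝ)) hs
    (by intro i _ j _ hij; simpa [Function.onFun] using hij) (fun t _ => measurableSet_singleton t)
  rwa [biUnion_of_singleton] at this

/-- The Stieltjes measure of m splits into its part on J and the rest. Its atoms dominate the jumps
α + β; off J it is at least its absolutely continuous part, whose density dominates D. Since l-a.e.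
the one-sided quotients converge, a lower bound holding only frequently, and on one side only,
already bounds the density. -/
theorem jumpSum_add_lintegral_le (hl : volume ≤ l) {m : ℝ → ℝ} (hm : Monotone m) {J : Set ℝ}
    (hJ : J.Countable) {α β : ℝ → ℝ≥0∞} {D : ℝ → ℝ} {a b : ℝ} (hab : a < b)
    (hα : ∀ r ∈ Ioc a b, ∀ s ∈ Ico a r, α r ≤ ENNReal.ofReal (m r - m s))
    (hβ : ∀ r ∈ Ico a b, ∀ s ∈ Ioc r b, β r ≤ ENNReal.ofReal (m s - m r))
    (hD : ∀ᵐ t ∂l, t ∈ Ioo a b → ∀ ε > 0,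
      (∃ᶠ s in 𝓝[>] t, (D t - ε) * l.real (Icc t s) ≤ m s - m t) ∨
      (∃ᶠ s in 𝓝[<] t, (D t - ε) * l.real (Icc s t) ≤ m t - m s)) :
    jumpSum J α β a b + ∫⁻ t in Ioo a b, ENNReal.ofReal (D t) ∂l ≤
      ENNReal.ofReal (m b - m a) := by
  set f := hm.stieltjesFunction with hf
  have hfx : ∀ x, f x = Function.rightLim m x := fun x => rfl
  have hfl : ∀ x, Function.leftLim f x = Function.leftLim m x := fun x =>
    leftLim_rightLim (hm.tendsto_leftLim x)
  have hα' : ∀ r ∈ Ioc a b, α r ≤ ENNReal.ofReal (m r - Function.leftLim m r) := fun r hr =>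
    ge_of_tendsto (ENNReal.tendsto_ofReal ((hm.tendsto_leftLim r).const_sub _)) <| by
      filter_upwards [Ico_mem_nhdsLT hr.1] with s hs using hα r hr s hs
  have hβ' : ∀ r ∈ Ico a b, β r ≤ ENNReal.ofReal (Function.rightLim m r - m r) := fun r hr =>
    ge_of_tendsto (ENNReal.tendsto_ofReal ((hm.tendsto_rightLim r).sub_const _)) <| by
      filter_upwards [Ioc_mem_nhdsGT hr.2] with s hs using hβ r hr s hs
  have hsing : ∀ r ∈ Ioo a b, α r + β r ≤ f.measure {r} := fun r hr => by
    rw [f.measure_singleton, hfl, hfx]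
    refine (add_le_add (hα' r ⟨hr.1, hr.2.le⟩) (hβ' r ⟨hr.1.le, hr.2⟩)).trans ?_
    rw [← ENNReal.ofReal_add (sub_nonneg.2 (hm.leftLim_le le_rfl))
      (sub_nonneg.2 (hm.le_rightLim le_rfl))]
    exact ENNReal.ofReal_le_ofReal (by linarith)
  have hcount : (J ∩ Ioo a b).Countable := hJ.mono inter_subset_left
  have hsum : ∑' t : (J ∩ Ioo a b : Set ℝ), (α t + β t) ≤ f.measure (J ∩ Ioo a b) := by
    rw [measure_countable_eq_tsum hcount]
    exact ENNReal.tsum_le_tsum fun t => hsing t t.2.2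
  have hrn : ∀ᵐ t ∂l, t ∈ Ioo a b → ENNReal.ofReal (D t) ≤ f.measure.rnDeriv l t := by
    filter_upwards [ae_rnDeriv_oneSided hl f.measure, hD] with t ht hDt htab
    refine ENNReal.le_of_forall_pos_le_add fun ε hε _ => ?_
    have hquot : ∀ x y, x < y → (D t - ε) * l.real (Icc x y) ≤ m y - m x →
        ENNReal.ofReal (D t - ε) ≤ f.measure (Icc x y) / l (Icc x y) := by
      intro x y hxy h
      have h0 : l (Icc x y) ≠ 0 := by
        have := hl (Icc x y)
        rw [Real.volume_Icc] at this
        have h1 : 0 < ENNReal.ofReal (y - x) := by simpa using hxy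
        exact (h1.trans_le this).ne'
      rw [ENNReal.le_div_iff_mul_le (Or.inl h0) (Or.inl measure_Icc_lt_top.ne),
        f.measure_Icc, hfl, hfx, ← ofReal_measureReal (measure_Icc_lt_top (μ := l)).ne,
        ← ENNReal.ofReal_mul' measureReal_nonneg]
      refine ENNReal.ofReal_le_ofReal (h.trans ?_)
      have h1 := hm.le_rightLim (le_refl y)
      have h2 := hm.leftLim_le (le_refl x)
      linarith
    have key : ENNReal.ofReal (D t - ε) ≤ f.measure.rnDeriv l t := by
      rcases hDt htab ε hε with h | h
      · refine ge_of_tendsto_of_frequently ht.1 ?_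
        exact (h.and_eventually self_mem_nhdsWithin).mono fun s hs => hquot t s hs.2 hs.1
      · refine ge_of_tendsto_of_frequently ht.2 ?_
        exact (h.and_eventually self_mem_nhdsWithin).mono fun s hs => hquot s t hs.2 hs.1
    calc ENNReal.ofReal (D t) = ENNReal.ofReal ((D t - ε) + ε) := by rw [sub_add_cancel]
      _ ≤ ENNReal.ofReal (D t - ε) + ENNReal.ofReal ε := ENNReal.ofReal_add_le
      _ ≤ _ := by rw [ENNReal.ofReal_coe_nnreal]; gcongr
  -- J is l-null, so removing it does not change the integral; it does prevent the atoms from being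
  -- counted twice.
  have hint : ∫⁻ t in Ioo a b, ENNReal.ofReal (D t) ∂l ≤ f.measure (Ioo a b \ J) := by
    have hJ0 : l J = 0 := hJ.measure_zero l
    calc ∫⁻ t in Ioo a b, ENNReal.ofReal (D t) ∂l
        = ∫⁻ t in Ioo a b \ J, ENNReal.ofReal (D t) ∂l :=
          (setLIntegral_congr (sdiff_null_ae_eq_self hJ0)).symm
      _ ≤ ∫⁻ t in Ioo a b \ J, f.measure.rnDeriv l t ∂l := by
          refine lintegral_mono_ae ?_
          rw [ae_restrict_iff' (measurableSet_Ioo.diff hJ.measurableSet)]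
          filter_upwards [hrn] with t ht hmem using ht hmem.1
      _ ≤ _ := Measure.setLIntegral_rnDeriv_le _
  have hIoo : f.measure (J ∩ Ioo a b) + f.measure (Ioo a b \ J) = f.measure (Ioo a b) := by
    rw [inter_comm, measure_inter_add_sdiff _ hJ.measurableSet]
  calc jumpSum J α β a b + ∫⁻ t in Ioo a b, ENNReal.ofReal (D t) ∂l
      ≤ (ENNReal.ofReal (Function.rightLim m a - m a) +
          ENNReal.ofReal (m b - Function.leftLim m b) + f.measure (J ∩ Ioo a b)) +
          f.measure (Ioo a b \ J) := by
        refine add_le_add (add_le_add (add_le_add ?_ ?_) hsum) hint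
        · exact hβ' a ⟨le_rfl, hab⟩
        · exact hα' b ⟨hab, le_rfl⟩
    _ = ENNReal.ofReal (Function.rightLim m a - m a) +
          ENNReal.ofReal (m b - Function.leftLim m b) +
          ENNReal.ofReal (Function.leftLim m b - Function.rightLim m a) := by
        rw [add_assoc, hIoo, f.measure_Ioo, hfl, hfx]
    _ = ENNReal.ofReal (m b - m a) := by
        have h1 := hm.le_rightLim (le_refl a)
        have h2 := hm.leftLim_le (le_refl b)
        have h3 := hm.rightLim_le_leftLim hab
        rw [← ENNReal.ofReal_add (by linarith) (by linarith),
          ← ENNReal.ofReal_add (by linarith) (by linarith)]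
        congr 1; ring

end MonotoneDecomposition

end

section

/-! ### Continuous sublinear gauges -/

section Gauge

variable {V : Type*} [NormedAddCommGroup V] [NormedSpace ℝ V]

/-- A continuous nonnegative sublinear function. -/
structure IsGauge (N : V → ℝ) : Prop where
  continuous : Continuous N
  nonneg : ∀ v, 0 ≤ N v
  add_le : ∀ v w, N (v + w) ≤ N v + N w
  smul : ∀ c : ℝ, 0 ≤ c → ∀ v, N (c • v) = c * N v

theorem isGauge_norm : IsGauge (fun v : V => ‖v‖) where
  continuous := continuous_norm
  nonneg := norm_nonneg
  add_le := norm_add_le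
  smul c hc v := by rw [norm_smul, Real.norm_of_nonneg hc]

namespace IsGauge

variable {N : V → ℝ} (hN : IsGauge N)
include hN

theorem zero : N 0 = 0 := by simpa using hN.smul 0 le_rfl 0

theorem exists_bound : ∃ c, 0 < c ∧ ∀ v, N v ≤ c * ‖v‖ := by
  have h0 : ∀ᶠ v in 𝓝 (0 : V), N v < 1 :=
    hN.continuous.continuousAt.eventually_lt continuousAt_const (by simp [hN.zero])
  obtain ⟨δ, hδ, h⟩ := Metric.eventually_nhds_iff.1 h0
  refine ⟨2 / δ, by positivity, fun v => ?_⟩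
  rcases eq_or_ne v 0 with rfl | hv
  · simp [hN.zero]
  have hv' : 0 < ‖v‖ := norm_pos_iff.2 hv
  have h1 : N ((δ / 2 / ‖v‖) • v) < 1 := by
    apply h
    rw [dist_zero_right, norm_smul, Real.norm_of_nonneg (by positivity)]
    field_simp
    linarith
  rw [hN.smul _ (by positivity)] at h1
  have : δ * N v < 2 * ‖v‖ := by
    field_simp at h1
    linarith
  rw [div_mul_eq_mul_div, le_div_iff₀ hδ]
  linarith

theorem sub_le (v w : V) : N v - N w ≤ N (v - w) := by
  have := hN.add_le (v - w) w
  rw [sub_add_cancel] at this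
  linarith

/-- Hahn–Banach for a sublinear majorant; the extension is automatically continuous because N(v) and
N(-v) are both at most c‖v‖. -/
theorem exists_dual_of_le (f : V →ₗ.[ℝ] ℝ) (hf : ∀ x : f.domain, f x ≤ N x) :
    ∃ ξ : V →L[ℝ] ℝ, (∀ x : f.domain, ξ x = f x) ∧ ∀ w, ξ w ≤ N w := by
  obtain ⟨g, hg, hgN⟩ := exists_extension_of_le_sublinear f N (fun c hc x => hN.smul c hc.le x)
    hN.add_le hf
  obtain ⟨c, hc, hNc⟩ := hN.exists_bound
  refine ⟨g.mkContinuous c fun v => ?_, hg, hgN⟩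
  rw [Real.norm_eq_abs, abs_le]
  constructor
  · have h1 := (hgN (-v)).trans (hNc (-v))
    rw [map_neg, norm_neg] at h1
    linarith
  · exact (hgN v).trans (hNc v)

/-- On the line through v, the functional c • v ↦ c N(v) is dominated by N; for c < 0 this uses 0 =
N(0) ≤ N(cv) + N(-cv). -/
theorem exists_dual (v : V) : ∃ ξ : V →L[ℝ] ℝ, ξ v = N v ∧ ∀ w, ξ w ≤ N w := by
  rcases eq_or_ne v 0 with rfl | hv
  · exact ⟨0, by simp [hN.zero], fun w => by simpa using hN.nonneg w⟩
  obtain ⟨ξ, h1, h2⟩ := hN.exists_dual_of_le (LinearPMap.mkSpanSingleton v (N v) hv) (by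
    rintro ⟨x, hx⟩
    obtain ⟨c, rfl⟩ := Submodule.mem_span_singleton.1 hx
    refine (LinearPMap.mkSpanSingleton'_apply v (N v) _ c hx).trans_le ?_
    rcases le_total 0 c with hc | hc
    · simp [hN.smul c hc]
    · have h1 := hN.smul (-c) (by linarith) v
      have h2 := hN.add_le (c • v) ((-c) • v)
      rw [← add_smul, add_neg_cancel, zero_smul, hN.zero] at h2
      simp only [RingHom.id_apply, smul_eq_mul]
      linarith)
  refine ⟨ξ, ?_, h2⟩
  have h3 := h1 ⟨v, Submodule.mem_span_singleton_self v⟩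
  have h4 := LinearPMap.mkSpanSingleton_apply ℝ ℝ (σ := RingHom.id ℝ) hv (N v)
  exact h3.trans h4

/-- Jensen's inequality: the supporting functional at the integral passes under the integral sign
and is dominated by N there. -/
theorem integral_le {μ : Measure ℝ} [CompleteSpace V] {g : ℝ → V} (hg : Integrable g μ) :
    N (∫ t, g t ∂μ) ≤ ∫ t, N (g t) ∂μ := by
  obtain ⟨c, hc, hNc⟩ := hN.exists_bound
  obtain ⟨ξ, h1, h2⟩ := hN.exists_dual (∫ t, g t ∂μ)
  rw [← h1, ← ξ.integral_comp_comm hg]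
  refine integral_mono (ξ.integrable_comp hg) ?_ fun t => h2 _
  refine (hg.norm.const_mul c).mono' (hN.continuous.comp_aestronglyMeasurable hg.1) ?_
  exact Eventually.of_forall fun t => by
    rw [Real.norm_of_nonneg (hN.nonneg _)]; exact hNc _

theorem integrable_comp {μ : Measure ℝ} {g : ℝ → V} (hg : Integrable g μ) :
    Integrable (fun t => N (g t)) μ := by
  obtain ⟨c, hc, hNc⟩ := hN.exists_bound
  refine (hg.norm.const_mul c).mono' (hN.continuous.comp_aestronglyMeasurable hg.1) ?_
  exact Eventually.of_forall fun t => by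
    rw [Real.norm_of_nonneg (hN.nonneg _)]; exact hNc _

end IsGauge

end Gauge

end

section

/-! ### One-sided limits and jumps of curves of bounded variation -/

section Curve

variable {V : Type*} [NormedAddCommGroup V] [NormedSpace ℝ V] [CompleteSpace V]

theorem constExt_of_mem {T : ℝ} {u : ℝ → V} {t : ℝ} (ht : t ∈ Icc 0 T) : constExt T u t = u t := by
  rw [constExt, min_eq_right ht.2, max_eq_right ht.1]

variable {T : ℝ} {u : ℝ → V} (hT : 0 < T) (hu : BoundedVariationOn u (Icc 0 T))

include hT hu in
theorem tendsto_leftLimit {t : ℝ} (ht : t ∈ Ioc 0 T) :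
    Tendsto u (𝓝[<] t) (𝓝 (leftLimit T u t)) := by
  refine ((boundedVariationOn_constExt hT hu).tendsto_leftLim t).congr' ?_
  filter_upwards [Ioo_mem_nhdsLT ht.1] with s hs
  exact constExt_of_mem ⟨hs.1.le, hs.2.le.trans ht.2⟩

include hT hu in
theorem tendsto_rightLimit {t : ℝ} (ht : t ∈ Ico 0 T) :
    Tendsto u (𝓝[>] t) (𝓝 (rightLimit T u t)) := by
  refine ((boundedVariationOn_constExt hT hu).tendsto_rightLim t).congr' ?_
  filter_upwards [Ioo_mem_nhdsGT ht.2] with s hs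
  exact constExt_of_mem ⟨ht.1.trans hs.1.le, hs.2.le⟩

include hT in
theorem leftLimit_zero : leftLimit T u 0 = u 0 := by
  refine leftLim_eq_of_tendsto ?_
  refine tendsto_const_nhds.congr' ?_
  filter_upwards [self_mem_nhdsWithin] with s hs
  rw [constExt, max_eq_left ((min_le_right _ _).trans (le_of_lt hs))]

include hT in
theorem rightLimit_end : rightLimit T u T = u T := by
  refine rightLim_eq_of_tendsto ?_
  refine tendsto_const_nhds.congr' ?_
  filter_upwards [self_mem_nhdsWithin] with s hs
  rw [constExt, min_eq_left (le_of_lt hs), max_eq_right hT.le]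

theorem leftLimit_eq_of_notMem {t : ℝ} (ht : t ∈ Icc 0 T) (hJ : t ∉ jumpSet T u) :
    leftLimit T u t = u t := by
  by_contra h
  exact hJ ⟨ht, Or.inl h⟩

theorem rightLimit_eq_of_notMem {t : ℝ} (ht : t ∈ Icc 0 T) (hJ : t ∉ jumpSet T u) :
    rightLimit T u t = u t := by
  by_contra h
  exact hJ ⟨ht, Or.inr (Ne.symm h)⟩

/-- The variation function of the extended curve. -/
def variationFun (T : ℝ) (u : ℝ → V) (t : ℝ) : ℝ := variationOnFromTo (constExt T u) univ 0 t

include hT hu in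
theorem variationFun_monotone : Monotone (variationFun T u) :=
  monotoneOn_univ.1 (variationOnFromTo.monotoneOn
    (boundedVariationOn_constExt hT hu).locallyBoundedVariationOn (mem_univ 0))

include hT hu in
theorem norm_sub_le_variationFun {s t : ℝ} (h : s ≤ t) :
    ‖constExt T u t - constExt T u s‖ ≤ variationFun T u t - variationFun T u s := by
  have hb := boundedVariationOn_constExt hT hu
  rw [variationFun, variationFun, variationOnFromTo.sub_right hb.locallyBoundedVariationOn
    (mem_univ _) (mem_univ _) (mem_univ _), variationOnFromTo.eq_of_le _ _ h, ← dist_eq_norm]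
  have hb' : BoundedVariationOn (constExt T u) (univ ∩ Icc s t) := hb.mono inter_subset_left
  exact hb'.dist_le ⟨mem_univ _, h, le_rfl⟩ ⟨mem_univ _, le_rfl, h⟩

include hT hu in
theorem countable_jumpSet : (jumpSet T u).Countable := by
  refine (variationFun_monotone hT hu).countable_not_continuousAt.mono ?_
  rintro t ⟨ht, hne⟩ hc
  have hcont : ContinuousAt (constExt T u) t := by
    rw [ContinuousAt, tendsto_iff_norm_sub_tendsto_zero]
    have h1 : Tendsto (fun s => |variationFun T u s - variationFun T u t|) (𝓝 t) (𝓝 0) := by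
      have := (hc.tendsto.sub_const (variationFun T u t)).abs
      simpa using this
    refine squeeze_zero (fun _ => norm_nonneg _) (fun s => ?_) h1
    rcases le_total t s with h | h
    · exact (norm_sub_le_variationFun hT hu h).trans (le_abs_self _)
    · rw [norm_sub_rev, abs_sub_comm]
      exact (norm_sub_le_variationFun hT hu h).trans (le_abs_self _)
  rcases hne with h | h
  · apply h
    have := leftLim_eq_of_tendsto  
      (hcont.tendsto.mono_left (nhdsWithin_le_nhds (s := Iio t)))
    rw [leftLimit, this, constExt_of_mem ht]
  · apply h
    have := rightLim_eq_of_tendsto  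
      (hcont.tendsto.mono_left (nhdsWithin_le_nhds (s := Ioi t)))
    rw [rightLimit, this, constExt_of_mem ht]

include hT hu in
theorem tendsto_constExt_left (t : ℝ) :
    Tendsto (constExt T u) (𝓝[<] t) (𝓝 (leftLimit T u t)) :=
  (boundedVariationOn_constExt hT hu).tendsto_leftLim t

include hT hu in
theorem tendsto_constExt_right (t : ℝ) :
    Tendsto (constExt T u) (𝓝[>] t) (𝓝 (rightLimit T u t)) :=
  (boundedVariationOn_constExt hT hu).tendsto_rightLim t

theorem jumpVariation_eq (cost : ℝ → V → V → ℝ≥0∞) (a b : ℝ) :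
    jumpVariation cost T u a b = jumpSum (jumpSet T u) (fun t => cost t (leftLimit T u t) (u t))
      (fun t => cost t (u t) (rightLimit T u t)) a b := rfl

/-- A vector measure of a curve of bounded variation is dominated by every finite measure which
dominates the increments of the right limits. -/
theorem enorm_vectorMeasure_le {f : ℝ → V} (hf : BoundedVariationOn f univ) (μ : Measure ℝ)
    [IsFiniteMeasure μ]
    (h : ∀ a b, a ≤ b → ‖Function.rightLim f b - Function.rightLim f a‖ₑ ≤ μ (Ioc a b))
    (s : Set ℝ) : ‖hf.vectorMeasure s‖ₑ ≤ μ s := by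
  have B : (inferInstance : MeasurableSpace ℝ) =
      MeasurableSpace.generateFrom {s | ∃ u v : ℝ, u ≤ v ∧ s = Ioc u v} := by
    have := borel_eq_generateFrom_Ioc_le ℝ
    rw [← BorelSpace.measurable_eq (α := ℝ)] at this
    convert this using 2
    grind only
  -- The increments of the right limits extend from half-open intervals to a vector measure
  -- dominated by μ. Uniqueness of the extension then identifies it with the measure of f.
  obtain ⟨m, hm, hmle⟩ :=
    VectorMeasure.exists_extension_of_isSetSemiring_of_le_measure_of_generateFrom
    (μ := μ) (m := AddContent.onIoc (Function.rightLim f)) IsSetSemiring.Ioc (by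
      rintro s ⟨u, v, huv, rfl⟩
      rw [AddContent.onIoc_apply huv]
      exact h u v huv) B
  have hIoc : ∀ a b : ℝ, a ≤ b → hf.vectorMeasure (Ioc a b) = m (Ioc a b) := fun a b hab => by
    rw [hf.vectorMeasure_Ioc hab, hm _ ⟨a, b, hab, rfl⟩, AddContent.onIoc_apply hab]
  -- Uniqueness on a π-system also needs equal total mass, which is obtained by exhausting the line
  -- with (-n, n].
  have huniv : hf.vectorMeasure univ = m univ := by
    have hU : (univ : Set ℝ) = ⋃ n : ℕ, Ioc (-(n : ℝ)) n := by
      refine (eq_univ_of_forall fun x => ?_).symm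
      obtain ⟨n, hn⟩ := exists_nat_gt |x|
      exact mem_iUnion.2 ⟨n, by linarith [neg_abs_le x], by linarith [le_abs_self x]⟩
    have hmono : Monotone fun n : ℕ => Ioc (-(n : ℝ)) n := fun i j hij => by
      have : (i : ℝ) ≤ j := by exact_mod_cast hij
      exact Ioc_subset_Ioc (by linarith) this
    have h1 := hf.vectorMeasure.tendsto_vectorMeasure_iUnion_atTop_nat hmono
      fun _ => measurableSet_Ioc
    have h2 := m.tendsto_vectorMeasure_iUnion_atTop_nat hmono fun _ => measurableSet_Ioc
    rw [← hU] at h1 h2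
    refine tendsto_nhds_unique h1 (h2.congr fun n => (hIoc _ _ ?_).symm)
    have : (0 : ℝ) ≤ n := n.cast_nonneg
    linarith
  have heq : hf.vectorMeasure = m := by
    refine VectorMeasure.ext_of_generateFrom {s | ∃ u v : ℝ, u ≤ v ∧ s = Ioc u v} ?_ B ?_ huniv
    · rintro _ ⟨a, b, hab, rfl⟩
      exact hIoc a b hab
    · rintro _ ⟨a, b, hab, rfl⟩ _ ⟨c, d, hcd, rfl⟩ hne
      rw [Ioc_inter_Ioc] at hne ⊢
      exact ⟨_, _, (nonempty_Ioc.1 hne).le, rfl⟩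
  rw [heq]
  exact hmle s

end Curve

end

section

/-! ### The diffuse part of the derivative and increments of the curve -/

section Diffuse

variable {V : Type*} [NormedAddCommGroup V] [NormedSpace ℝ V] [CompleteSpace V]

theorem IsGauge.ofReal_hasSum_le {N : V → ℝ} (hN : IsGauge N) {ι : Type*} {x : ι → V} {X : V}
    (hx : HasSum x X) : ENNReal.ofReal (N X) ≤ ∑' i, ENNReal.ofReal (N (x i)) := by
  have hsum : ∀ s : Finset ι, N (∑ i ∈ s, x i) ≤ ∑ i ∈ s, N (x i) := fun s => by
    classical
    induction s using Finset.induction_on with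
    | empty => simp [hN.zero]
    | insert a s ha ih =>
      rw [Finset.sum_insert ha, Finset.sum_insert ha]
      exact (hN.add_le _ _).trans (by linarith)
  refine le_of_tendsto (ENNReal.tendsto_ofReal ((hN.continuous.tendsto X).comp hx))
    (Eventually.of_forall fun s => ?_)
  calc ENNReal.ofReal (N (∑ i ∈ s, x i)) ≤ ENNReal.ofReal (∑ i ∈ s, N (x i)) :=
        ENNReal.ofReal_le_ofReal (hsum s)
    _ = ∑ i ∈ s, ENNReal.ofReal (N (x i)) :=
        ENNReal.ofReal_sum_of_nonneg fun i _ => hN.nonneg _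
    _ ≤ _ := ENNReal.sum_le_tsum s

/-- The jump variation of `u` for the gauge `N`. -/
def gaugeJump (N : V → ℝ) (T : ℝ) (u : ℝ → V) (a b : ℝ) : ℝ≥0∞ :=
  jumpSum (jumpSet T u) (fun t => ENNReal.ofReal (N (u t - leftLimit T u t)))
    (fun t => ENNReal.ofReal (N (rightLimit T u t - u t))) a b

variable {T : ℝ} {u : ℝ → V} (hT : 0 < T) (hu : BoundedVariationOn u (Icc 0 T))

include hT hu in
theorem norm_sub_leftLimit_le {r s : ℝ} (hr : r ∈ Ioc 0 T) (hs : s ∈ Ico 0 r) :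
    ‖u r - leftLimit T u r‖ ≤ variationFun T u r - variationFun T u s := by
  refine le_of_tendsto ((tendsto_leftLimit hT hu hr).const_sub _).norm ?_
  filter_upwards [Ico_mem_nhdsLT hs.2] with x hx
  have h1 := norm_sub_le_variationFun hT hu hx.2.le
  rw [constExt_of_mem ⟨hr.1.le, hr.2⟩,
    constExt_of_mem ⟨hs.1.trans hx.1, hx.2.le.trans hr.2⟩] at h1
  have h2 := variationFun_monotone hT hu hx.1
  linarith

include hT hu in
theorem norm_rightLimit_sub_le {r s : ℝ} (hr : r ∈ Ico 0 T) (hs : s ∈ Ioc r T) :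
    ‖rightLimit T u r - u r‖ ≤ variationFun T u s - variationFun T u r := by
  refine le_of_tendsto ((tendsto_rightLimit hT hu hr).sub_const _).norm ?_
  filter_upwards [Ioc_mem_nhdsGT hs.1] with x hx
  have h1 := norm_sub_le_variationFun hT hu hx.1.le
  rw [constExt_of_mem ⟨hr.1, hr.2.le⟩,
    constExt_of_mem ⟨hr.1.trans hx.1.le, hx.2.trans hs.2⟩] at h1
  have h2 := variationFun_monotone hT hu hx.2
  linarith

include hT hu in
-- The jumps of u are dominated by those of its variation function, a monotone function, so
-- `jumpSum_add_lintegral_le` applies with D = 0.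
theorem gaugeJump_norm_ne_top : gaugeJump (fun v : V => ‖v‖) T u 0 T ≠ ∞ := by
  have := jumpSum_add_lintegral_le (l := volume) le_rfl (variationFun_monotone hT hu)
    (countable_jumpSet hT hu) (D := fun _ => 0) hT
    (α := fun t => ENNReal.ofReal ‖u t - leftLimit T u t‖)
    (β := fun t => ENNReal.ofReal ‖rightLimit T u t - u t‖)
    (fun r hr s hs => ENNReal.ofReal_le_ofReal (norm_sub_leftLimit_le hT hu hr hs))
    (fun r hr s hs => ENNReal.ofReal_le_ofReal (norm_rightLimit_sub_le hT hu hr hs))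
    (Eventually.of_forall fun t _ ε hε => Or.inl (Eventually.frequently (by
      filter_upwards [self_mem_nhdsWithin] with s hs
      have h1 := variationFun_monotone hT hu (le_of_lt hs)
      have h2 : 0 ≤ volume.real (Icc t s) := measureReal_nonneg
      nlinarith)))
  exact ne_top_of_le_ne_top ENNReal.ofReal_ne_top (le_self_add.trans this)

theorem jumpSum_mono {J : Set ℝ} {α β α' β' : ℝ → ℝ≥0∞} (h : ∀ t, α t ≤ α' t)
    (h' : ∀ t, β t ≤ β' t) (a b : ℝ) : jumpSum J α β a b ≤ jumpSum J α' β' a b :=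
  add_le_add (add_le_add (h' a) (h b)) (ENNReal.tsum_le_tsum fun t => add_le_add (h t) (h' t))

theorem jumpSum_mul {J : Set ℝ} {α β : ℝ → ℝ≥0∞} (c : ℝ≥0∞) (a b : ℝ) :
    jumpSum J (fun t => c * α t) (fun t => c * β t) a b = c * jumpSum J α β a b := by
  simp only [jumpSum, mul_add, ← ENNReal.tsum_mul_left]

theorem jumpSum_add {J : Set ℝ} {α β α' β' : ℝ → ℝ≥0∞} (a b : ℝ) :
    jumpSum J (fun t => α t + α' t) (fun t => β t + β' t) a b =
      jumpSum J α β a b + jumpSum J α' β' a b := by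
  have : ∀ t : (J ∩ Ioo a b : Set ℝ), (α t + α' t) + (β t + β' t) = (α t + β t) + (α' t + β' t) :=
    fun t => by ring
  simp only [jumpSum, this, ENNReal.tsum_add]
  ring

/-- Additivity of jump sums, when the division point does not contribute unless it is in `J`. -/
theorem jumpSum_split {J : Set ℝ} {α β : ℝ → ℝ≥0∞} {a b c : ℝ} (hab : a < b) (hbc : b < c)
    (h : b ∉ J → α b = 0 ∧ β b = 0) :
    jumpSum J α β a c = jumpSum J α β a b + jumpSum J α β b c := by
  have hind : ∀ x y : ℝ, ∑' t : (J ∩ Ioo x y : Set ℝ), (α t + β t) =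
      ∑' t, (J ∩ Ioo x y).indicator (fun t => α t + β t) t := fun x y =>
    tsum_subtype (J ∩ Ioo x y) (fun t => α t + β t)
  have hsplit : (J ∩ Ioo a c).indicator (fun t => α t + β t) =
      fun t => (J ∩ Ioo a b).indicator (fun t => α t + β t) t +
        (J ∩ Ioo b c).indicator (fun t => α t + β t) t +
        ({b} : Set ℝ).indicator (fun t => α t + β t) t := by
    funext t
    by_cases htJ : t ∈ J
    · rcases lt_trichotomy t b with h1 | rfl | h1
      · simp [indicator, htJ, h1, h1.trans hbc, h1.ne, not_lt.2 h1.le]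
      · simp [indicator, htJ, hab, hbc]
      · simp [indicator, htJ, h1, hab.trans h1, h1.ne', not_lt.2 h1.le]
    · rcases eq_or_ne t b with rfl | hne
      · simp [indicator, htJ, h htJ]
      · simp [indicator, htJ, hne]
  have hb : ∑' t, ({b} : Set ℝ).indicator (fun t => α t + β t) t = α b + β b := by
    rw [tsum_eq_single b (fun t ht => by simp [ht])]; simp
  simp only [jumpSum, hind, hsplit, ENNReal.tsum_add, hb]
  ring

theorem jumpSum_mono_interval {J : Set ℝ} {α β : ℝ → ℝ≥0∞} {a b c : ℝ} (hab : a < b) (hbc : b < c)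
    (h : b ∉ J → α b = 0 ∧ β b = 0) :
    jumpSum J α β a b ≤ jumpSum J α β a c := by
  rw [jumpSum_split hab hbc h]; exact le_self_add

theorem gaugeJump_split {N : V → ℝ} (hN : IsGauge N) {a b c : ℝ} (ha : 0 ≤ a) (hab : a < b)
    (hbc : b < c) (hc : c ≤ T) :
    gaugeJump N T u a c = gaugeJump N T u a b + gaugeJump N T u b c := by
  refine jumpSum_split hab hbc fun h => ?_
  have hb : b ∈ Icc 0 T := ⟨(ha.trans_lt hab).le, (hbc.trans_le hc).le⟩
  rw [leftLimit_eq_of_notMem hb h, rightLimit_eq_of_notMem hb h, sub_self, hN.zero]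
  simp

include hT hu in
theorem gaugeJump_ne_top {N : V → ℝ} (hN : IsGauge N) : gaugeJump N T u 0 T ≠ ∞ := by
  obtain ⟨c, hc, hNc⟩ := hN.exists_bound
  have hle : ∀ v, ENNReal.ofReal (N v) ≤ ENNReal.ofReal c * ENNReal.ofReal ‖v‖ := fun v => by
    rw [← ENNReal.ofReal_mul hc.le]; exact ENNReal.ofReal_le_ofReal (hNc v)
  have h1 : gaugeJump N T u 0 T ≤ ENNReal.ofReal c * gaugeJump (fun v : V => ‖v‖) T u 0 T := by
    rw [gaugeJump, gaugeJump, ← jumpSum_mul]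
    exact jumpSum_mono (fun _ => hle _) (fun _ => hle _) _ _
  exact ne_top_of_le_ne_top
    (ENNReal.mul_ne_top ENNReal.ofReal_ne_top (gaugeJump_norm_ne_top hT hu)) h1

include hT hu in
theorem gaugeJump_ne_top' {N : V → ℝ} (hN : IsGauge N) {s t : ℝ} (hs : 0 ≤ s) (hst : s < t)
    (ht : t ≤ T) : gaugeJump N T u s t ≠ ∞ := by
  have h1 : gaugeJump N T u s t ≤ gaugeJump N T u 0 t := by
    rcases hs.eq_or_lt with rfl | hs'
    · exact le_rfl
    · rw [gaugeJump_split hN le_rfl hs' hst ht]; exact le_add_self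
  have h2 : gaugeJump N T u 0 t ≤ gaugeJump N T u 0 T := by
    rcases ht.eq_or_lt with rfl | ht'
    · exact le_rfl
    · rw [gaugeJump_split hN le_rfl (hs.trans_lt hst) ht' le_rfl]; exact le_self_add
  exact ne_top_of_le_ne_top (gaugeJump_ne_top hT hu hN) (h1.trans h2)

theorem diffusePart_apply (A : Set ℝ) (hA : MeasurableSet A) :
    diffusePart hT hu A = (boundedVariationOn_constExt hT hu).vectorMeasure
      (A ∩ (jumpSet T u)ᶜ ∩ Ioo 0 T) := by
  have hJ := (countable_jumpSet hT hu).measurableSet.compl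
  rw [diffusePart, VectorMeasure.restrict_apply _ hJ hA, distribDeriv,
    VectorMeasure.restrict_apply _ measurableSet_Ioo (hA.inter hJ)]

/-- The dominating measure is the Stieltjes measure of the variation of the right-limit function,
which is finite because the total variation is. -/
theorem exists_finiteMeasure_bound : ∃ μ : Measure ℝ, IsFiniteMeasure μ ∧
    ∀ s, ‖(boundedVariationOn_constExt hT hu).vectorMeasure s‖ₑ ≤ μ s := by
  set hf := boundedVariationOn_constExt hT hu
  refine ⟨(hf.stieltjesFunctionRightLim 0).measure,
    StieltjesFunction.isFiniteMeasure_of_forall_abs_le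
      (C := (eVariationOn (Function.rightLim (constExt T u)) univ).toReal) _
      (fun x => variationOnFromTo.abs_le_eVariationOn hf.rightLim), fun s => ?_⟩
  have : IsFiniteMeasure (hf.stieltjesFunctionRightLim 0).measure :=
    StieltjesFunction.isFiniteMeasure_of_forall_abs_le
      (C := (eVariationOn (Function.rightLim (constExt T u)) univ).toReal) _
      (fun x => variationOnFromTo.abs_le_eVariationOn hf.rightLim)
  refine enorm_vectorMeasure_le hf _ (fun u v huv => ?_) s
  simp only [StieltjesFunction.measure_Ioc, BoundedVariationOn.stieltjesFunctionRightLim_apply]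
  rw [← variationOnFromTo.add hf.rightLim.locallyBoundedVariationOn
    (mem_univ 0) (mem_univ u) (mem_univ v)]
  simp only [add_sub_cancel_left, variationOnFromTo, huv, ↓reduceIte, univ_inter]
  rw [ENNReal.ofReal_toReal]; swap
  · exact ((eVariationOn.mono _ (subset_univ _)).trans_lt hf.rightLim.lt_top).ne
  rw [← edist_eq_enorm_sub]
  exact eVariationOn.edist_le _ ⟨huv, le_rfl⟩ ⟨le_rfl, huv⟩

theorem exists_diffuse_bound : ∃ μ : Measure ℝ, IsFiniteMeasure μ ∧
    (diffusePart hT hu).variation ≤ μ ∧ (cantorPart hT hu).variation ≤ μ := by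
  obtain ⟨μ, hμ, h⟩ := exists_finiteMeasure_bound hT hu
  have hd : ∀ A, MeasurableSet A → ‖diffusePart hT hu A‖ₑ ≤ μ A := fun A hA => by
    rw [diffusePart_apply hT hu A hA]
    exact (h _).trans (measure_mono fun x hx => hx.1.1)
  refine ⟨μ, hμ, VectorMeasure.variation_le_of_forall_enorm_le hd,
    VectorMeasure.variation_le_of_forall_enorm_le fun A hA => ?_⟩
  set S := (Measure.mutuallySingular_singularPart (diffusePart hT hu).variation volume).nullSetᶜ
  -- Restriction of a vector measure to a nonmeasurable set is zero by convention, so the bound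
  -- holds in either case.
  by_cases hS : MeasurableSet S
  · rw [cantorPart, VectorMeasure.restrict_apply _ hS hA]
    exact (hd _ (hA.inter hS)).trans (measure_mono inter_subset_left)
  · rw [cantorPart, VectorMeasure.restrict_not_measurable _ hS]; simp

theorem diffusePart_singleton (t : ℝ) : diffusePart hT hu {t} = 0 := by
  rw [diffusePart_apply hT hu _ (measurableSet_singleton t)]
  by_cases ht : t ∈ (jumpSet T u)ᶜ ∩ Ioo 0 T
  · have : ({t} ∩ (jumpSet T u)ᶜ ∩ Ioo 0 T : Set ℝ) = {t} := by
      rw [inter_assoc]; exact inter_eq_left.2 (singleton_subset_iff.2 ht)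
    rw [this, BoundedVariationOn.vectorMeasure_singleton]
    have h1 := leftLimit_eq_of_notMem ⟨ht.2.1.le, ht.2.2.le⟩ ht.1
    have h2 := rightLimit_eq_of_notMem ⟨ht.2.1.le, ht.2.2.le⟩ ht.1
    rw [leftLimit] at h1
    rw [rightLimit] at h2
    rw [h1, h2, sub_self]
  · have : ({t} ∩ (jumpSet T u)ᶜ ∩ Ioo 0 T : Set ℝ) = ∅ := by
      rw [inter_assoc, singleton_inter_eq_empty]; exact ht
    rw [this, VectorMeasure.empty]

theorem cantorPart_apply (A : Set ℝ) (hA : MeasurableSet A) :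
    cantorPart hT hu A = diffusePart hT hu (A ∩
      (Measure.mutuallySingular_singularPart (diffusePart hT hu).variation volume).nullSetᶜ) :=
  VectorMeasure.restrict_apply _
    (Measure.MutuallySingular.measurableSet_nullSet _).compl hA

instance isFiniteMeasure_cantorPart : IsFiniteMeasure (cantorPart hT hu).variation := by
  obtain ⟨μ, hμ, -, h⟩ := exists_diffuse_bound hT hu
  exact ⟨(h univ).trans_lt (measure_lt_top μ univ)⟩

instance nullSingleton_cantorPart : NullSingletonClass (cantorPart hT hu).variation where
  measure_singleton t := by
    rw [VectorMeasure.variation_apply_eq_zero (measurableSet_singleton t)]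
    intro s hts hs
    rcases subset_singleton_iff_eq.1 hts with rfl | rfl
    · simp
    · rw [cantorPart_apply hT hu _ hs]
      by_cases ht : t ∈ (Measure.mutuallySingular_singularPart
          (diffusePart hT hu).variation volume).nullSetᶜ
      · rw [inter_eq_left.2 (singleton_subset_iff.2 ht), diffusePart_singleton]
      · rw [singleton_inter_eq_empty.2 ht, VectorMeasure.empty]

/-- The measure `‖u_C'‖ + L¹` on the whole line. -/
def lineMeasure : Measure ℝ := (cantorPart hT hu).variation + volume

instance : IsLocallyFiniteMeasure (lineMeasure hT hu) := by
  refine ⟨fun x => ⟨Ioo (x - 1) (x + 1), Ioo_mem_nhds (by linarith) (by linarith), ?_⟩⟩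
  rw [lineMeasure, Measure.add_apply]
  exact ENNReal.add_lt_top.2 ⟨measure_lt_top _ _, measure_Ioo_lt_top⟩

instance : NullSingletonClass (lineMeasure hT hu) where
  measure_singleton t := by simp [lineMeasure]

theorem volume_le_lineMeasure : volume ≤ lineMeasure hT hu := Measure.le_add_left le_rfl

theorem cantorPart_variation_compl : (cantorPart hT hu).variation (Ioo 0 T)ᶜ = 0 := by
  rw [VectorMeasure.variation_apply_eq_zero measurableSet_Ioo.compl]
  intro s hsub hs
  rw [cantorPart_apply hT hu _ hs, diffusePart_apply]
  · convert VectorMeasure.empty _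
    ext x
    simp only [mem_inter_iff, mem_empty_iff_false, iff_false]
    rintro ⟨⟨⟨hx, -⟩, -⟩, hx'⟩
    exact hsub hx hx'
  · exact hs.inter (Measure.MutuallySingular.measurableSet_nullSet _).compl

theorem lineMeasure_restrict : (lineMeasure hT hu).restrict (Ioo 0 T) = refMeasure hT hu := by
  rw [lineMeasure, Measure.restrict_add, refMeasure]
  congr 1
  refine Measure.restrict_eq_self_of_ae_mem ?_
  rw [ae_iff]
  exact cantorPart_variation_compl hT hu

theorem mutuallySingular_cantorPart : (cantorPart hT hu).variation ⟂ₘ volume := by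
  set h := Measure.mutuallySingular_singularPart (diffusePart hT hu).variation volume
  refine ⟨h.nullSet, h.measurableSet_nullSet, ?_, h.measure_compl_nullSet⟩
  rw [VectorMeasure.variation_apply_eq_zero h.measurableSet_nullSet]
  intro s hsub hs
  rw [cantorPart_apply hT hu _ hs]
  convert VectorMeasure.empty _
  ext x
  simp only [mem_inter_iff, mem_empty_iff_false, iff_false]
  exact fun hx => hx.2 (hsub hx.1)

/-- This is the absolute continuity that the Radon–Nikodým property asks for. Off the chosen set
`nullSet` the diffuse part is the Cantor part. On `nullSet` the singular part of its variation
vanishes, so what remains there is absolutely continuous with respect to Lebesgue measure. -/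
theorem diffusePart_eq_zero_of_null {s : Set ℝ} (hs : MeasurableSet s)
    (h0 : refMeasure hT hu s = 0) : diffusePart hT hu s = 0 := by
  set h := Measure.mutuallySingular_singularPart (diffusePart hT hu).variation volume
  have hfin : IsFiniteMeasure (diffusePart hT hu).variation := by
    obtain ⟨μ, hμ, h, -⟩ := exists_diffuse_bound hT hu
    exact ⟨(h univ).trans_lt (measure_lt_top μ univ)⟩
  rw [refMeasure, Measure.add_apply, add_eq_zero] at h0
  have h1 : diffusePart hT hu (s ∩ h.nullSetᶜ) = 0 := by
    rw [← cantorPart_apply hT hu s hs]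
    exact (VectorMeasure.variation_apply_eq_zero hs).1 h0.1 s Subset.rfl hs
  have h2 : diffusePart hT hu (s ∩ h.nullSet ∩ Ioo 0 T) = 0 := by
    have hm : MeasurableSet (s ∩ h.nullSet ∩ Ioo 0 T) :=
      (hs.inter h.measurableSet_nullSet).inter measurableSet_Ioo
    refine (VectorMeasure.variation_apply_eq_zero hm).1 ?_ _ Subset.rfl hm
    have hdec := Measure.haveLebesgueDecomposition_add (diffusePart hT hu).variation volume
    refine (congrArg (fun ν : Measure ℝ => ν (s ∩ h.nullSet ∩ Ioo 0 T)) hdec).trans ?_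
    simp only [Measure.add_apply, add_eq_zero]
    constructor
    · exact measure_mono_null (fun x hx => hx.1.2) h.measure_nullSet
    · refine withDensity_absolutelyContinuous _ _ ?_
      have := h0.2
      rw [Measure.restrict_apply hs] at this
      have hsub : s ∩ h.nullSet ∩ Ioo 0 T ⊆ s ∩ Ioo 0 T := fun x hx => ⟨hx.1.1, hx.2⟩
      exact measure_mono_null hsub this
  have h3 : diffusePart hT hu (s ∩ h.nullSet ∩ (Ioo 0 T)ᶜ) = 0 := by
    rw [diffusePart_apply hT hu _
      ((hs.inter h.measurableSet_nullSet).inter measurableSet_Ioo.compl)]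
    convert VectorMeasure.empty _
    ext x
    simp only [mem_inter_iff, mem_empty_iff_false, iff_false]
    exact fun hx => hx.1.1.2 hx.2
  have h4 : s = (s ∩ h.nullSet ∩ Ioo 0 T) ∪ (s ∩ h.nullSet ∩ (Ioo 0 T)ᶜ) ∪ (s ∩ h.nullSetᶜ) := by
    rw [inter_union_compl, inter_union_compl]
  rw [h4, VectorMeasure.of_union, VectorMeasure.of_union, h1, h2, h3]
  · simp
  · exact disjoint_compl_right.mono inter_subset_right inter_subset_right
  · exact (hs.inter h.measurableSet_nullSet).inter measurableSet_Ioo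
  · exact (hs.inter h.measurableSet_nullSet).inter measurableSet_Ioo.compl
  · rw [inter_union_compl]
    exact disjoint_compl_right.mono inter_subset_right inter_subset_right
  · exact ((hs.inter h.measurableSet_nullSet).inter measurableSet_Ioo).union
      ((hs.inter h.measurableSet_nullSet).inter measurableSet_Ioo.compl)
  · exact hs.inter h.measurableSet_nullSet.compl

/-- Existence of the density of the diffuse part in spaces with the Radon-Nikodym property. -/
theorem exists_density (hV : RadonNikodymProperty V) :
    ∃ g : ℝ → V, Integrable g (refMeasure hT hu) ∧
      diffusePart hT hu = (refMeasure hT hu).withDensityᵥ g := by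
  have : IsFiniteMeasure (refMeasure hT hu) := by unfold refMeasure; infer_instance
  refine hV ℝ (refMeasure hT hu) (diffusePart hT hu) ?_
    fun s hs h0 => diffusePart_eq_zero_of_null hT hu hs h0
  obtain ⟨μ, hμ, h, -⟩ := exists_diffuse_bound hT hu
  exact ((h univ).trans_lt (measure_lt_top μ univ)).ne

end Diffuse

end

/-! ### Difference quotients of the curve and the diffuse density -/

section

section Density

variable {V : Type*} [NormedAddCommGroup V] [NormedSpace ℝ V] [CompleteSpace V]
variable {T : ℝ} {u : ℝ → V} (hT : 0 < T) (hu : BoundedVariationOn u (Icc 0 T)) {g : ℝ → V}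
  (hg : Integrable g (refMeasure hT hu))
  (hgd : diffusePart hT hu = (refMeasure hT hu).withDensityᵥ g)

include hg in
theorem integrable_indicator_density :
    Integrable ((Ioo 0 T).indicator g) (lineMeasure hT hu) := by
  rw [integrable_indicator_iff measurableSet_Ioo, IntegrableOn, lineMeasure_restrict]
  exact hg

include hg hgd in
theorem integral_density {s t : ℝ} (hs : 0 ≤ s) (ht : t ≤ T) :
    ∫ r in Ioo s t, (Ioo 0 T).indicator g r ∂(lineMeasure hT hu) = diffusePart hT hu (Ioo s t) := by
  rw [hgd, withDensityᵥ_apply hg measurableSet_Ioo, ← lineMeasure_restrict,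
    Measure.restrict_restrict measurableSet_Ioo]
  have : Ioo s t ∩ Ioo 0 T = Ioo s t := inter_eq_left.2 (Ioo_subset_Ioo hs ht)
  rw [this]
  refine setIntegral_congr_fun measurableSet_Ioo fun r hr => ?_
  exact indicator_of_mem (Ioo_subset_Ioo hs ht hr) g

include hg hgd in
/-- The increment of `u` differs from the integral of the diffuse density by the jumps. -/
theorem gauge_increment_le {N : V → ℝ} (hN : IsGauge N) {s t : ℝ} (hs : 0 ≤ s) (hst : s < t)
    (ht : t ≤ T) :
    ENNReal.ofReal (N (u t - u s -
      ∫ r in Ioo s t, (Ioo 0 T).indicator g r ∂(lineMeasure hT hu))) ≤ gaugeJump N T u s t := by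
  set hf := boundedVariationOn_constExt hT hu
  set J := jumpSet T u
  have hJ : J.Countable := countable_jumpSet hT hu
  have hJc : (J ∩ Ioo s t).Countable := hJ.mono inter_subset_left
  have hsub : Ioo s t ⊆ Ioo 0 T := Ioo_subset_Ioo hs ht
  have hDu : hf.vectorMeasure (Ioo s t) = leftLimit T u t - rightLimit T u s :=
    hf.vectorMeasure_Ioo hst
  have hdiff : diffusePart hT hu (Ioo s t) = hf.vectorMeasure (Ioo s t \ J) := by
    rw [diffusePart_apply hT hu _ measurableSet_Ioo]
    congr 1
    rw [inter_right_comm, inter_eq_left.2 hsub, sdiff_eq]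
  have hsplit : hf.vectorMeasure (Ioo s t) =
      hf.vectorMeasure (J ∩ Ioo s t) + hf.vectorMeasure (Ioo s t \ J) := by
    rw [← VectorMeasure.of_union _ hJc.measurableSet (measurableSet_Ioo.diff hJ.measurableSet)]
    · congr 1
      rw [inter_comm, inter_union_sdiff]
    · exact disjoint_sdiff_right.mono_left inter_subset_left
  have hsum : HasSum (fun r : (J ∩ Ioo s t : Set ℝ) => rightLimit T u r - leftLimit T u r)
      (hf.vectorMeasure (J ∩ Ioo s t)) := by
    have : Countable (J ∩ Ioo s t : Set ℝ) := hJc.to_subtype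
    have h := hf.vectorMeasure.hasSum_of_disjoint_iUnion
      (f := fun r : (J ∩ Ioo s t : Set ℝ) => ({(r : ℝ)} : Set ℝ))
      (fun r => measurableSet_singleton _) (by
        intro a b hab
        simpa [Function.onFun, Subtype.coe_inj] using hab)
    rw [iUnion_of_singleton_coe] at h
    exact h.congr_fun fun r => (hf.vectorMeasure_singleton).symm
  rw [integral_density hT hu hg hgd hs ht]
  -- The derivative of u has mass u(t-) - u(s+) on the open interval, so the remainder consists of
  -- the inner right jump at s, the inner left jump at t, and the full jumps strictly between.
  have heq : u t - u s - diffusePart hT hu (Ioo s t) =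
      (rightLimit T u s - u s) + (u t - leftLimit T u t) + hf.vectorMeasure (J ∩ Ioo s t) := by
    rw [hdiff, eq_sub_of_add_eq' hsplit.symm, hDu]; abel
  rw [heq]
  calc ENNReal.ofReal (N ((rightLimit T u s - u s) + (u t - leftLimit T u t) +
        hf.vectorMeasure (J ∩ Ioo s t)))
      ≤ ENNReal.ofReal (N (rightLimit T u s - u s) + N (u t - leftLimit T u t) +
          N (hf.vectorMeasure (J ∩ Ioo s t))) := by
        refine ENNReal.ofReal_le_ofReal ((hN.add_le _ _).trans ?_)
        have := hN.add_le (rightLimit T u s - u s) (u t - leftLimit T u t)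
        linarith
    _ = ENNReal.ofReal (N (rightLimit T u s - u s)) + ENNReal.ofReal (N (u t - leftLimit T u t)) +
          ENNReal.ofReal (N (hf.vectorMeasure (J ∩ Ioo s t))) := by
        rw [ENNReal.ofReal_add (add_nonneg (hN.nonneg _) (hN.nonneg _)) (hN.nonneg _),
          ENNReal.ofReal_add (hN.nonneg _) (hN.nonneg _)]
    _ ≤ gaugeJump N T u s t := by
        refine add_le_add le_rfl ((hN.ofReal_hasSum_le hsum).trans
          (ENNReal.tsum_le_tsum fun r => ?_))
        rw [← ENNReal.ofReal_add (hN.nonneg _) (hN.nonneg _)]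
        refine ENNReal.ofReal_le_ofReal ?_
        have h1 := hN.add_le (u r - leftLimit T u r) (rightLimit T u r - u r)
        rwa [sub_add_sub_cancel'] at h1

/-- The purely atomic measure of the jumps of `u`. -/
def jumpMeasure (T : ℝ) (u : ℝ → V) : Measure ℝ :=
  Measure.sum fun r : jumpSet T u => (ENNReal.ofReal ‖u r - leftLimit T u r‖ +
    ENNReal.ofReal ‖rightLimit T u r - u r‖) • Measure.dirac (r : ℝ)

theorem jumpMeasure_apply {A : Set ℝ} (hA : MeasurableSet A) :
    jumpMeasure T u A = ∑' r, (jumpSet T u ∩ A).indicator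
      (fun r => ENNReal.ofReal ‖u r - leftLimit T u r‖ +
        ENNReal.ofReal ‖rightLimit T u r - u r‖) r := by
  set c : ℝ → ℝ≥0∞ := fun r => ENNReal.ofReal ‖u r - leftLimit T u r‖ +
        ENNReal.ofReal ‖rightLimit T u r - u r‖
  rw [jumpMeasure, Measure.sum_apply _ hA, ← indicator_indicator,
    ← tsum_subtype (jumpSet T u) (A.indicator c)]
  refine tsum_congr fun r => ?_
  rw [Measure.smul_apply, Measure.dirac_apply' _ hA, smul_eq_mul]
  by_cases hr : (r : ℝ) ∈ A <;> simp [hr, c]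

include hT in
-- Only an inequality: the measure of the closed interval counts both one-sided jumps at s and at t,
-- while the jump variation counts only those inside [s, t].
theorem gaugeJump_le_jumpMeasure {s t : ℝ} (hs : 0 ≤ s) (hst : s < t) (ht : t ≤ T) :
    gaugeJump (fun v : V => ‖v‖) T u s t ≤ jumpMeasure T u (Icc s t) := by
  set c : ℝ → ℝ≥0∞ := fun r => ENNReal.ofReal ‖u r - leftLimit T u r‖ +
        ENNReal.ofReal ‖rightLimit T u r - u r‖ with hc
  have hsm : s ∈ Icc 0 T := ⟨hs, hst.le.trans ht⟩
  have htm : t ∈ Icc 0 T := ⟨hs.trans hst.le, ht⟩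
  have hzero : ∀ r ∈ Icc 0 T, r ∉ jumpSet T u → c r = 0 := fun r hr hJ => by
    simp [hc, leftLimit_eq_of_notMem hr hJ, rightLimit_eq_of_notMem hr hJ]
  have hle : (fun r => ({s} : Set ℝ).indicator c r + ({t} : Set ℝ).indicator c r +
      (jumpSet T u ∩ Ioo s t).indicator c r) ≤ (jumpSet T u ∩ Icc s t).indicator c := by
    intro r
    by_cases hJ : r ∈ jumpSet T u
    · by_cases h1 : r = s
      · subst h1; simp [indicator, hJ, hst.ne, hst.le]
      · by_cases h2 : r = t
        · subst h2; simp [indicator, hJ, hst.ne', hst.le]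
        · by_cases h3 : s < r ∧ r < t
          · simp [indicator, hJ, h1, h2, h3.1, h3.2, h3.1.le, h3.2.le]
          · simp [indicator, h1, h2, h3]
    · by_cases h1 : r = s
      · subst h1; simp [indicator, hst.ne, hzero r hsm hJ]
      · by_cases h2 : r = t
        · subst h2; simp [indicator, hzero r htm hJ]
        · simp [indicator, h1, h2, hJ]
  rw [jumpMeasure_apply measurableSet_Icc]
  refine le_trans ?_ (ENNReal.tsum_le_tsum hle)
  rw [ENNReal.tsum_add, ENNReal.tsum_add, tsum_eq_single s (fun t ht => by simp [ht]),
    tsum_eq_single t (fun t ht => by simp [ht]), ← tsum_subtype (jumpSet T u ∩ Ioo s t) c]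
  simp only [indicator_of_mem (mem_singleton _)]
  exact add_le_add (add_le_add le_add_self le_self_add) le_rfl

include hT hu in
theorem isFiniteMeasure_jumpMeasure : IsFiniteMeasure (jumpMeasure T u) := by
  refine ⟨?_⟩
  set c : ℝ → ℝ≥0∞ := fun r => ENNReal.ofReal ‖u r - leftLimit T u r‖ +
        ENNReal.ofReal ‖rightLimit T u r - u r‖ with hc
  have hle : (jumpSet T u ∩ univ).indicator c ≤ fun r => ({0} : Set ℝ).indicator c r +
      ({T} : Set ℝ).indicator c r + (jumpSet T u ∩ Ioo 0 T).indicator c r := by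
    intro r
    by_cases hJ : r ∈ jumpSet T u
    · rcases hJ.1.1.eq_or_lt with rfl | h1
      · simp [indicator, hJ, hT.ne]
      · rcases hJ.1.2.eq_or_lt with rfl | h2
        · simp [indicator, hJ, hT.ne']
        · simp [indicator, hJ, h1, h2, h1.ne']
    · simp [indicator, hJ]
  rw [jumpMeasure_apply MeasurableSet.univ]
  refine (ENNReal.tsum_le_tsum hle).trans_lt ?_
  rw [ENNReal.tsum_add, ENNReal.tsum_add, tsum_eq_single 0 (fun t ht => by simp [ht]),
    tsum_eq_single T (fun t ht => by simp [ht]), ← tsum_subtype (jumpSet T u ∩ Ioo 0 T) c]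
  simp only [indicator_of_mem (mem_singleton _)]
  have h3 : ∑' r : (jumpSet T u ∩ Ioo 0 T : Set ℝ), c r ≤ gaugeJump (fun v : V => ‖v‖) T u 0 T :=
    le_add_self
  have h4 : ∀ r, c r < ∞ := fun r => ENNReal.add_lt_top.2 ⟨by simp, by simp⟩
  exact ENNReal.add_lt_top.2 ⟨ENNReal.add_lt_top.2 ⟨h4 _, h4 _⟩,
    h3.trans_lt (gaugeJump_norm_ne_top hT hu).lt_top⟩

include hT hu in
theorem mutuallySingular_jumpMeasure {l : Measure ℝ} [NullSingletonClass l] :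
    jumpMeasure T u ⟂ₘ l := by
  have hJ := countable_jumpSet hT hu
  refine ⟨(jumpSet T u)ᶜ, hJ.measurableSet.compl, ?_, ?_⟩
  · rw [jumpMeasure_apply hJ.measurableSet.compl]; simp
  · rw [compl_compl]; exact hJ.measure_zero l

include hg hgd in
/-- At almost every point the difference quotients of `u` converge to the diffuse density. -/
theorem ae_tendsto_density : ∀ᵐ t ∂(lineMeasure hT hu), t ∈ Ioo 0 T →
    Tendsto (fun s => ((lineMeasure hT hu).real (Icc t s))⁻¹ • (u s - u t)) (𝓝[>] t)
      (𝓝 ((Ioo 0 T).indicator g t)) ∧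
    Tendsto (fun s => ((lineMeasure hT hu).real (Icc s t))⁻¹ • (u t - u s)) (𝓝[<] t)
      (𝓝 ((Ioo 0 T).indicator g t)) := by
  set l := lineMeasure hT hu
  set G := (Ioo 0 T).indicator g with hG
  have hGi : Integrable G l := integrable_indicator_density hT hu hg
  have hl : volume ≤ l := volume_le_lineMeasure hT hu
  have := isFiniteMeasure_jumpMeasure hT hu
  have hsing : jumpMeasure T u ⟂ₘ l := mutuallySingular_jumpMeasure hT hu
  filter_upwards [ae_average_oneSided hl hGi.locallyIntegrable,
    ae_rnDeriv_oneSided hl (jumpMeasure T u), hsing.rnDeriv_ae_eq_zero] with t hav hrn hzero ht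
  simp only [hzero, Pi.zero_apply] at hrn
  have hlpos : ∀ x y : ℝ, x < y → 0 < l.real (Icc x y) := fun x y hxy => by
    have h1 := hl (Icc x y)
    rw [Real.volume_Icc] at h1
    have h2 := (ENNReal.ofReal_le_iff_le_toReal measure_Icc_lt_top.ne).1 h1
    rw [measureReal_def]; linarith
  -- The error has two parts: the jump mass divided by l, which tends to the density of a singular
  -- measure and hence to 0, and the mean oscillation of the diffuse density, which vanishes at
  -- Lebesgue points.
  have key : ∀ x y : ℝ, 0 ≤ x → x < y → y ≤ T →
      ‖(l.real (Icc x y))⁻¹ • (u y - u x) - G t‖ ≤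
        (jumpMeasure T u (Icc x y) / l (Icc x y)).toReal + ⨍ z in Icc x y, ‖G z - G t‖ ∂l := by
    intro x y hx hxy hy
    have hp := hlpos x y hxy
    have h1 : ‖u y - u x - ∫ r in Ioo x y, G r ∂l‖ ≤ (jumpMeasure T u (Icc x y)).toReal := by
      have := (gauge_increment_le hT hu hg hgd isGauge_norm hx hxy hy).trans
        (gaugeJump_le_jumpMeasure hT hx hxy hy)
      exact (ENNReal.ofReal_le_iff_le_toReal (measure_ne_top _ _)).1 this
    have h2 : ∫ r in Ioo x y, G r ∂l = ∫ r in Icc x y, G r ∂l :=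
      (setIntegral_congr_set Ioo_ae_eq_Icc)
    have hfin : l (Icc x y) ≠ ∞ := measure_Icc_lt_top.ne
    have h3 : ∫ r in Icc x y, (G r - G t) ∂l =
        (∫ r in Icc x y, G r ∂l) - l.real (Icc x y) • G t := by
      rw [integral_sub hGi.integrableOn (integrableOn_const hfin), setIntegral_const]
    have h4 : (l.real (Icc x y))⁻¹ • (u y - u x) - G t =
        (l.real (Icc x y))⁻¹ • ((u y - u x - ∫ r in Icc x y, G r ∂l) +
          ∫ r in Icc x y, (G r - G t) ∂l) := by
      rw [h3, sub_add_sub_cancel, smul_sub _ (u y - u x), smul_smul, inv_mul_cancel₀ hp.ne',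
        one_smul]
    rw [h4, norm_smul, norm_inv, Real.norm_of_nonneg hp.le, setAverage_eq, smul_eq_mul,
      ENNReal.toReal_div, ← measureReal_def l, div_eq_inv_mul, ← mul_add]
    refine mul_le_mul_of_nonneg_left ((norm_add_le _ _).trans (add_le_add ?_ ?_))
      (inv_nonneg.2 hp.le)
    · rw [← h2]; exact h1
    · exact norm_integral_le_integral_norm _
  have hz := ENNReal.tendsto_toReal ENNReal.zero_ne_top
  constructor
  · rw [tendsto_iff_norm_sub_tendsto_zero]
    have h1 := ((hz.comp hrn.1).add hav.1)
    rw [ENNReal.toReal_zero, add_zero] at h1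
    refine squeeze_zero' (Eventually.of_forall fun _ => norm_nonneg _) ?_ h1
    filter_upwards [Ioo_mem_nhdsGT ht.2] with s hs using key t s ht.1.le hs.1 hs.2.le
  · rw [tendsto_iff_norm_sub_tendsto_zero]
    have h1 := ((hz.comp hrn.2).add hav.2)
    rw [ENNReal.toReal_zero, add_zero] at h1
    refine squeeze_zero' (Eventually.of_forall fun _ => norm_nonneg _) ?_ h1
    filter_upwards [Ioo_mem_nhdsLT ht.1] with s hs using key s t hs.1.le hs.2 ht.2.le

end Density

end

/-! ### Total variation as jump variation plus the integral of the density -/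

section

section Variation

variable {V : Type*} [NormedAddCommGroup V] [NormedSpace ℝ V] [CompleteSpace V]

theorem sum_le_gaugeVariation (N : V → ℝ) (u : ℝ → V) {τ : ℕ → ℝ} (hτ : Monotone τ) (M : ℕ) :
    ∑ m ∈ Finset.range M, ENNReal.ofReal (N (u (τ (m + 1)) - u (τ m))) ≤
      gaugeVariation N u (τ 0) (τ M) :=
  le_iSup_of_le M (le_iSup_of_le τ (le_iSup_of_le hτ
    (le_iSup_of_le rfl (le_iSup_of_le rfl le_rfl))))

/-- Any partition of [a, s] becomes a partition of [a, t] by appending t. -/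
theorem gaugeVariation_add_le (N : V → ℝ) (u : ℝ → V) {a s t : ℝ} (has : a ≤ s) (hst : s ≤ t) :
    gaugeVariation N u a s + ENNReal.ofReal (N (u t - u s)) ≤ gaugeVariation N u a t := by
  have key : ∀ (M : ℕ) (τ : ℕ → ℝ), Monotone τ → τ 0 = a → τ M = s →
      ∑ m ∈ Finset.range M, ENNReal.ofReal (N (u (τ (m + 1)) - u (τ m))) +
        ENNReal.ofReal (N (u t - u s)) ≤ gaugeVariation N u a t := by
    intro M τ hτ h0 hM
    -- The new partition stays at t from index M + 1 on, which keeps it monotone on all of ℕ.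
    set τ' : ℕ → ℝ := fun i => if i ≤ M then τ i else t with hτ'
    have hmono : Monotone τ' := by
      intro i j hij
      simp only [hτ']
      split_ifs with h1 h2
      · exact hτ hij
      · exact (hτ h1).trans (hM.le.trans hst)
      · omega
      · exact le_rfl
    have h := sum_le_gaugeVariation N u hmono (M + 1)
    have e0 : τ' 0 = a := by simp [hτ', h0]
    have eM : τ' (M + 1) = t := by simp [hτ']
    have eM' : τ' M = s := by simp [hτ', hM]
    rw [e0, eM, Finset.sum_range_succ, eM, eM'] at h
    refine le_trans (le_of_eq ?_) h
    congr 1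
    refine Finset.sum_congr rfl fun m hm => ?_
    have := Finset.mem_range.1 hm
    simp only [hτ', if_pos this.le, if_pos (Nat.succ_le_of_lt this)]
  -- The extra increment is moved to the other side so that the supremum over partitions can be
  -- taken. Truncated subtraction then requires this increment alone to be bounded by the variation;
  -- the two-point partition a, s followed by t shows it.
  refine add_le_of_le_tsub_right_of_le ?_ ?_
  · have h := key 1 (fun i => if i = 0 then a else s) (by
      intro i j hij
      dsimp only
      split_ifs with h1 h2
      · exact le_rfl
      · exact has
      · omega
      · exact le_rfl) (by simp) (by simp)
    exact le_add_self.trans h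
  · exact iSup_le fun M => iSup_le fun τ => iSup_le fun h1 => iSup_le fun h2 => iSup_le fun h3 =>
      ENNReal.le_sub_of_add_le_right ENNReal.ofReal_ne_top (key M τ h1 h2 h3)

theorem gaugeVariation_mono (N : V → ℝ) (u : ℝ → V) {a s t : ℝ} (has : a ≤ s) (hst : s ≤ t) :
    gaugeVariation N u a s ≤ gaugeVariation N u a t :=
  le_self_add.trans (gaugeVariation_add_le N u has hst)

variable {T : ℝ} {u : ℝ → V} (hT : 0 < T) (hu : BoundedVariationOn u (Icc 0 T)) {g : ℝ → V}
  (hg : Integrable g (refMeasure hT hu))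
  (hgd : diffusePart hT hu = (refMeasure hT hu).withDensityᵥ g)

include hg hgd in
theorem gauge_sub_le {N : V → ℝ} (hN : IsGauge N) {s t : ℝ} (hs : 0 ≤ s) (hst : s < t)
    (ht : t ≤ T) : ENNReal.ofReal (N (u t - u s)) ≤ gaugeJump N T u s t +
      ∫⁻ r in Ioo s t, ENNReal.ofReal (N ((Ioo 0 T).indicator g r)) ∂(lineMeasure hT hu) := by
  have hGi := (integrable_indicator_density hT hu hg).integrableOn (s := Ioo s t)
  set I := ∫ r in Ioo s t, (Ioo 0 T).indicator g r ∂(lineMeasure hT hu) with hI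
  have h1 : N (u t - u s) ≤ N (u t - u s - I) + N I := by
    simpa using hN.add_le (u t - u s - I) I
  refine (ENNReal.ofReal_le_ofReal h1).trans ?_
  rw [ENNReal.ofReal_add (hN.nonneg _) (hN.nonneg _)]
  refine add_le_add (gauge_increment_le hT hu hg hgd hN hs hst ht) ?_
  rw [← ofReal_integral_eq_lintegral_ofReal (hN.integrable_comp hGi)
    (Eventually.of_forall fun _ => hN.nonneg _)]
  exact ENNReal.ofReal_le_ofReal (hN.integral_le hGi)

include hg hgd in
theorem gaugeVariation_le {N : V → ℝ} (hN : IsGauge N) {t : ℝ} (ht : t ∈ Ioc 0 T) :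
    gaugeVariation N u 0 t ≤ gaugeJump N T u 0 t +
      ∫⁻ r in Ioo 0 t, ENNReal.ofReal (N ((Ioo 0 T).indicator g r)) ∂(lineMeasure hT hu) := by
  set l := lineMeasure hT hu
  set G := (Ioo 0 T).indicator g with hG
  set W : ℝ → ℝ → ℝ≥0∞ := fun s t =>
    gaugeJump N T u s t + ∫⁻ r in Ioo s t, ENNReal.ofReal (N (G r)) ∂l with hW
  refine iSup_le fun M => iSup_le fun τ => iSup_le fun hτ => iSup_le fun h0 => iSup_le fun hM => ?_
  -- The case distinction is needed because W 0 0 need not vanish: the jump sum of the degenerate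
  -- interval still contains the right jump at 0.
  have key : ∀ k ≤ M, (∑ m ∈ Finset.range k, ENNReal.ofReal (N (u (τ (m + 1)) - u (τ m)))) ≤
      if τ k = 0 then 0 else W 0 (τ k) := by
    intro k
    induction k with
    | zero => simp
    | succ k ih =>
      intro hk
      have ih := ih (by omega)
      rw [Finset.sum_range_succ]
      have hk0 : 0 ≤ τ k := h0 ▸ hτ (Nat.zero_le k)
      have hkT : τ (k + 1) ≤ T := (hτ hk).trans (hM.le.trans ht.2)
      rcases (hτ (Nat.le_succ k)).eq_or_lt with h | h
      · rw [← Nat.succ_eq_add_one, ← h, sub_self, hN.zero, ENNReal.ofReal_zero, add_zero]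
        exact ih
      · rw [if_neg (hk0.trans_lt h).ne']
        have h1 : ENNReal.ofReal (N (u (τ (k + 1)) - u (τ k))) ≤ W (τ k) (τ (k + 1)) :=
          gauge_sub_le hT hu hg hgd hN hk0 h hkT
        split_ifs at ih with hz
        · rw [hz] at h1
          rw [hz, nonpos_iff_eq_zero.1 ih, zero_add]; exact h1
        · have hpos : 0 < τ k := lt_of_le_of_ne hk0 (Ne.symm hz)
          refine (add_le_add ih h1).trans ?_
          simp only [hW]
          rw [gaugeJump_split hN le_rfl hpos h hkT, add_add_add_comm]
          refine add_le_add le_rfl ?_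
          rw [← lintegral_union measurableSet_Ioo
            (Set.disjoint_left.2 fun x hx hx' => lt_asymm hx.2 hx'.1)]
          exact lintegral_mono_set (union_subset (Ioo_subset_Ioo_right h.le)
            (Ioo_subset_Ioo_left hk0))
  have := key M le_rfl
  rwa [hM, if_neg ht.1.ne'] at this

include hg hgd in
-- The variation of u on [0, r] is monotone in r, and its increments dominate N of the increments of
-- u. Hence its jumps and its l-derivative dominate the jumps of u and N of the density, and
-- `jumpSum_add_lintegral_le` applies.
theorem le_gaugeVariation {N : V → ℝ} (hN : IsGauge N) {t : ℝ} (ht : t ∈ Ioc 0 T) :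
    gaugeJump N T u 0 t +
      ∫⁻ r in Ioo 0 t, ENNReal.ofReal (N ((Ioo 0 T).indicator g r)) ∂(lineMeasure hT hu) ≤
      gaugeVariation N u 0 t := by
  set l := lineMeasure hT hu
  set G := (Ioo 0 T).indicator g with hG
  rcases eq_or_ne (gaugeVariation N u 0 t) ∞ with htop | hfin
  · rw [htop]; exact le_top
  -- Clamping to [0, t] makes the variation function monotone on the whole line, as the
  -- decomposition lemma requires.
  set cl : ℝ → ℝ := fun r => max 0 (min t r) with hcl
  have hcl0 : ∀ r, 0 ≤ cl r := fun r => le_max_left _ _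
  have hclt : ∀ r, cl r ≤ t := fun r => max_le ht.1.le (min_le_left _ _)
  have hclm : Monotone cl := fun r s h => max_le_max le_rfl (min_le_min le_rfl h)
  have hcle : ∀ r ∈ Icc 0 t, cl r = r := fun r hr => by simp [hcl, hr.1, hr.2]
  set m : ℝ → ℝ := fun r => (gaugeVariation N u 0 (cl r)).toReal with hm
  have hfin' : ∀ r, gaugeVariation N u 0 (cl r) ≠ ∞ := fun r =>
    ne_top_of_le_ne_top hfin (gaugeVariation_mono N u (hcl0 r) (hclt r))
  have hmono : Monotone m := fun r s h =>
    ENNReal.toReal_mono (hfin' s) (gaugeVariation_mono N u (hcl0 r) (hclm h))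
  have hinc : ∀ r s, 0 ≤ r → r ≤ s → s ≤ t → N (u s - u r) ≤ m s - m r := by
    intro r s hr hrs hs
    have h := gaugeVariation_add_le N u hr hrs
    have h1 := hfin' s
    have h2 := hfin' r
    have e1 := hcle r ⟨hr, hrs.trans hs⟩
    have e2 := hcle s ⟨hr.trans hrs, hs⟩
    rw [e2] at h1
    rw [e1] at h2
    have h3 := ENNReal.toReal_mono h1 h
    rw [ENNReal.toReal_add h2 ENNReal.ofReal_ne_top, ENNReal.toReal_ofReal (hN.nonneg _)] at h3
    simp only [hm, e1, e2]
    linarith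
  have h := jumpSum_add_lintegral_le (volume_le_lineMeasure hT hu) hmono
    (countable_jumpSet hT hu) (D := fun r => N (G r)) ht.1
    (α := fun r => ENNReal.ofReal (N (u r - leftLimit T u r)))
    (β := fun r => ENNReal.ofReal (N (rightLimit T u r - u r))) ?_ ?_ ?_
  · refine h.trans ?_
    refine (ENNReal.ofReal_le_ofReal (sub_le_self _ ENNReal.toReal_nonneg)).trans ?_
    simp only [hm, hcle t ⟨ht.1.le, le_rfl⟩]
    rw [ENNReal.ofReal_toReal hfin]
  · intro r hr s hs
    refine ENNReal.ofReal_le_ofReal ?_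
    have hlim := (hN.continuous.tendsto _).comp
      ((tendsto_leftLimit hT hu ⟨hr.1, hr.2.trans ht.2⟩).const_sub (u r))
    refine le_of_tendsto hlim ?_
    filter_upwards [Ico_mem_nhdsLT hs.2] with x hx
    exact (hinc x r (hs.1.trans hx.1) hx.2.le hr.2).trans
      (sub_le_sub_left (hmono hx.1) _)
  · intro r hr s hs
    refine ENNReal.ofReal_le_ofReal ?_
    have hlim := (hN.continuous.tendsto _).comp
      ((tendsto_rightLimit hT hu ⟨hr.1, hr.2.trans_le ht.2⟩).sub_const (u r))
    refine le_of_tendsto hlim ?_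
    filter_upwards [Ioc_mem_nhdsGT hs.1] with x hx
    exact (hinc r x hr.1 hx.1.le (hx.2.trans hs.2)).trans
      (sub_le_sub_right (hmono hx.2) _)
  · filter_upwards [ae_tendsto_density hT hu hg hgd] with r hr hrt ε hε
    left
    refine Eventually.frequently ?_
    have h1 := (hN.continuous.tendsto _).comp (hr ⟨hrt.1, hrt.2.trans_le ht.2⟩).1
    filter_upwards [h1.eventually_const_lt (show N (G r) - ε < N (G r) by linarith),
      Ioo_mem_nhdsGT hrt.2] with s hs hsr
    have h2 : 0 ≤ (l.real (Icc r s))⁻¹ := inv_nonneg.2 measureReal_nonneg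
    have hs : N (G r) - ε < N ((l.real (Icc r s))⁻¹ • (u s - u r)) := hs
    rw [hN.smul _ h2] at hs
    have h3 := hinc r s hrt.1.le hsr.1.le hsr.2.le
    rcases (measureReal_nonneg : 0 ≤ l.real (Icc r s)).eq_or_lt with h4 | h4
    · rw [← h4, mul_zero]; exact (hN.nonneg _).trans h3
    · rw [inv_mul_eq_div, lt_div_iff₀ h4] at hs
      exact hs.le.trans h3

include hg hgd in
theorem gaugeVariation_eq {N : V → ℝ} (hN : IsGauge N) {t : ℝ} (ht : t ∈ Ioc 0 T) :
    gaugeVariation N u 0 t = gaugeJump N T u 0 t +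
      ∫⁻ r in Ioo 0 t, ENNReal.ofReal (N ((Ioo 0 T).indicator g r)) ∂(lineMeasure hT hu) :=
  le_antisymm (gaugeVariation_le hT hu hg hgd hN ht) (le_gaugeVariation hT hu hg hgd hN ht)

include hT hu in
/-- The Lebesgue density of the reference measure is one almost everywhere. -/
theorem ae_tendsto_lineMeasure_div : ∀ᵐ t ∂(volume : Measure ℝ),
    Tendsto (fun s => (lineMeasure hT hu).real (Icc t s) / (s - t)) (𝓝[>] t) (𝓝 1) ∧
    Tendsto (fun s => (lineMeasure hT hu).real (Icc s t) / (t - s)) (𝓝[<] t) (𝓝 1) := by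
  set C := (cantorPart hT hu).variation with hC
  have hz := (mutuallySingular_cantorPart hT hu).rnDeriv_ae_eq_zero
  filter_upwards [ae_rnDeriv_oneSided (l := (volume : Measure ℝ)) le_rfl C, hz] with t ht h0
  rw [h0, Pi.zero_apply] at ht
  have hreal : ∀ x y : ℝ, x < y → (lineMeasure hT hu).real (Icc x y) / (y - x) =
      (C (Icc x y) / volume (Icc x y)).toReal + 1 := by
    intro x y hxy
    have h1 : (0 : ℝ) < y - x := sub_pos.2 hxy
    rw [lineMeasure, measureReal_def, Measure.add_apply, ENNReal.toReal_add (measure_ne_top _ _)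
      measure_Icc_lt_top.ne, ENNReal.toReal_div, Real.volume_Icc, ENNReal.toReal_ofReal h1.le,
      add_div, div_self h1.ne']
  have hz := ENNReal.tendsto_toReal ENNReal.zero_ne_top
  constructor
  · have := ((hz.comp ht.1).add_const 1)
    rw [ENNReal.toReal_zero, zero_add] at this
    refine this.congr' ?_
    filter_upwards [self_mem_nhdsWithin] with s hs
    exact (hreal t s hs).symm
  · have := ((hz.comp ht.2).add_const 1)
    rw [ENNReal.toReal_zero, zero_add] at this
    refine this.congr' ?_
    filter_upwards [self_mem_nhdsWithin] with s hs
    exact (hreal s t hs).symm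

include hg hgd in
/-- At Lebesgue almost every point `u` is differentiable, with derivative the diffuse density. -/
theorem ae_hasDerivAt : ∀ᵐ t ∂(volume : Measure ℝ), t ∈ Ioo 0 T → HasDerivAt u (g t) t := by
  have hac : (volume : Measure ℝ) ≪ lineMeasure hT hu :=
    Measure.absolutelyContinuous_of_le (volume_le_lineMeasure hT hu)
  filter_upwards [hac.ae_le (ae_tendsto_density hT hu hg hgd), ae_tendsto_lineMeasure_div hT hu]
    with t ht h1 htT
  have ht := ht htT
  rw [indicator_of_mem htT] at ht
  have hlpos : ∀ x y : ℝ, x < y → 0 < (lineMeasure hT hu).real (Icc x y) := fun x y hxy => by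
    have h1 := volume_le_lineMeasure hT hu (Icc x y)
    rw [Real.volume_Icc] at h1
    have h2 := (ENNReal.ofReal_le_iff_le_toReal measure_Icc_lt_top.ne).1 h1
    rw [measureReal_def]; linarith
  rw [hasDerivAt_iff_tendsto_slope, ← Set.Iio_union_Ioi, nhdsWithin_union, tendsto_sup]
  constructor
  · have := h1.2.smul ht.2
    rw [one_smul] at this
    refine this.congr' ?_
    filter_upwards [self_mem_nhdsWithin] with s hs
    have hp := hlpos s t hs
    rw [smul_smul, div_mul_eq_mul_div, mul_inv_cancel₀ hp.ne', one_div,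
      slope_comm, slope_def_module]
  · have := h1.1.smul ht.1
    rw [one_smul] at this
    refine this.congr' ?_
    filter_upwards [self_mem_nhdsWithin] with s hs
    have hp := hlpos t s hs
    rw [smul_smul, div_mul_eq_mul_div, mul_inv_cancel₀ hp.ne', one_div, slope_def_module]

end Variation

namespace RIS

variable {V : Type*} [NormedAddCommGroup V] [NormedSpace ℝ V] [CompleteSpace V] {S : RIS V}

theorem InclusionBV.inclusionAE {u : ℝ → V} {hT : 0 < S.T} {hu : BoundedVariationOn u (Icc 0 S.T)}
    (h : S.InclusionBV hT hu) : S.InclusionAE u := by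
  obtain ⟨g, hg, hgd, hinc⟩ := h
  have hle : volume.restrict (Ioo 0 S.T) ≤ refMeasure hT hu := Measure.le_add_left le_rfl
  have h1 := (Measure.absolutelyContinuous_of_le hle).ae_le hinc
  have h2 := (ae_restrict_iff' (measurableSet_Ioo (a := 0) (b := S.T))).2
    (ae_hasDerivAt hT hu hg hgd)
  filter_upwards [h1, h2] with t ht hd
  exact ⟨hd.differentiableAt, hd.deriv.symm ▸ ht⟩

end RIS

end

/-! ### Consequences of the energy assumptions: Gronwall bounds, limits of subgradients, stability
-/

section

/-- Bounded families of functionals have pointwise limits along ultrafilters. -/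
theorem exists_dual_limit {V : Type*} [NormedAddCommGroup V] [NormedSpace ℝ V] {ι : Type*}
    (l : Ultrafilter ι) {ξ : ι → V →L[ℝ] ℝ} {R : ℝ} (hR : ∀ᶠ i in l, ‖ξ i‖ ≤ R) :
    ∃ ζ : V →L[ℝ] ℝ, ∀ v, Tendsto (fun i => ξ i v) l (𝓝 (ζ v)) := by
  have hc := WeakDual.isCompact_closedBall (𝕜 := ℝ) (E := V) 0 R
  rw [isCompact_iff_ultrafilter_le_nhds] at hc
  obtain ⟨ζ, -, hζ⟩ := hc (l.map fun i => StrongDual.toWeakDual (ξ i)) (by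
    rw [le_principal_iff, Ultrafilter.coe_map, mem_map]
    filter_upwards [hR] with i hi
    simpa using hi)
  refine ⟨WeakDual.toStrongDual ζ, fun v => ?_⟩
  exact ((WeakBilin.eval_continuous (topDualPairing ℝ V) v).tendsto ζ).comp hζ

namespace RIS

variable {V : Type*} [NormedAddCommGroup V] [NormedSpace ℝ V] {S : RIS V}

namespace Admissible

variable (hS : S.Admissible)
include hS

theorem isGauge : IsGauge S.Ψ where
  continuous := hS.gauge_continuous
  nonneg v := by
    rcases eq_or_ne v 0 with rfl | hv
    · have := hS.gauge_homogeneous 0 le_rfl 0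
      simp only [zero_smul, zero_mul] at this
      exact this.ge
    · exact (hS.gauge_pos v hv).le
  add_le v w := by
    have h := hS.gauge_convex.2 (mem_univ v) (mem_univ w) (by norm_num : (0 : ℝ) ≤ 1 / 2)
      (by norm_num : (0 : ℝ) ≤ 1 / 2) (by norm_num)
    rw [← smul_add, hS.gauge_homogeneous _ (by norm_num)] at h
    simp only [smul_eq_mul] at h
    linarith
  smul := hS.gauge_homogeneous

theorem hasDerivWithinAt {u : V} (hu : u ∈ S.D) {t : ℝ} (ht : t ∈ Icc 0 S.T) :
    HasDerivWithinAt (fun s => S.E s u) (S.power t u) (Icc 0 S.T) t :=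
  (hS.energy_differentiable u hu t ht).hasDerivWithinAt

theorem hasDerivAt {u : V} (hu : u ∈ S.D) {t : ℝ} (ht : t ∈ Ioo 0 S.T) :
    HasDerivAt (fun s => S.E s u) (S.power t u) t :=
  (hS.hasDerivWithinAt hu ⟨ht.1.le, ht.2.le⟩).hasDerivAt (Icc_mem_nhds ht.1 ht.2)

/-- Gronwall's estimate for the energy. -/
theorem exists_gronwall : ∃ C, 0 ≤ C ∧ ∀ u ∈ S.D, ∀ s ∈ Icc 0 S.T, ∀ t ∈ Icc 0 S.T,
    S.Ψ u + S.E s u ≤ Real.exp (C * |t - s|) * (S.Ψ u + S.E t u) := by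
  obtain ⟨C, hC, hP⟩ := hS.power_bound
  refine ⟨C, hC, fun u hu => ?_⟩
  have hcont : ContinuousOn (fun s => S.E s u) (Icc 0 S.T) :=
    (hS.energy_differentiable u hu).continuousOn
  have hexp : ∀ k : ℝ, Continuous fun s : ℝ => Real.exp (k * s) := fun k => by fun_prop
  have hder : ∀ k : ℝ, ∀ t ∈ Ioo 0 S.T,
      HasDerivAt (fun s => Real.exp (k * s) * (S.Ψ u + S.E s u))
        (Real.exp (k * t) * k * (S.Ψ u + S.E t u) + Real.exp (k * t) * S.power t u) t := by
    intro k t ht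
    have h1 : HasDerivAt (fun s : ℝ => Real.exp (k * s)) (Real.exp (k * t) * k) t := by
      simpa using ((hasDerivAt_id t).const_mul k).exp
    exact h1.mul ((hS.hasDerivAt hu ht).const_add _)
  have hanti : AntitoneOn (fun s => Real.exp (-C * s) * (S.Ψ u + S.E s u)) (Icc 0 S.T) := by
    refine antitoneOn_of_deriv_nonpos (convex_Icc _ _)
      ((hexp _).continuousOn.mul (hcont.const_add _)) ?_ ?_ <;> rw [interior_Icc]
    · exact fun t ht => (hder _ t ht).differentiableAt.differentiableWithinAt
    · intro t ht
      rw [(hder _ t ht).deriv]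
      have h1 := (abs_le.1 (hP t ht u hu)).2
      have h2 := Real.exp_pos (-C * t)
      nlinarith
  have hmono : MonotoneOn (fun s => Real.exp (C * s) * (S.Ψ u + S.E s u)) (Icc 0 S.T) := by
    refine monotoneOn_of_deriv_nonneg (convex_Icc _ _)
      ((hexp _).continuousOn.mul (hcont.const_add _)) ?_ ?_ <;> rw [interior_Icc]
    · exact fun t ht => (hder _ t ht).differentiableAt.differentiableWithinAt
    · intro t ht
      rw [(hder _ t ht).deriv]
      have h1 := (abs_le.1 (hP t ht u hu)).1
      have h2 := Real.exp_pos (C * t)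
      nlinarith
  intro s hs t ht
  rcases le_total s t with h | h
  · have h1 := hmono hs ht h
    dsimp only at h1
    rw [abs_of_nonneg (sub_nonneg.2 h), mul_sub, Real.exp_sub, div_mul_eq_mul_div,
      le_div_iff₀ (Real.exp_pos _), mul_comm]
    exact h1
  · have h1 := hanti ht hs h
    dsimp only at h1
    rw [neg_mul, neg_mul, Real.exp_neg, Real.exp_neg, inv_mul_eq_div, inv_mul_eq_div,
      div_le_div_iff₀ (Real.exp_pos _) (Real.exp_pos _)] at h1
    rw [abs_of_nonpos (sub_nonpos.2 h), neg_sub, mul_sub, Real.exp_sub, div_mul_eq_mul_div,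
      le_div_iff₀ (Real.exp_pos _), mul_comm (Real.exp (C * s))]
    exact h1

/-- An energy bound at one time puts a state into a sublevel. -/
theorem exists_sublevel (e : ℝ) : ∃ e' > 0, ∀ t ∈ Icc 0 S.T, ∀ u ∈ S.D,
    S.Ψ u + S.E t u ≤ e → u ∈ S.sublevel e' := by
  obtain ⟨C, hC, h⟩ := hS.exists_gronwall
  refine ⟨Real.exp (C * S.T) * max e 1, by positivity, fun t ht u hu hle => ⟨hu, fun s hs => ?_⟩⟩
  have habs : |t - s| ≤ S.T := by
    rw [abs_le]; constructor <;> linarith [ht.1, ht.2, hs.1, hs.2]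
  calc S.Ψ u + S.E s u ≤ Real.exp (C * |t - s|) * (S.Ψ u + S.E t u) := h u hu s hs t ht
    _ ≤ Real.exp (C * |t - s|) * max e 1 := by gcongr; exact hle.trans (le_max_left _ _)
    _ ≤ _ := by gcongr

omit hS in
theorem _root_.BalancedViscosity.RIS.sublevel_mono {e e' : ℝ} (h : e ≤ e') :
    S.sublevel e ⊆ S.sublevel e' := fun _ hu => ⟨hu.1, fun t ht => (hu.2 t ht).trans h⟩

theorem exists_mem_sublevel {u : V} (hu : u ∈ S.D) : ∃ e > 0, u ∈ S.sublevel e := by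
  obtain ⟨e, he, h⟩ := hS.exists_sublevel (S.Ψ u + S.E 0 u)
  exact ⟨e, he, h 0 ⟨le_rfl, hS.T_pos.le⟩ u hu le_rfl⟩

theorem exists_energy_bound {e : ℝ} (he : 0 < e) :
    ∃ B, ∀ t ∈ Icc 0 S.T, ∀ u ∈ S.sublevel e, |S.E t u| ≤ B := by
  have hK : IsCompact (Icc 0 S.T ×ˢ S.sublevel e) := isCompact_Icc.prod (hS.coercive e he)
  obtain ⟨b, hb⟩ := LowerSemicontinuousOn.bddBelow_of_isCompact hK
    (hS.energy_lsc.mono (prod_mono Subset.rfl fun u hu => hu.1))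
  refine ⟨max e (-b), fun t ht u hu => abs_le.2 ⟨?_, ?_⟩⟩
  · have := hb (mem_image_of_mem _ (mk_mem_prod ht hu))
    dsimp only at this
    linarith [le_max_right e (-b)]
  · linarith [hu.2 t ht, hS.isGauge.nonneg u, le_max_left e (-b)]

/-- On sublevels the energy is uniformly Lipschitz continuous in time. -/
theorem exists_lipschitz (e : ℝ) : ∃ M, 0 ≤ M ∧
    (∀ t ∈ Ioo 0 S.T, ∀ u ∈ S.sublevel e, |S.power t u| ≤ M) ∧
    ∀ u ∈ S.sublevel e, ∀ s ∈ Icc 0 S.T, ∀ t ∈ Icc 0 S.T,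
      |S.E t u - S.E s u| ≤ M * |t - s| := by
  obtain ⟨C, hC, hP⟩ := hS.power_bound
  have hM : ∀ t ∈ Ioo 0 S.T, ∀ u ∈ S.sublevel e, |S.power t u| ≤ C * max e 0 := fun t ht u hu =>
    (hP t ht u hu.1).trans (mul_le_mul_of_nonneg_left
      ((hu.2 t ⟨ht.1.le, ht.2.le⟩).trans (le_max_left _ _)) hC)
  refine ⟨C * max e 0, by positivity, hM, fun u hu => ?_⟩
  set M := C * max e 0
  have hcont : ContinuousOn (fun s => S.E s u) (Icc 0 S.T) :=
    (hS.energy_differentiable u hu.1).continuousOn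
  have hder : ∀ k : ℝ, ∀ t ∈ Ioo 0 S.T,
      HasDerivAt (fun s => S.E s u + k * s) (S.power t u + k) t := by
    intro k t ht
    have h1 : HasDerivAt (fun s : ℝ => k * s) k t := by
      simpa using (hasDerivAt_id t).const_mul k
    exact (hS.hasDerivAt hu.1 ht).add h1
  have hanti : AntitoneOn (fun s => S.E s u + (-M) * s) (Icc 0 S.T) := by
    refine antitoneOn_of_deriv_nonpos (convex_Icc _ _) (hcont.add (by fun_prop)) ?_ ?_ <;>
      rw [interior_Icc]
    · exact fun t ht => (hder _ t ht).differentiableAt.differentiableWithinAt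
    · intro t ht
      rw [(hder _ t ht).deriv]
      linarith [(abs_le.1 (hM t ht u hu)).2]
  have hmono : MonotoneOn (fun s => S.E s u + M * s) (Icc 0 S.T) := by
    refine monotoneOn_of_deriv_nonneg (convex_Icc _ _) (hcont.add (by fun_prop)) ?_ ?_ <;>
      rw [interior_Icc]
    · exact fun t ht => (hder _ t ht).differentiableAt.differentiableWithinAt
    · intro t ht
      rw [(hder _ t ht).deriv]
      linarith [(abs_le.1 (hM t ht u hu)).1]
  have key : ∀ s ∈ Icc 0 S.T, ∀ t ∈ Icc 0 S.T, s ≤ t → |S.E t u - S.E s u| ≤ M * |t - s| := by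
    intro s hs t ht h
    have h1 := hanti hs ht h
    have h2 := hmono hs ht h
    dsimp only at h1 h2
    rw [abs_of_nonneg (sub_nonneg.2 h), abs_le]
    constructor <;> linarith
  intro s hs t ht
  rcases le_total s t with h | h
  · exact key s hs t ht h
  · rw [abs_sub_comm, abs_sub_comm t]; exact key t ht s hs h

theorem exists_stableSet_bound : ∃ c, 0 < c ∧ ∀ z ∈ S.stableSet, ‖z‖ ≤ c := by
  obtain ⟨c, hc, h⟩ := hS.isGauge.exists_bound
  refine ⟨c, hc, fun z hz => z.opNorm_le_bound hc.le fun v => ?_⟩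
  rw [Real.norm_eq_abs, abs_le]
  constructor
  · have := (hz (-v)).trans (h (-v))
    rw [map_neg, norm_neg] at this
    linarith
  · exact (hz v).trans (h v)

section Limits

variable {ι : Type*} {l : Filter ι} {e t : ℝ} {u : V} {τ : ι → ℝ} {w : ι → V}
  {ξ : ι → V →L[ℝ] ℝ} {R : ℝ}

/-- Lower semicontinuity gives one half. For the other, the subdifferential inequality at w i is
tested at the limit u: the linear term is at most R‖u - w i‖ and the remainder is eventually at most
Ψ(u - w i), so both vanish in the limit. -/
theorem tendsto_energy_left (he : 0 < e) (ht : t ∈ Icc 0 S.T) (hu : u ∈ S.sublevel e)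
    (hτ : Tendsto τ l (𝓝[Icc 0 S.T] t)) (hw : Tendsto w l (𝓝[S.sublevel e] u))
    (hR : ∀ᶠ i in l, ‖ξ i‖ ≤ R) (hξ : ∀ᶠ i in l, ξ i ∈ S.energySubdiff (τ i) (w i)) :
    Tendsto (fun i => S.E (τ i) (w i)) l (𝓝 (S.E t u)) := by
  obtain ⟨ω, hω, hω0, hsub⟩ := hS.uniform_subdiff e he
  rw [tendsto_order]
  constructor
  · intro y hy
    have h1 := hS.energy_lsc (t, u) (mk_mem_prod ht hu.1) y hy
    rw [nhdsWithin_prod_eq] at h1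
    exact (hτ.prodMk (hw.mono_right (nhdsWithin_mono _ fun _ hv => hv.1))).eventually h1
  · intro y hy
    have hE : Tendsto (fun i => S.E (τ i) u) l (𝓝 (S.E t u)) :=
      ((hS.energy_differentiable u hu.1).continuousOn t ht).tendsto.comp hτ
    have hw' : Tendsto w l (𝓝 u) := hw.mono_right nhdsWithin_le_nhds
    have hwu : Tendsto (fun i => u - w i) l (𝓝 0) := by simpa using hw'.const_sub u
    have hΨ : Tendsto (fun i => S.Ψ (u - w i)) l (𝓝 0) := by
      simpa [hS.isGauge.zero, Function.comp_def] using (hS.gauge_continuous.tendsto 0).comp hwu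
    have hn : Tendsto (fun i => R * ‖u - w i‖) l (𝓝 0) := by
      simpa using hwu.norm.const_mul R
    have hω1 : ∀ᶠ i in l, ω (τ i) (w i) u < 1 := by
      have h1 := hω (t, u, u) (mk_mem_prod ht (mk_mem_prod hu hu)) 1 (by
        simp [hω0 t ht u hu])
      rw [nhdsWithin_prod_eq, nhdsWithin_prod_eq] at h1
      exact (hτ.prodMk (hw.prodMk (tendsto_nhdsWithin_iff.2
        ⟨tendsto_const_nhds, Eventually.of_forall fun _ => hu⟩))).eventually h1
    have hlim := (hE.add hn).add hΨ
    rw [add_zero, add_zero] at hlim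
    filter_upwards [hlim.eventually_lt_const hy, hω1, hR, hξ,
      hw.eventually self_mem_nhdsWithin, hτ.eventually self_mem_nhdsWithin]
      with i h1 h2 h3 h4 h5 h6
    have h7 := hsub (τ i) h6 (w i) h5 u hu (ξ i) h4
    have h8 : -(R * ‖u - w i‖) ≤ ξ i (u - w i) := by
      have := (ξ i).le_of_opNorm_le h3 (u - w i)
      rw [Real.norm_eq_abs] at this
      exact (abs_le.1 this).1
    have h9 : ω (τ i) (w i) u * min (S.Ψ (u - w i)) (S.Ψ (-(u - w i))) ≤ S.Ψ (u - w i) := by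
      have hm : 0 ≤ min (S.Ψ (u - w i)) (S.Ψ (-(u - w i))) :=
        le_min (hS.isGauge.nonneg _) (hS.isGauge.nonneg _)
      have := min_le_left (S.Ψ (u - w i)) (S.Ψ (-(u - w i)))
      nlinarith
    linarith

/-- The Fréchet subdifferential is closed along bounded families. -/
theorem mem_energySubdiff_of_tendsto [l.NeBot] (he : 0 < e) (ht : t ∈ Icc 0 S.T)
    (hu : u ∈ S.sublevel e) (hτ : Tendsto τ l (𝓝[Icc 0 S.T] t))
    (hw : Tendsto w l (𝓝[S.sublevel e] u)) (hR : ∀ᶠ i in l, ‖ξ i‖ ≤ R)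
    (hξ : ∀ᶠ i in l, ξ i ∈ S.energySubdiff (τ i) (w i)) {ζ : V →L[ℝ] ℝ}
    (hζ : ∀ v, Tendsto (fun i => ξ i v) l (𝓝 (ζ v))) : ζ ∈ S.energySubdiff t u := by
  have hE := hS.tendsto_energy_left he ht hu hτ hw hR hξ
  -- The larger sublevel contains every v in D with Ψ v + E t v ≤ e + 1. States outside it have so
  -- much energy that the Fréchet inequality near u is automatic, so (E3) is needed only inside.
  obtain ⟨e₁, he₁, hsub₁⟩ := hS.exists_sublevel (e + 1)
  set e' := max e e₁
  have he' : 0 < e' := he.trans_le (le_max_left _ _)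
  have hle : S.sublevel e ⊆ S.sublevel e' := sublevel_mono (le_max_left _ _)
  have hu' := hle hu
  have hw' := hw.mono_right (nhdsWithin_mono _ hle)
  obtain ⟨ω, hω, hω0, hsub⟩ := hS.uniform_subdiff e' he'
  have hwu : Tendsto w l (𝓝 u) := hw.mono_right nhdsWithin_le_nhds
  have key : ∀ v ∈ S.sublevel e', S.E t u + ζ (v - u) -
      ω t u v * min (S.Ψ (v - u)) (S.Ψ (-(v - u))) ≤ S.E t v := by
    intro v hv
    have hmin : Continuous fun x => min (S.Ψ (v - x)) (S.Ψ (-(v - x))) :=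
      (hS.gauge_continuous.comp (continuous_const.sub continuous_id)).min
        (hS.gauge_continuous.comp (continuous_const.sub continuous_id).neg)
    have hlm := (hmin.tendsto u).comp hwu
    have hEv : Tendsto (fun i => S.E (τ i) v) l (𝓝 (S.E t v)) :=
      ((hS.energy_differentiable v hv.1).continuousOn t ht).tendsto.comp hτ
    have hlin : Tendsto (fun i => ξ i (v - w i)) l (𝓝 (ζ (v - u))) := by
      have h0 : Tendsto (fun i => ξ i (u - w i)) l (𝓝 0) := by
        have hn : Tendsto (fun i => R * ‖u - w i‖) l (𝓝 0) := by
          have : Tendsto (fun i => u - w i) l (𝓝 0) := by simpa using hwu.const_sub u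
          simpa using this.norm.const_mul R
        refine squeeze_zero_norm' ?_ hn
        filter_upwards [hR] with i hi using (ξ i).le_of_opNorm_le hi _
      have := (hζ (v - u)).add h0
      rw [add_zero] at this
      refine this.congr fun i => ?_
      rw [← map_add]; congr 1; abel
    refine le_of_forall_pos_le_add fun δ hδ => ?_
    set mn := min (S.Ψ (v - u)) (S.Ψ (-(v - u)))
    have hmn : 0 ≤ mn := le_min (hS.isGauge.nonneg _) (hS.isGauge.nonneg _)
    set δ' := δ / (mn + 1)
    have hδ' : 0 < δ' := by positivity
    have hω1 : ∀ᶠ i in l, ω (τ i) (w i) v < ω t u v + δ' := by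
      have h1 := hω (t, u, v) (mk_mem_prod ht (mk_mem_prod hu' hv)) (ω t u v + δ')
        (lt_add_of_pos_right _ hδ')
      rw [nhdsWithin_prod_eq, nhdsWithin_prod_eq] at h1
      exact (hτ.prodMk (hw'.prodMk (tendsto_nhdsWithin_iff.2
        ⟨tendsto_const_nhds, Eventually.of_forall fun _ => hv⟩))).eventually h1
    have hlim := (hE.add hlin).sub (hlm.const_mul (ω t u v + δ'))
    have h1 : S.E t u + ζ (v - u) - (ω t u v + δ') * mn ≤ S.E t v := by
      refine le_of_tendsto_of_tendsto hlim hEv ?_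
      filter_upwards [hω1, hξ, hw'.eventually self_mem_nhdsWithin,
        hτ.eventually self_mem_nhdsWithin] with i h2 h3 h4 h5
      have h6 := hsub (τ i) h5 (w i) h4 v hv (ξ i) h3
      have hm : 0 ≤ min (S.Ψ (v - w i)) (S.Ψ (-(v - w i))) :=
        le_min (hS.isGauge.nonneg _) (hS.isGauge.nonneg _)
      have := mul_le_mul_of_nonneg_right h2.le hm
      dsimp only [Function.comp]
      linarith
    have h2 : δ' * mn ≤ δ := by
      simp only [δ']
      rw [div_mul_eq_mul_div, div_le_iff₀ (by positivity)]
      nlinarith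
    linarith
  obtain ⟨c, hc, hΨc⟩ := hS.isGauge.exists_bound
  refine ⟨hu.1, fun η hη => ?_⟩
  -- Since ω is upper semicontinuous and vanishes on the diagonal, the remainder in the limit
  -- inequality is o(‖v - u‖).
  have h1 : ∀ᶠ v in 𝓝[S.sublevel e'] u, ω t u v < η / c := by
    have h1 := hω (t, u, u) (mk_mem_prod ht (mk_mem_prod hu' hu')) (η / c) (by
      dsimp only; rw [hω0 t ht u hu']; positivity)
    rw [nhdsWithin_prod_eq, nhdsWithin_prod_eq] at h1
    have c1 : Tendsto (fun _ : V => t) (𝓝[S.sublevel e'] u) (𝓝[Icc 0 S.T] t) :=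
      tendsto_nhdsWithin_iff.2 ⟨tendsto_const_nhds, Eventually.of_forall fun _ => ht⟩
    have c2 : Tendsto (fun _ : V => u) (𝓝[S.sublevel e'] u) (𝓝[S.sublevel e'] u) :=
      tendsto_nhdsWithin_iff.2 ⟨tendsto_const_nhds, Eventually.of_forall fun _ => hu'⟩
    exact (c1.prodMk (c2.prodMk tendsto_id)).eventually h1
  rw [eventually_nhdsWithin_iff] at h1 ⊢
  have h2 : ∀ᶠ v in 𝓝 u, S.Ψ v + (S.E t u + ζ (v - u)) < e + 1 := by
    have hcont : Continuous fun v => S.Ψ v + (S.E t u + ζ (v - u)) :=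
      hS.gauge_continuous.add (continuous_const.add
        (ζ.continuous.comp (continuous_id.sub continuous_const)))
    refine hcont.continuousAt.eventually_lt continuousAt_const ?_
    have := hu.2 t ht
    simp only [sub_self, map_zero, add_zero]
    linarith
  filter_upwards [h1, h2] with v h3 h4 hvD
  by_cases hv : v ∈ S.sublevel e'
  · have h5 := key v hv
    have h6 : ω t u v * min (S.Ψ (v - u)) (S.Ψ (-(v - u))) ≤ η * ‖v - u‖ := by
      have hm : 0 ≤ min (S.Ψ (v - u)) (S.Ψ (-(v - u))) :=
        le_min (hS.isGauge.nonneg _) (hS.isGauge.nonneg _)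
      calc ω t u v * min (S.Ψ (v - u)) (S.Ψ (-(v - u)))
          ≤ η / c * min (S.Ψ (v - u)) (S.Ψ (-(v - u))) :=
            mul_le_mul_of_nonneg_right (h3 hv).le hm
        _ ≤ η / c * (c * ‖v - u‖) := by
            gcongr
            exact (min_le_left _ _).trans (hΨc _)
        _ = η * ‖v - u‖ := by field_simp
    linarith
  · have h5 : e + 1 < S.Ψ v + S.E t v := by
      by_contra hcon
      exact hv (sublevel_mono (le_max_right _ _) (hsub₁ t ht v hvD (not_lt.1 hcon)))
    have : 0 ≤ η * ‖v - u‖ := by positivity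
    linarith

theorem neg_mem_stableSet_of_tendsto [l.NeBot] {z : ι → V →L[ℝ] ℝ} {ζ : V →L[ℝ] ℝ}
    (hz : ∀ᶠ i in l, z i ∈ S.stableSet) (hζ : ∀ v, Tendsto (fun i => z i v) l (𝓝 (ζ v))) :
    ζ ∈ S.stableSet := fun v => le_of_tendsto (hζ v) (hz.mono fun _ hi => hi v)

/-- Almost minimal subgradients have cluster points, which are again subgradients. -/
theorem exists_limit_subgradient [l.NeBot] (he : 0 < e) (ht : t ∈ Icc 0 S.T)
    (hu : u ∈ S.sublevel e) (hτ : Tendsto τ l (𝓝[Icc 0 S.T] t))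
    (hw : Tendsto w l (𝓝[S.sublevel e] u)) {z : ι → V →L[ℝ] ℝ} {r : ι → ℝ} {r₀ : ℝ}
    (hr : Tendsto r l (𝓝 r₀)) (hξ : ∀ᶠ i in l, ξ i ∈ S.energySubdiff (τ i) (w i))
    (hz : ∀ᶠ i in l, z i ∈ S.stableSet) (hξz : ∀ᶠ i in l, ‖-ξ i - z i‖ ≤ r i) :
    ∃ U : Ultrafilter ι, ↑U ≤ l ∧ ∃ ζ ∈ S.energySubdiff t u, ∃ ζ' ∈ S.stableSet,
      ‖-ζ - ζ'‖ ≤ r₀ ∧ ∀ v, Tendsto (fun i => ξ i v) U (𝓝 (ζ v)) := by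
  obtain ⟨c, hc, hK⟩ := hS.exists_stableSet_bound
  have hRz : ∀ᶠ i in l, ‖z i‖ ≤ c := hz.mono fun i hi => hK _ hi
  have hRξ : ∀ᶠ i in l, ‖ξ i‖ ≤ r₀ + 1 + c := by
    filter_upwards [hRz, hξz, hr.eventually_lt_const (lt_add_one r₀)] with i h1 h2 h3
    have h4 : ‖-ξ i‖ ≤ ‖-ξ i - z i‖ + ‖z i‖ := by simpa using norm_add_le (-ξ i - z i) (z i)
    rw [norm_neg] at h4
    linarith
  set U := Ultrafilter.of l
  have hU : ↑U ≤ l := Ultrafilter.of_le l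
  obtain ⟨ζ, hζ⟩ := exists_dual_limit U (hRξ.filter_mono hU)
  obtain ⟨ζ', hζ'⟩ := exists_dual_limit U (hRz.filter_mono hU)
  refine ⟨U, hU, ζ, hS.mem_energySubdiff_of_tendsto he ht hu (hτ.mono_left hU) (hw.mono_left hU)
    (hRξ.filter_mono hU) (hξ.filter_mono hU) hζ, ζ',
    hS.neg_mem_stableSet_of_tendsto (hz.filter_mono hU) hζ', ?_, hζ⟩
  have hr0 : 0 ≤ r₀ := ge_of_tendsto (hr.mono_left hU)
    ((hξz.filter_mono hU).mono fun i hi => (norm_nonneg _).trans hi)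
  refine ContinuousLinearMap.opNorm_le_bound _ hr0 fun v => ?_
  have h1 : Tendsto (fun i => ‖(-ξ i - z i) v‖) U (𝓝 ‖(-ζ - ζ') v‖) :=
    (((hζ v).neg.sub (hζ' v))).norm
  refine le_of_tendsto_of_tendsto h1 ((hr.mono_left hU).mul_const ‖v‖) ?_
  filter_upwards [hξz.filter_mono hU] with i hi using (-ξ i - z i).le_of_opNorm_le hi v

end Limits

omit hS in
theorem _root_.BalancedViscosity.RIS.zero_mem_stableSet_add {t : ℝ} {u : V} :
    0 ∈ S.stableSet + S.energySubdiff t u ↔ ∃ ξ ∈ S.energySubdiff t u, -ξ ∈ S.stableSet := by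
  constructor
  · rintro ⟨z, hz, ξ, hξ, h⟩
    exact ⟨ξ, hξ, by rwa [← eq_neg_of_add_eq_zero_left h]⟩
  · rintro ⟨ξ, hξ, h⟩
    exact ⟨-ξ, h, ξ, hξ, neg_add_cancel ξ⟩

/-- Local stability: some element of `-∂E_t(u)` belongs to `K*`. -/
def _root_.BalancedViscosity.RIS.Stable (S : RIS V) (t : ℝ) (u : V) : Prop :=
  ∃ ξ ∈ S.energySubdiff t u, -ξ ∈ S.stableSet

/-- Subgradients with -ξ ∈ K* are uniformly bounded, so they have a cluster point. Taking z = -ξ and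
r = 0 in `exists_limit_subgradient` leaves distance 0 in the limit, so the cluster point again
satisfies -ζ ∈ K*. -/
theorem stable_of_tendsto {ι : Type*} {l : Filter ι} [l.NeBot] {e t : ℝ} {u : V} {τ : ι → ℝ}
    {w : ι → V} (he : 0 < e) (ht : t ∈ Icc 0 S.T) (hu : u ∈ S.sublevel e)
    (hτ : Tendsto τ l (𝓝[Icc 0 S.T] t)) (hw : Tendsto w l (𝓝[S.sublevel e] u))
    (hst : ∀ᶠ i in l, S.Stable (τ i) (w i)) :
    S.Stable t u ∧ Tendsto (fun i => S.E (τ i) (w i)) l (𝓝 (S.E t u)) := by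
  classical
  obtain ⟨c, hc, hK⟩ := hS.exists_stableSet_bound
  choose ξ hξ hz using fun i : {i // S.Stable (τ i) (w i)} => i.2
  set ξ' : ι → V →L[ℝ] ℝ := fun i => if h : S.Stable (τ i) (w i) then ξ ⟨i, h⟩ else 0 with hξ'
  have h1 : ∀ᶠ i in l, ξ' i ∈ S.energySubdiff (τ i) (w i) := hst.mono fun i hi => by
    simp only [hξ', dif_pos hi]; exact hξ ⟨i, hi⟩
  have h2 : ∀ᶠ i in l, -ξ' i ∈ S.stableSet := hst.mono fun i hi => by
    simp only [hξ', dif_pos hi]; exact hz ⟨i, hi⟩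
  have h3 : ∀ᶠ i in l, ‖ξ' i‖ ≤ c := h2.mono fun i hi => by simpa using hK _ hi
  refine ⟨?_, hS.tendsto_energy_left he ht hu hτ hw h3 h1⟩
  obtain ⟨U, -, ζ, hζ, ζ', hζ', h4, -⟩ := hS.exists_limit_subgradient he ht hu hτ hw
    (z := fun i => -ξ' i) (r := fun _ => 0) tendsto_const_nhds h1 h2
    (Eventually.of_forall fun i => by simp)
  exact ⟨ζ, hζ, by rwa [sub_eq_zero.1 (norm_le_zero_iff.1 h4)]⟩

/-- The conclusion keeps the limiting pair instead of only bounding the slope: a constant family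
then shows that the infimum is attained, and a general family gives lower semicontinuity. -/
theorem slope_le_of_tendsto {ι : Type*} {l : Filter ι} [l.NeBot] {e t : ℝ} {u : V}
    {w : ι → V} (he : 0 < e) (ht : t ∈ Icc 0 S.T) (hu : u ∈ S.sublevel e)
    (hw : Tendsto w l (𝓝[S.sublevel e] u)) {r : ι → ℝ} {r₀ : ℝ} (hr : Tendsto r l (𝓝 r₀))
    (hsl : ∀ᶠ i in l, S.slope t (w i) < ENNReal.ofReal (r i)) :
    ∃ ζ ∈ S.energySubdiff t u, ∃ z ∈ S.stableSet, ‖-ζ - z‖ ≤ r₀ := by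
  classical
  have hex : ∀ i : {i // S.slope t (w i) < ENNReal.ofReal (r i)}, ∃ p : (V →L[ℝ] ℝ) × (V →L[ℝ] ℝ),
      p.1 ∈ S.energySubdiff t (w i) ∧ p.2 ∈ S.stableSet ∧ ‖-p.1 - p.2‖ ≤ r i := by
    rintro ⟨i, hi⟩
    simp only [slope, iInf_lt_iff] at hi
    obtain ⟨ξ, hξ, z, hz, h⟩ := hi
    refine ⟨(-ξ, z), hξ, hz, ?_⟩
    rw [neg_neg]
    have h0 : 0 < r i := ENNReal.ofReal_pos.1 (pos_of_gt h)
    rw [← ofReal_norm, ENNReal.ofReal_lt_ofReal_iff h0] at h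
    exact h.le
  choose p hp1 hp2 hp3 using hex
  set q : ι → (V →L[ℝ] ℝ) × (V →L[ℝ] ℝ) := fun i =>
    if h : S.slope t (w i) < ENNReal.ofReal (r i) then p ⟨i, h⟩ else 0 with hq
  obtain ⟨U, -, ζ, hζ, z, hz, h4, -⟩ := hS.exists_limit_subgradient he ht hu
    (tendsto_nhdsWithin_iff.2 ⟨tendsto_const_nhds, Eventually.of_forall fun _ => ht⟩) hw
    (ξ := fun i => (q i).1) (z := fun i => (q i).2) hr
    (hsl.mono fun i hi => by simp only [hq, dif_pos hi]; exact hp1 ⟨i, hi⟩)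
    (hsl.mono fun i hi => by simp only [hq, dif_pos hi]; exact hp2 ⟨i, hi⟩)
    (hsl.mono fun i hi => by simp only [hq, dif_pos hi]; exact hp3 ⟨i, hi⟩)
  exact ⟨ζ, hζ, z, hz, h4⟩

/-- The slope is attained. -/
theorem exists_slope_eq {t : ℝ} {u : V} (ht : t ∈ Icc 0 S.T) (hsl : S.slope t u ≠ ∞) :
    ∃ ζ ∈ S.energySubdiff t u, ∃ z ∈ S.stableSet, ‖-ζ - z‖ₑ = S.slope t u := by
  have huD : u ∈ S.D := by
    by_contra h
    refine hsl ?_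
    simp only [slope, iInf_eq_top]
    exact fun ξ hξ => absurd hξ.1 h
  obtain ⟨e, he, hu⟩ := hS.exists_mem_sublevel huD
  have hr : Tendsto (fun n : ℕ => (S.slope t u).toReal + 1 / ((n : ℝ) + 1)) atTop
      (𝓝 ((S.slope t u).toReal)) := by
    simpa using tendsto_one_div_add_atTop_nhds_zero_nat.const_add (S.slope t u).toReal
  obtain ⟨ζ, hζ, z, hz, h⟩ := hS.slope_le_of_tendsto (w := fun _ => u) he ht hu
    (tendsto_nhdsWithin_iff.2 ⟨tendsto_const_nhds, Eventually.of_forall fun _ => hu⟩) hr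
    (Eventually.of_forall fun n => by
      rw [ENNReal.lt_ofReal_iff_toReal_lt hsl]
      have : 0 < 1 / ((n : ℝ) + 1) := by positivity
      linarith)
  refine ⟨ζ, hζ, z, hz, le_antisymm ?_ ?_⟩
  · rw [← ofReal_norm]
    exact ENNReal.ofReal_le_of_le_toReal h
  · exact iInf₂_le_of_le (-ζ) (by simpa using hζ) (iInf₂_le z hz)

theorem lowerSemicontinuousOn_slope {t e : ℝ} (ht : t ∈ Icc 0 S.T) (he : 0 < e) :
    LowerSemicontinuousOn (S.slope t) (S.sublevel e) := by
  intro u hu y hy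
  by_contra hcon
  rw [not_eventually] at hcon
  obtain ⟨y', hy1, hy2⟩ := exists_between hy
  have hyfin : y' ≠ ∞ := hy2.ne_top
  set l : Filter V := 𝓝[S.sublevel e] u ⊓ 𝓟 {v | ¬ y < S.slope t v}
  have : l.NeBot := frequently_mem_iff_neBot.1 hcon
  obtain ⟨ζ, hζ, z, hz, h⟩ := hS.slope_le_of_tendsto (l := l) (w := id) (r := fun _ => y'.toReal)
    he ht hu (tendsto_id.mono_left inf_le_left) tendsto_const_nhds (by
      have : ∀ᶠ v in l, v ∈ {v | ¬ y < S.slope t v} :=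
        (eventually_mem_set.2 (mem_principal_self _)).filter_mono inf_le_right
      filter_upwards [this] with v hv
      rw [ENNReal.ofReal_toReal hyfin]
      exact (not_lt.1 hv).trans_lt hy1)
  refine absurd hy2 (not_lt.2 ?_)
  calc S.slope t u ≤ ‖-ζ - z‖ₑ := iInf₂_le_of_le (-ζ) (by simpa using hζ) (iInf₂_le z hz)
    _ ≤ y' := by rw [← ofReal_norm]; exact ENNReal.ofReal_le_of_le_toReal h

/-- The uniform subdifferential inequality, with a bounded remainder which is uniformly small for
close states. -/
theorem exists_uniform_subdiff {e : ℝ} (he : 0 < e) : ∃ (ω : ℝ → V → V → ℝ) (B : ℝ), 0 ≤ B ∧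
    (∀ t ∈ Icc 0 S.T, ∀ u ∈ S.sublevel e, ∀ v ∈ S.sublevel e, 0 ≤ ω t u v ∧ ω t u v ≤ B) ∧
    (∀ η > 0, ∃ δ > 0, ∀ t ∈ Icc 0 S.T, ∀ u ∈ S.sublevel e, ∀ v ∈ S.sublevel e, ‖v - u‖ < δ →
      ω t u v < η) ∧
    ∀ t ∈ Icc 0 S.T, ∀ u ∈ S.sublevel e, ∀ v ∈ S.sublevel e, ∀ ξ ∈ S.energySubdiff t u,
      S.E t u + ξ (v - u) - ω t u v * S.Ψ (v - u) ≤ S.E t v := by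
  obtain ⟨ω, hω, hω0, hsub⟩ := hS.uniform_subdiff e he
  have hcp := hS.coercive e he
  have hcomp := (isCompact_Icc (a := (0 : ℝ)) (b := S.T)).prod (hcp.prod hcp)
  obtain ⟨B, hB⟩ := UpperSemicontinuousOn.bddAbove_of_isCompact hcomp hω
  -- With the positive part of ω, the minimum of the two gauges may be replaced by Ψ (v - u).
  refine ⟨fun t u v => max 0 (ω t u v), max 0 B, le_max_left _ _, fun t ht u hu v hv =>
    ⟨le_max_left _ _, max_le_max le_rfl
      (hB (mem_image_of_mem _ (mk_mem_prod ht (mk_mem_prod hu hv))))⟩, ?_, ?_⟩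
  · intro η hη
    -- A sequence of counterexamples has, by compactness, a limit on the diagonal, where ω vanishes;
    -- upper semicontinuity contradicts the lower bound η.
    by_contra! hcon
    choose s hs x hx y hy hxy hωη using fun n : ℕ => hcon (1 / ((n : ℝ) + 1)) (by positivity)
    obtain ⟨⟨t, u, v⟩, hp, φ, hφ, hlim⟩ := hcomp.tendsto_subseq
      (x := fun n => (s n, x n, y n)) fun n => mk_mem_prod (hs n) (mk_mem_prod (hx n) (hy n))
    have h1 : Tendsto (fun n => x (φ n)) atTop (𝓝 u) :=
      ((continuous_fst.comp continuous_snd).tendsto _).comp hlim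
    have h2 : Tendsto (fun n => y (φ n)) atTop (𝓝 v) :=
      ((continuous_snd.comp continuous_snd).tendsto _).comp hlim
    have h3 : Tendsto (fun n => ‖y (φ n) - x (φ n)‖) atTop (𝓝 0) :=
      squeeze_zero (fun _ => norm_nonneg _) (fun n => (hxy (φ n)).le)
        (tendsto_one_div_add_atTop_nhds_zero_nat.comp hφ.tendsto_atTop)
    have h4 := tendsto_nhds_unique h3 (h2.sub h1).norm
    rw [eq_comm, norm_eq_zero, sub_eq_zero] at h4
    subst h4
    have h5 := hω (t, v, v) hp η (by simpa [hω0 t hp.1 v hp.2.1] using hη)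
    have h6 := (tendsto_nhdsWithin_iff.2 ⟨hlim, Eventually.of_forall fun n =>
      mk_mem_prod (hs (φ n)) (mk_mem_prod (hx (φ n)) (hy (φ n)))⟩).eventually h5
    obtain ⟨n, hn⟩ := h6.exists
    exact absurd (hωη (φ n)) (not_le.2 (max_lt hη hn))
  · intro t ht u hu v hv ξ hξ
    have h1 := hsub t ht u hu v hv ξ hξ
    have hm : 0 ≤ min (S.Ψ (v - u)) (S.Ψ (-(v - u))) :=
      le_min (hS.isGauge.nonneg _) (hS.isGauge.nonneg _)
    have h2 : ω t u v * min (S.Ψ (v - u)) (S.Ψ (-(v - u))) ≤ max 0 (ω t u v) * S.Ψ (v - u) :=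
      (mul_le_mul_of_nonneg_right (le_max_right _ _) hm).trans
        (mul_le_mul_of_nonneg_left (min_le_left _ _) (le_max_left _ _))
    dsimp only
    linarith

end Admissible

end RIS

end

/-! ### Explicit form of the contact potential and of the Finsler functional -/

section

namespace RIS

namespace Admissible

variable {V : Type*} [NormedAddCommGroup V] [NormedSpace ℝ V] {S : RIS V} (hS : S.Admissible)
include hS

/-- A functional dominated by `Ψ + c ‖·‖` lies at distance at most `c` from `K*`. -/
theorem exists_stableSet_near {c : ℝ} (hc : 0 ≤ c) {ξ : V →L[ℝ] ℝ}
    (h : ∀ w, ξ w ≤ S.Ψ w + c * ‖w‖) : ∃ z ∈ S.stableSet, ‖ξ - z‖ ≤ c := by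
  have hG := hS.isGauge
  have hN : IsGauge (fun p : V × V => S.Ψ p.1 + c * ‖p.2‖) :=
    { continuous := (hG.continuous.comp continuous_fst).add (continuous_snd.norm.const_mul c)
      nonneg := fun p => add_nonneg (hG.nonneg _) (by positivity)
      add_le := fun p q => by
        have h1 := hG.add_le p.1 q.1
        have h2 := mul_le_mul_of_nonneg_left (norm_add_le p.2 q.2) hc
        dsimp only [Prod.fst_add, Prod.snd_add]
        linarith
      smul := fun k hk p => by
        dsimp only [Prod.smul_fst, Prod.smul_snd]
        rw [hG.smul k hk, norm_smul, Real.norm_of_nonneg hk]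
        ring }
  -- On the diagonal, ξ is dominated by the gauge Ψ(a) + c‖b‖. A Hahn–Banach extension to V × V
  -- splits ξ into its two partial functionals: the first lies in K*, the second has norm at most c.
  let D : Submodule ℝ (V × V) := LinearMap.eqLocus (LinearMap.fst ℝ V V) (LinearMap.snd ℝ V V)
  have hD : ∀ p : V × V, p ∈ D ↔ p.1 = p.2 := fun p => Iff.rfl
  let f : (V × V) →ₗ.[ℝ] ℝ := ⟨D, (ξ : V →ₗ[ℝ] ℝ).comp ((LinearMap.fst ℝ V V).comp D.subtype)⟩
  obtain ⟨η, h1, h2⟩ := hN.exists_dual_of_le f (by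
    rintro ⟨⟨a, b⟩, hab⟩
    obtain rfl : a = b := (hD _).1 hab
    exact h a)
  refine ⟨η.comp (ContinuousLinearMap.inl ℝ V V), fun w => by simpa using h2 (w, 0), ?_⟩
  refine ContinuousLinearMap.opNorm_le_bound _ hc fun w => ?_
  have h3 : ∀ w, (ξ - η.comp (ContinuousLinearMap.inl ℝ V V)) w = η (0, w) := by
    intro w
    have h4 : η (w, w) = ξ w := h1 ⟨(w, w), (hD _).2 rfl⟩
    have h5 : η (w, w) = η (w, 0) + η (0, w) := by rw [← map_add]; simp
    simp only [sub_apply, ContinuousLinearMap.comp_apply,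
      ContinuousLinearMap.inl_apply]
    linarith
  rw [h3, Real.norm_eq_abs, abs_le]
  have h6 := h2 (0, w)
  have h7 := h2 (0, -w)
  have h8 : η (0, -w) = -η (0, w) := by rw [← map_neg]; simp
  simp only [hG.zero, zero_add, norm_neg] at h6 h7
  rw [h8] at h7
  constructor <;> linarith

/-- If c is smaller than the distance from ξ to K*, then `exists_stableSet_near` supplies w with ξ w
> Ψ w + c‖w‖. Testing the conjugate at the multiple of w of norm ‖v‖ makes the viscous terms at v
and at the test vector cancel, for every ε at once. -/
theorem le_contactPotential (v : V) (ξ : V →L[ℝ] ℝ) :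
    ENNReal.ofReal (S.Ψ v) + (⨅ z ∈ S.stableSet, ‖ξ - z‖ₑ) * ‖v‖ₑ ≤ S.contactPotential v ξ := by
  have hG := hS.isGauge
  have hF0 : ∀ r, 0 ≤ r → 0 ≤ S.F r := fun r hr => by
    rcases hr.eq_or_lt with rfl | hr
    · exact hS.viscous_zero.ge
    · exact (hS.viscous_pos r hr).le
  refine le_iInf₂ fun ε hε => ?_
  have hpot : S.Ψ v ≤ S.viscousPotential ε v :=
    le_add_of_nonneg_right (mul_nonneg (inv_nonneg.2 hε.le) (hF0 _ (norm_nonneg _)))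
  rcases eq_or_ne v 0 with rfl | hv
  · simp only [enorm_zero, mul_zero, add_zero]
    exact (ENNReal.ofReal_le_ofReal hpot).trans le_self_add
  have hvn : 0 < ‖v‖ := norm_pos_iff.2 hv
  have key : ∀ c : ℝ, 0 < c → ENNReal.ofReal c < (⨅ z ∈ S.stableSet, ‖ξ - z‖ₑ) →
      ENNReal.ofReal (S.Ψ v + c * ‖v‖) ≤
        ENNReal.ofReal (S.viscousPotential ε v) + S.viscousConjugate ε ξ := by
    intro c hc hlt
    obtain ⟨w, hw⟩ : ∃ w, S.Ψ w + c * ‖w‖ < ξ w := by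
      by_contra! hcon
      obtain ⟨z, hz, hzc⟩ := hS.exists_stableSet_near hc.le hcon
      refine absurd hlt (not_lt.2 ((iInf₂_le z hz).trans ?_))
      rw [← ofReal_norm]
      exact ENNReal.ofReal_le_ofReal hzc
    have hw0 : 0 < ‖w‖ := by
      rw [norm_pos_iff]
      rintro rfl
      simp [hG.zero] at hw
    set k := ‖v‖ / ‖w‖ with hk
    have hk0 : 0 < k := by positivity
    have hkw : ‖k • w‖ = ‖v‖ := by
      rw [norm_smul, Real.norm_of_nonneg hk0.le, hk]
      field_simp
    have h1 : S.Ψ (k • w) + c * ‖v‖ ≤ ξ (k • w) := by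
      rw [← hkw, norm_smul, Real.norm_of_nonneg hk0.le, hG.smul k hk0.le, map_smul, smul_eq_mul]
      nlinarith
    have h2 : ENNReal.ofReal (ξ (k • w) - S.viscousPotential ε (k • w)) ≤ S.viscousConjugate ε ξ :=
      le_iSup (fun v => ENNReal.ofReal (ξ v - S.viscousPotential ε v)) (k • w)
    refine le_trans ?_ (add_le_add le_rfl h2)
    refine le_trans (ENNReal.ofReal_le_ofReal ?_) ENNReal.ofReal_add_le
    have h3 : ‖ε • k • w‖ = ‖ε • v‖ := by rw [norm_smul, hkw, norm_smul]
    simp only [viscousPotential, h3]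
    linarith
  refine add_le_of_le_tsub_left_of_le ((ENNReal.ofReal_le_ofReal hpot).trans le_self_add) ?_
  refine ENNReal.mul_le_of_forall_lt fun a ha b hb => ?_
  rcases eq_or_ne a 0 with rfl | h0
  · rw [zero_mul]; exact zero_le
  have hfin : a ≠ ∞ := ha.ne_top
  have hpos : 0 < a.toReal := ENNReal.toReal_pos h0 hfin
  have h1 := key a.toReal hpos (by rwa [ENNReal.ofReal_toReal hfin])
  rw [ENNReal.ofReal_add (hG.nonneg _) (by positivity), ENNReal.ofReal_mul hpos.le,
    ENNReal.ofReal_toReal hfin, ofReal_norm] at h1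
  exact (mul_le_mul_right hb.le a).trans
    (ENNReal.le_sub_of_add_le_left ENNReal.ofReal_ne_top h1)

/-- The tangent line of the viscous profile with a prescribed positive slope. -/
theorem exists_tangent {d : ℝ} (hd : 0 < d) :
    ∃ x₀ > 0, S.F x₀ ≤ d * x₀ ∧ ∀ x, 0 ≤ x → S.F x₀ + d * (x - x₀) ≤ S.F x := by
  have hcont := hS.viscous_contDiff.continuousOn_derivWithin (uniqueDiffOn_Ici 0) le_rfl
  obtain ⟨x₀, hx₀, hdx⟩ := intermediate_value_Ici hcont hS.viscous_superlinear
    (show d ∈ Ici _ by rw [mem_Ici, hS.viscous_deriv_zero]; exact hd.le)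
  have hpos : 0 < x₀ := lt_of_le_of_ne hx₀ (by
    rintro rfl
    rw [hS.viscous_deriv_zero] at hdx
    exact hd.ne hdx)
  have hdiff := hS.viscous_contDiff.differentiableOn one_ne_zero x₀ hx₀
  have htan : ∀ x, 0 ≤ x → S.F x₀ + d * (x - x₀) ≤ S.F x := by
    intro x hx
    rcases lt_trichotomy x x₀ with h | rfl | h
    · have h1 := hS.viscous_convex.slope_le_derivWithin hx hx₀ h hdiff
      rw [slope_def_field, hdx, div_le_iff₀ (sub_pos.2 h)] at h1
      linarith
    · simp
    · have h1 := hS.viscous_convex.derivWithin_le_slope hx₀ hx h hdiff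
      rw [slope_def_field, hdx, le_div_iff₀ (sub_pos.2 h)] at h1
      linarith
  refine ⟨x₀, hpos, ?_, htan⟩
  have := htan 0 le_rfl
  rw [hS.viscous_zero] at this
  linarith

/-- The optimal ε puts ‖εv‖ at the point x₀ where F has slope d: the tangent line bounds the
conjugate by ε⁻¹(d x₀ - F x₀), which turns the viscous term into exactly d‖v‖. For v = 0 there is no
such ε, and ε → ∞ is used instead. Positivity of d ensures x₀ > 0. -/
theorem contactPotential_le {v : V} {ξ z : V →L[ℝ] ℝ} (hz : z ∈ S.stableSet) {d : ℝ} (hd : 0 < d)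
    (h : ‖ξ - z‖ ≤ d) : S.contactPotential v ξ ≤ ENNReal.ofReal (S.Ψ v + d * ‖v‖) := by
  have hG := hS.isGauge
  obtain ⟨x₀, hx₀, hle, htan⟩ := hS.exists_tangent hd
  have hconj : ∀ ε, 0 < ε → S.viscousConjugate ε ξ ≤ ENNReal.ofReal (ε⁻¹ * (d * x₀ - S.F x₀)) := by
    refine fun ε hε => iSup_le fun w => ENNReal.ofReal_le_ofReal ?_
    have h1 : ξ w ≤ S.Ψ w + d * ‖w‖ := by
      have h2 := (le_abs_self _).trans ((ξ - z).le_of_opNorm_le h w)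
      have h3 := hz w
      rw [sub_apply] at h2
      linarith
    have h2 := htan (ε * ‖w‖) (by positivity)
    have h3 := mul_le_mul_of_nonneg_left h2 (inv_nonneg.2 hε.le)
    have h4 : ε⁻¹ * (S.F x₀ + d * (ε * ‖w‖ - x₀)) = d * ‖w‖ - ε⁻¹ * (d * x₀ - S.F x₀) := by
      field_simp
      ring
    rw [viscousPotential, norm_smul, Real.norm_of_nonneg hε.le]
    linarith
  have hc : 0 ≤ d * x₀ - S.F x₀ := sub_nonneg.2 hle
  rcases eq_or_ne v 0 with rfl | hv
  · rw [hG.zero, norm_zero, mul_zero, add_zero, ENNReal.ofReal_zero]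
    have hlim : Tendsto (fun ε : ℝ => ENNReal.ofReal (ε⁻¹ * (d * x₀ - S.F x₀))) atTop (𝓝 0) := by
      rw [← ENNReal.ofReal_zero]
      refine (ENNReal.continuous_ofReal.tendsto 0).comp ?_
      simpa using tendsto_inv_atTop_zero.mul_const (d * x₀ - S.F x₀)
    refine ge_of_tendsto hlim ?_
    filter_upwards [eventually_gt_atTop 0] with ε hε
    refine (iInf₂_le ε hε).trans ?_
    have : S.viscousPotential ε (0 : V) = 0 := by
      simp [viscousPotential, hG.zero, hS.viscous_zero]
    rw [this, ENNReal.ofReal_zero, zero_add]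
    exact hconj ε hε
  · have hvn : 0 < ‖v‖ := norm_pos_iff.2 hv
    set ε := x₀ / ‖v‖ with hε
    have hε0 : 0 < ε := by positivity
    refine (iInf₂_le ε hε0).trans ((add_le_add le_rfl (hconj ε hε0)).trans ?_)
    have h1 : ‖ε • v‖ = x₀ := by
      rw [norm_smul, Real.norm_of_nonneg hε0.le, hε]; field_simp
    have hF : 0 < S.F x₀ := hS.viscous_pos x₀ hx₀
    rw [viscousPotential, h1, ← ENNReal.ofReal_add (add_nonneg (hG.nonneg _) (by positivity))
      (mul_nonneg (inv_nonneg.2 hε0.le) hc)]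
    refine ENNReal.ofReal_le_ofReal (le_of_eq ?_)
    rw [hε]
    field_simp
    ring

theorem le_finsler (t : ℝ) (u v : V) :
    ENNReal.ofReal (S.Ψ v) + S.slope t u * ‖v‖ₑ ≤ S.finsler t u v :=
  le_iInf₂ fun ξ hξ => le_trans (add_le_add le_rfl (mul_le_mul_left
    (iInf₂_le ξ hξ) _)) (hS.le_contactPotential v ξ)

/-- The slope is attained at some subgradient. Its distance to K* may be zero, so
`contactPotential_le` is applied with that distance plus δ, and δ ↓ 0. -/
theorem finsler_le {t : ℝ} (ht : t ∈ Icc 0 S.T) {u : V} (hsl : S.slope t u ≠ ∞) (v : V) :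
    S.finsler t u v ≤ ENNReal.ofReal (S.Ψ v) + S.slope t u * ‖v‖ₑ := by
  obtain ⟨ζ, hζ, z, hz, h⟩ := hS.exists_slope_eq ht hsl
  have h1 : S.slope t u * ‖v‖ₑ = ENNReal.ofReal (‖-ζ - z‖ * ‖v‖) := by
    rw [← h, ENNReal.ofReal_mul (norm_nonneg _), ofReal_norm, ofReal_norm]
  rw [h1, ← ENNReal.ofReal_add (hS.isGauge.nonneg _) (by positivity)]
  refine (iInf₂_le (-ζ) (by simpa using hζ)).trans ?_
  have hlim : Tendsto (fun δ : ℝ => ENNReal.ofReal (S.Ψ v + (‖-ζ - z‖ + δ) * ‖v‖)) (𝓝[>] 0)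
      (𝓝 (ENNReal.ofReal (S.Ψ v + ‖-ζ - z‖ * ‖v‖))) := by
    have : Continuous fun δ : ℝ => ENNReal.ofReal (S.Ψ v + (‖-ζ - z‖ + δ) * ‖v‖) :=
      ENNReal.continuous_ofReal.comp (by fun_prop)
    simpa using (this.tendsto 0).mono_left nhdsWithin_le_nhds
  refine ge_of_tendsto hlim ?_
  filter_upwards [self_mem_nhdsWithin] with δ hδ
  have hδ : 0 < δ := hδ
  exact hS.contactPotential_le hz (by positivity) (le_add_of_nonneg_right hδ.le)

/-- The infimum over subgradients and over ε collapses to the slope, so the viscous profile F no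
longer enters the cost. It also makes the functional 1-homogeneous in the velocity, hence transition
costs independent of parametrization. -/
theorem finsler_eq {t : ℝ} (ht : t ∈ Icc 0 S.T) {u : V} (hsl : S.slope t u ≠ ∞) (v : V) :
    S.finsler t u v = ENNReal.ofReal (S.Ψ v) + S.slope t u * ‖v‖ₑ :=
  le_antisymm (hS.finsler_le ht hsl v) (hS.le_finsler t u v)

theorem slope_ne_top_of_nonempty {t : ℝ} {u : V} (h : (S.energySubdiff t u).Nonempty) :
    S.slope t u ≠ ∞ := by
  obtain ⟨ξ, hξ⟩ := h
  have : S.slope t u ≤ ‖-ξ - 0‖ₑ := iInf₂_le_of_le (-ξ) (by simpa using hξ)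
    (iInf₂_le 0 fun w => by simpa using hS.isGauge.nonneg w)
  refine ne_top_of_le_ne_top ?_ this
  rw [← ofReal_norm]
  exact ENNReal.ofReal_ne_top

end Admissible

end RIS

end

section

/-! ### Absolutely continuous curves -/

section AbsolutelyContinuous

theorem ofReal_integral_le {α : Type*} [MeasurableSpace α] {μ : Measure α} {f : α → ℝ}
    (hf : Integrable f μ) : ENNReal.ofReal (∫ x, f x ∂μ) ≤ ∫⁻ x, ENNReal.ofReal (f x) ∂μ := by
  have h1 : Integrable (fun x => max (f x) 0) μ := hf.pos_part
  have h2 := ofReal_integral_eq_lintegral_ofReal h1 (Eventually.of_forall fun x => le_max_right _ _)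
  have h3 : ∀ x, ENNReal.ofReal (max (f x) 0) = ENNReal.ofReal (f x) := fun x => by
    rw [ENNReal.ofReal_max, ENNReal.ofReal_zero, max_eq_left zero_le]
  simp only [h3] at h2
  rw [← h2]
  exact ENNReal.ofReal_le_ofReal (integral_mono hf h1 fun x => le_max_left _ _)

variable {V : Type*} [NormedAddCommGroup V] [NormedSpace ℝ V] {N : V → ℝ} {c c' : ℝ → V}

theorem ACOn.mono {a b a' b' : ℝ} (h : ACOn N c a b) (ha : a ≤ a') (hb : b' ≤ b) :
    ACOn N c a' b' := by
  obtain ⟨m, hm, h0, h1⟩ := h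
  exact ⟨m, hm.mono_set (Icc_subset_Icc ha hb), h0, fun r₀ r₁ h2 h3 h4 =>
    h1 r₀ r₁ (ha.trans h2) h3 (h4.trans hb)⟩

theorem ACOn.congr {a b : ℝ} (h : ACOn N c a b) (hc : ∀ r ∈ Icc a b, c' r = c r) :
    ACOn N c' a b := by
  obtain ⟨m, hm, h0, h1⟩ := h
  refine ⟨m, hm, h0, fun r₀ r₁ h2 h3 h4 => ?_⟩
  rw [hc r₀ ⟨h2, h3.le.trans h4⟩, hc r₁ ⟨h2.trans h3.le, h4⟩]
  exact h1 r₀ r₁ h2 h3 h4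

theorem ACOn.affine {a b k s : ℝ} (hk : 0 < k) (h : ACOn N c (k * a + s) (k * b + s)) :
    ACOn N (fun r => c (k * r + s)) a b := by
  obtain ⟨m, hm, h0, h1⟩ := h
  refine ⟨fun r => k * m (k * r + s), ?_, fun r => mul_nonneg hk.le (h0 _), ?_⟩
  · rcases le_or_gt a b with hab | hab
    · have hi : IntervalIntegrable m volume (k * a + s) (k * b + s) := by
        rw [intervalIntegrable_iff_integrableOn_Icc_of_le (by gcongr)]
        exact hm
      have h2 := (hi.comp_add_right s).comp_mul_left (c := k)
      rw [← intervalIntegrable_iff_integrableOn_Icc_of_le hab]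
      simp only [add_sub_cancel_right, mul_div_cancel_left₀ _ hk.ne'] at h2
      exact h2.const_mul k
    · simp [Icc_eq_empty_of_lt hab]
  · intro r₀ r₁ h2 h3 h4
    rw [intervalIntegral.integral_const_mul, intervalIntegral.integral_comp_mul_add _ hk.ne',
      smul_eq_mul, mul_inv_cancel_left₀ hk.ne']
    exact h1 _ _ (by gcongr) (by gcongr) (by gcongr)

theorem ACOn.neg (hN : ∀ v, N (-v) = N v) {a b : ℝ} (h : ACOn N c a b) :
    ACOn N (fun r => c (-r)) (-b) (-a) := by
  obtain ⟨m, hm, h0, h1⟩ := h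
  refine ⟨fun r => m (-r), ?_, fun r => h0 _, ?_⟩
  · have h2 := (Measure.measurePreserving_neg (volume : Measure ℝ)).integrableOn_comp_preimage
      (Homeomorph.neg ℝ).measurableEmbedding (f := m) (s := Icc a b)
    have h3 : Neg.neg ⁻¹' Icc a b = Icc (-b) (-a) := by
      ext x
      simp only [mem_preimage, mem_Icc]
      constructor <;> rintro ⟨h4, h5⟩ <;> constructor <;> linarith
    rw [h3] at h2
    exact h2.2 hm
  · intro r₀ r₁ h2 h3 h4
    rw [intervalIntegral.integral_comp_neg, ← hN, neg_sub]
    exact h1 _ _ (by linarith) (by linarith) (by linarith)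

theorem ACOn.of_le {N' : V → ℝ} {C : ℝ} (hC : 0 ≤ C) (hN : ∀ v, N' v ≤ C * N v) {a b : ℝ}
    (h : ACOn N c a b) : ACOn N' c a b := by
  obtain ⟨m, hm, h0, h1⟩ := h
  refine ⟨fun r => C * m r, hm.const_mul C, fun r => mul_nonneg hC (h0 r), fun r₀ r₁ h2 h3 h4 => ?_⟩
  rw [intervalIntegral.integral_const_mul]
  exact (hN _).trans (mul_le_mul_of_nonneg_left (h1 _ _ h2 h3 h4) hC)

theorem ACOn.glue (hN : IsGauge N) {a b d : ℝ} (h : ACOn N c a b)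
    (h' : ACOn N c b d) : ACOn N c a d := by
  obtain ⟨m, hm, h0, h1⟩ := h
  obtain ⟨m', hm', h0', h1'⟩ := h'
  set M : ℝ → ℝ := fun r => (Icc a b).indicator m r + (Icc b d).indicator m' r with hM
  have hMi : Integrable M := ((integrable_indicator_iff measurableSet_Icc).2 hm).add
    ((integrable_indicator_iff measurableSet_Icc).2 hm')
  have hM0 : ∀ r, 0 ≤ M r := fun r =>
    add_nonneg (indicator_nonneg (fun r _ => h0 r) r) (indicator_nonneg (fun r _ => h0' r) r)
  have e1 : ∀ r₀ r₁, a ≤ r₀ → r₀ ≤ r₁ → r₁ ≤ b → N (c r₁ - c r₀) ≤ ∫ r in r₀..r₁, M r := by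
    intro r₀ r₁ h2 h3 h4
    rcases h3.eq_or_lt with rfl | h3
    · simp [hN.zero]
    refine (h1 r₀ r₁ h2 h3 h4).trans (intervalIntegral.integral_mono_on h3.le ?_
      hMi.intervalIntegrable fun r hr => ?_)
    · rw [intervalIntegrable_iff_integrableOn_Icc_of_le h3.le]
      exact hm.mono_set (Icc_subset_Icc h2 h4)
    · simp only [hM]
      rw [indicator_of_mem (show r ∈ Icc a b from ⟨h2.trans hr.1, hr.2.trans h4⟩)]
      exact le_add_of_nonneg_right (indicator_nonneg (fun r _ => h0' r) r)
  have e2 : ∀ r₀ r₁, b ≤ r₀ → r₀ ≤ r₁ → r₁ ≤ d → N (c r₁ - c r₀) ≤ ∫ r in r₀..r₁, M r := by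
    intro r₀ r₁ h2 h3 h4
    rcases h3.eq_or_lt with rfl | h3
    · simp [hN.zero]
    refine (h1' r₀ r₁ h2 h3 h4).trans (intervalIntegral.integral_mono_on h3.le ?_
      hMi.intervalIntegrable fun r hr => ?_)
    · rw [intervalIntegrable_iff_integrableOn_Icc_of_le h3.le]
      exact hm'.mono_set (Icc_subset_Icc h2 h4)
    · simp only [hM]
      rw [indicator_of_mem (show r ∈ Icc b d from ⟨h2.trans hr.1, hr.2.trans h4⟩)]
      exact le_add_of_nonneg_left (indicator_nonneg (fun r _ => h0 r) r)
  refine ⟨M, hMi.integrableOn, hM0, fun r₀ r₁ h2 h3 h4 => ?_⟩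
  rcases le_total r₁ b with h5 | h5
  · exact e1 r₀ r₁ h2 h3.le h5
  rcases le_total b r₀ with h6 | h6
  · exact e2 r₀ r₁ h6 h3.le h4
  rw [← intervalIntegral.integral_add_adjacent_intervals (hMi.intervalIntegrable (b := b))
    hMi.intervalIntegrable]
  have h7 := hN.add_le (c b - c r₀) (c r₁ - c b)
  rw [sub_add_sub_cancel'] at h7
  exact h7.trans (add_le_add (e1 r₀ b h2 h6 le_rfl) (e2 b r₁ le_rfl h5 h4))

theorem scalarDeriv_of_differentiableAt (hN : IsGauge N) {r : ℝ} (h : DifferentiableAt ℝ c r) :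
    scalarDeriv N c r = ENNReal.ofReal (N (deriv c r)) := by
  have h1 := hasDerivAt_iff_tendsto_slope_zero.1 h.hasDerivAt
  exact ((ENNReal.continuous_ofReal.tendsto _).comp ((hN.continuous.tendsto _).comp h1)).limsup_eq

/-- The increments of an absolutely continuous curve are controlled by its scalar derivative. -/
theorem ACOn.ofReal_sub_le (hN : IsGauge N) {a b : ℝ} (h : ACOn N c a b) {x y : ℝ} (hx : a ≤ x)
    (hxy : x ≤ y) (hy : y ≤ b) :
    ENNReal.ofReal (N (c y - c x)) ≤ ∫⁻ r in Ioc x y, scalarDeriv N c r := by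
  rcases hxy.eq_or_lt with rfl | hlt
  · simp [hN.zero]
  obtain ⟨m, hm, h0, h1⟩ := h
  obtain ⟨ξ, hξ, hξN⟩ := hN.exists_dual (c y - c x)
  have hmi : ∀ r s, a ≤ r → r ≤ s → s ≤ b → IntervalIntegrable m volume r s :=
      fun r s hr hrs hs => by
    rw [intervalIntegrable_iff_integrableOn_Icc_of_le hrs]
    exact hm.mono_set (Icc_subset_Icc hr hs)
  -- Because N may be asymmetric, only upper bounds for increments of ξ ∘ c are at hand. They say
  -- that p is monotone, and a monotone function grows at least by the integral of its derivative,
  -- which is the inequality needed for ξ ∘ c.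
  set p : ℝ → ℝ := fun r => (∫ s in x..r, m s) - ξ (c r) with hp
  have hpm : MonotoneOn p (uIcc x y) := by
    rw [uIcc_of_le hxy]
    intro r hr s hs hrs
    rcases hrs.eq_or_lt with rfl | hrs
    · exact le_rfl
    have h2 := (hξN _).trans (h1 r s (hx.trans hr.1) hrs (hs.2.trans hy))
    have h3 := intervalIntegral.integral_add_adjacent_intervals
      (hmi x r hx hr.1 (hr.2.trans hy)) (hmi r s (hx.trans hr.1) hrs.le (hs.2.trans hy))
    rw [map_sub] at h2
    simp only [hp]
    linarith
  have hxm : x ∈ uIcc x y := left_mem_uIcc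
  have hym : y ∈ uIcc x y := right_mem_uIcc
  have hpd := hpm.intervalIntegral_deriv_mem_uIcc
  rw [uIcc_of_le (sub_nonneg.2 (hpm hxm hym hxy))] at hpd
  have hpi := hpm.intervalIntegrable_deriv
  have hmxy := hmi x y hx hxy hy
  have h2 : N (c y - c x) ≤ ∫ r in x..y, (m r - deriv p r) := by
    rw [intervalIntegral.integral_sub hmxy hpi, ← hξ, map_sub]
    have h3 := hpd.2
    simp only [hp, intervalIntegral.integral_same] at h3
    linarith
  rw [intervalIntegral.integral_of_le hxy] at h2
  refine (ENNReal.ofReal_le_ofReal h2).trans ((ofReal_integral_le ?_).trans ?_)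
  · have := hmxy.sub hpi
    rwa [intervalIntegrable_iff_integrableOn_Ioc_of_le hxy] at this
  refine lintegral_mono_ae ?_
  rw [← Measure.restrict_congr_set Ioo_ae_eq_Ioc, ae_restrict_iff' measurableSet_Ioo]
  filter_upwards [hmxy.ae_hasDerivAt_integral, hpm.ae_differentiableWithinAt_of_mem]
    with r hr hpr hrI
  have hru : r ∈ uIcc x y := by rw [uIcc_of_le hxy]; exact ⟨hrI.1.le, hrI.2.le⟩
  have hd1 := hr hru x hxm
  have hd2 := ((hpr hru).differentiableAt (by
    rw [uIcc_of_le hxy]; exact Icc_mem_nhds hrI.1 hrI.2)).hasDerivAt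
  have hd3 : HasDerivAt (fun s => ξ (c s)) (m r - deriv p r) r := by
    refine (hd1.sub hd2).congr_of_eventuallyEq (Eventually.of_forall fun s => ?_)
    simp [hp]
  have h4 := (ENNReal.continuous_ofReal.tendsto _).comp (hasDerivAt_iff_tendsto_slope_zero.1 hd3)
  rw [← h4.limsup_eq]
  refine limsup_le_limsup (Eventually.of_forall fun t => ENNReal.ofReal_le_ofReal ?_)
  have h5 := hξN (t⁻¹ • (c (r + t) - c r))
  rw [map_smul, map_sub] at h5
  exact h5

variable [CompleteSpace V]

/-- Absolutely continuous curves in a space with the Radon-Nikodym property are differentiable. -/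
theorem ACOn.differentiable (hV : RadonNikodymProperty V) {x y : ℝ} (hxy : x < y)
    (h : ACOn (fun v : V => ‖v‖) c x y) :
    (∀ᵐ r ∂(volume : Measure ℝ), r ∈ Ioo x y → DifferentiableAt ℝ c r) ∧
      IntegrableOn (deriv c) (Ioo x y) := by
  have hT : 0 < y - x := sub_pos.2 hxy
  set u : ℝ → V := fun r => c (r + x) with hu'
  have hu : BoundedVariationOn u (Icc 0 (y - x)) := by
    obtain ⟨m, hm, h0, h1⟩ := h
    have hmi : ∀ r s, x ≤ r → r ≤ s → s ≤ y → IntervalIntegrable m volume r s :=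
      fun r s hr hrs hs => by
        rw [intervalIntegrable_iff_integrableOn_Icc_of_le hrs]
        exact hm.mono_set (Icc_subset_Icc hr hs)
    set M : ℝ → ℝ := fun r => ∫ s in x..(r + x), m s with hM
    have hMsub : ∀ r ∈ Icc 0 (y - x), ∀ s ∈ Icc 0 (y - x), r ≤ s →
        M s - M r = ∫ q in (r + x)..(s + x), m q := by
      intro r hr s hs hrs
      rw [sub_eq_iff_eq_add', hM]
      exact (intervalIntegral.integral_add_adjacent_intervals
        (hmi _ _ le_rfl (by linarith [hr.1]) (by linarith [hr.2]))
        (hmi _ _ (by linarith [hr.1]) (by linarith) (by linarith [hs.2]))).symm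
    have hMm : MonotoneOn M (Icc 0 (y - x)) := fun r hr s hs hrs => by
      have h2 := hMsub r hr s hs hrs
      have h3 : 0 ≤ ∫ q in (r + x)..(s + x), m q :=
        intervalIntegral.integral_nonneg (by linarith) fun q _ => h0 q
      linarith
    have hle : eVariationOn u (Icc 0 (y - x)) ≤ eVariationOn M (Icc 0 (y - x)) := by
      refine iSup_le fun p => le_trans (Finset.sum_le_sum fun i _ => ?_)
        (eVariationOn.sum_le p.2.2.1 p.2.2.2)
      have hmono := p.2.2.1 (Nat.le_succ i)
      have h2 := p.2.2.2 i
      have h3 := p.2.2.2 (i + 1)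
      rw [edist_dist, edist_dist, dist_eq_norm, dist_eq_norm]
      refine ENNReal.ofReal_le_ofReal ?_
      refine le_trans ?_ (le_abs_self _)
      rw [hMsub _ h2 _ h3 hmono]
      rcases hmono.eq_or_lt with h4 | h4
      · rw [← Nat.succ_eq_add_one, ← h4]; simp
      · exact h1 _ _ (by linarith [h2.1]) (by linarith) (by linarith [h3.2])
    refine ne_top_of_le_ne_top ?_ hle
    have := hMm.eVariationOn_eq (left_mem_Icc.2 hT.le) (right_mem_Icc.2 hT.le)
    rw [inter_self] at this
    rw [this]
    exact ENNReal.ofReal_ne_top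
  -- From here only the bounded variation of the shifted curve is used: differentiability a.e. and
  -- integrability of the derivative come from the density of its diffuse part.
  obtain ⟨g, hg, hgd⟩ := exists_density hT hu hV
  have hd := ae_hasDerivAt hT hu hg hgd
  have hvol : volume.restrict (Ioo 0 (y - x)) ≤ refMeasure hT hu := Measure.le_add_left le_rfl
  have hgi : IntegrableOn g (Ioo 0 (y - x)) := hg.mono_measure hvol
  have hshift := measurePreserving_sub_right (volume : Measure ℝ) x
  have hemb : MeasurableEmbedding fun r : ℝ => r - x := (Homeomorph.subRight x).measurableEmbedding
  have hpre : (fun r : ℝ => r - x) ⁻¹' Ioo 0 (y - x) = Ioo x y := by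
    ext r; simp
  have hd' : ∀ᵐ r ∂(volume : Measure ℝ), r ∈ Ioo x y → HasDerivAt c (g (r - x)) r := by
    filter_upwards [hshift.quasiMeasurePreserving.ae hd] with r hr hrI
    have h1 := hr (by rw [← hpre] at hrI; exact hrI)
    have h2 : HasDerivAt (fun s : ℝ => u (s - x)) (g (r - x)) r := h1.comp_sub_const r x
    simpa [hu'] using h2
  refine ⟨hd'.mono fun r hr hrI => (hr hrI).differentiableAt, ?_⟩
  have h3 := (hshift.integrableOn_comp_preimage hemb).2 hgi
  rw [hpre] at h3
  refine h3.congr_fun_ae ?_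
  rw [EventuallyEq, ae_restrict_iff' measurableSet_Ioo]
  filter_upwards [hd'] with r hr hrI using (hr hrI).deriv.symm

end AbsolutelyContinuous

end

/-! ### Riemann sums below an integral -/

section

section Riemann

/-- Some equidistant Riemann sum does not exceed the integral. -/
theorem exists_riemannSum_le {h : ℝ → ℝ≥0∞} (hh : Measurable h) {L : ℝ} (hL : 0 < L) {n : ℕ}
    (hn : 0 < n) : ∃ τ ∈ Ioo 0 (L / n), ENNReal.ofReal (L / n) *
      ∑ i ∈ Finset.range n, h (i * (L / n) + τ) ≤ ∫⁻ q in Ioo 0 L, h q := by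
  have hn' : (0 : ℝ) < n := Nat.cast_pos.2 hn
  set δ := L / n with hδ
  have hδ0 : 0 < δ := by positivity
  have hvol : volume (Ioo 0 δ) = ENNReal.ofReal δ := by rw [Real.volume_Ioo, sub_zero]
  have hpos : ENNReal.ofReal δ ≠ 0 := (ENNReal.ofReal_pos.2 hδ0).ne'
  have hm : ∀ i : ℕ, Measurable fun τ : ℝ => h (i * δ + τ) := fun i =>
    hh.comp (measurable_const.add measurable_id)
  -- The mean over the shift τ of the Riemann sums is the integral divided by δ, so some shift does
  -- not exceed it. No continuity of h is needed.
  obtain ⟨τ, hτ, hle⟩ := exists_le_setLAverage (μ := (volume : Measure ℝ)) (s := Ioo 0 δ)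
    (f := fun τ => ∑ i ∈ Finset.range n, h (i * δ + τ)) (by rw [hvol]; exact hpos)
    (by rw [hvol]; exact ENNReal.ofReal_ne_top)
    (Finset.measurable_fun_sum _ fun i _ => hm i).aemeasurable
  refine ⟨τ, hτ, ?_⟩
  rw [setLAverage_eq, hvol] at hle
  have h1 := mul_le_mul_right hle (ENNReal.ofReal δ)
  rw [ENNReal.mul_div_cancel hpos ENNReal.ofReal_ne_top] at h1
  refine h1.trans ?_
  rw [lintegral_finsetSum _ fun i _ => hm i]
  have h2 : ∀ i : ℕ, ∫⁻ τ in Ioo 0 δ, h (i * δ + τ) =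
      ∫⁻ q in Ioo (i * δ) ((i + 1) * δ), h q := by
    intro i
    have := (measurePreserving_add_left (volume : Measure ℝ) (i * δ)).setLIntegral_comp_preimage_emb
      (Homeomorph.addLeft (i * δ)).measurableEmbedding h (Ioo (i * δ) ((i + 1) * δ))
    rw [← this]
    congr 2
    ext q
    simp only [mem_Ioo, mem_preimage]
    constructor <;> rintro ⟨h3, h4⟩ <;> constructor <;> linarith
  simp only [h2]
  rw [← lintegral_biUnion_finset]
  · refine lintegral_mono_set (iUnion₂_subset fun i hi => ?_)
    have hi : ((i : ℝ) + 1) ≤ n := by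
      have := Finset.mem_range.1 hi
      exact_mod_cast this
    refine Ioo_subset_Ioo (by positivity) ?_
    calc ((i : ℝ) + 1) * δ ≤ n * δ := by gcongr
      _ = L := by rw [hδ]; field_simp
  · intro i _ j _ hij
    refine Set.disjoint_left.2 fun q hq hq' => ?_
    rcases lt_or_gt_of_ne hij with h3 | h3
    · have : ((i : ℝ) + 1) ≤ j := by exact_mod_cast h3
      have := mul_le_mul_of_nonneg_right this hδ0.le
      linarith [hq.2, hq'.1]
    · have : ((j : ℝ) + 1) ≤ i := by exact_mod_cast h3
      have := mul_le_mul_of_nonneg_right this hδ0.le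
      linarith [hq'.2, hq.1]
  · exact fun i _ => measurableSet_Ioo

theorem continuous_real_Iic (ν : Measure ℝ) [IsFiniteMeasure ν] [NullSingletonClass ν] :
    Continuous fun b => ν.real (Iic b) := by
  rw [continuous_iff_continuousAt]
  intro b
  rw [continuousAt_iff_continuous_left'_right']
  have hmono : Monotone fun b => ν.real (Iic b) := fun a b h =>
    measureReal_mono (Iic_subset_Iic.2 h)
  have hl : Tendsto (fun x => ν (Iic x)) (𝓝[<] b) (𝓝 (ν (Iic b))) := by
    rw [← measure_congr (Iio_ae_eq_Iic (μ := ν) (a := b))]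
    obtain ⟨w, hw, hwb, hwt⟩ := exists_seq_strictMono_tendsto b
    have h1 : Tendsto (fun n => ν (Iic (w n))) atTop (𝓝 (ν (⋃ n, Iic (w n)))) :=
      tendsto_measure_iUnion_atTop fun m n h => Iic_subset_Iic.2 (hw.monotone h)
    have h2 : (⋃ n, Iic (w n)) = Iio b := by
      ext x
      simp only [mem_iUnion, mem_Iic, mem_Iio]
      exact ⟨fun ⟨n, hn⟩ => hn.trans_lt (hwb n), fun hx =>
        ((hwt.eventually_const_lt hx).exists).imp fun n hn => hn.le⟩
    rw [h2] at h1
    have hm : Monotone fun x => ν (Iic x) := fun a b h => measure_mono (Iic_subset_Iic.2 h)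
    have h3 := hm.tendsto_nhdsLT b
    have h4 : Tendsto w atTop (𝓝[<] b) :=
      tendsto_nhdsWithin_iff.2 ⟨hwt, Eventually.of_forall hwb⟩
    rwa [tendsto_nhds_unique (h3.comp h4) h1] at h3
  have hr : Tendsto (fun x => ν (Iic x)) (𝓝[>] b) (𝓝 (ν (Iic b))) := by
    obtain ⟨w, hw, hwb, hwt⟩ := exists_seq_strictAnti_tendsto b
    have h1 : Tendsto (fun n => ν (Iic (w n))) atTop (𝓝 (ν (⋂ n, Iic (w n)))) :=
      tendsto_measure_iInter_atTop (fun n => measurableSet_Iic.nullMeasurableSet)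
        (fun m n h => Iic_subset_Iic.2 (hw.antitone h)) ⟨0, measure_ne_top _ _⟩
    have h2 : (⋂ n, Iic (w n)) = Iic b := by
      ext x
      simp only [mem_iInter, mem_Iic]
      exact ⟨fun h => ge_of_tendsto' hwt h, fun hx n => hx.trans (hwb n).le⟩
    rw [h2] at h1
    have hm : Monotone fun x => ν (Iic x) := fun a b h => measure_mono (Iic_subset_Iic.2 h)
    have h3 := hm.tendsto_nhdsGT b
    have h4 : Tendsto w atTop (𝓝[>] b) :=
      tendsto_nhdsWithin_iff.2 ⟨hwt, Eventually.of_forall hwb⟩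
    rwa [tendsto_nhds_unique (h3.comp h4) h1] at h3
  exact ⟨(ENNReal.tendsto_toReal (measure_ne_top _ _)).comp hl,
    (ENNReal.tendsto_toReal (measure_ne_top _ _)).comp hr⟩

/-- A Riemann sum with respect to a measure without atoms, with equally weighted intervals. -/
theorem exists_riemannSum_measure_le (ν : Measure ℝ) [IsFiniteMeasure ν] [NullSingletonClass ν]
    {h : ℝ → ℝ≥0∞} (hh : Measurable h) (hL : 0 < ν.real univ) {n : ℕ} (hn : 0 < n) :
    ∃ τ ∈ Ioo 0 (ν.real univ / n), ∃ x : ℕ → ℝ,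
      (∀ i < n, ν.real (Iic (x i)) = i * (ν.real univ / n) + τ) ∧
      ENNReal.ofReal (ν.real univ / n) * ∑ i ∈ Finset.range n, h (x i) ≤ ∫⁻ r, h r ∂ν := by
  classical
  set L := ν.real univ with hLdef
  set F : ℝ → ℝ := fun b => ν.real (Iic b) with hF
  have hFm : Monotone F := fun a b h => measureReal_mono (Iic_subset_Iic.2 h)
  have hFc : Continuous F := continuous_real_Iic ν
  have hF0 : ∀ b, 0 ≤ F b := fun b => measureReal_nonneg
  have hFL : ∀ b, F b ≤ L := fun b => measureReal_mono (subset_univ _)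
  have htop : Tendsto F atTop (𝓝 L) :=
    (ENNReal.tendsto_toReal (measure_ne_top _ _)).comp (tendsto_measure_Iic_atTop ν)
  have hbot : Tendsto F atBot (𝓝 0) := by
    have h1 : Tendsto (fun b => ν (Ici b)) atBot (𝓝 (ν univ)) := tendsto_measure_Ici_atBot ν
    have h2 := (ENNReal.tendsto_toReal (measure_ne_top ν univ)).comp h1
    have h3 := h2.const_sub L
    rw [hLdef, measureReal_def, sub_self] at h3
    refine h3.congr fun b => ?_
    have h4 := measureReal_compl (μ := ν) (measurableSet_Ici (a := b))
    rw [compl_Ici, measureReal_congr (Iio_ae_eq_Iic (μ := ν) (a := b))] at h4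
    exact h4.symm
  -- The quantile function of ν: it pushes Lebesgue measure on (0, L) to ν, and F (r q) = q because
  -- ν has no atoms. This reduces the claim to `exists_riemannSum_le`.
  set r : ℝ → ℝ := fun q => if q ∈ Ioo 0 L then sInf {b | q ≤ F b} else 0 with hr
  have hne : ∀ q ∈ Ioo 0 L, {b | q ≤ F b}.Nonempty := fun q hq =>
    ((htop.eventually_const_lt hq.2).exists).imp fun b hb => hb.le
  have hbdd : ∀ q ∈ Ioo 0 L, BddBelow {b | q ≤ F b} := fun q hq => by
    obtain ⟨b, hb⟩ := (hbot.eventually_lt_const hq.1).exists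
    exact ⟨b, fun b' hb' => le_of_not_gt fun hlt =>
      absurd (hb'.trans (hFm hlt.le)) (not_le.2 hb)⟩
  have hclosed : ∀ q, IsClosed {b | q ≤ F b} := fun q => isClosed_le continuous_const hFc
  have hgal : ∀ q ∈ Ioo 0 L, ∀ b, r q ≤ b ↔ q ≤ F b := by
    intro q hq b
    simp only [hr, if_pos hq]
    constructor
    · intro hle
      exact ((hclosed q).csInf_mem (hne q hq) (hbdd q hq)).trans (hFm hle)
    · exact fun hle => csInf_le (hbdd q hq) hle
  have hFr : ∀ q ∈ Ioo 0 L, F (r q) = q := by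
    intro q hq
    refine le_antisymm ?_ ((hgal q hq _).1 le_rfl)
    by_contra hcon
    have h1 : ∀ᶠ b in 𝓝 (r q), q < F b := hFc.continuousAt.eventually_const_lt (not_le.1 hcon)
    obtain ⟨b, hb, hbq⟩ := ((h1.filter_mono nhdsWithin_le_nhds).and
      (self_mem_nhdsWithin (a := r q) (s := Iio (r q)))).exists
    exact absurd ((hgal q hq b).2 hb.le) (not_le.2 hbq)
  have hrm : Measurable r := by
    refine measurable_of_Iic fun b => ?_
    have : r ⁻¹' Iic b = (Ioo 0 L ∩ Iic (F b)) ∪ ((Ioo 0 L)ᶜ ∩ {_q | 0 ≤ b}) := by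
      ext q
      by_cases hq : q ∈ Ioo 0 L
      · have := hgal q hq b
        simp [hq, this]
      · have h0 : r q = 0 := if_neg hq
        simp [hq, h0]
    rw [this]
    exact (measurableSet_Ioo.inter measurableSet_Iic).union
      (measurableSet_Ioo.compl.inter (MeasurableSet.const _))
  have hmap : (volume.restrict (Ioo 0 L)).map r = ν := by
    refine Measure.ext_of_Iic _ _ fun b => ?_
    rw [Measure.map_apply hrm measurableSet_Iic, Measure.restrict_apply (hrm measurableSet_Iic)]
    have h1 : r ⁻¹' Iic b ∩ Ioo 0 L = Ioo 0 L ∩ Iic (F b) := by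
      ext q
      simp only [mem_inter_iff, mem_preimage, mem_Iic]
      exact ⟨fun h => ⟨h.2, (hgal q h.2 b).1 h.1⟩, fun h => ⟨(hgal q h.1 b).2 h.2, h.1⟩⟩
    have h2 : (Ioo 0 L ∩ Iic (F b) : Set ℝ) =ᵐ[volume] Ioc 0 (F b) := by
      refine (Ioo_ae_eq_Ioc.inter (ae_eq_refl _)).trans (Eq.eventuallyEq ?_)
      change (Ioc 0 L ∩ Iic (F b) : Set ℝ) = Ioc 0 (F b)
      ext q
      simp only [mem_inter_iff, mem_Ioc, mem_Iic]
      exact ⟨fun h => ⟨h.1.1, h.2⟩, fun h => ⟨⟨h.1, h.2.trans (hFL b)⟩, h.2⟩⟩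
    rw [h1, measure_congr h2, Real.volume_Ioc, sub_zero, hF]
    exact ENNReal.ofReal_toReal (measure_ne_top _ _)
  obtain ⟨τ, hτ, hle⟩ := exists_riemannSum_le (hh.comp hrm) hL hn
  have hn' : (0 : ℝ) < n := Nat.cast_pos.2 hn
  refine ⟨τ, hτ, fun i => r (i * (L / n) + τ), fun i hi => hFr _ ⟨?_, ?_⟩, ?_⟩
  · have := hτ.1; positivity
  · have h1 : ((i : ℝ) + 1) ≤ n := by exact_mod_cast hi
    have h2 : ((i : ℝ) + 1) * (L / n) ≤ n * (L / n) := by gcongr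
    have h3 : n * (L / n) = L := by field_simp
    linarith [hτ.2]
  · refine hle.trans (le_of_eq ?_)
    conv_rhs => rw [← hmap]
    rw [lintegral_map hh hrm]
    rfl

end Riemann

theorem LowerSemicontinuousOn.measurable_indicator {f : ℝ → ℝ≥0∞} {s : Set ℝ}
    (hf : LowerSemicontinuousOn f s) (hs : MeasurableSet s) : Measurable (s.indicator f) := by
  refine measurable_of_Ioi fun b => ?_
  obtain ⟨U, hU, h⟩ := lowerSemicontinuousOn_iff_preimage_Ioi.1 hf b
  have : s.indicator f ⁻¹' Ioi b = s ∩ U := by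
    rw [← h]
    ext x
    by_cases hx : x ∈ s <;> simp [hx]
  rw [this]
  exact hs.inter hU.measurableSet

end

/-! ### Transition curves and the chain-rule inequality on norm-absolutely continuous pieces -/

section

namespace RIS

variable {V : Type*} [NormedAddCommGroup V] [NormedSpace ℝ V]

/-- Admissible transition curves on an arbitrary parameter interval. -/
structure IsTransition (S : RIS V) (t : ℝ) (ϑ : ℝ → V) (a b : ℝ) : Prop where
  mem : ∃ e > 0, ∀ r ∈ Icc a b, ϑ r ∈ S.sublevel e
  gauge_ac : ACOn S.Ψ ϑ a b
  norm_ac : ∀ c d, a ≤ c → c ≤ d → d ≤ b → (∀ r ∈ Icc c d, 0 < S.slope t (ϑ r)) →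
    ACOn (fun v : V => ‖v‖) ϑ c d

open Classical in
/-- The dissipation density along a curve. -/
def density (S : RIS V) (t : ℝ) (ϑ : ℝ → V) (r : ℝ) : ℝ≥0∞ :=
  if 0 < S.slope t (ϑ r) then S.finsler t (ϑ r) (deriv ϑ r) else scalarDeriv S.Ψ ϑ r

variable {S : RIS V} {t : ℝ} {ϑ : ℝ → V} {a b : ℝ}

theorem density_of_pos {r : ℝ} (h : 0 < S.slope t (ϑ r)) :
    S.density t ϑ r = S.finsler t (ϑ r) (deriv ϑ r) := if_pos h

theorem density_of_zero {r : ℝ} (h : S.slope t (ϑ r) = 0) :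
    S.density t ϑ r = scalarDeriv S.Ψ ϑ r := if_neg (by simp [h])

theorem IsTransition.mono (h : S.IsTransition t ϑ a b) {a' b' : ℝ} (ha : a ≤ a') (hb : b' ≤ b) :
    S.IsTransition t ϑ a' b' := by
  obtain ⟨e, he, hm⟩ := h.mem
  exact ⟨⟨e, he, fun r hr => hm r ⟨ha.trans hr.1, hr.2.trans hb⟩⟩, h.gauge_ac.mono ha hb,
    fun c d hc hcd hd => h.norm_ac c d (ha.trans hc) hcd (hd.trans hb)⟩

namespace Admissible

variable (hS : S.Admissible)
include hS

/-- Compactness of the sublevel, together with Ψ vanishing only at 0. This is what makes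
Ψ-absolutely continuous curves in a sublevel norm continuous. -/
theorem exists_norm_lt_of_gauge_lt {e : ℝ} (he : 0 < e) {η : ℝ} (hη : 0 < η) : ∃ δ > 0,
    ∀ u ∈ S.sublevel e, ∀ v ∈ S.sublevel e, S.Ψ (v - u) < δ → ‖v - u‖ < η := by
  by_contra! hcon
  choose x hx y hy hxy hη' using fun n : ℕ => hcon (1 / ((n : ℝ) + 1)) (by positivity)
  have hcp := hS.coercive e he
  obtain ⟨⟨u, v⟩, hp, φ, hφ, hlim⟩ := (hcp.prod hcp).tendsto_subseq
    (x := fun n => (x n, y n)) fun n => mk_mem_prod (hx n) (hy n)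
  have h1 : Tendsto (fun n => y (φ n) - x (φ n)) atTop (𝓝 (v - u)) :=
    ((continuous_snd.tendsto _).comp hlim).sub ((continuous_fst.tendsto _).comp hlim)
  have h2 : Tendsto (fun n => S.Ψ (y (φ n) - x (φ n))) atTop (𝓝 0) :=
    squeeze_zero (fun _ => hS.isGauge.nonneg _) (fun n => (hxy (φ n)).le)
      (tendsto_one_div_add_atTop_nhds_zero_nat.comp hφ.tendsto_atTop)
  have h3 := tendsto_nhds_unique h2 ((hS.gauge_continuous.tendsto _).comp h1)
  have h4 : v - u = 0 := by
    by_contra hne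
    exact (hS.gauge_pos _ hne).ne h3
  rw [h4] at h1
  have h5 := ge_of_tendsto' h1.norm fun n => hη' (φ n)
  rw [norm_zero] at h5
  exact absurd h5 (not_le.2 hη)

theorem continuousOn_transition (h : S.IsTransition t ϑ a b) : ContinuousOn ϑ (Icc a b) := by
  obtain ⟨e, he, hm⟩ := h.mem
  obtain ⟨m, hmi, hm0, hm1⟩ := h.gauge_ac
  rcases lt_or_ge b a with hab | hab
  · rw [Icc_eq_empty_of_lt hab]; exact continuousOn_empty _
  have hmi' : ∀ r s, a ≤ r → r ≤ s → s ≤ b → IntervalIntegrable m volume r s :=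
    fun r s hr hrs hs => by
      rw [intervalIntegrable_iff_integrableOn_Icc_of_le hrs]
      exact hmi.mono_set (Icc_subset_Icc hr hs)
  set M : ℝ → ℝ := fun r => ∫ s in a..r, m s with hM
  have hMc : ContinuousOn M (Icc a b) := by
    have := intervalIntegral.continuousOn_primitive_interval (μ := volume) (a := a) (b := b)
      (f := m) (by rwa [uIcc_of_le hab])
    rwa [uIcc_of_le hab] at this
  have hsub : ∀ r ∈ Icc a b, ∀ s ∈ Icc a b, r < s → S.Ψ (ϑ s - ϑ r) ≤ M s - M r := by
    intro r hr s hs hrs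
    have h1 := intervalIntegral.integral_add_adjacent_intervals
      (hmi' a r le_rfl hr.1 hr.2) (hmi' r s hr.1 hrs.le hs.2)
    have h2 := hm1 r s hr.1 hrs hs.2
    simp only [hM]
    linarith
  intro r hr
  rw [ContinuousWithinAt, Metric.tendsto_nhds]
  intro η hη
  obtain ⟨δ, hδ, hlt⟩ := hS.exists_norm_lt_of_gauge_lt he hη
  filter_upwards [(Metric.tendsto_nhds.1 (hMc r hr)) δ hδ, self_mem_nhdsWithin] with s hs hsI
  rw [Real.dist_eq] at hs
  rcases lt_trichotomy r s with h1 | rfl | h1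
  · rw [dist_eq_norm]
    exact hlt _ (hm r hr) _ (hm s hsI)
      ((hsub r hr s hsI h1).trans_lt ((le_abs_self _).trans_lt hs))
  · rwa [dist_self]
  · rw [dist_eq_norm, norm_sub_rev]
    rw [abs_sub_comm] at hs
    exact hlt _ (hm s hsI) _ (hm r hr)
      ((hsub s hsI r hr h1).trans_lt ((le_abs_self _).trans_lt hs))

theorem lowerSemicontinuousOn_slope_comp (ht : t ∈ Icc 0 S.T) {e : ℝ} (he : 0 < e) {s : Set ℝ}
    (hm : ∀ r ∈ s, ϑ r ∈ S.sublevel e) (hc : ContinuousOn ϑ s) :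
    LowerSemicontinuousOn (fun r => S.slope t (ϑ r)) s := fun r hr y hy =>
  (tendsto_nhdsWithin_iff.2 ⟨hc r hr, by
    filter_upwards [self_mem_nhdsWithin] with q hq using hm q hq⟩).eventually
    (hS.lowerSemicontinuousOn_slope ht he (ϑ r) (hm r hr) y hy)

/-- For an optimal pair write -ζ = z + (-ζ - z): the part in K* is bounded by Ψ, the other by the
slope times the norm. An infinite slope leaves only the trivial case v = u. -/
theorem energy_sub_le_slope {ω : ℝ} (ht : t ∈ Icc 0 S.T) {u v : V} (h : ∀ ξ ∈ S.energySubdiff t u,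
      S.E t u + ξ (v - u) - ω * S.Ψ (v - u) ≤ S.E t v) :
    ENNReal.ofReal (S.E t u - S.E t v) ≤
      ENNReal.ofReal ((1 + ω) * S.Ψ (v - u)) + S.slope t u * ‖v - u‖ₑ := by
  by_cases hsl : S.slope t u = ∞
  · rcases eq_or_ne v u with rfl | hne
    · simp
    · rw [hsl, ENNReal.top_mul (by simpa [sub_eq_zero] using hne), add_top]; exact le_top
  · obtain ⟨ζ, hζ, z, hz, hn⟩ := hS.exists_slope_eq ht hsl
    have h1 := h ζ hζ
    have h2 := hz (v - u)
    have h3 := (le_abs_self _).trans ((-ζ - z).le_opNorm (v - u))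
    simp only [sub_apply, neg_apply] at h3
    rw [← hn, ← ofReal_norm (-ζ - z), ← ofReal_norm (v - u), ← ENNReal.ofReal_mul (norm_nonneg _)]
    refine le_trans (ENNReal.ofReal_le_ofReal ?_) ENNReal.ofReal_add_le
    linarith

variable [CompleteSpace V] (hV : RadonNikodymProperty V)
include hV

/-- The upper gradient property of the slope along curves which are absolutely continuous with
respect to the norm. -/
theorem energy_sub_le_of_ac (ht : t ∈ Icc 0 S.T) {e : ℝ} (he : 0 < e) (hab : a ≤ b)
    (hm : ∀ r ∈ Icc a b, ϑ r ∈ S.sublevel e) (hc : ContinuousOn ϑ (Icc a b))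
    (hac : ACOn (fun v : V => ‖v‖) ϑ a b) :
    ENNReal.ofReal (S.E t (ϑ a) - S.E t (ϑ b)) ≤ ∫⁻ r in Ioo a b,
      (ENNReal.ofReal (S.Ψ (deriv ϑ r)) + S.slope t (ϑ r) * ‖deriv ϑ r‖ₑ) := by
  classical
  rcases hab.eq_or_lt with rfl | hlt
  · simp
  obtain ⟨hdiff, hint⟩ := hac.differentiable hV hlt
  have hG := hS.isGauge
  obtain ⟨cΨ, hcΨ, hΨle⟩ := hG.exists_bound
  obtain ⟨ω, B, -, hω, hωs, hsub⟩ := hS.exists_uniform_subdiff he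
  have hdm : Measurable fun r => ‖deriv ϑ r‖ₑ := (stronglyMeasurable_deriv ϑ).enorm
  -- The slope is only lower semicontinuous, so arbitrary Riemann sums may exceed its integral. With
  -- arc length ν as reference measure, `exists_riemannSum_measure_le` provides base points for
  -- which slope times step length stays below the integral.
  set ν : Measure ℝ := (volume.restrict (Ioo a b)).withDensity fun r => ‖deriv ϑ r‖ₑ with hν
  have hνfin : IsFiniteMeasure ν := isFiniteMeasure_withDensity hint.2.ne
  have hνatom : NullSingletonClass ν := inferInstance
  set h : ℝ → ℝ≥0∞ := (Icc a b).indicator fun r => S.slope t (ϑ r) with hh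
  have hhm : Measurable h := LowerSemicontinuousOn.measurable_indicator
    (hS.lowerSemicontinuousOn_slope_comp ht he hm hc) measurableSet_Icc
  have hhν : ∫⁻ r, h r ∂ν = ∫⁻ r in Ioo a b, S.slope t (ϑ r) * ‖deriv ϑ r‖ₑ := by
    rw [hν, lintegral_withDensity_eq_lintegral_mul _ hdm hhm]
    refine setLIntegral_congr_fun measurableSet_Ioo fun r hr => ?_
    simp only [Pi.mul_apply, hh]
    rw [indicator_of_mem (Ioo_subset_Icc_self hr), mul_comm]
  have hΨm : Measurable fun r => ENNReal.ofReal (S.Ψ (deriv ϑ r)) :=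
    (hG.continuous.comp_stronglyMeasurable (stronglyMeasurable_deriv ϑ)).measurable.ennreal_ofReal
  rw [lintegral_add_left hΨm, ← hhν]
  set A := ∫⁻ r in Ioo a b, ENNReal.ofReal (S.Ψ (deriv ϑ r)) with hA
  have hΨac : ACOn S.Ψ ϑ a b := hac.of_le hcΨ.le hΨle
  have hincΨ : ∀ r s, a ≤ r → r ≤ s → s ≤ b → ENNReal.ofReal (S.Ψ (ϑ s - ϑ r)) ≤
      ∫⁻ q in Ioc r s, ENNReal.ofReal (S.Ψ (deriv ϑ q)) := by
    intro r s hr hrs hs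
    refine (hΨac.ofReal_sub_le hG hr hrs hs).trans (lintegral_mono_ae ?_)
    rw [← Measure.restrict_congr_set Ioo_ae_eq_Ioc, ae_restrict_iff' measurableSet_Ioo]
    filter_upwards [hdiff] with q hq hqI
    rw [scalarDeriv_of_differentiableAt hG (hq ⟨hr.trans_lt hqI.1, hqI.2.trans_le hs⟩)]
  have hincN : ∀ r s, a ≤ r → r ≤ s → s ≤ b → ENNReal.ofReal ‖ϑ s - ϑ r‖ ≤ ν (Ioc r s) := by
    intro r s hr hrs hs
    refine (hac.ofReal_sub_le isGauge_norm hr hrs hs).trans ?_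
    have h1 : ν (Ioo r s) = ν (Ioc r s) := measure_congr Ioo_ae_eq_Ioc
    rw [← h1, hν, withDensity_apply _ measurableSet_Ioo,
      Measure.restrict_restrict measurableSet_Ioo,
      inter_eq_left.2 (Ioo_subset_Ioo hr hs), ← Measure.restrict_congr_set Ioo_ae_eq_Ioc]
    refine lintegral_mono_ae ?_
    rw [ae_restrict_iff' measurableSet_Ioo]
    filter_upwards [hdiff] with q hq hqI
    rw [scalarDeriv_of_differentiableAt isGauge_norm (hq ⟨hr.trans_lt hqI.1, hqI.2.trans_le hs⟩),
      ofReal_norm]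
  have haI : a ∈ Icc a b := ⟨le_rfl, hab⟩
  have hbI : b ∈ Icc a b := ⟨hab, le_rfl⟩
  set L := ν.real univ with hL
  have hνle : ∀ s, ν s ≤ ENNReal.ofReal L := fun s => by
    rw [hL, measureReal_def, ENNReal.ofReal_toReal (measure_ne_top _ _)]
    exact measure_mono (subset_univ _)
  rcases (measureReal_nonneg : 0 ≤ L).eq_or_lt with hL0 | hL0
  · have h1 := (hincN a b le_rfl hab le_rfl).trans (hνle _)
    rw [show L = 0 from hL0.symm, ENNReal.ofReal_zero, nonpos_iff_eq_zero,
      ENNReal.ofReal_eq_zero] at h1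
    rw [sub_eq_zero.1 (norm_le_zero_iff.1 h1)]
    simp
  have hν_a : ∀ q ≤ a, ν.real (Iic q) = 0 := by
    intro q hq
    rw [measureReal_eq_zero_iff, hν, withDensity_apply _ measurableSet_Iic,
      Measure.restrict_restrict measurableSet_Iic]
    have : Iic q ∩ Ioo a b = ∅ := by
      ext x; simp only [mem_inter_iff, mem_Iic, mem_Ioo, mem_empty_iff_false, iff_false]
      rintro ⟨h1, h2, -⟩; linarith
    rw [this]; simp
  have hν_b : ∀ q, b ≤ q → ν.real (Iic q) = L := by
    intro q hq
    rw [hL, measureReal_def, measureReal_def, hν, withDensity_apply _ measurableSet_Iic,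
      Measure.restrict_restrict measurableSet_Iic, withDensity_apply _ MeasurableSet.univ,
      Measure.restrict_univ]
    have : Iic q ∩ Ioo a b = Ioo a b := inter_eq_right.2 fun x hx => hx.2.le.trans hq
    rw [this]
  have hIoc : ∀ r s, r ≤ s → ν (Ioc r s) = ENNReal.ofReal (ν.real (Iic s) - ν.real (Iic r)) := by
    intro r s hrs
    rw [← Iic_sdiff_Iic, ← measureReal_sdiff (Iic_subset_Iic.2 hrs) measurableSet_Iic,
      measureReal_def, ENNReal.ofReal_toReal (measure_ne_top _ _)]
  have key : ∀ η : ℝ, 0 < η → ENNReal.ofReal (S.E t (ϑ a) - S.E t (ϑ b)) ≤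
      ENNReal.ofReal η + (ENNReal.ofReal (1 + η) * A + ∫⁻ r, h r ∂ν) := by
    intro η hη
    obtain ⟨δ₁, hδ₁, hω1⟩ := hωs η hη
    -- The first base point is not a itself. The energy lost on the initial piece is not covered by
    -- the sum; lower semicontinuity makes it less than η.
    have hlsc : ∀ᶠ v in 𝓝[S.sublevel e] (ϑ a), S.E t (ϑ a) - η < S.E t v := by
      have h1 := hS.energy_lsc (t, ϑ a) (mk_mem_prod ht (hm a haI).1) (S.E t (ϑ a) - η)
        (by dsimp only; linarith)
      rw [nhdsWithin_prod_eq] at h1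
      have c1 : Tendsto (fun _ : V => t) (𝓝[S.sublevel e] (ϑ a)) (𝓝[Icc 0 S.T] t) :=
        tendsto_nhdsWithin_iff.2 ⟨tendsto_const_nhds, Eventually.of_forall fun _ => ht⟩
      exact (c1.prodMk (tendsto_id.mono_right (nhdsWithin_mono _ fun _ hv => hv.1))).eventually h1
    obtain ⟨δ₂, hδ₂, hE2⟩ := Metric.mem_nhdsWithin_iff.1 hlsc
    obtain ⟨n, hn⟩ := exists_nat_gt (L / min δ₁ δ₂)
    -- The arc length of each piece will be below both thresholds: δ₁ makes the remainder ω at most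
    -- η on every step, δ₂ keeps the first base point in the neighbourhood where the energy is
    -- almost E t (ϑ a).
    have hmin : 0 < min δ₁ δ₂ := lt_min hδ₁ hδ₂
    have hn0 : (0 : ℝ) < n := (by positivity : (0 : ℝ) ≤ L / min δ₁ δ₂).trans_lt hn
    have hnpos : 0 < n := Nat.cast_pos.1 hn0
    set δ := L / n with hδ
    have hδlt : δ < min δ₁ δ₂ := by
      rw [hδ, div_lt_iff₀ hn0]; rwa [div_lt_iff₀ hmin, mul_comm] at hn
    have hδ0 : 0 < δ := by positivity
    obtain ⟨τ, hτ, x, hx, hsum⟩ := exists_riemannSum_measure_le ν hhm hL0 hnpos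
    -- The n base points followed by b. Consecutive points are at arc length δ, except that the last
    -- piece has length δ - τ.
    set p : ℕ → ℝ := fun i => if i < n then x i else b with hp
    have hFp : ∀ i ≤ n, ν.real (Iic (p i)) = if i < n then i * δ + τ else L := by
      intro i hi
      by_cases h1 : i < n
      · simp only [hp, if_pos h1]; exact hx i h1
      · simp only [hp, if_neg h1]; exact hν_b b le_rfl
    have hlast : ∀ i < n, (i : ℝ) * δ + δ ≤ L := by
      intro i hi
      have h1 : ((i : ℝ) + 1) ≤ n := by exact_mod_cast hi
      have h2 : ((i : ℝ) + 1) * δ ≤ n * δ := by gcongr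
      have h3 : n * δ = L := by rw [hδ]; field_simp
      linarith
    have hpI : ∀ i ≤ n, p i ∈ Icc a b := by
      intro i hi
      by_cases h1 : i < n
      · have h2 := hFp i hi
        rw [if_pos h1] at h2
        have h3 : (0 : ℝ) ≤ i * δ := by positivity
        constructor
        · by_contra hcon
          rw [hν_a _ (not_le.1 hcon).le] at h2
          linarith [hτ.1]
        · by_contra hcon
          rw [hν_b _ (not_le.1 hcon).le] at h2
          linarith [hτ.2, hlast i h1]
      · simp only [hp, if_neg h1]; exact hbI
    have hstep : ∀ i < n, p i ≤ p (i + 1) ∧ ν (Ioc (p i) (p (i + 1))) ≤ ENNReal.ofReal δ := by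
      intro i hi
      have h1 := hFp i hi.le
      have h2 := hFp (i + 1) hi
      rw [if_pos hi] at h1
      have h3 : ν.real (Iic (p i)) < ν.real (Iic (p (i + 1))) ∧
          ν.real (Iic (p (i + 1))) ≤ ν.real (Iic (p i)) + δ := by
        rw [h1, h2]
        have h5 := hlast i hi
        split_ifs with h4
        · push_cast
          constructor <;> linarith
        · have h6 : i + 1 = n := by omega
          have h7 : (n : ℝ) * δ = L := by rw [hδ]; field_simp
          have h8 : ((i : ℝ) + 1) = n := by exact_mod_cast h6
          rw [← h8] at h7
          constructor <;> linarith [hτ.1, hτ.2]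
      have h4 : p i ≤ p (i + 1) := by
        by_contra hcon
        have : ν.real (Iic (p (i + 1))) ≤ ν.real (Iic (p i)) :=
          measureReal_mono (Iic_subset_Iic.2 (not_le.1 hcon).le)
        linarith [h3.1]
      refine ⟨h4, ?_⟩
      rw [hIoc _ _ h4]
      exact ENNReal.ofReal_le_ofReal (by linarith [h3.2])
    have hterm : ∀ i < n, ENNReal.ofReal (S.E t (ϑ (p i)) - S.E t (ϑ (p (i + 1)))) ≤
        ENNReal.ofReal (1 + η) * (∫⁻ q in Ioc (p i) (p (i + 1)), ENNReal.ofReal (S.Ψ (deriv ϑ q))) +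
          ENNReal.ofReal δ * h (x i) := by
      intro i hi
      obtain ⟨h1, h2⟩ := hstep i hi
      have h3 := hpI i hi.le
      have h4 := hpI (i + 1) hi
      have h5 := hincN _ _ h3.1 h1 h4.2
      have h6 : ‖ϑ (p (i + 1)) - ϑ (p i)‖ < δ₁ :=
        ((ENNReal.ofReal_le_ofReal_iff hδ0.le).1 (h5.trans h2)).trans_lt
          (hδlt.trans_le (min_le_left _ _))
      have h7 := hω1 t ht _ (hm _ h3) _ (hm _ h4) h6
      have h8 := hS.energy_sub_le_slope ht (hsub t ht _ (hm _ h3) _ (hm _ h4))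
      refine h8.trans (add_le_add ?_ ?_)
      · refine le_trans ?_ (mul_le_mul_right (hincΨ _ _ h3.1 h1 h4.2) _)
        rw [← ENNReal.ofReal_mul (by positivity)]
        exact ENNReal.ofReal_le_ofReal (mul_le_mul_of_nonneg_right (by linarith) (hG.nonneg _))
      · have h9 : h (x i) = S.slope t (ϑ (p i)) := by
          have : p i = x i := if_pos hi
          rw [← this]
          exact indicator_of_mem h3 _
        rw [h9, mul_comm, ← ofReal_norm]
        exact mul_le_mul_left (h5.trans h2) _
    have hsumE : ∀ k ≤ n, ENNReal.ofReal (S.E t (ϑ (p 0)) - S.E t (ϑ (p k))) ≤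
        ENNReal.ofReal (1 + η) * (∫⁻ q in Ioc (p 0) (p k), ENNReal.ofReal (S.Ψ (deriv ϑ q))) +
          ENNReal.ofReal δ * ∑ i ∈ Finset.range k, h (x i) ∧ p 0 ≤ p k := by
      intro k
      induction k with
      | zero => simp
      | succ k ih =>
        intro hk
        obtain ⟨ih, hle⟩ := ih (by omega)
        obtain ⟨h1, -⟩ := hstep k hk
        refine ⟨?_, hle.trans h1⟩
        have h2 : S.E t (ϑ (p 0)) - S.E t (ϑ (p (k + 1))) =
          (S.E t (ϑ (p 0)) - S.E t (ϑ (p k))) + (S.E t (ϑ (p k)) - S.E t (ϑ (p (k + 1)))) := by ring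
        rw [h2, ← Ioc_union_Ioc_eq_Ioc hle h1, lintegral_union measurableSet_Ioc
          (Set.disjoint_left.2 fun x hx hx' => absurd hx.2 (not_le.2 hx'.1)),
          Finset.sum_range_succ, mul_add, mul_add, add_add_add_comm]
        exact ENNReal.ofReal_add_le.trans (add_le_add ih (hterm k hk))
    have h1 := (hsumE n le_rfl).1
    have hpn : p n = b := if_neg (lt_irrefl n)
    rw [hpn] at h1
    have hp0 := hpI 0 (Nat.zero_le n)
    have h2 : S.E t (ϑ a) - η < S.E t (ϑ (p 0)) := by
      refine hE2 ⟨?_, hm _ hp0⟩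
      rw [Metric.mem_ball, dist_eq_norm]
      have h3 := hincN a (p 0) le_rfl hp0.1 hp0.2
      rw [hIoc _ _ hp0.1, hν_a a le_rfl, sub_zero, hFp 0 (Nat.zero_le n), if_pos hnpos,
        Nat.cast_zero, zero_mul, zero_add, ENNReal.ofReal_le_ofReal_iff hτ.1.le] at h3
      exact (h3.trans_lt hτ.2).trans (hδlt.trans_le (min_le_right _ _))
    have h3 : S.E t (ϑ a) - S.E t (ϑ b) =
      (S.E t (ϑ a) - S.E t (ϑ (p 0))) + (S.E t (ϑ (p 0)) - S.E t (ϑ b)) := by ring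
    rw [h3]
    refine ENNReal.ofReal_add_le.trans (add_le_add (ENNReal.ofReal_le_ofReal (by linarith)) ?_)
    refine h1.trans (add_le_add (mul_le_mul_right ?_ _) hsum)
    rw [hA, Measure.restrict_congr_set Ioo_ae_eq_Ioc]
    exact lintegral_mono_set (Ioc_subset_Ioc_left hp0.1)
  have hlim : Tendsto (fun η : ℝ => ENNReal.ofReal η +
      (ENNReal.ofReal (1 + η) * A + ∫⁻ r, h r ∂ν)) (𝓝[>] 0)
      (𝓝 (ENNReal.ofReal 0 + (ENNReal.ofReal (1 + 0) * A + ∫⁻ r, h r ∂ν))) := by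
    have h1 : Tendsto (fun η : ℝ => ENNReal.ofReal η) (𝓝[>] 0) (𝓝 (ENNReal.ofReal 0)) :=
      (ENNReal.continuous_ofReal.tendsto 0).mono_left nhdsWithin_le_nhds
    have h2 : Tendsto (fun η : ℝ => ENNReal.ofReal (1 + η)) (𝓝[>] 0)
        (𝓝 (ENNReal.ofReal (1 + 0))) :=
      ((ENNReal.continuous_ofReal.comp (continuous_const.add continuous_id)).tendsto 0).mono_left
        nhdsWithin_le_nhds
    exact h1.add ((ENNReal.Tendsto.mul_const h2 (Or.inl (by simp))).add_const _)
  simp only [ENNReal.ofReal_zero, zero_add, add_zero, ENNReal.ofReal_one, one_mul] at hlim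
  refine ge_of_tendsto hlim ?_
  filter_upwards [self_mem_nhdsWithin] with η hη using key η hη

end Admissible

end RIS

end

/-! ### Energy released along a whole transition -/

section

theorem lintegral_Ioc_add {f : ℝ → ℝ≥0∞} {x y z : ℝ} (hxy : x ≤ y) (hyz : y ≤ z) :
    ∫⁻ r in Ioc x z, f r = (∫⁻ r in Ioc x y, f r) + ∫⁻ r in Ioc y z, f r := by
  rw [← Ioc_union_Ioc_eq_Ioc hxy hyz, lintegral_union measurableSet_Ioc
    (Set.disjoint_left.2 fun x hx hx' => absurd hx.2 (not_le.2 hx'.1))]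

namespace RIS

variable {V : Type*} [NormedAddCommGroup V] [NormedSpace ℝ V]

variable {S : RIS V} {t : ℝ} {ϑ : ℝ → V} {a b : ℝ}

namespace Admissible

variable (hS : S.Admissible)
include hS

theorem isClosed_stable (ht : t ∈ Icc 0 S.T) (h : S.IsTransition t ϑ a b) :
    IsClosed {r | r ∈ Icc a b ∧ S.slope t (ϑ r) = 0} := by
  obtain ⟨e, he, hm⟩ := h.mem
  obtain ⟨U, hU, hUe⟩ := lowerSemicontinuousOn_iff_preimage_Ioi.1
    (hS.lowerSemicontinuousOn_slope_comp ht he hm (hS.continuousOn_transition h)) 0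
  have : {r | r ∈ Icc a b ∧ S.slope t (ϑ r) = 0} = Icc a b ∩ Uᶜ := by
    ext r
    have h1 : r ∈ Icc a b ∩ (fun r => S.slope t (ϑ r)) ⁻¹' Ioi 0 ↔ r ∈ Icc a b ∩ U := by rw [hUe]
    simp only [mem_inter_iff, mem_preimage, mem_Ioi, pos_iff_ne_zero] at h1
    simp only [mem_ofPred_eq, mem_inter_iff, mem_compl_iff]
    tauto
  rw [this]
  exact isClosed_Icc.inter hU.isClosed_compl

variable [CompleteSpace V] (hV : RadonNikodymProperty V)
include hV

/-- Transition curves are differentiable at almost every unstable parameter. -/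
theorem ae_differentiableAt (ht : t ∈ Icc 0 S.T) (h : S.IsTransition t ϑ a b) :
    ∀ᵐ r ∂(volume : Measure ℝ), r ∈ Ioo a b → 0 < S.slope t (ϑ r) → DifferentiableAt ℝ ϑ r := by
  have hF := hS.isClosed_stable ht h
  -- The unstable parameters form a relatively open set, so countably many rational intervals inside
  -- it suffice, and norm-absolute continuity applies on each.
  have hpq : ∀ pq : ℚ × ℚ, ∀ᵐ r ∂(volume : Measure ℝ),
      (a ≤ pq.1 ∧ (pq.2 : ℝ) ≤ b ∧ ∀ s ∈ Icc (pq.1 : ℝ) pq.2, 0 < S.slope t (ϑ s)) →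
        r ∈ Ioo (pq.1 : ℝ) pq.2 → DifferentiableAt ℝ ϑ r := by
    rintro ⟨p, q⟩
    by_cases hc : a ≤ p ∧ (q : ℝ) ≤ b ∧ ∀ s ∈ Icc (p : ℝ) q, 0 < S.slope t (ϑ s)
    · rcases lt_or_ge (p : ℝ) q with hlt | hge
      · exact ((h.norm_ac p q hc.1 hlt.le hc.2.1 hc.2.2).differentiable hV hlt).1.mono
          fun r hr _ => hr
      · refine Eventually.of_forall fun r _ hr => ?_
        simp [Ioo_eq_empty_of_le hge] at hr
    · exact Eventually.of_forall fun r hr => absurd hr hc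
  filter_upwards [ae_all_iff.2 hpq] with r hr hrI hsl
  have hrF : r ∈ {r | r ∈ Icc a b ∧ S.slope t (ϑ r) = 0}ᶜ := fun h' => hsl.ne' h'.2
  obtain ⟨l, u, hlu, hsub⟩ := mem_nhds_iff_exists_Ioo_subset.1
    (inter_mem (hF.isOpen_compl.mem_nhds hrF) (Ioo_mem_nhds hrI.1 hrI.2))
  obtain ⟨p, hp1, hp2⟩ := exists_rat_btwn hlu.1
  obtain ⟨q, hq1, hq2⟩ := exists_rat_btwn hlu.2
  have hsub' : ∀ s ∈ Icc (p : ℝ) q, s ∈ Ioo a b ∧ 0 < S.slope t (ϑ s) := fun s hs => by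
    have h1 := hsub ⟨hp1.trans_le hs.1, hs.2.trans_lt hq2⟩
    refine ⟨h1.2, pos_iff_ne_zero.2 fun h2 => h1.1 ⟨⟨h1.2.1.le, h1.2.2.le⟩, h2⟩⟩
  have hpq' : (p : ℝ) ≤ q := (hp2.trans hq1).le
  exact hr (p, q) ⟨(hsub' p ⟨le_rfl, hpq'⟩).1.1.le, (hsub' q ⟨hpq', le_rfl⟩).1.2.le,
    fun s hs => (hsub' s hs).2⟩ ⟨hp2, hq1⟩

/-- The dissipation along a transition dominates the increments of the gauge. -/
theorem ofReal_gauge_sub_le (ht : t ∈ Icc 0 S.T) (h : S.IsTransition t ϑ a b) {x y : ℝ}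
    (hx : a ≤ x) (hxy : x ≤ y) (hy : y ≤ b) :
    ENNReal.ofReal (S.Ψ (ϑ y - ϑ x)) ≤ ∫⁻ r in Ioc x y, S.density t ϑ r := by
  refine (h.gauge_ac.ofReal_sub_le hS.isGauge hx hxy hy).trans (lintegral_mono_ae ?_)
  rw [← Measure.restrict_congr_set Ioo_ae_eq_Ioc, ae_restrict_iff' measurableSet_Ioo]
  filter_upwards [hS.ae_differentiableAt hV ht h] with r hr hrI
  rcases eq_or_ne (S.slope t (ϑ r)) 0 with h0 | h0
  · rw [density_of_zero h0]
  · have hpos := pos_iff_ne_zero.2 h0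
    rw [density_of_pos hpos, scalarDeriv_of_differentiableAt hS.isGauge
      (hr ⟨hx.trans_lt hrI.1, hrI.2.trans_le hy⟩ hpos)]
    exact le_self_add.trans (hS.le_finsler t _ _)

theorem energy_sub_le_of_unstable (ht : t ∈ Icc 0 S.T) (h : S.IsTransition t ϑ a b) {x y : ℝ}
    (hx : a ≤ x) (hxy : x ≤ y) (hy : y ≤ b) (hG : ∀ r ∈ Icc x y, 0 < S.slope t (ϑ r)) :
    ENNReal.ofReal (S.E t (ϑ x) - S.E t (ϑ y)) ≤ ∫⁻ r in Ioc x y, S.density t ϑ r := by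
  obtain ⟨e, he, hm⟩ := h.mem
  have hsub : Icc x y ⊆ Icc a b := Icc_subset_Icc hx hy
  refine (hS.energy_sub_le_of_ac hV ht he hxy (fun r hr => hm r (hsub hr))
    ((hS.continuousOn_transition h).mono hsub) (h.norm_ac x y hx hxy hy hG)).trans ?_
  rw [← Measure.restrict_congr_set (Ioo_ae_eq_Ioc (a := x) (b := y))]
  refine setLIntegral_mono' measurableSet_Ioo fun r hr => ?_
  rw [density_of_pos (hG r (Ioo_subset_Icc_self hr))]
  exact hS.le_finsler t _ _

/-- Near the right end of an unstable interval the slope is at most inversely proportional to the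
distance from the end point, along some sequence of parameters. -/
theorem exists_slope_mul_le (ht : t ∈ Icc 0 S.T) (h : S.IsTransition t ϑ a b) {x y : ℝ}
    (hx : a ≤ x) (hxy : x < y) (hy : y ≤ b) (hG : ∀ r ∈ Ico x y, 0 < S.slope t (ϑ r))
    (hfin : ∫⁻ r in Ioc x y, S.density t ϑ r ≠ ∞) {ε : ℝ} (hε : 0 < ε) :
    ∃ z ∈ Ico x y, S.slope t (ϑ z) * ‖ϑ y - ϑ z‖ₑ ≤ ENNReal.ofReal ε := by
  by_contra! hcon
  have hc := hS.continuousOn_transition h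
  obtain ⟨δ, hδ, hlt⟩ := exists_pos_setLIntegral_lt_of_measure_lt hfin
    (ENNReal.ofReal_pos.2 (half_pos hε)).ne'
  obtain ⟨x', hx', hvol⟩ : ∃ x' ∈ Ico x y, volume (Ioc x' y) < δ := by
    have hlim : Tendsto (fun x' => volume (Ioc x' y)) (𝓝[<] y) (𝓝 0) := by
      simp only [Real.volume_Ioc]
      rw [← ENNReal.ofReal_zero]
      refine (ENNReal.continuous_ofReal.tendsto 0).comp ?_
      have : Continuous fun x' : ℝ => y - x' := by fun_prop
      simpa using (this.tendsto y).mono_left nhdsWithin_le_nhds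
    obtain ⟨x', h1, h2⟩ := ((hlim.eventually_lt_const hδ).and (Ico_mem_nhdsLT hxy)).exists
    exact ⟨x', h2, h1⟩
  -- If the claim fails, the slope exceeds ε / d near y. Between a point y₁ of maximal distance and
  -- a later point y₂ at half that distance, the length is at least d y₁ / 2 and the slope at least
  -- ε / d y₁. The dissipation there is thus at least ε / 2, against the absolute continuity of the
  -- integral.
  set d : ℝ → ℝ := fun r => ‖ϑ y - ϑ r‖ with hd
  have hsub : Icc x' y ⊆ Icc a b := Icc_subset_Icc (hx.trans hx'.1) hy
  have hdc : ContinuousOn d (Icc x' y) := (continuousOn_const.sub (hc.mono hsub)).norm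
  obtain ⟨y₁, hy₁, hmax⟩ := isCompact_Icc.exists_isMaxOn ⟨x', left_mem_Icc.2 hx'.2.le⟩ hdc
  have hD : 0 < d y₁ := by
    have h1 := hcon x' hx'
    have h2 : 0 < d x' := by
      rw [hd]; dsimp only
      rw [norm_pos_iff]
      intro h3
      rw [h3, enorm_zero, mul_zero] at h1
      exact absurd h1 (not_lt.2 zero_le)
    exact h2.trans_le (hmax (left_mem_Icc.2 hx'.2.le))
  have hy₁y : y₁ < y := lt_of_le_of_ne hy₁.2 (by rintro rfl; simp [hd] at hD)
  obtain ⟨y₂, hy₂, hdy₂⟩ : ∃ y₂ ∈ Icc y₁ y, d y₂ = d y₁ / 2 := by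
    refine intermediate_value_Icc' hy₁y.le (hdc.mono (Icc_subset_Icc_left hy₁.1)) ⟨?_, by linarith⟩
    simp only [hd, sub_self, norm_zero]
    positivity
  have hy₂y : y₂ < y := lt_of_le_of_ne hy₂.2 (by
    rintro rfl
    simp only [hd, sub_self, norm_zero] at hdy₂ hD
    linarith)
  have hG' : ∀ r ∈ Icc y₁ y₂, 0 < S.slope t (ϑ r) := fun r hr =>
    hG r ⟨hx'.1.trans (hy₁.1.trans hr.1), hr.2.trans_lt hy₂y⟩
  have ha₁ : a ≤ y₁ := hx.trans (hx'.1.trans hy₁.1)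
  have hac := h.norm_ac y₁ y₂ ha₁ hy₂.1 (hy₂.2.trans hy) hG'
  have h1 : ENNReal.ofReal (d y₁ / 2) ≤ ∫⁻ r in Ioc y₁ y₂, ‖deriv ϑ r‖ₑ := by
    have h2 : d y₁ / 2 ≤ ‖ϑ y₂ - ϑ y₁‖ := by
      have h3 : d y₁ ≤ d y₂ + ‖ϑ y₂ - ϑ y₁‖ := by
        have := norm_add_le (ϑ y - ϑ y₂) (ϑ y₂ - ϑ y₁)
        rwa [sub_add_sub_cancel] at this
      linarith
    refine (ENNReal.ofReal_le_ofReal h2).trans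
      ((hac.ofReal_sub_le isGauge_norm le_rfl hy₂.1 le_rfl).trans (lintegral_mono_ae ?_))
    rw [← Measure.restrict_congr_set Ioo_ae_eq_Ioc, ae_restrict_iff' measurableSet_Ioo]
    filter_upwards [hS.ae_differentiableAt hV ht h] with r hr hrI
    rw [scalarDeriv_of_differentiableAt isGauge_norm (hr ⟨ha₁.trans_lt hrI.1,
      hrI.2.trans_le (hy₂.2.trans hy)⟩ (hG' r (Ioo_subset_Icc_self hrI))), ofReal_norm]
  have h2 : ENNReal.ofReal (ε / d y₁) * ∫⁻ r in Ioc y₁ y₂, ‖deriv ϑ r‖ₑ ≤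
      ∫⁻ r in Ioc y₁ y₂, S.density t ϑ r := by
    rw [← lintegral_const_mul' _ _ ENNReal.ofReal_ne_top]
    refine setLIntegral_mono' measurableSet_Ioc fun r hr => ?_
    have hr' : r ∈ Icc y₁ y₂ := Ioc_subset_Icc_self hr
    rw [density_of_pos (hG' r hr')]
    refine le_trans (mul_le_mul_left ?_ _) (le_add_self.trans (hS.le_finsler t _ _))
    have h3 := hcon r ⟨hx'.1.trans (hy₁.1.trans hr'.1), hr'.2.trans_lt hy₂y⟩
    have h4 : d r ≤ d y₁ := hmax ⟨hy₁.1.trans hr'.1, hr'.2.trans hy₂.2⟩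
    have h5 : ENNReal.ofReal ε ≤ S.slope t (ϑ r) * ENNReal.ofReal (d y₁) :=
      h3.le.trans (mul_le_mul_right (by rw [← ofReal_norm]; exact ENNReal.ofReal_le_ofReal h4) _)
    rw [ENNReal.ofReal_div_of_pos hD]
    exact ENNReal.div_le_of_le_mul h5
  have h3 : ∫⁻ r in Ioc y₁ y₂, S.density t ϑ r < ENNReal.ofReal (ε / 2) := by
    have h4 := hlt (Ioc x' y) ((Measure.restrict_apply_le _ _).trans_lt hvol)
    rw [Measure.restrict_restrict measurableSet_Ioc,
      inter_eq_left.2 (Ioc_subset_Ioc_left hx'.1)] at h4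
    exact (lintegral_mono_set (Ioc_subset_Ioc hy₁.1 hy₂.2)).trans_lt h4
  have h4 : ENNReal.ofReal (ε / 2) ≤ ∫⁻ r in Ioc y₁ y₂, S.density t ϑ r := by
    refine le_trans (le_of_eq ?_) ((mul_le_mul_right h1 _).trans h2)
    rw [← ENNReal.ofReal_mul (by positivity)]
    congr 1
    field_simp
  exact absurd h3 (not_lt.2 h4)

/-- The energy released along a transition is bounded by its dissipation. -/
theorem energy_sub_le_of_transition (ht : t ∈ Icc 0 S.T) (hab : a ≤ b)
    (h : S.IsTransition t ϑ a b) :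
    ENNReal.ofReal (S.E t (ϑ a) - S.E t (ϑ b)) ≤ ∫⁻ r in Ioc a b, S.density t ϑ r := by
  rcases eq_or_ne (∫⁻ r in Ioc a b, S.density t ϑ r) ∞ with htop | hfin
  · rw [htop]; exact le_top
  have hG := hS.isGauge
  have hc := hS.continuousOn_transition h
  have hF := hS.isClosed_stable ht h
  obtain ⟨e, he, hm⟩ := h.mem
  obtain ⟨ω, B, -, hω, hωs, hsub⟩ := hS.exists_uniform_subdiff he
  set Φ : ℝ → ℝ → ℝ≥0∞ := fun x y => ∫⁻ r in Ioc x y, S.density t ϑ r with hΦ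
  have key : ∀ η : ℝ, 0 < η → ENNReal.ofReal (S.E t (ϑ a) - S.E t (ϑ b)) ≤
      ENNReal.ofReal (1 + η) * Φ a b := by
    intro η hη
    obtain ⟨δ, hδ, hωη⟩ := hωs η hη
    obtain ⟨κ, hκ, hunif⟩ := Metric.uniformContinuousOn_iff.1
      (isCompact_Icc.uniformContinuousOn_of_continuous hc) δ hδ
    -- The desired estimate up to the factor 1 + η, which absorbs the remainder ω. R is transitive
    -- along ordered parameters, so it is enough to advance from any x by a fixed amount κ / 2, or
    -- to reach b.
    set R : ℝ → ℝ → Prop := fun x y => ENNReal.ofReal (S.E t (ϑ x) - S.E t (ϑ y)) ≤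
      ENNReal.ofReal (1 + η) * Φ x y with hR
    have hadd : ∀ x y z, ENNReal.ofReal (S.E t (ϑ x) - S.E t (ϑ z)) ≤
        ENNReal.ofReal (S.E t (ϑ x) - S.E t (ϑ y)) +
          ENNReal.ofReal (S.E t (ϑ y) - S.E t (ϑ z)) := fun x y z => by
      rw [← sub_add_sub_cancel (S.E t (ϑ x)) (S.E t (ϑ y))]; exact ENNReal.ofReal_add_le
    have htrans : ∀ x y z, x ≤ y → y ≤ z → R x y → R y z → R x z := by
      intro x y z hxy hyz h1 h2
      have h3 : Φ x z = Φ x y + Φ y z := lintegral_Ioc_add hxy hyz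
      simp only [hR, h3, mul_add]
      exact (hadd x y z).trans (add_le_add h1 h2)
    have hnear : ∀ x ∈ Icc a b, ∀ y ∈ Icc a b, x ≤ y → y < x + κ →
        ENNReal.ofReal (S.E t (ϑ x) - S.E t (ϑ y)) ≤
          ENNReal.ofReal (1 + η) * Φ x y + S.slope t (ϑ x) * ‖ϑ y - ϑ x‖ₑ := by
      intro x hx y hy hxy hlt
      have h1 := hunif x hx y hy (by rw [Real.dist_eq, abs_sub_comm, abs_of_nonneg] <;> linarith)
      rw [dist_eq_norm, norm_sub_rev] at h1
      have h2 := hωη t ht _ (hm x hx) _ (hm y hy) h1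
      refine (hS.energy_sub_le_slope ht (hsub t ht _ (hm x hx) _ (hm y hy))).trans
        (add_le_add ?_ le_rfl)
      refine le_trans ?_ (mul_le_mul_right (hS.ofReal_gauge_sub_le hV ht h hx.1 hxy hy.2) _)
      rw [← ENNReal.ofReal_mul (by positivity)]
      exact ENNReal.ofReal_le_ofReal (mul_le_mul_of_nonneg_right (by linarith) (hG.nonneg _))
    have hstable : ∀ x ∈ Icc a b, S.slope t (ϑ x) = 0 →
        R x b ∨ ∃ y, x + κ / 2 ≤ y ∧ y ≤ b ∧ R x y := by
      intro x hx h0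
      rcases lt_or_ge b (x + κ) with h1 | h1
      · left
        have := hnear x hx b ⟨hab, le_rfl⟩ hx.2 h1
        rwa [h0, zero_mul, add_zero] at this
      · right
        refine ⟨x + κ / 2, le_rfl, by linarith, ?_⟩
        have := hnear x hx (x + κ / 2) ⟨by linarith [hx.1], by linarith⟩ (by linarith) (by linarith)
        rwa [h0, zero_mul, add_zero] at this
    have hone : (1 : ℝ≥0∞) ≤ ENNReal.ofReal (1 + η) := by
      rw [← ENNReal.ofReal_one]; exact ENNReal.ofReal_le_ofReal (by linarith)
    have hunst : ∀ x y, a ≤ x → x ≤ y → y ≤ b → (∀ r ∈ Icc x y, 0 < S.slope t (ϑ r)) → R x y :=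
      fun x y hx hxy hy hpos => (hS.energy_sub_le_of_unstable hV ht h hx hxy hy hpos).trans
        (le_mul_of_one_le_left zero_le hone)
    have hfinxy : ∀ x y, a ≤ x → y ≤ b → Φ x y ≠ ∞ := fun x y hx hy =>
      ne_top_of_le_ne_top hfin (lintegral_mono_set (Ioc_subset_Ioc hx hy))
    -- Norm-absolute continuity may fail at the stable endpoint y. The upper-gradient estimate is
    -- used up to some z close to y, and the last step is taken directly from z, where
    -- `exists_slope_mul_le` makes the slope term at most ε.
    have hend : ∀ x y, a ≤ x → x < y → y ≤ b → (∀ r ∈ Ico x y, 0 < S.slope t (ϑ r)) → R x y := by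
      intro x y hx hxy hy hpos
      refine ENNReal.le_of_forall_pos_le_add fun ε hε _ => ?_
      set x' := max x (y - κ / 2) with hx'
      have hx'y : x' < y := max_lt hxy (by linarith)
      obtain ⟨z, hz, hzε⟩ := hS.exists_slope_mul_le hV ht h (hx.trans (le_max_left x (y - κ / 2)))
        hx'y hy (fun r hr => hpos r ⟨(le_max_left _ _).trans hr.1, hr.2⟩)
        (hfinxy x' y (hx.trans (le_max_left _ _)) hy) (NNReal.coe_pos.2 hε)
      have hxz : x ≤ z := (le_max_left _ _).trans hz.1
      have hz2 : y - κ / 2 ≤ z := (le_max_right _ _).trans hz.1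
      have h1 := hunst x z hx hxz (hz.2.le.trans hy) fun r hr =>
        hpos r ⟨hr.1, hr.2.trans_lt hz.2⟩
      have h2 := hnear z ⟨hx.trans hxz, hz.2.le.trans hy⟩ y ⟨hx.trans hxy.le, hy⟩ hz.2.le
        (by linarith)
      have h3 : Φ x y = Φ x z + Φ z y := lintegral_Ioc_add hxz hz.2.le
      rw [h3, mul_add, add_assoc]
      rw [ENNReal.ofReal_coe_nnreal] at hzε
      exact (hadd x z y).trans (add_le_add h1 (h2.trans (add_le_add le_rfl hzε)))
    -- From x one moves through the unstable stretch to the next stable parameter s, then advances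
    -- by κ / 2 (or to b) directly from s, where the slope term vanishes. Without a stable parameter
    -- ahead, b is reached at once.
    have hstep : ∀ x ∈ Icc a b, R x b ∨ ∃ y, x + κ / 2 ≤ y ∧ y ≤ b ∧ R x y := by
      intro x hx
      by_cases hne : ({r | r ∈ Icc a b ∧ S.slope t (ϑ r) = 0} ∩ Ici x).Nonempty
      · set s := sInf ({r | r ∈ Icc a b ∧ S.slope t (ϑ r) = 0} ∩ Ici x) with hs
        have hbdd : BddBelow ({r | r ∈ Icc a b ∧ S.slope t (ϑ r) = 0} ∩ Ici x) :=
          ⟨x, fun r hr => hr.2⟩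
        have hmem := (hF.inter isClosed_Ici).csInf_mem hne hbdd
        rw [← hs] at hmem
        have hxs : x ≤ s := hmem.2
        have hRs : R x s := by
          rcases hxs.eq_or_lt with h1 | h1
          · rw [← h1]; simp [hR]
          · refine hend x s hx.1 h1 hmem.1.1.2 fun r hr => pos_iff_ne_zero.2 fun h0 => ?_
            exact absurd (csInf_le hbdd ⟨⟨⟨hx.1.trans hr.1, hr.2.le.trans hmem.1.1.2⟩, h0⟩, hr.1⟩)
              (not_le.2 hr.2)
        rcases hstable s hmem.1.1 hmem.1.2 with h1 | ⟨y, h1, h2, h3⟩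
        · exact Or.inl (htrans x s b hxs hmem.1.1.2 hRs h1)
        · exact Or.inr ⟨y, by linarith, h2, htrans x s y hxs (by linarith) hRs h3⟩
      · left
        refine hunst x b hx.1 hx.2 le_rfl fun r hr => pos_iff_ne_zero.2 fun h0 => hne ?_
        exact ⟨r, ⟨⟨hx.1.trans hr.1, hr.2⟩, h0⟩, hr.1⟩
    have hind : ∀ n : ℕ, R a b ∨ ∃ y, a + n * (κ / 2) ≤ y ∧ y ≤ b ∧ R a y := by
      intro n
      induction n with
      | zero => exact Or.inr ⟨a, by simp, hab, by simp [hR]⟩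
      | succ n ih =>
        rcases ih with ih | ⟨y, h1, h2, h3⟩
        · exact Or.inl ih
        · have hay : a ≤ y := by
            have : (0 : ℝ) ≤ n * (κ / 2) := by positivity
            linarith
          rcases hstep y ⟨hay, h2⟩ with h4 | ⟨z, h4, h5, h6⟩
          · exact Or.inl (htrans a y b hay h2 h3 h4)
          · refine Or.inr ⟨z, ?_, h5, htrans a y z hay (by linarith) h3 h6⟩
            push_cast
            linarith
    obtain ⟨n, hn⟩ := exists_nat_gt ((b - a) / (κ / 2))
    rcases hind n with h1 | ⟨y, h1, h2, -⟩
    · exact h1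
    · rw [div_lt_iff₀ (by positivity)] at hn
      linarith
  have hlim : Tendsto (fun η : ℝ => ENNReal.ofReal (1 + η) * Φ a b) (𝓝[>] 0)
      (𝓝 (ENNReal.ofReal (1 + 0) * Φ a b)) :=
    ENNReal.Tendsto.mul_const
      (((ENNReal.continuous_ofReal.comp (continuous_const.add continuous_id)).tendsto 0).mono_left
        nhdsWithin_le_nhds) (Or.inl (by simp))
  simp only [add_zero, ENNReal.ofReal_one, one_mul] at hlim
  refine ge_of_tendsto hlim ?_
  filter_upwards [self_mem_nhdsWithin] with η hη using key η hη

end Admissible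

end RIS

end

/-! ### Reparametrization, triangle inequality and loops for the Finsler cost -/

section

theorem lintegral_comp_affine (f : ℝ → ℝ≥0∞) {k : ℝ} (hk : 0 < k) (s : ℝ) :
    ∫⁻ r, f (k * r + s) = ENNReal.ofReal k⁻¹ * ∫⁻ r, f r := by
  have hemb : MeasurableEmbedding fun r : ℝ => k * r :=
    (Homeomorph.mulLeft₀ k hk.ne').measurableEmbedding
  rw [← hemb.lintegral_map (fun r => f (r + s)), Real.map_volume_mul_left hk.ne',
    lintegral_smul_measure, lintegral_add_right_eq_self (fun r => f r) s,
    abs_of_pos (inv_pos.2 hk), smul_eq_mul]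

namespace RIS

variable {V : Type*} [NormedAddCommGroup V] [NormedSpace ℝ V]

variable {S : RIS V} {t : ℝ} {ϑ ϑ' : ℝ → V} {a b : ℝ}

theorem IsTransition.congr (h : S.IsTransition t ϑ a b) (heq : ∀ r ∈ Icc a b, ϑ' r = ϑ r) :
    S.IsTransition t ϑ' a b := by
  obtain ⟨e, he, hm⟩ := h.mem
  refine ⟨⟨e, he, fun r hr => by rw [heq r hr]; exact hm r hr⟩, h.gauge_ac.congr heq,
    fun c d hc hcd hd hpos => ?_⟩
  have hsub : Icc c d ⊆ Icc a b := Icc_subset_Icc hc hd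
  exact (h.norm_ac c d hc hcd hd fun r hr => by
    rw [← heq r (hsub hr)]; exact hpos r hr).congr fun r hr => heq r (hsub hr)

theorem IsTransition.affine {k s : ℝ} (hk : 0 < k)
    (h : S.IsTransition t ϑ (k * a + s) (k * b + s)) :
    S.IsTransition t (fun r => ϑ (k * r + s)) a b := by
  obtain ⟨e, he, hm⟩ := h.mem
  have hmaps : ∀ c d r, r ∈ Icc c d → k * r + s ∈ Icc (k * c + s) (k * d + s) := fun c d r hr =>
    ⟨by gcongr; exact hr.1, by gcongr; exact hr.2⟩
  refine ⟨⟨e, he, fun r hr => hm _ (hmaps a b r hr)⟩, h.gauge_ac.affine hk,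
    fun c d hc hcd hd hpos => ACOn.affine hk (h.norm_ac _ _ (by gcongr) (by gcongr) (by gcongr)
      fun q hq => ?_)⟩
  have h1 := hpos ((q - s) / k) ⟨by rw [le_div_iff₀ hk]; linarith [hq.1],
    by rw [div_le_iff₀ hk]; linarith [hq.2]⟩
  rwa [mul_div_cancel₀ _ hk.ne', sub_add_cancel] at h1

theorem density_congr {r : ℝ} (h : ϑ =ᶠ[𝓝 r] ϑ') : S.density t ϑ r = S.density t ϑ' r := by
  have h1 : scalarDeriv S.Ψ ϑ r = scalarDeriv S.Ψ ϑ' r := by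
    refine limsup_congr ?_
    have h2 : Tendsto (fun s : ℝ => r + s) (𝓝[≠] 0) (𝓝 r) := by
      have : Continuous fun s : ℝ => r + s := by fun_prop
      simpa using (this.tendsto 0).mono_left nhdsWithin_le_nhds
    filter_upwards [h2.eventually h] with s hs
    rw [hs, h.self_of_nhds]
  rw [density, density, h.deriv_eq, h.self_of_nhds, h1]

theorem mem_transitions {u₀ u₁ : V} :
    ϑ ∈ S.transitions t u₀ u₁ ↔ S.IsTransition t ϑ 0 1 ∧ ϑ 0 = u₀ ∧ ϑ 1 = u₁ := by
  constructor
  · rintro ⟨h1, h2, h3, h4, h5⟩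
    exact ⟨⟨h1, h2, fun c d hc hcd hd hpos =>
      h3 c d hcd fun r hr => ⟨⟨hc.trans hr.1, hr.2.trans hd⟩, hpos r hr⟩⟩, h4, h5⟩
  · rintro ⟨⟨h1, h2, h3⟩, h4, h5⟩
    refine ⟨h1, h2, fun c d hcd hsub => ?_, h4, h5⟩
    exact h3 c d (hsub ⟨le_rfl, hcd⟩).1.1 hcd (hsub ⟨hcd, le_rfl⟩).1.2 fun r hr => (hsub hr).2

theorem transitionDensity_eq {r : ℝ} (hr : r ∈ Icc (0 : ℝ) 1) :
    S.transitionDensity t ϑ r = S.density t ϑ r := by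
  simp only [transitionDensity, density, unstableSet, mem_ofPred_eq, hr, true_and]

theorem lintegral_transitionDensity :
    ∫⁻ r in Icc 0 1, S.transitionDensity t ϑ r = ∫⁻ r in Ioc 0 1, S.density t ϑ r := by
  rw [setLIntegral_congr_fun measurableSet_Icc fun r hr => transitionDensity_eq hr,
    Measure.restrict_congr_set Ioc_ae_eq_Icc]

theorem exists_transition_lt {u₀ u₁ : V} {x : ℝ≥0∞} (h : S.finslerCost t u₀ u₁ < x) :
    ∃ ϑ, S.IsTransition t ϑ 0 1 ∧ ϑ 0 = u₀ ∧ ϑ 1 = u₁ ∧ ∫⁻ r in Ioc 0 1, S.density t ϑ r < x := by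
  simp only [finslerCost, iInf_lt_iff] at h
  obtain ⟨ϑ, hϑ, h⟩ := h
  rw [lintegral_transitionDensity] at h
  obtain ⟨h1, h2, h3⟩ := mem_transitions.1 hϑ
  exact ⟨ϑ, h1, h2, h3, h⟩

namespace Admissible

variable (hS : S.Admissible)
include hS

theorem isTransition_glue {d : ℝ} (h : S.IsTransition t ϑ a b)
    (h' : S.IsTransition t ϑ b d) : S.IsTransition t ϑ a d := by
  obtain ⟨e, he, hm⟩ := h.mem
  obtain ⟨e', he', hm'⟩ := h'.mem
  refine ⟨⟨max e e', lt_max_of_lt_left he, fun r hr => ?_⟩, h.gauge_ac.glue hS.isGauge h'.gauge_ac,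
    fun x y hx hxy hy hpos => ?_⟩
  · rcases le_total r b with h1 | h1
    · exact sublevel_mono (le_max_left _ _) (hm r ⟨hr.1, h1⟩)
    · exact sublevel_mono (le_max_right _ _) (hm' r ⟨h1, hr.2⟩)
  · rcases le_total y b with h1 | h1
    · exact h.norm_ac x y hx hxy h1 hpos
    rcases le_total b x with h2 | h2
    · exact h'.norm_ac x y h2 hxy hy hpos
    · exact (h.norm_ac x b hx h2 le_rfl fun r hr => hpos r ⟨hr.1, hr.2.trans h1⟩).glue isGauge_norm
        (h'.norm_ac b y le_rfl h1 hy fun r hr => hpos r ⟨h2.trans hr.1, hr.2⟩)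

theorem finsler_eq_top {u : V} (h : S.slope t u = ∞) (v : V) : S.finsler t u v = ∞ := by
  simp only [finsler, iInf_eq_top]
  intro ξ hξ
  exact absurd h (hS.slope_ne_top_of_nonempty ⟨-ξ, hξ⟩)

theorem finsler_smul (ht : t ∈ Icc 0 S.T) (u v : V) {k : ℝ} (hk : 0 < k) :
    S.finsler t u (k • v) = ENNReal.ofReal k * S.finsler t u v := by
  by_cases h : S.slope t u = ∞
  · rw [hS.finsler_eq_top h, hS.finsler_eq_top h, ENNReal.mul_top]
    exact (ENNReal.ofReal_pos.2 hk).ne'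
  · rw [hS.finsler_eq ht h, hS.finsler_eq ht h, hS.isGauge.smul k hk.le, ENNReal.ofReal_mul hk.le,
      enorm_smul, Real.enorm_of_nonneg hk.le]
    ring

theorem density_affine (ht : t ∈ Icc 0 S.T) {k s : ℝ} (hk : 0 < k) (r : ℝ) :
    S.density t (fun r => ϑ (k * r + s)) r = ENNReal.ofReal k * S.density t ϑ (k * r + s) := by
  have hd : deriv (fun r => ϑ (k * r + s)) r = k • deriv ϑ (k * r + s) := by
    have h1 := deriv_comp_mul_left k (fun q => ϑ (q + s)) r
    rw [deriv_comp_add_const] at h1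
    exact h1
  by_cases h : 0 < S.slope t (ϑ (k * r + s))
  · rw [density_of_pos (ϑ := fun r => ϑ (k * r + s)) h, density_of_pos h, hd,
      hS.finsler_smul ht _ _ hk]
  · have h0 := not_lt.1 h
    rw [nonpos_iff_eq_zero] at h0
    rw [density_of_zero (ϑ := fun r => ϑ (k * r + s)) h0, density_of_zero h0, scalarDeriv,
      scalarDeriv]
    have hmap : map (fun h : ℝ => k * h) (𝓝[≠] 0) = 𝓝[≠] 0 := by
      have h1 := (Homeomorph.mulLeft₀ k hk.ne').isEmbedding.map_nhdsWithin_eq {0}ᶜ 0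
      have h2 : (fun h : ℝ => k * h) '' {0}ᶜ = {0}ᶜ := by
        ext x
        constructor
        · rintro ⟨y, hy, rfl⟩; simpa [hk.ne'] using hy
        · intro hx; exact ⟨x / k, by simpa [hk.ne'] using hx, by field_simp⟩
      simp only [Homeomorph.coe_mulLeft₀, mul_zero] at h1
      rwa [h2] at h1
    rw [← ENNReal.limsup_const_mul_of_ne_top ENNReal.ofReal_ne_top]
    conv_rhs => rw [← hmap]
    change _ = limsup ((fun h : ℝ => ENNReal.ofReal k *
      ENNReal.ofReal (S.Ψ (h⁻¹ • (ϑ (k * r + s + h) - ϑ (k * r + s))))) ∘ fun h => k * h) (𝓝[≠] 0)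
    refine limsup_congr (Eventually.of_forall fun h => ?_)
    dsimp only [Function.comp]
    rw [← ENNReal.ofReal_mul hk.le, ← hS.isGauge.smul k hk.le, smul_smul, mul_inv, ← mul_assoc,
      mul_inv_cancel₀ hk.ne', one_mul, mul_add, add_right_comm]

/-- Transition curves may be parametrized by any interval. -/
theorem finslerCost_le (ht : t ∈ Icc 0 S.T) (hab : a < b) (h : S.IsTransition t ϑ a b) :
    S.finslerCost t (ϑ a) (ϑ b) ≤ ∫⁻ r in Ioc a b, S.density t ϑ r := by
  set k := b - a with hk
  have hk0 : 0 < k := sub_pos.2 hab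
  have h1 : S.IsTransition t (fun r => ϑ (k * r + a)) 0 1 := by
    refine IsTransition.affine hk0 ?_
    have e1 : k * 0 + a = a := by ring
    have e2 : k * 1 + a = b := by rw [hk]; ring
    rwa [e1, e2]
  have h2 : (fun r => ϑ (k * r + a)) ∈ S.transitions t (ϑ a) (ϑ b) :=
    mem_transitions.2 ⟨h1, by simp, by simp [hk]⟩
  refine (iInf₂_le _ h2).trans (le_of_eq ?_)
  rw [lintegral_transitionDensity, ← lintegral_indicator measurableSet_Ioc,
    ← lintegral_indicator measurableSet_Ioc]
  have h3 : ∀ r, (Ioc (0 : ℝ) 1).indicator (S.density t fun r => ϑ (k * r + a)) r =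
      ENNReal.ofReal k * (Ioc a b).indicator (S.density t ϑ) (k * r + a) := by
    intro r
    have hiff : r ∈ Ioc (0 : ℝ) 1 ↔ k * r + a ∈ Ioc a b := by
      simp only [mem_Ioc, hk]
      constructor
      · rintro ⟨h4, h5⟩; constructor <;> nlinarith
      · rintro ⟨h4, h5⟩
        constructor
        · by_contra hcon; nlinarith [not_lt.1 hcon]
        · by_contra hcon; nlinarith [not_le.1 hcon]
    by_cases hr : r ∈ Ioc (0 : ℝ) 1
    · rw [indicator_of_mem hr, indicator_of_mem (hiff.1 hr), hS.density_affine ht hk0]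
    · rw [indicator_of_notMem hr, indicator_of_notMem fun h => hr (hiff.2 h), mul_zero]
  simp only [h3]
  rw [lintegral_const_mul' _ _ ENNReal.ofReal_ne_top, lintegral_comp_affine _ hk0, ← mul_assoc,
    ← ENNReal.ofReal_mul hk0.le, mul_inv_cancel₀ hk0.ne', ENNReal.ofReal_one, one_mul]

/-- Almost optimal transitions are concatenated on [0, 2]; `finslerCost_le` allows this parameter
interval, and the density is local, so the costs add. -/
theorem finslerCost_triangle (ht : t ∈ Icc 0 S.T) (u v w : V) :
    S.finslerCost t u w ≤ S.finslerCost t u v + S.finslerCost t v w := by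
  classical
  by_contra! hcon
  obtain ⟨x, y, hx, hy, hxy⟩ : ∃ x y, S.finslerCost t u v < x ∧ S.finslerCost t v w < y ∧
      x + y ≤ S.finslerCost t u w := by
    obtain ⟨h1, h2⟩ := ENNReal.add_lt_top.1 (hcon.trans_le le_top)
    obtain ⟨z, hz1, hz2⟩ := exists_between hcon
    obtain ⟨y, hy1, hy2⟩ := exists_between (lt_tsub_iff_left.2 hz1)
    refine ⟨S.finslerCost t u w - y, y, ?_, hy1, ?_⟩
    · exact lt_tsub_iff_right.2 ((lt_tsub_iff_left.1 hy2).trans hz2)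
    · exact (tsub_add_cancel_of_le ((hy2.le.trans tsub_le_self).trans hz2.le)).le
  obtain ⟨ϑ₁, h1, h10, h11, h1x⟩ := exists_transition_lt hx
  obtain ⟨ϑ₂, h2, h20, h21, h2y⟩ := exists_transition_lt hy
  -- The shift is written as an affine map k * r + s so that the reparametrization lemmas apply
  -- verbatim.
  set θ : ℝ → V := fun r => if r ≤ 1 then ϑ₁ r else ϑ₂ (1 * r + -1) with hθ
  have e1 : ∀ r ∈ Icc (0 : ℝ) 1, θ r = ϑ₁ r := fun r hr => if_pos hr.2
  have e2 : ∀ r ∈ Icc (1 : ℝ) 2, θ r = ϑ₂ (1 * r + -1) := by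
    intro r hr
    rcases hr.1.eq_or_lt with h3 | h3
    · rw [← h3, e1 1 (by simp), h11]; simp [h20]
    · exact if_neg (not_le.2 h3)
  have hθ1 : S.IsTransition t θ 0 1 := h1.congr e1
  have hθ2 : S.IsTransition t θ 1 2 := by
    refine IsTransition.congr (IsTransition.affine one_pos ?_) e2
    norm_num
    exact h2
  have hcost := hS.finslerCost_le ht (by norm_num : (0 : ℝ) < 2) (hS.isTransition_glue hθ1 hθ2)
  have hz0 : θ 0 = u := by rw [e1 0 (by simp), h10]
  have hz2 : θ 2 = w := by rw [e2 2 (by norm_num)]; norm_num; exact h21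
  rw [hz0, hz2, lintegral_Ioc_add (by norm_num : (0 : ℝ) ≤ 1) (by norm_num : (1 : ℝ) ≤ 2)] at hcost
  have i1 : ∫⁻ r in Ioc 0 1, S.density t θ r = ∫⁻ r in Ioc 0 1, S.density t ϑ₁ r := by
    rw [← Measure.restrict_congr_set (Ioo_ae_eq_Ioc (a := (0 : ℝ)) (b := 1))]
    refine setLIntegral_congr_fun measurableSet_Ioo fun r hr => density_congr ?_
    filter_upwards [Ioo_mem_nhds hr.1 hr.2] with s hs using e1 s ⟨hs.1.le, hs.2.le⟩
  have i2 : ∫⁻ r in Ioc 1 2, S.density t θ r = ∫⁻ r in Ioc 0 1, S.density t ϑ₂ r := by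
    have h3 : ∫⁻ r in Ioc 1 2, S.density t θ r =
        ∫⁻ r in Ioc 1 2, S.density t ϑ₂ (1 * r + -1) := by
      rw [← Measure.restrict_congr_set (Ioo_ae_eq_Ioc (a := (1 : ℝ)) (b := 2))]
      refine setLIntegral_congr_fun measurableSet_Ioo fun r hr => ?_
      have h4 : θ =ᶠ[𝓝 r] fun r => ϑ₂ (1 * r + -1) := by
        filter_upwards [Ioo_mem_nhds hr.1 hr.2] with s hs using e2 s ⟨hs.1.le, hs.2.le⟩
      rw [density_congr h4, hS.density_affine ht one_pos, ENNReal.ofReal_one, one_mul]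
    rw [h3, ← lintegral_indicator measurableSet_Ioc, ← lintegral_indicator measurableSet_Ioc]
    have h4 : (Ioc (1 : ℝ) 2).indicator (fun r => S.density t ϑ₂ (1 * r + -1)) =
        fun r => (Ioc (0 : ℝ) 1).indicator (S.density t ϑ₂) (1 * r + -1) := by
      ext r
      simp only [indicator, mem_Ioc]
      congr 1
      simp only [eq_iff_iff]
      constructor <;> rintro ⟨h5, h6⟩ <;> constructor <;> linarith
    rw [h4, lintegral_comp_affine _ one_pos]
    simp
  rw [i1, i2] at hcost
  exact absurd (hcost.trans_lt (ENNReal.add_lt_add h1x h2y)) (not_lt.2 hxy)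

/-- The constant curve has zero dissipation because the slope is finite. With an empty
subdifferential its density would be infinite even at zero velocity. -/
theorem finslerCost_self_of_nonempty (ht : t ∈ Icc 0 S.T) {u : V}
    (h : (S.energySubdiff t u).Nonempty) : S.finslerCost t u u = 0 := by
  have hsl := hS.slope_ne_top_of_nonempty h
  obtain ⟨e, he, hu⟩ := hS.exists_mem_sublevel h.some_mem.1
  have hac : ∀ (N : V → ℝ), IsGauge N → ∀ a b, ACOn N (fun _ => u) a b := fun N hN a b =>
    ⟨fun _ => 0, integrableOn_zero, fun _ => le_rfl, fun r₀ r₁ _ _ _ => by simp [hN.zero]⟩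
  have htr : S.IsTransition t (fun _ => u) 0 1 := ⟨⟨e, he, fun _ _ => hu⟩, hac _ hS.isGauge 0 1,
    fun c d _ _ _ _ => hac _ isGauge_norm c d⟩
  have h1 := hS.finslerCost_le ht one_pos htr
  refine nonpos_iff_eq_zero.1 (h1.trans (le_of_eq ?_))
  have hz : ∀ r, S.density t (fun _ => u) r = 0 := by
    intro r
    by_cases h0 : 0 < S.slope t u
    · rw [density_of_pos (ϑ := fun _ => u) h0, hS.finsler_eq ht hsl, deriv_const, hS.isGauge.zero]
      simp
    · have h0 := nonpos_iff_eq_zero.1 (not_lt.1 h0)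
      rw [density_of_zero (ϑ := fun _ => u) h0]
      simp [scalarDeriv, hS.isGauge.zero]
  simp [hz]

variable [CompleteSpace V] (hV : RadonNikodymProperty V)
include hV

theorem energy_sub_le_finslerCost (ht : t ∈ Icc 0 S.T) (u v : V) :
    ENNReal.ofReal (S.E t u - S.E t v) ≤ S.finslerCost t u v := by
  refine le_iInf₂ fun ϑ hϑ => ?_
  obtain ⟨h, rfl, rfl⟩ := mem_transitions.1 hϑ
  rw [lintegral_transitionDensity]
  exact hS.energy_sub_le_of_transition hV ht zero_le_one h

/-- A short unstable piece is run forwards and then backwards. Reversal leaves the slope term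
unchanged and changes the gauge term by at most c‖v‖, so both costs are bounded by integrals over a
short interval. This shows that staying put is free even where the subdifferential is empty and the
constant curve has infinite cost. -/
theorem exists_small_loop (ht : t ∈ Icc 0 S.T) (hab : a < b) (h : S.IsTransition t ϑ a b)
    (hpos : ∀ r ∈ Icc a b, 0 < S.slope t (ϑ r)) (hfin : ∫⁻ r in Ioc a b, S.density t ϑ r ≠ ∞)
    {ε : ℝ≥0∞} (hε : ε ≠ 0) : ∃ δ > 0, ∀ x y, a ≤ x → x < y → y ≤ b → y - x < δ →
      S.finslerCost t (ϑ x) (ϑ y) + S.finslerCost t (ϑ y) (ϑ x) ≤ ε := by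
  obtain ⟨c, hc, hΨ⟩ := hS.isGauge.exists_bound
  have hac := h.norm_ac a b le_rfl hab.le le_rfl hpos
  obtain ⟨-, hint⟩ := hac.differentiable hV hab
  set f : ℝ → ℝ≥0∞ := fun r => ENNReal.ofReal c * ‖deriv ϑ r‖ₑ + S.density t ϑ r with hf
  have hdm : Measurable fun r => ENNReal.ofReal c * ‖deriv ϑ r‖ₑ :=
    (stronglyMeasurable_deriv ϑ).enorm.const_mul _
  have hffin : ∫⁻ r in Ioc a b, (S.density t ϑ r + f r) ≠ ∞ := by
    simp only [hf, add_left_comm (S.density t ϑ _)]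
    rw [lintegral_add_left hdm, ← Measure.restrict_congr_set (Ioo_ae_eq_Ioc (a := a) (b := b)),
      lintegral_const_mul' _ _ ENNReal.ofReal_ne_top]
    refine ENNReal.add_ne_top.2 ⟨ENNReal.mul_ne_top ENNReal.ofReal_ne_top hint.2.ne, ?_⟩
    have h2 : ∀ r, S.density t ϑ r + S.density t ϑ r = 2 * S.density t ϑ r := fun r => by ring
    simp only [h2]
    rw [lintegral_const_mul' _ _ (by simp), Measure.restrict_congr_set Ioo_ae_eq_Ioc]
    exact ENNReal.mul_ne_top (by simp) hfin
  have hrev : ∀ x y, a ≤ x → x < y → y ≤ b →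
      S.finslerCost t (ϑ y) (ϑ x) ≤ ∫⁻ r in Ioc x y, f r := by
    intro x y hx hxy hy
    have hsub : Icc x y ⊆ Icc a b := Icc_subset_Icc hx hy
    obtain ⟨e, he, hm⟩ := h.mem
    have hneg : ∀ r ∈ Icc (-y) (-x), -r ∈ Icc x y := fun r hr =>
      ⟨by linarith [hr.2], by linarith [hr.1]⟩
    have hacn : ACOn (fun v : V => ‖v‖) (fun r => ϑ (-r)) (-y) (-x) :=
      ((hac.mono hx hy).neg fun v => norm_neg v)
    have htr : S.IsTransition t (fun r => ϑ (-r)) (-y) (-x) :=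
      ⟨⟨e, he, fun r hr => hm _ (hsub (hneg r hr))⟩, hacn.of_le hc.le hΨ,
        fun p q hp _ hq _ => hacn.mono hp hq⟩
    have h1 := hS.finslerCost_le ht (neg_lt_neg hxy) htr
    simp only [neg_neg] at h1
    refine h1.trans ?_
    have hemb : MeasurableEmbedding fun r : ℝ => -r := (Homeomorph.neg ℝ).measurableEmbedding
    rw [← (Measure.measurePreserving_neg
        (volume : Measure ℝ)).setLIntegral_comp_preimage_emb hemb f,
      ← Measure.restrict_congr_set (Ioo_ae_eq_Ioc (a := -y) (b := -x))]
    refine (setLIntegral_mono' measurableSet_Ioo fun r hr => ?_).trans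
      (lintegral_mono_set (t := (fun r : ℝ => -r) ⁻¹' Ioc x y)
        fun r hr => ⟨by linarith [hr.2], by linarith [hr.1]⟩)
    have hpr := hpos (-r) (hsub (hneg r (Ioo_subset_Icc_self hr)))
    rw [density_of_pos (ϑ := fun r => ϑ (-r)) hpr, deriv_comp_neg, hf]
    dsimp only
    rw [density_of_pos hpr]
    by_cases hsl : S.slope t (ϑ (-r)) = ∞
    · rw [hS.finsler_eq_top hsl (deriv ϑ (-r)), add_top]; exact le_top
    · rw [hS.finsler_eq ht hsl, hS.finsler_eq ht hsl, enorm_neg]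
      refine add_le_add ?_ le_add_self
      rw [← ofReal_norm, ← ENNReal.ofReal_mul hc.le]
      refine ENNReal.ofReal_le_ofReal ?_
      have := hΨ (-deriv ϑ (-r))
      rwa [norm_neg] at this
  obtain ⟨δ, hδ, hlt⟩ := exists_pos_setLIntegral_lt_of_measure_lt hffin hε
  obtain ⟨δ', hδ'0, hδ'⟩ := ENNReal.lt_iff_exists_nnreal_btwn.1 hδ
  refine ⟨δ', by exact_mod_cast hδ'0, fun x y hx hxy hy hd => ?_⟩
  have h1 := hlt (Ioc x y) ((Measure.restrict_apply_le _ _).trans_lt (by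
    rw [Real.volume_Ioc]
    refine lt_of_lt_of_le ?_ hδ'.le
    rw [← ENNReal.ofReal_coe_nnreal]
    exact (ENNReal.ofReal_lt_ofReal_iff (by exact_mod_cast hδ'0)).2 hd))
  rw [Measure.restrict_restrict measurableSet_Ioc, inter_eq_left.2 (Ioc_subset_Ioc hx hy)] at h1
  refine le_trans ?_ h1.le
  refine le_trans (add_le_add (hS.finslerCost_le ht hxy (h.mono hx hy)) (hrev x y hx hxy hy)) ?_
  exact le_lintegral_add _ _

/-- Staying at a state costs nothing if that state can be left or reached at a finite cost. -/
theorem finslerCost_self (ht : t ∈ Icc 0 S.T) {u w : V}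
    (h : S.finslerCost t u w ≠ ∞ ∨ S.finslerCost t w u ≠ ∞) : S.finslerCost t u u = 0 := by
  by_cases hne : (S.energySubdiff t u).Nonempty
  · exact hS.finslerCost_self_of_nonempty ht hne
  have hsl : 0 < S.slope t u := by
    have : S.slope t u = ∞ := by
      simp only [slope, iInf_eq_top]
      intro ξ hξ
      exact absurd ⟨-ξ, hξ⟩ hne
    rw [this]; exact ENNReal.zero_lt_top
  by_contra hcon
  obtain ⟨ε, hε, hεu⟩ := exists_between (pos_iff_ne_zero.2 hcon)
  -- An empty subdifferential means infinite slope at u; by lower semicontinuity the finite-cost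
  -- transition is unstable near u, as `exists_small_loop` demands.
  have hlsc : ∀ ϑ, S.IsTransition t ϑ 0 1 → ∀ r ∈ Icc (0 : ℝ) 1, ϑ r = u →
      ∃ δ > 0, ∀ q ∈ Icc (0 : ℝ) 1, |q - r| < δ → 0 < S.slope t (ϑ q) := by
    intro ϑ h1 r hr hru
    obtain ⟨e, he, hm⟩ := h1.mem
    have h2 := hS.lowerSemicontinuousOn_slope_comp ht he hm (hS.continuousOn_transition h1) r hr 0
      (by dsimp only; rw [hru]; exact hsl)
    obtain ⟨δ, hδ, h3⟩ := Metric.mem_nhdsWithin_iff.1 h2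
    exact ⟨δ, hδ, fun q hq hd => h3 ⟨by rwa [Metric.mem_ball, Real.dist_eq], hq⟩⟩
  rcases h with h | h
  · obtain ⟨ϑ, h1, h2, -, h4⟩ := exists_transition_lt h.lt_top
    obtain ⟨δ, hδ, hpos⟩ := hlsc ϑ h1 0 (by simp) h2
    set b := min (δ / 2) 1 with hb
    have hb0 : 0 < b := by positivity
    have hb1 : b ≤ 1 := min_le_right _ _
    obtain ⟨κ, hκ, hloop⟩ := hS.exists_small_loop hV ht hb0 (h1.mono le_rfl hb1)
      (fun r hr => hpos r ⟨hr.1, hr.2.trans hb1⟩ (by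
        rw [sub_zero, abs_of_nonneg hr.1]
        have := hr.2.trans (min_le_left _ _)
        linarith))
      (ne_top_of_le_ne_top h4.ne (lintegral_mono_set (Ioc_subset_Ioc_right hb1)))
      hε.ne'
    have h5 := hloop 0 (min b (κ / 2)) le_rfl (by positivity) (min_le_left _ _) (by
      have := min_le_right b (κ / 2); linarith)
    rw [h2] at h5
    have h6 := (hS.finslerCost_triangle ht u _ u).trans h5
    exact absurd h6 (not_le.2 hεu)
  · obtain ⟨ϑ, h1, -, h2, h4⟩ := exists_transition_lt h.lt_top
    obtain ⟨δ, hδ, hpos⟩ := hlsc ϑ h1 1 (by simp) h2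
    set b := min (δ / 2) 1 with hb
    have hb0 : 0 < b := by positivity
    have hb1 : b ≤ 1 := min_le_right _ _
    have hb2 : b ≤ δ / 2 := min_le_left _ _
    obtain ⟨κ, hκ, hloop⟩ := hS.exists_small_loop hV ht (by linarith : 1 - b < 1)
      (h1.mono (by linarith) le_rfl)
      (fun r hr => hpos r ⟨by linarith [hr.1], hr.2⟩ (by
        rw [abs_sub_comm, abs_of_nonneg (by linarith [hr.2])]
        linarith [hr.1]))
      (ne_top_of_le_ne_top h4.ne (lintegral_mono_set (Ioc_subset_Ioc_left (by linarith))))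
      hε.ne'
    have hm0 : 0 < min b (κ / 2) := by positivity
    have hm1 := min_le_right b (κ / 2)
    have h5 := hloop (1 - min b (κ / 2)) 1 (by linarith [min_le_left b (κ / 2)])
      (by linarith) le_rfl (by linarith)
    rw [h2, add_comm] at h5
    exact absurd ((hS.finslerCost_triangle ht u _ u).trans h5) (not_le.2 hεu)

end Admissible

end RIS

end

section

/-! ### Increments of functions with prescribed jumps and difference quotients -/

section Increments

variable {l : Measure ℝ} [IsLocallyFiniteMeasure l] [NullSingletonClass l]

theorem measureReal_Icc_pos (hl : volume ≤ l) {a b : ℝ} (hab : a < b) : 0 < l.real (Icc a b) := by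
  refine ENNReal.toReal_pos (ne_of_gt ?_) isCompact_Icc.measure_ne_top
  refine lt_of_lt_of_le ?_ (hl (Icc a b))
  simpa using hab

theorem ae_tendsto_inv_mul_integral (hl : volume ≤ l) {f : ℝ → ℝ} (hf : LocallyIntegrable f l) :
    ∀ᵐ t ∂l,
      Tendsto (fun s => (l.real (Icc t s))⁻¹ * ∫ x in Ioo t s, f x ∂l) (𝓝[>] t) (𝓝 (f t)) ∧
      Tendsto (fun s => (l.real (Icc s t))⁻¹ * ∫ x in Ioo s t, f x ∂l) (𝓝[<] t) (𝓝 (f t)) := by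
  have hkey : ∀ a b t, a < b → |(l.real (Icc a b))⁻¹ * ∫ x in Ioo a b, f x ∂l - f t| ≤
      ⨍ z in Icc a b, ‖f z - f t‖ ∂l := by
    intro a b t hab
    have h0 := measureReal_Icc_pos hl hab
    have hfi : IntegrableOn f (Icc a b) l := hf.integrableOn_isCompact isCompact_Icc
    have hci : IntegrableOn (fun _ : ℝ => f t) (Icc a b) l :=
      integrableOn_const isCompact_Icc.measure_ne_top
    rw [setAverage_eq, smul_eq_mul, setIntegral_congr_set (Ioo_ae_eq_Icc (a := a) (b := b))]
    have h1 : (l.real (Icc a b))⁻¹ * ∫ x in Icc a b, f x ∂l - f t =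
        (l.real (Icc a b))⁻¹ * ∫ x in Icc a b, (f x - f t) ∂l := by
      rw [integral_sub hfi hci, setIntegral_const, smul_eq_mul]
      field_simp
    rw [h1, abs_mul, abs_of_pos (inv_pos.2 h0)]
    refine mul_le_mul_of_nonneg_left ?_ (inv_pos.2 h0).le
    rw [← Real.norm_eq_abs]
    exact norm_integral_le_integral_norm _
  filter_upwards [ae_average_oneSided hl hf] with t ht
  constructor
  · rw [tendsto_iff_norm_sub_tendsto_zero]
    refine squeeze_zero' (Eventually.of_forall fun _ => norm_nonneg _) ?_ ht.1
    filter_upwards [self_mem_nhdsWithin] with s hs using hkey t s t hs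
  · rw [tendsto_iff_norm_sub_tendsto_zero]
    refine squeeze_zero' (Eventually.of_forall fun _ => norm_nonneg _) ?_ ht.2
    filter_upwards [self_mem_nhdsWithin] with s hs using hkey s t t hs

/-- A lower bound for the increment of a function which is controlled by jump sums and by an
integral, in terms of its jumps and of its one-sided difference quotients. -/
theorem jumpSum_add_integral_le_sub (hl : volume ≤ l) {J : Set ℝ} (hJ : J.Countable)
    {n n' Δ Δ' : ℝ → ℝ≥0∞} {b : ℝ} (hb : 0 < b)
    (h0 : ∀ t ∈ Ioo 0 b, t ∉ J → (n t = 0 ∧ n' t = 0) ∧ Δ t = 0 ∧ Δ' t = 0)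
    (hn : jumpSum J n n' 0 b ≠ ∞) (hΔ : jumpSum J Δ Δ' 0 b ≠ ∞)
    {w : ℝ → ℝ} (hw : Integrable w l) {e : ℝ → ℝ} {K κ : ℝ} (hK0 : 0 ≤ K) (hκ : 0 ≤ K + κ)
    (hK : ∀ s t, 0 ≤ s → s < t → t ≤ b → |e t - e s| ≤ K * ((jumpSum J n n' s t).toReal +
      (jumpSum J Δ Δ' s t).toReal + ∫ r in Ioo s t, w r ∂l))
    (hα : ∀ r ∈ Ioc 0 b, ∀ ε > 0, ∃ᶠ s in 𝓝[<] r, κ * (Δ r).toReal - ε ≤ e r - e s)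
    (hβ : ∀ r ∈ Ico 0 b, ∀ ε > 0, ∃ᶠ s in 𝓝[>] r, κ * (Δ' r).toReal - ε ≤ e s - e r)
    {d : ℝ → ℝ} (hd : Integrable d l) (hdw : ∀ t, |d t| ≤ K * w t)
    (hquot : ∀ᵐ t ∂l, t ∈ Ioo 0 b → ∀ ε > 0,
      (∃ᶠ s in 𝓝[>] t, (d t - ε) * l.real (Icc t s) ≤ e s - e t) ∨
      (∃ᶠ s in 𝓝[<] t, (d t - ε) * l.real (Icc s t) ≤ e t - e s)) :
    κ * (jumpSum J Δ Δ' 0 b).toReal + ∫ r in Ioo 0 b, d r ∂l ≤ e b - e 0 := by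
  have hfin : ∀ {α β : ℝ → ℝ≥0∞}, (∀ t ∈ Ioo 0 b, t ∉ J → α t = 0 ∧ β t = 0) →
      jumpSum J α β 0 b ≠ ∞ → ∀ s t, 0 ≤ s → s < t → t ≤ b → jumpSum J α β s t ≠ ∞ := by
    intro α β h h1 s t hs hst ht
    have h2 : jumpSum J α β s t ≤ jumpSum J α β 0 t := by
      rcases hs.eq_or_lt with rfl | hs'
      · exact le_rfl
      · rw [jumpSum_split hs' hst (h s ⟨hs', hst.trans_le ht⟩)]; exact le_add_self
    have h3 : jumpSum J α β 0 t ≤ jumpSum J α β 0 b := by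
      rcases ht.eq_or_lt with rfl | ht'
      · exact le_rfl
      · exact jumpSum_mono_interval (hs.trans_lt hst) ht' (h t ⟨hs.trans_lt hst, ht'⟩)
    exact ne_top_of_le_ne_top h1 (h2.trans h3)
  have hn0 := fun t ht htJ => (h0 t ht htJ).1
  have hΔ0 := fun t ht htJ => (h0 t ht htJ).2
  have hwnn : 0 < K → ∀ t, 0 ≤ w t := fun hKp t =>
    nonneg_of_mul_nonneg_right ((abs_nonneg _).trans (hdw t)) hKp
  set inc : ℝ → ℝ → ℝ := fun s t => (jumpSum J n n' s t).toReal + (jumpSum J Δ Δ' s t).toReal +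
    ∫ r in Ioo s t, w r ∂l with hinc
  have hadd : ∀ r s t, 0 ≤ r → r < s → s < t → t ≤ b → inc r t = inc r s + inc s t := by
    intro r s t hr hrs hst ht
    have hs : s ∈ Ioo 0 b := ⟨hr.trans_lt hrs, hst.trans_le ht⟩
    have hint : ∫ x in Ioo r t, w x ∂l = ∫ x in Ioo r s, w x ∂l + ∫ x in Ioo s t, w x ∂l := by
      rw [← setIntegral_congr_set (Ioo_ae_eq_Ioc (a := r) (b := s)).symm,
        ← setIntegral_union (Set.disjoint_left.2 fun x hx hx' => not_lt.2 hx.2 hx'.1)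
          measurableSet_Ioo hw.integrableOn hw.integrableOn, Ioc_union_Ioo_eq_Ioo hrs.le hst]
    simp only [hinc]
    rw [jumpSum_split hrs hst (hn0 s hs), jumpSum_split hrs hst (hΔ0 s hs), hint,
      ENNReal.toReal_add (hfin hn0 hn r s hr hrs hs.2.le) (hfin hn0 hn s t hs.1.le hst ht),
      ENNReal.toReal_add (hfin hΔ0 hΔ r s hr hrs hs.2.le) (hfin hΔ0 hΔ s t hs.1.le hst ht)]
    ring
  -- A primitive of the additive interval function `inc`. The value at 0 is set by hand because `inc
  -- 0 0` still contains right jumps at 0.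
  set N : ℝ → ℝ := fun r => if r = 0 then 0 else inc 0 r with hN
  have hNinc : ∀ s t, 0 ≤ s → s < t → t ≤ b → N t - N s = inc s t := by
    intro s t hs hst ht
    simp only [hN, if_neg (hs.trans_lt hst).ne']
    rcases hs.eq_or_lt with rfl | hs'
    · simp
    · rw [if_neg hs'.ne', hadd 0 s t le_rfl hs' hst ht]; ring
  set cl : ℝ → ℝ := fun r => max 0 (min b r) with hcl
  have hcl0 : ∀ r, 0 ≤ cl r := fun r => le_max_left _ _
  have hclb : ∀ r, cl r ≤ b := fun r => max_le hb.le (min_le_left _ _)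
  have hclm : Monotone cl := fun r s h => max_le_max le_rfl (min_le_min le_rfl h)
  have hcle : ∀ r ∈ Icc 0 b, cl r = r := fun r hr => by simp [hcl, hr.1, hr.2]
  -- By the control of e, this function is monotone, although e itself need not be.
  set m : ℝ → ℝ := fun r => K * N (cl r) + e (cl r) with hm
  have hmono : Monotone m := by
    intro r s hrs
    rcases (hclm hrs).eq_or_lt with h | h
    · simp only [hm, h]; exact le_rfl
    · have h1 := hK _ _ (hcl0 r) h (hclb s)
      have h2 := hNinc _ _ (hcl0 r) h (hclb s)
      have h3 := neg_abs_le (e (cl s) - e (cl r))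
      have h4 : K * N (cl s) - K * N (cl r) = K * inc (cl r) (cl s) := by rw [← h2]; ring
      simp only [hm]
      linarith
  have hminc : ∀ s t, 0 ≤ s → s < t → t ≤ b → m t - m s = K * inc s t + (e t - e s) := by
    intro s t hs hst ht
    simp only [hm, hcle s ⟨hs, hst.le.trans ht⟩, hcle t ⟨hs.trans hst.le, ht⟩]
    rw [← hNinc s t hs hst ht]; ring
  have hKw : ∀ s t, 0 ≤ K * ∫ r in Ioo s t, w r ∂l := by
    intro s t
    rcases hK0.eq_or_lt with h | h
    · rw [← h, zero_mul]
    · exact mul_nonneg hK0 (integral_nonneg fun r => hwnn h r)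
  have hleft : ∀ (α β : ℝ → ℝ≥0∞) s t, α t ≤ jumpSum J α β s t := fun α β s t => by
    rw [jumpSum]; exact le_add_self.trans le_self_add
  have hright : ∀ (α β : ℝ → ℝ≥0∞) s t, β s ≤ jumpSum J α β s t := fun α β s t => by
    rw [jumpSum]; exact le_self_add.trans le_self_add
  have hstep : ∀ {x y : ℝ≥0∞} {s t p : ℝ}, 0 ≤ s → s < t → t ≤ b →
      x ≤ jumpSum J n n' s t → y ≤ jumpSum J Δ Δ' s t → p ≤ e t - e s →
      K * x.toReal + K * y.toReal + p ≤ m t - m s := by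
    intro x y s t p hs hst ht hx hy hp
    have h1 := ENNReal.toReal_mono (hfin hn0 hn s t hs hst ht) hx
    have h2 := ENNReal.toReal_mono (hfin hΔ0 hΔ s t hs hst ht) hy
    have h3 := hKw s t
    have h4 := mul_le_mul_of_nonneg_left h1 hK0
    have h5 := mul_le_mul_of_nonneg_left h2 hK0
    rw [hminc s t hs hst ht]
    simp only [hinc]
    linarith [mul_add K ((jumpSum J n n' s t).toReal + (jumpSum J Δ Δ' s t).toReal)
      (∫ r in Ioo s t, w r ∂l), mul_add K (jumpSum J n n' s t).toReal
      (jumpSum J Δ Δ' s t).toReal]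
  have hof : ∀ {x y : ℝ≥0∞} {z : ℝ}, x ≠ ∞ → y ≠ ∞ →
      (∀ ε > 0, K * x.toReal + K * y.toReal + (κ * y.toReal - ε) ≤ z) →
      ENNReal.ofReal K * x + ENNReal.ofReal (K + κ) * y ≤ ENNReal.ofReal z := by
    intro x y z hx hy h
    rw [← ENNReal.ofReal_toReal hx, ← ENNReal.ofReal_toReal hy, ← ENNReal.ofReal_mul hK0,
      ← ENNReal.ofReal_mul hκ, ← ENNReal.ofReal_add (by positivity) (by positivity)]
    refine ENNReal.ofReal_le_ofReal (le_of_forall_pos_le_add fun ε hε => ?_)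
    linarith [h ε hε, add_mul K κ y.toReal]
  -- The decomposition of m has jumps at least K n + (K + κ) Δ and density at least K w + d, all
  -- nonnegative. The increment of K N is known exactly, and subtracting it leaves the claim for e.
  have h := jumpSum_add_lintegral_le hl hmono hJ (D := fun r => K * w r + d r) hb
    (α := fun r => ENNReal.ofReal K * n r + ENNReal.ofReal (K + κ) * Δ r)
    (β := fun r => ENNReal.ofReal K * n' r + ENNReal.ofReal (K + κ) * Δ' r) ?_ ?_ ?_
  · rw [jumpSum_add, jumpSum_mul, jumpSum_mul] at h
    have hD0 : ∀ r, 0 ≤ K * w r + d r := fun r => by linarith [hdw r, neg_abs_le (d r)]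
    have hDi : IntegrableOn (fun r => K * w r + d r) (Ioo 0 b) l :=
      ((hw.const_mul K).add hd).integrableOn
    rw [← ofReal_integral_eq_lintegral_ofReal hDi (Eventually.of_forall hD0),
      ← ENNReal.ofReal_toReal hn, ← ENNReal.ofReal_toReal hΔ, ← ENNReal.ofReal_mul hK0,
      ← ENNReal.ofReal_mul hκ, ← ENNReal.ofReal_add (by positivity) (by positivity),
      ← ENNReal.ofReal_add (by positivity) (integral_nonneg hD0),
      ENNReal.ofReal_le_ofReal_iff (sub_nonneg.2 (hmono hb.le)),
      integral_add (hw.const_mul K).integrableOn hd.integrableOn, integral_const_mul,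
      hminc 0 b le_rfl hb le_rfl] at h
    simp only [hinc] at h
    linarith [mul_add K ((jumpSum J n n' 0 b).toReal + (jumpSum J Δ Δ' 0 b).toReal)
      (∫ r in Ioo 0 b, w r ∂l), mul_add K (jumpSum J n n' 0 b).toReal
      (jumpSum J Δ Δ' 0 b).toReal, add_mul K κ (jumpSum J Δ Δ' 0 b).toReal]
  · intro r hr s hs
    refine hof (ne_top_of_le_ne_top (hfin hn0 hn s r hs.1 hs.2 hr.2) (hleft _ _ _ _))
      (ne_top_of_le_ne_top (hfin hΔ0 hΔ s r hs.1 hs.2 hr.2) (hleft _ _ _ _)) fun ε hε => ?_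
    obtain ⟨s', hs', hs1⟩ := ((hα r hr ε hε).and_eventually (Ioo_mem_nhdsLT hs.2)).exists
    refine (hstep (hs.1.trans hs1.1.le) hs1.2 hr.2 (hleft _ _ _ _) (hleft _ _ _ _) hs').trans ?_
    exact sub_le_sub_left (hmono hs1.1.le) _
  · intro r hr s hs
    refine hof (ne_top_of_le_ne_top (hfin hn0 hn r s hr.1 hs.1 hs.2) (hright _ _ _ _))
      (ne_top_of_le_ne_top (hfin hΔ0 hΔ r s hr.1 hs.1 hs.2) (hright _ _ _ _)) fun ε hε => ?_
    obtain ⟨s', hs', hs1⟩ := ((hβ r hr ε hε).and_eventually (Ioo_mem_nhdsGT hs.1)).exists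
    refine (hstep hr.1 hs1.1 (hs1.2.le.trans hs.2) (hright _ _ _ _) (hright _ _ _ _) hs').trans ?_
    exact sub_le_sub_right (hmono hs1.2.le) _
  · filter_upwards [ae_tendsto_inv_mul_integral hl hw.locallyIntegrable, hquot]
      with t ht hq htb ε hε
    have hε' : 0 < ε / (2 * (K + 1)) := by positivity
    have hεK : K * (ε / (2 * (K + 1))) ≤ ε / 2 := by
      rw [← mul_div_assoc, div_le_div_iff₀ (by positivity) two_pos]
      nlinarith
    have hcomb : ∀ {s r q}, 0 ≤ s → s < r → r ≤ b →
        w t - ε / (2 * (K + 1)) < (l.real (Icc s r))⁻¹ * ∫ x in Ioo s r, w x ∂l →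
        (d t - ε / 2) * l.real (Icc s r) ≤ q → q ≤ e r - e s →
        (K * w t + d t - ε) * l.real (Icc s r) ≤ m r - m s := by
      intro s r q hs hsr hr h1 h2 h3
      have h4 := measureReal_Icc_pos hl hsr
      rw [inv_mul_eq_div, lt_div_iff₀ h4] at h1
      have h5 := mul_le_mul_of_nonneg_left h1.le hK0
      rw [hminc s r hs hsr hr]
      simp only [hinc]
      have h6 : 0 ≤ K * (jumpSum J n n' s r).toReal := by positivity
      have h7 : 0 ≤ K * (jumpSum J Δ Δ' s r).toReal := by positivity
      have h8 := mul_le_mul_of_nonneg_right hεK h4.le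
      nlinarith
    rcases hq htb (ε / 2) (by positivity) with h | h
    · left
      refine (h.and_eventually (((ht.1.eventually_const_lt (sub_lt_self _ hε')).and
        (Ioo_mem_nhdsGT htb.2)))).mono ?_
      rintro s ⟨h1, h2, h3⟩
      exact hcomb htb.1.le h3.1 h3.2.le h2 h1 le_rfl
    · right
      refine (h.and_eventually (((ht.2.eventually_const_lt (sub_lt_self _ hε')).and
        (Ioo_mem_nhdsLT htb.1)))).mono ?_
      rintro s ⟨h1, h2, h3⟩
      exact hcomb h3.1.le h3.2 htb.2.le h2 h1 le_rfl

end Increments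

end

/-! ### One-sided limits of stable states -/

section

theorem frequently_left_of_ae {p : ℝ → Prop} {a t : ℝ} (hat : a < t)
    (h : ∀ᵐ s ∂(volume : Measure ℝ), s ∈ Ioo a t → p s) : ∃ᶠ s in 𝓝[<] t, p s := by
  intro hcon
  obtain ⟨c, hc, hsub⟩ := mem_nhdsLT_iff_exists_Ioo_subset.1 hcon
  have h1 : volume (Ioo (max a c) t) = 0 := by
    refine measure_mono_null (fun s hs => ?_) h
    simp only [mem_compl_iff, mem_ofPred_eq, Classical.not_imp]
    exact ⟨⟨(le_max_left _ _).trans_lt hs.1, hs.2⟩, hsub ⟨(le_max_right _ _).trans_lt hs.1, hs.2⟩⟩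
  rw [Real.volume_Ioo, ENNReal.ofReal_eq_zero] at h1
  have : max a c < t := max_lt hat hc
  linarith

theorem frequently_right_of_ae {p : ℝ → Prop} {t b : ℝ} (htb : t < b)
    (h : ∀ᵐ s ∂(volume : Measure ℝ), s ∈ Ioo t b → p s) : ∃ᶠ s in 𝓝[>] t, p s := by
  intro hcon
  obtain ⟨c, hc, hsub⟩ := mem_nhdsGT_iff_exists_Ioo_subset.1 hcon
  have h1 : volume (Ioo t (min b c)) = 0 := by
    refine measure_mono_null (fun s hs => ?_) h
    simp only [mem_compl_iff, mem_ofPred_eq, Classical.not_imp]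
    exact ⟨⟨hs.1, hs.2.trans_le (min_le_left _ _)⟩, hsub ⟨hs.1, hs.2.trans_le (min_le_right _ _)⟩⟩
  rw [Real.volume_Ioo, ENNReal.ofReal_eq_zero] at h1
  have : t < min b c := lt_min htb hc
  linarith

theorem ae_notMem_of_countable {J : Set ℝ} (hJ : J.Countable) (l : Measure ℝ)
    [NullSingletonClass l] : ∀ᵐ s ∂l, s ∉ J := by
  have : l J = 0 := hJ.measure_zero l
  exact measure_eq_zero_iff_ae_notMem.1 this

namespace RIS.Admissible

variable {V : Type*} [NormedAddCommGroup V] [NormedSpace ℝ V] [CompleteSpace V] {S : RIS V}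
  (hS : S.Admissible) {u : ℝ → V} (hu : BoundedVariationOn u (Icc 0 S.T)) {e : ℝ} (he : 0 < e)
  (hmem : ∀ t ∈ Icc 0 S.T, u t ∈ S.sublevel e)
include hS hu he hmem

theorem leftLimit_mem_sublevel {t : ℝ} (ht : t ∈ Icc 0 S.T) :
    leftLimit S.T u t ∈ S.sublevel e := by
  rcases ht.1.eq_or_lt with rfl | h0
  · rw [leftLimit_zero hS.T_pos]; exact hmem 0 ht
  · refine (hS.coercive e he).isClosed.mem_of_tendsto
      (tendsto_leftLimit hS.T_pos hu ⟨h0, ht.2⟩) ?_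
    filter_upwards [Ioo_mem_nhdsLT h0] with s hs using hmem s ⟨hs.1.le, hs.2.le.trans ht.2⟩

theorem rightLimit_mem_sublevel {t : ℝ} (ht : t ∈ Icc 0 S.T) :
    rightLimit S.T u t ∈ S.sublevel e := by
  rcases ht.2.eq_or_lt with rfl | h0
  · rw [rightLimit_end hS.T_pos]; exact hmem _ ht
  · refine (hS.coercive e he).isClosed.mem_of_tendsto
      (tendsto_rightLimit hS.T_pos hu ⟨ht.1, h0⟩) ?_
    filter_upwards [Ioo_mem_nhdsGT h0] with s hs using hmem s ⟨ht.1.trans hs.1.le, hs.2.le⟩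

theorem stable_leftLimit {t : ℝ} (ht : t ∈ Ioc 0 S.T) {l : Filter ℝ} [l.NeBot]
    (hl : l ≤ 𝓝[<] t) (hst : ∀ᶠ s in l, S.Stable s (u s)) :
    S.Stable t (leftLimit S.T u t) ∧
      Tendsto (fun s => S.E s (u s)) l (𝓝 (S.E t (leftLimit S.T u t))) := by
  have hIoo : ∀ᶠ s in l, s ∈ Ioo 0 t := hl (Ioo_mem_nhdsLT ht.1)
  refine hS.stable_of_tendsto (τ := fun s => s) (w := u) he ⟨ht.1.le, ht.2⟩
    (hS.leftLimit_mem_sublevel hu he hmem ⟨ht.1.le, ht.2⟩) ?_ ?_ hst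
  · refine tendsto_nhdsWithin_iff.2 ⟨hl.trans nhdsWithin_le_nhds, ?_⟩
    filter_upwards [hIoo] with s hs using ⟨hs.1.le, hs.2.le.trans ht.2⟩
  · refine tendsto_nhdsWithin_iff.2 ⟨(tendsto_leftLimit hS.T_pos hu ht).mono_left hl, ?_⟩
    filter_upwards [hIoo] with s hs using hmem s ⟨hs.1.le, hs.2.le.trans ht.2⟩

theorem stable_rightLimit {t : ℝ} (ht : t ∈ Ico 0 S.T) {l : Filter ℝ} [l.NeBot]
    (hl : l ≤ 𝓝[>] t) (hst : ∀ᶠ s in l, S.Stable s (u s)) :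
    S.Stable t (rightLimit S.T u t) ∧
      Tendsto (fun s => S.E s (u s)) l (𝓝 (S.E t (rightLimit S.T u t))) := by
  have hIoo : ∀ᶠ s in l, s ∈ Ioo t S.T := hl (Ioo_mem_nhdsGT ht.2)
  refine hS.stable_of_tendsto (τ := fun s => s) (w := u) he ⟨ht.1, ht.2.le⟩
    (hS.rightLimit_mem_sublevel hu he hmem ⟨ht.1, ht.2.le⟩) ?_ ?_ hst
  · refine tendsto_nhdsWithin_iff.2 ⟨hl.trans nhdsWithin_le_nhds, ?_⟩
    filter_upwards [hIoo] with s hs using ⟨ht.1.trans hs.1.le, hs.2.le⟩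
  · refine tendsto_nhdsWithin_iff.2 ⟨(tendsto_rightLimit hS.T_pos hu ht).mono_left hl, ?_⟩
    filter_upwards [hIoo] with s hs using hmem s ⟨ht.1.trans hs.1.le, hs.2.le⟩

/-- Stability at almost every time implies stability outside the jump set. -/
theorem stable_of_ae (hae : ∀ᵐ t ∂(volume : Measure ℝ), t ∈ Ioo 0 S.T → S.Stable t (u t)) {t : ℝ}
    (ht : t ∈ Icc 0 S.T) (hJ : t ∉ jumpSet S.T u) : S.Stable t (u t) := by
  rcases ht.1.eq_or_lt with rfl | h0
  · have hfr : ∃ᶠ s in 𝓝[>] (0 : ℝ), s ∈ {s | S.Stable s (u s)} :=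
      frequently_right_of_ae hS.T_pos hae
    have := frequently_mem_iff_neBot.1 hfr
    have h1 := (hS.stable_rightLimit hu he hmem (t := 0) ⟨le_rfl, hS.T_pos⟩ inf_le_left
      (mem_inf_of_right (mem_principal_self _))).1
    rwa [rightLimit_eq_of_notMem ht hJ] at h1
  · have hfr : ∃ᶠ s in 𝓝[<] t, s ∈ {s | S.Stable s (u s)} := by
      refine frequently_left_of_ae h0 ?_
      filter_upwards [hae] with s hs hs' using hs ⟨hs'.1, hs'.2.trans_le ht.2⟩
    have := frequently_mem_iff_neBot.1 hfr
    have h1 := (hS.stable_leftLimit hu he hmem ⟨h0, ht.2⟩ inf_le_left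
      (mem_inf_of_right (mem_principal_self _))).1
    rwa [leftLimit_eq_of_notMem ht hJ] at h1

variable (hst : ∀ t ∈ Icc 0 S.T, t ∉ jumpSet S.T u → S.Stable t (u t))
include hst

theorem eventually_stable_left {t : ℝ} (ht : t ∈ Ioc 0 S.T) :
    ∀ᶠ s in 𝓝[<] t ⊓ 𝓟 (jumpSet S.T u)ᶜ, S.Stable s (u s) := by
  filter_upwards [mem_inf_of_left (Ioo_mem_nhdsLT ht.1),
    mem_inf_of_right (mem_principal_self _)] with s hs hsJ
  exact hst s ⟨hs.1.le, hs.2.le.trans ht.2⟩ hsJ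

theorem eventually_stable_right {t : ℝ} (ht : t ∈ Ico 0 S.T) :
    ∀ᶠ s in 𝓝[>] t ⊓ 𝓟 (jumpSet S.T u)ᶜ, S.Stable s (u s) := by
  filter_upwards [mem_inf_of_left (Ioo_mem_nhdsGT ht.2),
    mem_inf_of_right (mem_principal_self _)] with s hs hsJ
  exact hst s ⟨ht.1.trans hs.1.le, hs.2.le⟩ hsJ

omit hS he hmem hst in
theorem _root_.BalancedViscosity.neBot_left_jumpSet_compl (hT : 0 < S.T) (t : ℝ) :
    (𝓝[<] t ⊓ 𝓟 (jumpSet S.T u)ᶜ).NeBot :=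
  frequently_mem_iff_neBot.1 <| frequently_left_of_ae (sub_one_lt t) <|
    (ae_notMem_of_countable (countable_jumpSet hT hu) volume).mono fun _ hs _ => hs

omit hS he hmem hst in
theorem _root_.BalancedViscosity.neBot_right_jumpSet_compl (hT : 0 < S.T) (t : ℝ) :
    (𝓝[>] t ⊓ 𝓟 (jumpSet S.T u)ᶜ).NeBot :=
  frequently_mem_iff_neBot.1 <| frequently_right_of_ae (lt_add_one t) <|
    (ae_notMem_of_countable (countable_jumpSet hT hu) volume).mono fun _ hs _ => hs

theorem stable_tendsto_left {t : ℝ} (ht : t ∈ Ioc 0 S.T) :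
    S.Stable t (leftLimit S.T u t) ∧ Tendsto (fun s => S.E s (u s))
      (𝓝[<] t ⊓ 𝓟 (jumpSet S.T u)ᶜ) (𝓝 (S.E t (leftLimit S.T u t))) := by
  have := neBot_left_jumpSet_compl hu hS.T_pos t
  exact hS.stable_leftLimit hu he hmem ht inf_le_left
    (hS.eventually_stable_left hu he hmem hst ht)

theorem stable_tendsto_right {t : ℝ} (ht : t ∈ Ico 0 S.T) :
    S.Stable t (rightLimit S.T u t) ∧ Tendsto (fun s => S.E s (u s))
      (𝓝[>] t ⊓ 𝓟 (jumpSet S.T u)ᶜ) (𝓝 (S.E t (rightLimit S.T u t))) := by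
  have := neBot_right_jumpSet_compl hu hS.T_pos t
  exact hS.stable_rightLimit hu he hmem ht inf_le_left
    (hS.eventually_stable_right hu he hmem hst ht)

theorem finslerCost_self_of_notMem {t : ℝ} (ht : t ∈ Icc 0 S.T) (hJ : t ∉ jumpSet S.T u) :
    S.finslerCost t (leftLimit S.T u t) (u t) = 0 ∧
      S.finslerCost t (u t) (rightLimit S.T u t) = 0 := by
  obtain ⟨ξ, hξ, -⟩ := hst t ht hJ
  rw [leftLimit_eq_of_notMem ht hJ, rightLimit_eq_of_notMem ht hJ, and_self]
  exact hS.finslerCost_self_of_nonempty ht ⟨ξ, hξ⟩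

end RIS.Admissible

end

/-! ### Energy difference quotients with respect to the reference measure -/

section

section Density

variable {l : Measure ℝ} [IsLocallyFiniteMeasure l] [NullSingletonClass l]

/-- The density of the Lebesgue measure. -/
def lebesgueDensity (l : Measure ℝ) (t : ℝ) : ℝ :=
  ((volume : Measure ℝ).rnDeriv l t).toReal

theorem lebesgueDensity_nonneg (t : ℝ) : 0 ≤ lebesgueDensity l t := ENNReal.toReal_nonneg

theorem ae_tendsto_sub_div (hl : volume ≤ l) : ∀ᵐ t ∂l,
    Tendsto (fun s => (l.real (Icc t s))⁻¹ * (s - t)) (𝓝[>] t) (𝓝 (lebesgueDensity l t)) ∧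
    Tendsto (fun s => (l.real (Icc s t))⁻¹ * (t - s)) (𝓝[<] t) (𝓝 (lebesgueDensity l t)) := by
  have key : ∀ a b : ℝ, a ≤ b →
      (volume (Icc a b) / l (Icc a b)).toReal = (l.real (Icc a b))⁻¹ * (b - a) := by
    intro a b hab
    rw [ENNReal.toReal_div, Real.volume_Icc, ENNReal.toReal_ofReal (sub_nonneg.2 hab),
      div_eq_inv_mul, Measure.real]
  filter_upwards [ae_rnDeriv_oneSided hl volume, Measure.rnDeriv_lt_top volume l] with t ht hfin
  constructor
  · refine ((ENNReal.tendsto_toReal hfin.ne).comp ht.1).congr' ?_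
    filter_upwards [self_mem_nhdsWithin] with s hs using key t s (le_of_lt hs)
  · refine ((ENNReal.tendsto_toReal hfin.ne).comp ht.2).congr' ?_
    filter_upwards [self_mem_nhdsWithin] with s hs using key s t (le_of_lt hs)

theorem integrable_lebesgueDensity_mul (hl : volume ≤ l) {f : ℝ → ℝ} (hf : Integrable f) :
    Integrable (fun t => lebesgueDensity l t * f t) l :=
  (integrable_rnDeriv_smul_iff (Measure.absolutelyContinuous_of_le hl)).2 hf

theorem setIntegral_lebesgueDensity_mul (hl : volume ≤ l) (f : ℝ → ℝ) {s : Set ℝ}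
    (hs : MeasurableSet s) : ∫ t in s, lebesgueDensity l t * f t ∂l = ∫ t in s, f t :=
  setIntegral_rnDeriv_smul (Measure.absolutelyContinuous_of_le hl) hs

/-- Otherwise ‖f z - f t‖ ≥ η almost everywhere on a right neighbourhood and the averages could not
vanish. This selects later times at which an a.e. property holds and the density is close to its
value at t, although f has no pointwise limit. -/
theorem frequently_right_of_average {E : Type*} [NormedAddCommGroup E] (hl : volume ≤ l)
    {f : ℝ → E} (hf : LocallyIntegrable f l) {t : ℝ}
    (h : Tendsto (fun y => ⨍ z in Icc t y, ‖f z - f t‖ ∂l) (𝓝[>] t) (𝓝 0)) {p : ℝ → Prop}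
    (hp : ∀ᵐ s ∂l, p s) {η : ℝ} (hη : 0 < η) : ∃ᶠ s in 𝓝[>] t, p s ∧ ‖f s - f t‖ < η := by
  intro hcon
  obtain ⟨c, hc, hsub⟩ := mem_nhdsGT_iff_exists_Ioo_subset.1 hcon
  obtain ⟨y, hy, hyc⟩ := ((h.eventually_lt_const hη).and (Ioo_mem_nhdsGT hc)).exists
  have h0 := measureReal_Icc_pos hl hyc.1
  have hfi : IntegrableOn (fun z => ‖f z - f t‖) (Icc t y) l :=
    ((hf.integrableOn_isCompact isCompact_Icc).sub
      (integrableOn_const isCompact_Icc.measure_ne_top)).norm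
  have h1 : ∫ _ in Ioo t y, η ∂l ≤ ∫ z in Ioo t y, ‖f z - f t‖ ∂l := by
    refine setIntegral_mono_on_ae (integrableOn_const measure_Ioo_lt_top.ne)
      (hfi.mono_set Ioo_subset_Icc_self) measurableSet_Ioo ?_
    filter_upwards [hp] with z hz hzI
    have h2 : ¬(p z ∧ ‖f z - f t‖ < η) := hsub ⟨hzI.1, hzI.2.trans hyc.2⟩
    exact not_lt.1 fun h3 => h2 ⟨hz, h3⟩
  rw [setIntegral_congr_set (Ioo_ae_eq_Icc (a := t) (b := y)),
    setIntegral_congr_set (Ioo_ae_eq_Icc (a := t) (b := y)), setIntegral_const, smul_eq_mul] at h1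
  rw [setAverage_eq, smul_eq_mul, inv_mul_eq_div, div_lt_iff₀ h0, mul_comm] at hy
  linarith

end Density

namespace RIS.Admissible

variable {V : Type*} [NormedAddCommGroup V] [NormedSpace ℝ V] [CompleteSpace V] {S : RIS V}
  (hS : S.Admissible)
include hS

/-- By 1-homogeneity, testing the subgradient inequality at 2v and at 0 forces η v = Ψ v; what
remains is η ∈ K*. -/
theorem zero_mem_gaugeSubdiff_add {t : ℝ} {u v : V} :
    0 ∈ S.gaugeSubdiff v + S.energySubdiff t u ↔
      ∃ ξ ∈ S.energySubdiff t u, -ξ ∈ S.stableSet ∧ -ξ v = S.Ψ v := by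
  have hg := hS.isGauge
  constructor
  · rintro ⟨η, hη, ξ, hξ, h⟩
    have hη' : η = -ξ := eq_neg_of_add_eq_zero_left h
    have h1 : η v = S.Ψ v := by
      have h2 := hη ((2 : ℝ) • v)
      have h3 := hη ((0 : ℝ) • v)
      rw [map_sub, map_smul, hg.smul _ (by norm_num), smul_eq_mul] at h2 h3
      linarith
    refine ⟨ξ, hξ, fun w => ?_, by rw [← h1, hη']; rfl⟩
    have h2 := hη w
    rw [map_sub] at h2
    rw [← hη']
    linarith
  · rintro ⟨ξ, hξ, h1, h2⟩
    refine ⟨-ξ, fun w => ?_, ξ, hξ, neg_add_cancel ξ⟩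
    have h3 := h1 w
    rw [map_sub]
    have h4 : (-ξ) v = S.Ψ v := h2
    linarith

variable {u : ℝ → V} (hu : BoundedVariationOn u (Icc 0 S.T)) {e : ℝ} (he : 0 < e)
  (hmem : ∀ t ∈ Icc 0 S.T, u t ∈ S.sublevel e)
include hu he hmem

/-- The explicit time dependence at the frozen state u t; using l as a clock multiplies the power by
the Lebesgue density. It is subtracted from the full quotient so that (E3) can be used at one time.
-/
theorem ae_tendsto_energy_quotient : ∀ᵐ t ∂(lineMeasure hS.T_pos hu), t ∈ Ioo 0 S.T →
    Tendsto (fun s => ((lineMeasure hS.T_pos hu).real (Icc t s))⁻¹ * (S.E s (u t) - S.E t (u t)))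
      (𝓝[>] t) (𝓝 (lebesgueDensity (lineMeasure hS.T_pos hu) t * S.power t (u t))) ∧
    Tendsto (fun s => ((lineMeasure hS.T_pos hu).real (Icc s t))⁻¹ * (S.E t (u t) - S.E s (u t)))
      (𝓝[<] t) (𝓝 (lebesgueDensity (lineMeasure hS.T_pos hu) t * S.power t (u t))) := by
  filter_upwards [ae_tendsto_sub_div (volume_le_lineMeasure hS.T_pos hu)] with t ht htT
  have hd := hasDerivAt_iff_tendsto_slope.1
    (hS.hasDerivAt (hmem t (Ioo_subset_Icc_self htT)).1 htT)
  constructor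
  · refine (ht.1.mul (hd.mono_left (nhdsGT_le_nhdsNE t))).congr' ?_
    filter_upwards [self_mem_nhdsWithin] with s hs
    have : s - t ≠ 0 := (sub_pos.2 hs).ne'
    rw [slope_def_field, mul_assoc, mul_div_cancel₀ _ this]
  · refine (ht.2.mul (hd.mono_left (nhdsLT_le_nhdsNE t))).congr' ?_
    filter_upwards [self_mem_nhdsWithin] with s hs
    have : t - s ≠ 0 := (sub_pos.2 hs).ne'
    rw [slope_comm, slope_def_field, mul_assoc, mul_div_cancel₀ _ this]

variable {g : ℝ → V} (hg : Integrable g (refMeasure hS.T_pos hu))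
  (hgd : diffusePart hS.T_pos hu = (refMeasure hS.T_pos hu).withDensityᵥ g)

omit he hmem in
theorem tendsto_of_left {t : ℝ} (ht : t ∈ Ioo 0 S.T) (hJ : t ∉ jumpSet S.T u) :
    Tendsto u (𝓝[<] t) (𝓝 (u t)) := by
  have := tendsto_leftLimit hS.T_pos hu ⟨ht.1, ht.2.le⟩
  rwa [leftLimit_eq_of_notMem (Ioo_subset_Icc_self ht) hJ] at this

omit he hmem in
theorem tendsto_of_right {t : ℝ} (ht : t ∈ Ioo 0 S.T) (hJ : t ∉ jumpSet S.T u) :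
    Tendsto u (𝓝[>] t) (𝓝 (u t)) := by
  have := tendsto_rightLimit hS.T_pos hu ⟨ht.1.le, ht.2⟩
  rwa [rightLimit_eq_of_notMem (Ioo_subset_Icc_self ht) hJ] at this

include hg hgd in
/-- An upper bound for the left difference quotients of the energy yields the inclusion. -/
theorem ae_inclusion_of_left_quotient : ∀ᵐ t ∂(lineMeasure hS.T_pos hu), t ∈ Ioo 0 S.T →
    ∀ (r : ℝ → ℝ) (F : Filter ℝ) [F.NeBot], F ≤ 𝓝[<] t → (∀ᶠ s in F, S.Stable s (u s)) →
      (∀ᶠ s in F, ((lineMeasure hS.T_pos hu).real (Icc s t))⁻¹ * (S.E t (u t) - S.E s (u s)) ≤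
        r s) →
      Tendsto r F (𝓝 (lebesgueDensity (lineMeasure hS.T_pos hu) t * S.power t (u t) -
        S.Ψ ((Ioo 0 S.T).indicator g t))) →
      0 ∈ S.gaugeSubdiff (g t) + S.energySubdiff t (u t) := by
  set l := lineMeasure hS.T_pos hu with hl
  obtain ⟨ω, B, hB, hω, hω0, hsub⟩ := hS.exists_uniform_subdiff he
  filter_upwards [hS.ae_tendsto_energy_quotient hu he hmem, ae_tendsto_density hS.T_pos hu hg hgd,
    ae_notMem_of_countable (countable_jumpSet hS.T_pos hu) l] with t hE hq hJ ht r F _ hF hst hr hrt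
  have htI := Ioo_subset_Icc_self ht
  have hut := hS.tendsto_of_left hu ht hJ
  set q : ℝ → V := fun s => (l.real (Icc s t))⁻¹ • (u t - u s) with hqdef
  have hGt : (Ioo 0 S.T).indicator g t = g t := indicator_of_mem ht g
  rw [hGt] at hq hrt
  have hqF : Tendsto q F (𝓝 (g t)) := (hq ht).2.mono_left hF
  have hIoo : ∀ᶠ s in F, s ∈ Ioo 0 t := hF (Ioo_mem_nhdsLT ht.1)
  have hex : ∃ ξ : ℝ → V →L[ℝ] ℝ, ∀ᶠ s in F, ξ s ∈ S.energySubdiff s (u s) ∧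
      -ξ s ∈ S.stableSet := by
    have h1 : ∀ s, ∃ ξ : V →L[ℝ] ℝ, S.Stable s (u s) → ξ ∈ S.energySubdiff s (u s) ∧
        -ξ ∈ S.stableSet := fun s => by
      by_cases h : S.Stable s (u s)
      · obtain ⟨ξ, h2⟩ := h
        exact ⟨ξ, fun _ => h2⟩
      · exact ⟨0, fun h' => absurd h' h⟩
    choose ξ hξ using h1
    exact ⟨ξ, hst.mono fun s hs => hξ s hs⟩
  obtain ⟨ξ, hξ⟩ := hex
  have hτ : Tendsto (fun s : ℝ => s) F (𝓝[Icc 0 S.T] t) := by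
    refine tendsto_nhdsWithin_iff.2 ⟨hF.trans nhdsWithin_le_nhds, ?_⟩
    filter_upwards [hIoo] with s hs using ⟨hs.1.le, hs.2.le.trans ht.2.le⟩
  have hw : Tendsto u F (𝓝[S.sublevel e] (u t)) := by
    refine tendsto_nhdsWithin_iff.2 ⟨hut.mono_left hF, ?_⟩
    filter_upwards [hIoo] with s hs using hmem s ⟨hs.1.le, hs.2.le.trans ht.2.le⟩
  -- The cluster point of the stable subgradients at earlier times lies in the subdifferential at t,
  -- with -ζ ∈ K*. Only -ζ (g t) ≥ Ψ (g t) remains to be shown.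
  obtain ⟨U, hU, ζ, hζ, ζ', hζ', hdist, hlim⟩ := hS.exists_limit_subgradient he htI (hmem t htI)
    hτ hw (z := fun s => -ξ s) (r := fun _ => 0) (r₀ := 0) tendsto_const_nhds
    (hξ.mono fun _ h => h.1) (hξ.mono fun _ h => h.2) (Eventually.of_forall fun s => by simp)
  have hζeq : -ζ = ζ' := by
    rw [← sub_eq_zero]; exact norm_le_zero_iff.1 hdist
  rw [← hζeq] at hζ'
  refine hS.zero_mem_gaugeSubdiff_add.2 ⟨ζ, hζ, hζ', le_antisymm (hζ' (g t)) ?_⟩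
  obtain ⟨c, hc, hcb⟩ := hS.exists_stableSet_bound
  -- the subgradients applied to the difference quotients
  have hξq : Tendsto (fun s => ξ s (q s)) U (𝓝 (ζ (g t))) := by
    have h1 : Tendsto (fun s => ξ s (q s - g t)) U (𝓝 0) := by
      have h2 : Tendsto (fun s => c * ‖q s - g t‖) U (𝓝 0) := by
        have := ((hqF.mono_left hU).sub_const (g t)).norm.const_mul c
        simpa using this
      refine squeeze_zero_norm' ?_ h2
      filter_upwards [hU hξ] with s hs
      refine ((ξ s).le_opNorm _).trans (mul_le_mul_of_nonneg_right ?_ (norm_nonneg _))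
      rw [← norm_neg]; exact hcb _ hs.2
    have h3 := h1.add (hlim (g t))
    rw [zero_add] at h3
    refine h3.congr fun s => ?_
    rw [map_sub]; ring
  have hωlim : Tendsto (fun s => ω s (u s) (u t)) F (𝓝 0) := by
    rw [Metric.tendsto_nhds]
    intro η hη
    obtain ⟨δ, hδ, h1⟩ := hω0 η hη
    have h2 := (hut.mono_left hF).eventually (Metric.ball_mem_nhds (u t) hδ)
    filter_upwards [hIoo, h2] with s hs hd
    have hsI : s ∈ Icc 0 S.T := ⟨hs.1.le, hs.2.le.trans ht.2.le⟩
    have h3 := h1 s hsI (u s) (hmem s hsI) (u t) (hmem t htI) (by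
      rw [← dist_eq_norm, dist_comm]; exact hd)
    have h4 := (hω s hsI (u s) (hmem s hsI) (u t) (hmem t htI)).1
    rwa [Real.dist_eq, sub_zero, abs_of_nonneg h4]
  have hΨq : Tendsto (fun s => S.Ψ (q s)) F (𝓝 (S.Ψ (g t))) :=
    (hS.isGauge.continuous.tendsto _).comp hqF
  -- (E3) at the earlier state u s, tested at u t and divided by l[s,t]. In the limit the two power
  -- terms cancel, leaving ζ (g t) ≤ -Ψ (g t).
  have hmain : ∀ᶠ s in F, ξ s (q s) ≤ r s - (l.real (Icc s t))⁻¹ * (S.E t (u t) - S.E s (u t)) +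
      ω s (u s) (u t) * S.Ψ (q s) := by
    filter_upwards [hIoo, hξ, hr] with s hs hξs hrs
    have hsI : s ∈ Icc 0 S.T := ⟨hs.1.le, hs.2.le.trans ht.2.le⟩
    have h1 := hsub s hsI (u s) (hmem s hsI) (u t) (hmem t htI) (ξ s) hξs.1
    have h2 : 0 ≤ (l.real (Icc s t))⁻¹ := inv_nonneg.2 measureReal_nonneg
    have h3 := mul_le_mul_of_nonneg_left h1 h2
    have h4 : S.Ψ (q s) = (l.real (Icc s t))⁻¹ * S.Ψ (u t - u s) := hS.isGauge.smul _ h2 _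
    have h5 : ξ s (q s) = (l.real (Icc s t))⁻¹ * ξ s (u t - u s) := by
      simp only [hqdef, map_smul, smul_eq_mul]
    rw [h4, h5]
    linarith
  have hrhs := ((hrt.sub ((hE ht).2.mono_left hF)).add (hωlim.mul hΨq)).mono_left hU
  have h1 := le_of_tendsto_of_tendsto hξq hrhs (hU hmain)
  have h2 : (-ζ) (g t) = -ζ (g t) := rfl
  linarith

include hg hgd in
/-- Stability at earlier times bounds the left difference quotients of the energy from below. -/
theorem ae_le_left_quotient (hst : ∀ t ∈ Icc 0 S.T, t ∉ jumpSet S.T u → S.Stable t (u t)) :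
    ∀ᵐ t ∂(lineMeasure hS.T_pos hu), t ∈ Ioo 0 S.T → ∀ ε > 0, ∃ᶠ s in 𝓝[<] t,
      (lebesgueDensity (lineMeasure hS.T_pos hu) t * S.power t (u t) -
        S.Ψ ((Ioo 0 S.T).indicator g t) - ε) * (lineMeasure hS.T_pos hu).real (Icc s t) ≤
      S.E t (u t) - S.E s (u s) := by
  set l := lineMeasure hS.T_pos hu with hl
  obtain ⟨ω, B, hB, hω, hω0, hsub⟩ := hS.exists_uniform_subdiff he
  filter_upwards [hS.ae_tendsto_energy_quotient hu he hmem, ae_tendsto_density hS.T_pos hu hg hgd,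
    ae_notMem_of_countable (countable_jumpSet hS.T_pos hu) l] with t hE hq hJ ht ε hε
  have htI := Ioo_subset_Icc_self ht
  have hut := hS.tendsto_of_left hu ht hJ
  set G := (Ioo 0 S.T).indicator g with hG
  have hΨG := hS.isGauge.nonneg (G t)
  have hfr : ∃ᶠ s in 𝓝[<] t, s ∈ (jumpSet S.T u)ᶜ :=
    frequently_mem_iff_neBot.2 (neBot_left_jumpSet_compl hu hS.T_pos t)
  -- One quarter of ε pays for η Ψ(G t), one for the error in Ψ of the quotient (enlarged by 1 + η),
  -- and one half for the time increment. The summand 1 covers Ψ(G t) = 0.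
  set η := ε / (4 * (S.Ψ (G t) + 1)) with hη
  have hη0 : 0 < η := by positivity
  have hη1 : η * S.Ψ (G t) ≤ ε / 4 := by
    rw [hη, div_mul_eq_mul_div, div_le_div_iff₀ (by positivity) (by norm_num)]
    nlinarith
  obtain ⟨δ, hδ, hδω⟩ := hω0 η hη0
  have hΨq := (hS.isGauge.continuous.tendsto _).comp (hq ht).2
  have hκ : 0 < ε / (4 * (1 + η)) := by positivity
  refine (hfr.and_eventually ((((hE ht).2.eventually_const_lt (sub_lt_self _ (half_pos hε))).and
    (hΨq.eventually_lt_const (lt_add_of_pos_right _ hκ))).and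
    ((hut.eventually (Metric.ball_mem_nhds (u t) hδ)).and (Ioo_mem_nhdsLT ht.1)))).mono ?_
  rintro s ⟨hsJ, ⟨h1, h2⟩, h3, hs⟩
  have hsI : s ∈ Icc 0 S.T := ⟨hs.1.le, hs.2.le.trans ht.2.le⟩
  obtain ⟨ξ, hξ, hξK⟩ := hst s hsI hsJ
  have h4 := hsub s hsI (u s) (hmem s hsI) (u t) (hmem t htI) ξ hξ
  have h5 := hδω s hsI (u s) (hmem s hsI) (u t) (hmem t htI) (by
    rw [← dist_eq_norm, dist_comm]; exact h3)
  have h6 : -S.Ψ (u t - u s) ≤ ξ (u t - u s) := by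
    have := hξK (u t - u s)
    have h7 : (-ξ) (u t - u s) = -ξ (u t - u s) := rfl
    linarith
  have hl0 := measureReal_Icc_pos (volume_le_lineMeasure hS.T_pos hu) hs.2
  rw [inv_mul_eq_div, lt_div_iff₀ hl0] at h1
  have h2' : S.Ψ ((l.real (Icc s t))⁻¹ • (u t - u s)) < S.Ψ (G t) + ε / (4 * (1 + η)) := h2
  rw [hS.isGauge.smul _ (inv_pos.2 hl0).le, inv_mul_eq_div, div_lt_iff₀ hl0] at h2'
  have h8 := hS.isGauge.nonneg (u t - u s)
  have h9 : ω s (u s) (u t) * S.Ψ (u t - u s) ≤ η * S.Ψ (u t - u s) :=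
    mul_le_mul_of_nonneg_right h5.le h8
  have h10 : (1 + η) * S.Ψ (u t - u s) ≤
      (1 + η) * ((S.Ψ (G t) + ε / (4 * (1 + η))) * l.real (Icc s t)) :=
    mul_le_mul_of_nonneg_left h2'.le (by positivity)
  have h11 : (1 + η) * ((S.Ψ (G t) + ε / (4 * (1 + η))) * l.real (Icc s t)) =
      (S.Ψ (G t) + η * S.Ψ (G t) + ε / 4) * l.real (Icc s t) := by
    field_simp
  have h12 := mul_le_mul_of_nonneg_right hη1 hl0.le
  nlinarith

include hg hgd in
/-- The inclusion at later times bounds the right difference quotients of the energy from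
above. -/
theorem ae_le_right_quotient (hinc : ∀ᵐ t ∂(lineMeasure hS.T_pos hu), t ∈ Ioo 0 S.T →
      0 ∈ S.gaugeSubdiff (g t) + S.energySubdiff t (u t)) :
    ∀ᵐ t ∂(lineMeasure hS.T_pos hu), t ∈ Ioo 0 S.T → ∀ ε > 0, ∃ᶠ s in 𝓝[>] t,
      (S.Ψ ((Ioo 0 S.T).indicator g t) -
        lebesgueDensity (lineMeasure hS.T_pos hu) t * S.power t (u t) - ε) *
          (lineMeasure hS.T_pos hu).real (Icc t s) ≤
      S.E t (u t) - S.E s (u s) := by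
  set l := lineMeasure hS.T_pos hu with hl
  obtain ⟨ω, B, hB, hω, hω0, hsub⟩ := hS.exists_uniform_subdiff he
  obtain ⟨k, hk, hkb⟩ := hS.exists_stableSet_bound
  obtain ⟨c, hc, hcb⟩ := hS.isGauge.exists_bound
  set G := (Ioo 0 S.T).indicator g with hG
  have hGi := (integrable_indicator_density hS.T_pos hu hg).locallyIntegrable
  have hl1 : volume ≤ l := volume_le_lineMeasure hS.T_pos hu
  filter_upwards [hS.ae_tendsto_energy_quotient hu he hmem, ae_tendsto_density hS.T_pos hu hg hgd,
    ae_notMem_of_countable (countable_jumpSet hS.T_pos hu) l, ae_average_oneSided hl1 hGi]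
    with t hE hq hJ hav ht ε hε
  have htI := Ioo_subset_Icc_self ht
  have hut := hS.tendsto_of_right hu ht hJ
  have hΨG := hS.isGauge.nonneg (G t)
  set q : ℝ → V := fun s => (l.real (Icc t s))⁻¹ • (u s - u t) with hqdef
  have hqG : Tendsto q (𝓝[>] t) (𝓝 (G t)) := (hq ht).1
  -- Here k bounds the norm on K* and c‖·‖ bounds Ψ: replacing g s by the quotient inside ξ costs k
  -- κ, and replacing Ψ(g s) by Ψ(g t) costs less than c κ, together ε / 4.
  set κ := ε / (4 * (k + c)) with hκ
  have hκ0 : 0 < κ := by positivity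
  have hkκ : k * κ + c * κ = ε / 4 := by rw [← add_mul, hκ]; field_simp
  have hfr : ∃ᶠ s in 𝓝[>] t, (s ∈ Ioo 0 S.T →
      0 ∈ S.gaugeSubdiff (g s) + S.energySubdiff s (u s)) ∧ ‖G s - G t‖ < κ / 2 :=
    frequently_right_of_average hl1 hGi hav.1 hinc (half_pos hκ0)
  set m := S.Ψ (-G t) + 1 with hm
  have hm0 : 0 < m := by have := hS.isGauge.nonneg (-G t); positivity
  set η := ε / (4 * m) with hη
  have hη0 : 0 < η := by positivity
  have hηm : η * m = ε / 4 := by rw [hη]; field_simp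
  obtain ⟨δ, hδ, hδω⟩ := hω0 η hη0
  have hΨq : Tendsto (fun s => S.Ψ (-q s)) (𝓝[>] t) (𝓝 (S.Ψ (-G t))) :=
    (hS.isGauge.continuous.tendsto _).comp hqG.neg
  refine (hfr.and_eventually ((((hE ht).1.eventually_lt_const
    (lt_add_of_pos_right _ (by positivity : 0 < ε / 4))).and
    ((hΨq.eventually_lt_const (lt_add_of_pos_right _ one_pos)).and
      (hqG.eventually (Metric.ball_mem_nhds (G t) (half_pos hκ0))))).and
    ((hut.eventually (Metric.ball_mem_nhds (u t) hδ)).and (Ioo_mem_nhdsGT ht.2)))).mono ?_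
  rintro s ⟨⟨h1, h2⟩, ⟨h3, h4, h5⟩, h6, hs⟩
  have hsT : s ∈ Ioo 0 S.T := ⟨ht.1.trans hs.1, hs.2⟩
  have hsI := Ioo_subset_Icc_self hsT
  obtain ⟨ξ, hξ, hξK, hξg⟩ := hS.zero_mem_gaugeSubdiff_add.1 (h1 hsT)
  have hGs : G s = g s := indicator_of_mem hsT g
  rw [← hGs] at hξg
  have hl0 := measureReal_Icc_pos hl1 hs.1
  set L := l.real (Icc t s) with hL
  have hus : u t - u s = L • -q s := by
    rw [hqdef, smul_neg, smul_smul, mul_inv_cancel₀ hl0.ne', one_smul, neg_sub]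
  have h7 := hsub s hsI (u s) (hmem s hsI) (u t) (hmem t htI) ξ hξ
  have h8 := hδω s hsI (u s) (hmem s hsI) (u t) (hmem t htI) (by
    rw [← dist_eq_norm, dist_comm]; exact h6)
  rw [hus, hS.isGauge.smul _ hl0.le, map_smul, smul_eq_mul] at h7
  rw [inv_mul_eq_div, div_lt_iff₀ hl0] at h3
  -- the value of the subgradient at the difference quotient
  have h9 : S.Ψ (G t) - ε / 4 ≤ ξ (-q s) := by
    have e1 : ξ (-q s) = S.Ψ (G s) - ξ (q s - G s) := by
      rw [← hξg, map_sub, map_neg]; ring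
    have e2 : |ξ (q s - G s)| ≤ k * ‖q s - G s‖ := by
      refine (ξ.le_opNorm _).trans (mul_le_mul_of_nonneg_right ?_ (norm_nonneg _))
      rw [← norm_neg]; exact hkb _ hξK
    have e3 := hS.isGauge.sub_le (G t) (G s)
    have e4 := hcb (G t - G s)
    rw [norm_sub_rev] at e4
    have e5 : ‖q s - G s‖ ≤ κ := by
      have e6 : ‖q s - G t‖ < κ / 2 := by rw [← dist_eq_norm]; exact h5
      rw [norm_sub_rev] at h2
      linarith [norm_sub_le_norm_sub_add_norm_sub (q s) (G t) (G s)]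
    have e6 := mul_le_mul_of_nonneg_left e5 hk.le
    have e7 := mul_le_mul_of_nonneg_left h2.le hc.le
    have e8 : 0 < c * κ := by positivity
    have e9 := (abs_le.1 e2).2
    linarith
  have h10 := hS.isGauge.nonneg (-q s)
  have h11 : ω s (u s) (u t) * (L * S.Ψ (-q s)) ≤ L * (ε / 4) := by
    have e1 : ω s (u s) (u t) * (L * S.Ψ (-q s)) ≤ η * (L * m) := by
      have e2 : L * S.Ψ (-q s) ≤ L * m := mul_le_mul_of_nonneg_left h4.le hl0.le
      have e3 := (hω s hsI (u s) (hmem s hsI) (u t) (hmem t htI)).1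
      exact mul_le_mul h8.le e2 (mul_nonneg hl0.le h10) hη0.le
    rw [← hηm]; linarith
  have h12 := mul_le_mul_of_nonneg_left h9 hl0.le
  nlinarith

end RIS.Admissible

end

/-! ### Measurability of the power and control of energy increments -/

section

theorem ereal_coe_eq_neg_iff {r : ℝ} {x : ℝ≥0∞} :
    (r : EReal) = -(x : EReal) ↔ x ≠ ∞ ∧ x.toReal = -r := by
  constructor
  · intro h
    have hx : x ≠ ∞ := by
      rintro rfl
      simp at h
    refine ⟨hx, ?_⟩
    rw [← ENNReal.ofReal_toReal hx, EReal.coe_ennreal_ofReal, max_eq_left ENNReal.toReal_nonneg,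
      ← EReal.coe_neg, EReal.coe_eq_coe_iff] at h
    linarith
  · rintro ⟨hx, h⟩
    rw [← ENNReal.ofReal_toReal hx, EReal.coe_ennreal_ofReal, max_eq_left ENNReal.toReal_nonneg,
      ← EReal.coe_neg, EReal.coe_eq_coe_iff, h, neg_neg]

theorem ereal_add_coe_eq_iff {x : ℝ≥0∞} {a b : ℝ} :
    (x : EReal) + (a : EReal) = (b : EReal) ↔ x ≠ ∞ ∧ x.toReal + a = b := by
  constructor
  · intro h
    have hx : x ≠ ∞ := by
      rintro rfl
      simp at h
    refine ⟨hx, ?_⟩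
    rw [← ENNReal.ofReal_toReal hx, EReal.coe_ennreal_ofReal, max_eq_left ENNReal.toReal_nonneg,
      ← EReal.coe_add, EReal.coe_eq_coe_iff] at h
    exact h
  · rintro ⟨hx, h⟩
    rw [← ENNReal.ofReal_toReal hx, EReal.coe_ennreal_ofReal, max_eq_left ENNReal.toReal_nonneg,
      ← EReal.coe_add, EReal.coe_eq_coe_iff]
    exact h

namespace RIS.Admissible

variable {V : Type*} [NormedAddCommGroup V] [NormedSpace ℝ V] [CompleteSpace V] {S : RIS V}
  (hS : S.Admissible)
include hS

/-- A stable state has a subgradient bounded below by -Ψ, so by (E3) the energy cannot drop faster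
than linearly in the distance. The estimate is one-sided; a two-sided one needs stability at both
states. -/
theorem exists_energy_sub_le {e : ℝ} (he : 0 < e) : ∃ M A : ℝ, 0 ≤ M ∧ 0 ≤ A ∧
    (∀ t ∈ Ioo 0 S.T, ∀ x ∈ S.sublevel e, |S.power t x| ≤ M) ∧
    ∀ s ∈ Icc 0 S.T, ∀ t ∈ Icc 0 S.T, ∀ x ∈ S.sublevel e, ∀ y ∈ S.sublevel e, S.Stable s x →
      S.E s x - S.E t y ≤ M * |t - s| + A * ‖y - x‖ := by
  obtain ⟨M, hM, hP, hL⟩ := hS.exists_lipschitz e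
  obtain ⟨ω, B, hB, hω, -, hsub⟩ := hS.exists_uniform_subdiff he
  obtain ⟨c, hc, hcb⟩ := hS.isGauge.exists_bound
  refine ⟨M, (1 + B) * c, hM, by positivity, hP, fun s hs t ht x hx y hy ⟨ξ, hξ, hξK⟩ => ?_⟩
  have h1 := hsub s hs x hx y hy ξ hξ
  have h2 := hξK (y - x)
  have h2' : (-ξ) (y - x) = -ξ (y - x) := rfl
  have h3 := hS.isGauge.nonneg (y - x)
  have h4 := mul_le_mul_of_nonneg_right (hω s hs x hx y hy).2 h3
  have h5 := (abs_le.1 (hL y hy s hs t ht)).1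
  have h6 := mul_le_mul_of_nonneg_left (hcb (y - x)) (by positivity : 0 ≤ 1 + B)
  nlinarith

variable {u : ℝ → V} (hu : BoundedVariationOn u (Icc 0 S.T)) {e : ℝ} (he : 0 < e)
  (hmem : ∀ t ∈ Icc 0 S.T, u t ∈ S.sublevel e)
include hu he hmem

omit he hmem in
theorem continuousAt_constExt {t : ℝ} (ht : t ∈ Icc 0 S.T) (hJ : t ∉ jumpSet S.T u) :
    ContinuousAt (constExt S.T u) t := by
  rw [continuousAt_iff_continuous_left'_right']
  have h1 := tendsto_constExt_left hS.T_pos hu t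
  have h2 := tendsto_constExt_right hS.T_pos hu t
  rw [leftLimit_eq_of_notMem ht hJ, ← constExt_of_mem (u := u) ht] at h1
  rw [rightLimit_eq_of_notMem ht hJ, ← constExt_of_mem (u := u) ht] at h2
  exact ⟨h1, h2⟩

/-- The power is a limit of quotients of s ↦ E (s + h) (u s), and off the countable jump set these
energies are lower semicontinuous in s. The sets `A h` keep s + h inside [0, T], and the constant B
makes the values nonnegative. -/
theorem aestronglyMeasurable_power :
    AEStronglyMeasurable (fun s => S.power s (u s)) (volume.restrict (Ioo 0 S.T)) := by
  obtain ⟨B, hB⟩ := hS.exists_energy_bound he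
  have hJ := countable_jumpSet hS.T_pos hu
  set A : ℝ → Set ℝ := fun h => Icc 0 (S.T - h) \ jumpSet S.T u with hA
  set f : ℝ → ℝ → ℝ≥0∞ := fun h s => ENNReal.ofReal (S.E (s + h) (constExt S.T u s) + B) with hf
  have hmeas : ∀ h, 0 ≤ h → Measurable ((A h).indicator (f h)) := by
    intro h hh
    refine LowerSemicontinuousOn.measurable_indicator ?_
      (measurableSet_Icc.diff hJ.measurableSet)
    have hsub : A h ⊆ Icc 0 S.T := fun s hs => ⟨hs.1.1, hs.1.2.trans (sub_le_self _ hh)⟩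
    have hlsc : LowerSemicontinuousOn (fun s => S.E (s + h) (constExt S.T u s)) (A h) := by
      intro s hs y hy
      have hs' := hsub hs
      have hmaps : ∀ r ∈ A h, (r + h, constExt S.T u r) ∈ Icc 0 S.T ×ˢ S.D := fun r hr =>
        ⟨⟨add_nonneg hr.1.1 hh, by linarith [hr.1.2]⟩, by
          rw [constExt_of_mem (hsub hr)]; exact (hmem r (hsub hr)).1⟩
      have hct : ContinuousWithinAt (fun r => (r + h, constExt S.T u r)) (A h) s :=
        ((continuous_id.add continuous_const).continuousAt.prodMk
          (hS.continuousAt_constExt hu hs' hs.2)).continuousWithinAt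
      have htd := tendsto_nhdsWithin_iff.2 ⟨hct, eventually_mem_nhdsWithin.mono hmaps⟩
      exact htd.eventually (hS.energy_lsc _ (hmaps s hs) y hy)
    exact (ENNReal.continuous_ofReal.comp (continuous_id.add continuous_const) :
      Continuous fun x : ℝ => ENNReal.ofReal (x + B)).comp_lowerSemicontinuousOn hlsc
        fun x y hxy => ENNReal.ofReal_le_ofReal (by linarith)
  have hval : ∀ h s, 0 ≤ h → s ∈ A h →
      ((A h).indicator (f h) s).toReal = S.E (s + h) (u s) + B := by
    intro h s hh hs
    have hs' : s ∈ Icc 0 S.T := ⟨hs.1.1, hs.1.2.trans (sub_le_self _ hh)⟩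
    have h1 := (abs_le.1 (hB (s + h) ⟨add_nonneg hs.1.1 hh, by linarith [hs.1.2]⟩ (u s)
      (hmem s hs'))).1
    rw [indicator_of_mem hs, hf]
    dsimp only
    rw [constExt_of_mem hs', ENNReal.toReal_ofReal (by linarith)]
  set k : ℕ → ℝ := fun n => 1 / ((n : ℝ) + 1) with hk
  have hk0 : ∀ n, 0 < k n := fun n => Nat.one_div_pos_of_nat
  have hklim : Tendsto k atTop (𝓝 0) := tendsto_one_div_add_atTop_nhds_zero_nat
  have hseq : ∀ n, AEMeasurable (fun s => (k n)⁻¹ * (((A (k n)).indicator (f (k n)) s).toReal -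
      ((A 0).indicator (f 0) s).toReal)) (volume.restrict (Ioo 0 S.T)) := fun n =>
    (((hmeas _ (hk0 n).le).ennreal_toReal.sub (hmeas 0 le_rfl).ennreal_toReal).const_mul
      _).aemeasurable
  refine (aemeasurable_of_tendsto_metrizable_ae atTop hseq ?_).aestronglyMeasurable
  filter_upwards [ae_restrict_mem measurableSet_Ioo,
    ae_notMem_of_countable hJ (volume.restrict (Ioo 0 S.T))] with s hs hsJ
  have hd := hasDerivAt_iff_tendsto_slope_zero.1
    (hS.hasDerivAt (hmem s (Ioo_subset_Icc_self hs)).1 hs)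
  have hk' : Tendsto k atTop (𝓝[≠] 0) :=
    tendsto_nhdsWithin_iff.2 ⟨hklim, Eventually.of_forall fun n => (hk0 n).ne'⟩
  refine (hd.comp hk').congr' ?_
  filter_upwards [hklim.eventually_lt_const (sub_pos.2 hs.2)] with n hn
  rw [hval _ s (hk0 n).le ⟨⟨hs.1.le, by linarith⟩, hsJ⟩,
    hval 0 s le_rfl ⟨⟨hs.1.le, by linarith [hs.2]⟩, hsJ⟩, add_zero]
  simp only [Function.comp, smul_eq_mul]
  ring

theorem integrableOn_power : IntegrableOn (fun s => S.power s (u s)) (Ioo 0 S.T) := by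
  obtain ⟨M, hM, hP, -⟩ := hS.exists_lipschitz e
  refine Integrable.mono' (integrableOn_const (C := M) measure_Ioo_lt_top.ne)
    (hS.aestronglyMeasurable_power hu he hmem) ?_
  filter_upwards [ae_restrict_mem measurableSet_Ioo] with s hs
  exact hP s hs _ (hmem s (Ioo_subset_Icc_self hs))

variable (hst : ∀ t ∈ Icc 0 S.T, t ∉ jumpSet S.T u → S.Stable t (u t))
include hst

theorem jumpVariation_finslerCost_split {a b c : ℝ} (ha : 0 ≤ a) (hab : a < b) (hbc : b < c)
    (hc : c ≤ S.T) : jumpVariation S.finslerCost S.T u a c =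
      jumpVariation S.finslerCost S.T u a b + jumpVariation S.finslerCost S.T u b c := by
  rw [jumpVariation_eq, jumpVariation_eq, jumpVariation_eq]
  exact jumpSum_split hab hbc fun h => hS.finslerCost_self_of_notMem hu he hmem hst
    ⟨ha.trans hab.le, hbc.le.trans hc⟩ h

theorem jumpVariation_finslerCost_le {s t : ℝ} (hs : 0 ≤ s) (hst' : s < t) (ht : t ≤ S.T) :
    jumpVariation S.finslerCost S.T u s t ≤ jumpVariation S.finslerCost S.T u 0 S.T := by
  have h1 : jumpVariation S.finslerCost S.T u s t ≤ jumpVariation S.finslerCost S.T u 0 t := by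
    rcases hs.eq_or_lt with rfl | hs'
    · exact le_rfl
    · rw [hS.jumpVariation_finslerCost_split hu he hmem hst le_rfl hs' hst' ht]; exact le_add_self
  refine h1.trans ?_
  rcases ht.eq_or_lt with rfl | ht'
  · exact le_rfl
  · rw [hS.jumpVariation_finslerCost_split hu he hmem hst le_rfl (hs.trans_lt hst') ht' le_rfl]
    exact le_self_add

variable (hjc : S.JumpConditions u)
include hjc

theorem finslerCost_left_eq {t : ℝ} (ht : t ∈ Icc 0 S.T) :
    S.finslerCost t (leftLimit S.T u t) (u t) ≠ ∞ ∧
      (S.finslerCost t (leftLimit S.T u t) (u t)).toReal =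
        S.E t (leftLimit S.T u t) - S.E t (u t) := by
  by_cases hJ : t ∈ jumpSet S.T u
  · have := ereal_coe_eq_neg_iff.1 (hjc t hJ).1
    rwa [neg_sub] at this
  · rw [(hS.finslerCost_self_of_notMem hu he hmem hst ht hJ).1, leftLimit_eq_of_notMem ht hJ]
    simp

theorem finslerCost_right_eq {t : ℝ} (ht : t ∈ Icc 0 S.T) :
    S.finslerCost t (u t) (rightLimit S.T u t) ≠ ∞ ∧
      (S.finslerCost t (u t) (rightLimit S.T u t)).toReal =
        S.E t (u t) - S.E t (rightLimit S.T u t) := by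
  by_cases hJ : t ∈ jumpSet S.T u
  · have := ereal_coe_eq_neg_iff.1 (hjc t hJ).2.1
    rwa [neg_sub] at this
  · rw [(hS.finslerCost_self_of_notMem hu he hmem hst ht hJ).2, rightLimit_eq_of_notMem ht hJ]
    simp

/-- At a jump the two half costs add up to the energy drop from the left to the right limit. The
left limit is stable, so the drop is at most A times the jump size, and the jump sizes are summable.
The boundary jumps are finite by the jump conditions. -/
theorem jumpVariation_finslerCost_ne_top :
    jumpVariation S.finslerCost S.T u 0 S.T ≠ ∞ := by
  obtain ⟨M, A, hM, hA, -, hEs⟩ := hS.exists_energy_sub_le he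
  have hT := hS.T_pos
  have hterm : ∀ t ∈ Ioc 0 S.T, S.finslerCost t (leftLimit S.T u t) (u t) +
      S.finslerCost t (u t) (rightLimit S.T u t) ≤ ENNReal.ofReal A *
        (ENNReal.ofReal ‖u t - leftLimit S.T u t‖ + ENNReal.ofReal ‖rightLimit S.T u t - u t‖) := by
    intro t ht
    have htI := Ioc_subset_Icc_self ht
    obtain ⟨h1, h2⟩ := hS.finslerCost_left_eq hu he hmem hst hjc htI
    obtain ⟨h3, h4⟩ := hS.finslerCost_right_eq hu he hmem hst hjc htI
    have h5 := hEs t htI t htI _ (hS.leftLimit_mem_sublevel hu he hmem htI) _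
      (hS.rightLimit_mem_sublevel hu he hmem htI) (hS.stable_tendsto_left hu he hmem hst ht).1
    rw [← ENNReal.ofReal_toReal h1, ← ENNReal.ofReal_toReal h3, h2, h4,
      ← ENNReal.ofReal_add (h2 ▸ ENNReal.toReal_nonneg) (h4 ▸ ENNReal.toReal_nonneg),
      ← ENNReal.ofReal_add (norm_nonneg _) (norm_nonneg _), ← ENNReal.ofReal_mul hA]
    refine ENNReal.ofReal_le_ofReal ?_
    have h6 := norm_sub_le_norm_sub_add_norm_sub (rightLimit S.T u t) (u t) (leftLimit S.T u t)
    have h7 := mul_le_mul_of_nonneg_left h6 hA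
    rw [sub_self, abs_zero, mul_zero, zero_add] at h5
    linarith
  have h0 := (hS.finslerCost_right_eq hu he hmem hst hjc ⟨le_rfl, hT.le⟩).1
  have h1 := (hS.finslerCost_left_eq hu he hmem hst hjc ⟨hT.le, le_rfl⟩).1
  rw [jumpVariation]
  refine ENNReal.add_ne_top.2 ⟨ENNReal.add_ne_top.2 ⟨h0, h1⟩, ?_⟩
  refine ne_top_of_le_ne_top (ENNReal.mul_ne_top (ENNReal.ofReal_ne_top (r := A))
    (gaugeJump_norm_ne_top hT hu)) ?_
  rw [gaugeJump, jumpSum, mul_add, ← ENNReal.tsum_mul_left]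
  exact (ENNReal.tsum_le_tsum fun t : ↥(jumpSet S.T u ∩ Ioo 0 S.T) =>
    hterm t.1 ⟨t.2.2.1, t.2.2.2.le⟩).trans le_add_self

variable {g : ℝ → V} (hg : Integrable g (refMeasure hS.T_pos hu))
  (hgd : diffusePart hS.T_pos hu = (refMeasure hS.T_pos hu).withDensityᵥ g)
include hg hgd

/-- At a jump time u itself may be unstable. The increment is therefore routed through the right
limit at s and the left limit at t, both stable, where `exists_energy_sub_le` applies in both
directions; the two remaining pieces are half-jump costs. -/
theorem exists_abs_energy_sub_le : ∃ K, 0 ≤ K ∧ (∀ t ∈ Ioo 0 S.T, |S.power t (u t)| ≤ K) ∧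
    (∀ v, S.Ψ v ≤ K * ‖v‖) ∧ 1 ≤ K ∧
    ∀ s t, 0 ≤ s → s < t → t ≤ S.T → |S.E t (u t) - S.E s (u s)| ≤
      K * ((gaugeJump (fun v : V => ‖v‖) S.T u s t).toReal +
        (jumpVariation S.finslerCost S.T u s t).toReal +
        ((t - s) + ∫ r in Ioo s t, ‖(Ioo 0 S.T).indicator g r‖ ∂(lineMeasure hS.T_pos hu))) := by
  have hT := hS.T_pos
  obtain ⟨M, A, hM, hA, hP, hEs⟩ := hS.exists_energy_sub_le he
  obtain ⟨c, hc, hcb⟩ := hS.isGauge.exists_bound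
  set K := 1 + M + 2 * A + c with hK
  refine ⟨K, by positivity, fun t ht => (hP t ht _ (hmem t (Ioo_subset_Icc_self ht))).trans
    (by linarith), fun v => (hcb v).trans (mul_le_mul_of_nonneg_right (by linarith)
    (norm_nonneg v)), by linarith, fun s t hs hst' ht => ?_⟩
  have hsI : s ∈ Ico 0 S.T := ⟨hs, hst'.trans_le ht⟩
  have htI : t ∈ Ioc 0 S.T := ⟨hs.trans_lt hst', ht⟩
  have hsC := Ico_subset_Icc_self hsI
  have htC := Ioc_subset_Icc_self htI
  obtain ⟨hl1, hl2⟩ := hS.finslerCost_left_eq hu he hmem hst hjc htC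
  obtain ⟨hr1, hr2⟩ := hS.finslerCost_right_eq hu he hmem hst hjc hsC
  have hlm := hS.leftLimit_mem_sublevel hu he hmem htC
  have hrm := hS.rightLimit_mem_sublevel hu he hmem hsC
  have h1 := hEs t htC s hsC _ hlm _ hrm (hS.stable_tendsto_left hu he hmem hst htI).1
  have h2 := hEs s hsC t htC _ hrm _ hlm (hS.stable_tendsto_right hu he hmem hst hsI).1
  rw [abs_sub_comm, abs_of_pos (sub_pos.2 hst'), norm_sub_rev] at h1
  rw [abs_of_pos (sub_pos.2 hst')] at h2
  have hJfin : jumpVariation S.finslerCost S.T u s t ≠ ∞ := ne_top_of_le_ne_top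
    (hS.jumpVariation_finslerCost_ne_top hu he hmem hst hjc)
    (hS.jumpVariation_finslerCost_le hu he hmem hst hs hst' ht)
  have h3 : (S.finslerCost t (leftLimit S.T u t) (u t)).toReal +
      (S.finslerCost s (u s) (rightLimit S.T u s)).toReal ≤
      (jumpVariation S.finslerCost S.T u s t).toReal := by
    rw [← ENNReal.toReal_add hl1 hr1]
    refine ENNReal.toReal_mono hJfin ?_
    rw [jumpVariation, add_comm]
    exact le_self_add
  have hnfin := gaugeJump_ne_top' hT hu isGauge_norm hs hst' ht
  have h4 : ‖u t - leftLimit S.T u t‖ + ‖rightLimit S.T u s - u s‖ ≤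
      (gaugeJump (fun v : V => ‖v‖) S.T u s t).toReal := by
    rw [← ENNReal.ofReal_le_iff_le_toReal hnfin, ENNReal.ofReal_add (norm_nonneg _) (norm_nonneg _),
      gaugeJump, jumpSum, add_comm (ENNReal.ofReal ‖u t - _‖)]
    exact le_self_add
  have hGi := integrable_indicator_density hT hu hg
  have h5 : ‖u t - u s‖ ≤ (gaugeJump (fun v : V => ‖v‖) S.T u s t).toReal +
      ∫ r in Ioo s t, ‖(Ioo 0 S.T).indicator g r‖ ∂(lineMeasure hT hu) := by
    have h := gauge_sub_le hT hu hg hgd isGauge_norm hs hst' ht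
    rw [← ofReal_integral_eq_lintegral_ofReal hGi.norm.integrableOn
      (Eventually.of_forall fun _ => norm_nonneg _), ← ENNReal.ofReal_toReal hnfin,
      ← ENNReal.ofReal_add ENNReal.toReal_nonneg (integral_nonneg fun _ => norm_nonneg _)] at h
    exact (ENNReal.ofReal_le_ofReal_iff (add_nonneg ENNReal.toReal_nonneg
      (integral_nonneg fun _ => norm_nonneg _))).1 h
  have h6 : ‖leftLimit S.T u t - rightLimit S.T u s‖ ≤ ‖u t - leftLimit S.T u t‖ + ‖u t - u s‖ +
      ‖rightLimit S.T u s - u s‖ := by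
    have e1 : leftLimit S.T u t - rightLimit S.T u s =
        -(u t - leftLimit S.T u t) + (u t - u s) - (rightLimit S.T u s - u s) := by abel
    rw [e1]
    refine (norm_sub_le _ _).trans (add_le_add_left ((norm_add_le _ _).trans ?_) _)
    rw [norm_neg]
  set X := (gaugeJump (fun v : V => ‖v‖) S.T u s t).toReal
  set Y := (jumpVariation S.finslerCost S.T u s t).toReal
  set Z := ∫ r in Ioo s t, ‖(Ioo 0 S.T).indicator g r‖ ∂(lineMeasure hT hu) with hZ
  have hX : 0 ≤ X := ENNReal.toReal_nonneg
  have hY : 0 ≤ Y := ENNReal.toReal_nonneg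
  have hZ0 : 0 ≤ Z := integral_nonneg fun _ => norm_nonneg _
  have h7 : A * ‖leftLimit S.T u t - rightLimit S.T u s‖ ≤ A * (2 * X + Z) :=
    mul_le_mul_of_nonneg_left (by linarith) hA
  have h8 : Y + M * (t - s) + A * (2 * X + Z) ≤ K * (X + Y + ((t - s) + Z)) := by
    have e1 : 0 < t - s := sub_pos.2 hst'
    have e2 : K * (X + Y + ((t - s) + Z)) - (Y + M * (t - s) + A * (2 * X + Z)) =
      (1 + M + c) * X + (M + 2 * A + c) * Y + (1 + 2 * A + c) * (t - s) +
        (1 + M + A + c) * Z := by rw [hK]; ring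
    have e3 : 0 ≤ (1 + M + c) * X + (M + 2 * A + c) * Y + (1 + 2 * A + c) * (t - s) +
        (1 + M + A + c) * Z := by positivity
    linarith
  have hd1 : 0 ≤ (S.finslerCost t (leftLimit S.T u t) (u t)).toReal := ENNReal.toReal_nonneg
  have hd2 : 0 ≤ (S.finslerCost s (u s) (rightLimit S.T u s)).toReal := ENNReal.toReal_nonneg
  rw [abs_le]
  constructor <;> linarith

end RIS.Admissible

end

/-! ### Sufficiency of the inclusion and the jump conditions -/

section

namespace RIS.Admissible

variable {V : Type*} [NormedAddCommGroup V] [NormedSpace ℝ V] [CompleteSpace V] {S : RIS V}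
  (hS : S.Admissible) {u : ℝ → V} (hu : BoundedVariationOn u (Icc 0 S.T)) {e : ℝ} (he : 0 < e)
  (hmem : ∀ t ∈ Icc 0 S.T, u t ∈ S.sublevel e)
  (hst : ∀ t ∈ Icc 0 S.T, t ∉ jumpSet S.T u → S.Stable t (u t)) (hjc : S.JumpConditions u)
  {g : ℝ → V} (hg : Integrable g (refMeasure hS.T_pos hu))
  (hgd : diffusePart hS.T_pos hu = (refMeasure hS.T_pos hu).withDensityᵥ g)
include hS hu he hmem hst hjc hg hgd

/-- The energy balance of a curve which satisfies the inclusion and the jump conditions. -/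
theorem energy_balance (hinc : ∀ᵐ t ∂(lineMeasure hS.T_pos hu), t ∈ Ioo 0 S.T →
      0 ∈ S.gaugeSubdiff (g t) + S.energySubdiff t (u t)) {b : ℝ} (hb : b ∈ Ioc 0 S.T) :
    ∫ r in Ioo 0 b, S.Ψ ((Ioo 0 S.T).indicator g r) ∂(lineMeasure hS.T_pos hu) +
      (jumpVariation S.finslerCost S.T u 0 b).toReal + S.E b (u b) =
    S.E 0 (u 0) + ∫ s in Ioo 0 b, S.power s (u s) := by
  have hT := hS.T_pos
  obtain ⟨K, hK0, hP, hΨ, hK1, hK⟩ := hS.exists_abs_energy_sub_le hu he hmem hst hjc hg hgd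
  set l := lineMeasure hT hu with hl
  have hl1 : volume ≤ l := volume_le_lineMeasure hT hu
  set G := (Ioo 0 S.T).indicator g with hG
  have hGi : Integrable G l := integrable_indicator_density hT hu hg
  set p : ℝ → ℝ := (Ioo 0 S.T).indicator fun s => S.power s (u s) with hp
  have hpi : Integrable p :=
    (integrable_indicator_iff measurableSet_Ioo).2 (hS.integrableOn_power hu he hmem)
  set χ : ℝ → ℝ := (Ioo 0 S.T).indicator fun _ => 1 with hχ
  have hχi : Integrable χ := (integrable_indicator_iff measurableSet_Ioo).2
    (integrableOn_const measure_Ioo_lt_top.ne)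
  -- w is the l-density of the control function for energy increments, and d below is the expected
  -- l-derivative of the energy along u.
  set w : ℝ → ℝ := fun t => lebesgueDensity l t * χ t + ‖G t‖ with hw
  set d : ℝ → ℝ := fun t => lebesgueDensity l t * p t - S.Ψ (G t) with hd
  have hwi : Integrable w l := (integrable_lebesgueDensity_mul hl1 hχi).add hGi.norm
  have hΨi : Integrable (fun t => S.Ψ (G t)) l := hS.isGauge.integrable_comp hGi
  have hdp : Integrable (fun t => lebesgueDensity l t * p t) l :=
    integrable_lebesgueDensity_mul hl1 hpi
  have hdi : Integrable d l := hdp.sub hΨi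
  have hdw : ∀ t, |d t| ≤ K * w t := by
    intro t
    have h1 : |p t| ≤ K * χ t := by
      by_cases ht : t ∈ Ioo 0 S.T
      · simp only [hp, hχ, indicator_of_mem ht, mul_one]; exact hP t ht
      · simp [hp, hχ, indicator_of_notMem ht]
    have h2 := hΨ (G t)
    have h3 := hS.isGauge.nonneg (G t)
    have h4 : |lebesgueDensity l t * p t| ≤ lebesgueDensity l t * (K * χ t) := by
      rw [abs_mul, abs_of_nonneg (lebesgueDensity_nonneg t)]
      exact mul_le_mul_of_nonneg_left h1 (lebesgueDensity_nonneg t)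
    refine (abs_sub _ _).trans ?_
    rw [abs_of_nonneg h3]
    simp only [hw]
    linarith
  have hwint : ∀ s t, 0 ≤ s → s < t → t ≤ S.T →
      ∫ r in Ioo s t, w r ∂l = (t - s) + ∫ r in Ioo s t, ‖G r‖ ∂l := by
    intro s t hs hst' ht
    have hsub : Ioo s t ⊆ Ioo 0 S.T := Ioo_subset_Ioo hs ht
    rw [integral_add (integrable_lebesgueDensity_mul hl1 hχi).integrableOn hGi.norm.integrableOn,
      setIntegral_lebesgueDensity_mul hl1 _ measurableSet_Ioo,
      setIntegral_congr_fun (g := fun _ => (1 : ℝ)) measurableSet_Ioo fun r hr =>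
        indicator_of_mem (hsub hr) _]
    simp [hst'.le]
  have hdint : ∫ r in Ioo 0 b, d r ∂l =
      (∫ s in Ioo 0 b, S.power s (u s)) - ∫ r in Ioo 0 b, S.Ψ (G r) ∂l := by
    rw [integral_sub hdp.integrableOn hΨi.integrableOn,
      setIntegral_lebesgueDensity_mul hl1 _ measurableSet_Ioo]
    congr 1
    exact setIntegral_congr_fun measurableSet_Ioo fun r hr =>
      indicator_of_mem (Ioo_subset_Ioo_right hb.2 hr) fun s => S.power s (u s)
  have hdt : ∀ t ∈ Ioo 0 S.T, d t = lebesgueDensity l t * S.power t (u t) - S.Ψ (G t) :=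
    fun t ht => by simp only [hd, hp, indicator_of_mem ht]
  have hsubI : ∀ r ∈ Ioc 0 b, r ∈ Ioc 0 S.T := fun r hr => ⟨hr.1, hr.2.trans hb.2⟩
  have hsubI' : ∀ r ∈ Ico 0 b, r ∈ Ico 0 S.T := fun r hr => ⟨hr.1, hr.2.trans_le hb.2⟩
  have hJb : jumpVariation S.finslerCost S.T u 0 b ≠ ∞ := ne_top_of_le_ne_top
    (hS.jumpVariation_finslerCost_ne_top hu he hmem hst hjc)
    (hS.jumpVariation_finslerCost_le hu he hmem hst le_rfl hb.1 hb.2)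
  have hnb := gaugeJump_ne_top' hT hu isGauge_norm le_rfl hb.1 hb.2
  have h0 : ∀ t ∈ Ioo 0 b, t ∉ jumpSet S.T u →
      (ENNReal.ofReal ‖u t - leftLimit S.T u t‖ = 0 ∧
        ENNReal.ofReal ‖rightLimit S.T u t - u t‖ = 0) ∧
      S.finslerCost t (leftLimit S.T u t) (u t) = 0 ∧
        S.finslerCost t (u t) (rightLimit S.T u t) = 0 := by
    intro t ht hJ
    have htI : t ∈ Icc 0 S.T := ⟨ht.1.le, ht.2.le.trans hb.2⟩
    refine ⟨?_, hS.finslerCost_self_of_notMem hu he hmem hst htI hJ⟩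
    rw [leftLimit_eq_of_notMem htI hJ, rightLimit_eq_of_notMem htI hJ]
    simp
  have hleft : ∀ r ∈ Ioc 0 b, Tendsto (fun s => S.E r (u r) - S.E s (u s))
      (𝓝[<] r ⊓ 𝓟 (jumpSet S.T u)ᶜ)
      (𝓝 (-(S.finslerCost r (leftLimit S.T u r) (u r)).toReal)) := by
    intro r hr
    rw [(hS.finslerCost_left_eq hu he hmem hst hjc (Ioc_subset_Icc_self (hsubI r hr))).2, neg_sub]
    exact (hS.stable_tendsto_left hu he hmem hst (hsubI r hr)).2.const_sub _
  have hright : ∀ r ∈ Ico 0 b, Tendsto (fun s => S.E s (u s) - S.E r (u r))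
      (𝓝[>] r ⊓ 𝓟 (jumpSet S.T u)ᶜ)
      (𝓝 (-(S.finslerCost r (u r) (rightLimit S.T u r)).toReal)) := by
    intro r hr
    rw [(hS.finslerCost_right_eq hu he hmem hst hjc (Ico_subset_Icc_self (hsubI' r hr))).2, neg_sub]
    exact (hS.stable_tendsto_right hu he hmem hst (hsubI' r hr)).2.sub_const _
  have hKb : ∀ s t, 0 ≤ s → s < t → t ≤ b → |S.E t (u t) - S.E s (u s)| ≤
      K * ((gaugeJump (fun v : V => ‖v‖) S.T u s t).toReal +
        (jumpVariation S.finslerCost S.T u s t).toReal + ∫ r in Ioo s t, w r ∂l) := by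
    intro s t hs hst' ht
    rw [hwint s t hs hst' (ht.trans hb.2)]
    exact hK s t hs hst' (ht.trans hb.2)
  have hnbL : ∀ r, (𝓝[<] r ⊓ 𝓟 (jumpSet S.T u)ᶜ).NeBot := neBot_left_jumpSet_compl hu hT
  have hnbR : ∀ r, (𝓝[>] r ⊓ 𝓟 (jumpSet S.T u)ᶜ).NeBot := neBot_right_jumpSet_compl hu hT
  -- The lower bound needs only stability; κ = -1 because the energy drops by the Finsler cost at
  -- jumps. Limits along the complement of the jump set suffice, since only frequent s are required.
  have hlow := jumpSum_add_integral_le_sub hl1 (countable_jumpSet hT hu) hb.1 h0 hnb hJb hwi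
    (e := fun t => S.E t (u t)) (κ := -1) hK0 (by linarith) hKb
    (fun r hr ε hε => by
      have h1 := (hleft r hr).eventually_const_lt (sub_lt_self _ hε)
      exact ((h1.mono fun s hs => by linarith).frequently).filter_mono inf_le_left)
    (fun r hr ε hε => by
      have h1 := (hright r hr).eventually_const_lt (sub_lt_self _ hε)
      exact ((h1.mono fun s hs => by linarith).frequently).filter_mono inf_le_left)
    hdi hdw (by
      filter_upwards [hS.ae_le_left_quotient hu he hmem hg hgd hst] with t ht htb ε hε
      have htT : t ∈ Ioo 0 S.T := ⟨htb.1, htb.2.trans_le hb.2⟩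
      right
      rw [hdt t htT]
      exact ht htT ε hε)
  -- The same lemma for the negative energy, with κ = 1; here the full inclusion enters, through
  -- right quotients.
  have hupp := jumpSum_add_integral_le_sub hl1 (countable_jumpSet hT hu) hb.1 h0 hnb hJb hwi
    (e := fun t => -S.E t (u t)) (κ := 1) (d := fun t => -d t) hK0 (by linarith)
    (fun s t hs hst' ht => by
      have h1 := hKb s t hs hst' ht
      rwa [← abs_neg, neg_sub, ← neg_sub_neg] at h1)
    (fun r hr ε hε => by
      have h1 := (hleft r hr).eventually_lt_const (lt_add_of_pos_right _ hε)
      exact ((h1.mono fun s hs => by linarith).frequently).filter_mono inf_le_left)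
    (fun r hr ε hε => by
      have h1 := (hright r hr).eventually_lt_const (lt_add_of_pos_right _ hε)
      exact ((h1.mono fun s hs => by linarith).frequently).filter_mono inf_le_left)
    hdi.neg (fun t => by rw [abs_neg]; exact hdw t) (by
      filter_upwards [hS.ae_le_right_quotient hu he hmem hg hgd hinc] with t ht htb ε hε
      have htT : t ∈ Ioo 0 S.T := ⟨htb.1, htb.2.trans_le hb.2⟩
      left
      rw [hdt t htT, neg_sub]
      refine (ht htT ε hε).mono fun s hs => ?_
      linarith)
  rw [integral_neg] at hupp
  rw [hdint] at hlow hupp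
  rw [jumpVariation_eq]
  linarith

end RIS.Admissible

namespace RIS

variable {V : Type*} [NormedAddCommGroup V] [NormedSpace ℝ V] [CompleteSpace V] {S : RIS V}

/-- The jump variation of Ψ is finite, so the truncated subtraction in the definition is exact and
leaves ∫ Ψ(g) dl. -/
theorem finslerVariation_eq (hS : S.Admissible) {u : ℝ → V}
    (hu : BoundedVariationOn u (Icc 0 S.T)) {g : ℝ → V}
    (hg : Integrable g (refMeasure hS.T_pos hu))
    (hgd : diffusePart hS.T_pos hu = (refMeasure hS.T_pos hu).withDensityᵥ g) {t : ℝ}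
    (ht : t ∈ Ioc 0 S.T) :
    S.finslerVariation u 0 t =
      ENNReal.ofReal (∫ r in Ioo 0 t, S.Ψ ((Ioo 0 S.T).indicator g r) ∂(lineMeasure hS.T_pos hu)) +
        jumpVariation S.finslerCost S.T u 0 t := by
  have hΨi := hS.isGauge.integrable_comp (integrable_indicator_density hS.T_pos hu hg)
  have h1 : jumpVariation S.gaugeCost S.T u 0 t = gaugeJump S.Ψ S.T u 0 t := rfl
  rw [finslerVariation, gaugeVariation_eq hS.T_pos hu hg hgd hS.isGauge ht, h1,
    ENNReal.add_sub_cancel_left (gaugeJump_ne_top' hS.T_pos hu hS.isGauge le_rfl ht.1 ht.2),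
    ofReal_integral_eq_lintegral_ofReal hΨi.integrableOn
      (Eventually.of_forall fun _ => hS.isGauge.nonneg _)]

theorem intervalIntegral_power_eq {u : ℝ → V} {t : ℝ} (ht : 0 ≤ t) :
    ∫ s in (0 : ℝ)..t, S.power s (u s) = ∫ s in Ioo 0 t, S.power s (u s) := by
  rw [intervalIntegral.integral_of_le ht, setIntegral_congr_set Ioo_ae_eq_Ioc]

/-- The energy balance in terms of real numbers. -/
theorem energy_balance_iff (hS : S.Admissible) {u : ℝ → V}
    (hu : BoundedVariationOn u (Icc 0 S.T)) {g : ℝ → V}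
    (hg : Integrable g (refMeasure hS.T_pos hu))
    (hgd : diffusePart hS.T_pos hu = (refMeasure hS.T_pos hu).withDensityᵥ g) {t : ℝ}
    (ht : t ∈ Ioc 0 S.T) :
    (S.finslerVariation u 0 t : EReal) + (S.E t (u t) : EReal) =
      ((S.E 0 (u 0) + ∫ s in (0 : ℝ)..t, S.power s (u s) : ℝ) : EReal) ↔
    jumpVariation S.finslerCost S.T u 0 t ≠ ∞ ∧
      ∫ r in Ioo 0 t, S.Ψ ((Ioo 0 S.T).indicator g r) ∂(lineMeasure hS.T_pos hu) +
        (jumpVariation S.finslerCost S.T u 0 t).toReal + S.E t (u t) =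
      S.E 0 (u 0) + ∫ s in Ioo 0 t, S.power s (u s) := by
  rw [ereal_add_coe_eq_iff, finslerVariation_eq hS hu hg hgd ht, intervalIntegral_power_eq ht.1.le]
  have h0 : 0 ≤ ∫ r in Ioo 0 t, S.Ψ ((Ioo 0 S.T).indicator g r) ∂(lineMeasure hS.T_pos hu) :=
    integral_nonneg fun _ => hS.isGauge.nonneg _
  constructor
  · rintro ⟨h1, h2⟩
    have h3 := (ENNReal.add_ne_top.1 h1).2
    rw [ENNReal.toReal_add ENNReal.ofReal_ne_top h3, ENNReal.toReal_ofReal h0] at h2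
    exact ⟨h3, h2⟩
  · rintro ⟨h1, h2⟩
    refine ⟨ENNReal.add_ne_top.2 ⟨ENNReal.ofReal_ne_top, h1⟩, ?_⟩
    rwa [ENNReal.toReal_add ENNReal.ofReal_ne_top h1, ENNReal.toReal_ofReal h0]

/-- The inclusion and the jump conditions characterize balanced viscosity solutions: sufficiency. -/
theorem isBVSolution_of_inclusion (hS : S.Admissible) {u : ℝ → V}
    (hu : BoundedVariationOn u (Icc 0 S.T)) {e : ℝ} (he : 0 < e)
    (hmem : ∀ t ∈ Icc 0 S.T, u t ∈ S.sublevel e) (hinc : S.InclusionBV hS.T_pos hu)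
    (hjc : S.JumpConditions u) : S.IsBVSolution u := by
  have hT := hS.T_pos
  obtain ⟨g, hg, hgd, hinc⟩ := hinc
  rw [← lineMeasure_restrict, ae_restrict_iff' measurableSet_Ioo] at hinc
  have hst : ∀ t ∈ Icc 0 S.T, t ∉ jumpSet S.T u → S.Stable t (u t) := by
    intro t ht hJ
    refine hS.stable_of_ae hu he hmem ?_ ht hJ
    filter_upwards [ae_mono (volume_le_lineMeasure hT hu) hinc] with s hs hsT
    obtain ⟨ξ, h1, h2, -⟩ := hS.zero_mem_gaugeSubdiff_add.1 (hs hsT)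
    exact ⟨ξ, h1, h2⟩
  have hJT := hS.jumpVariation_finslerCost_ne_top hu he hmem hst hjc
  refine ⟨fun t ht => (hmem t ht).1, ?_, ?_, ?_, ?_⟩
  · have hΨi := hS.isGauge.integrable_comp (integrable_indicator_density hT hu hg)
    rw [gaugeVariation_eq hT hu hg hgd hS.isGauge ⟨hT, le_rfl⟩]
    refine ENNReal.add_ne_top.2 ⟨gaugeJump_ne_top hT hu hS.isGauge, ?_⟩
    rw [← ofReal_integral_eq_lintegral_ofReal hΨi.integrableOn
      (Eventually.of_forall fun _ => hS.isGauge.nonneg _)]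
    exact ENNReal.ofReal_ne_top
  · rintro t ⟨ht, hJ⟩
    exact zero_mem_stableSet_add.2 (hst t ht hJ)
  · rw [intervalIntegrable_iff_integrableOn_Ioo_of_le hT.le]
    exact hS.integrableOn_power hu he hmem
  · intro t ht
    refine (energy_balance_iff hS hu hg hgd ht).2 ⟨ne_top_of_le_ne_top hJT
      (hS.jumpVariation_finslerCost_le hu he hmem hst le_rfl ht.1 ht.2), ?_⟩
    exact hS.energy_balance hu he hmem hst hjc hg hgd hinc ht

end RIS

end

/-! ### Necessity of the inclusion and the jump conditions -/

section

namespace RIS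

variable {V : Type*} [NormedAddCommGroup V] [NormedSpace ℝ V] [CompleteSpace V] {S : RIS V}
  {u : ℝ → V}

namespace IsBVSolution

variable (h : S.IsBVSolution u) (hS : S.Admissible) (hu : BoundedVariationOn u (Icc 0 S.T))
include h hS

theorem stable {t : ℝ} (ht : t ∈ Icc 0 S.T) (hJ : t ∉ jumpSet S.T u) : S.Stable t (u t) :=
  zero_mem_stableSet_add.1 (h.local_stability t ⟨ht, hJ⟩)

theorem integrableOn_power : IntegrableOn (fun s => S.power s (u s)) (Ioo 0 S.T) := by
  rw [← intervalIntegrable_iff_integrableOn_Ioo_of_le hS.T_pos.le]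
  exact h.power_integrable

variable {g : ℝ → V} (hg : Integrable g (refMeasure hS.T_pos hu))
  (hgd : diffusePart hS.T_pos hu = (refMeasure hS.T_pos hu).withDensityᵥ g)
include hg hgd

/-- Dissipation is nonnegative, so the balance bounds the energy by its initial value plus ∫ |P|,
while Ψ(u t) is bounded through the variation. By Gronwall, a bound at one time per state is enough
for a common sublevel. -/
theorem exists_sublevel : ∃ e > 0, ∀ t ∈ Icc 0 S.T, u t ∈ S.sublevel e := by
  have hT := hS.T_pos
  set C := |S.E 0 (u 0)| + ∫ s in Ioo 0 S.T, ‖S.power s (u s)‖ with hC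
  have hC0 : 0 ≤ ∫ s in Ioo 0 S.T, ‖S.power s (u s)‖ := integral_nonneg fun _ => norm_nonneg _
  have hE : ∀ t ∈ Icc 0 S.T, S.E t (u t) ≤ C := by
    intro t ht
    rcases ht.1.eq_or_lt with rfl | h0
    · exact (le_abs_self _).trans (by linarith)
    · obtain ⟨-, h2⟩ := (energy_balance_iff hS hu hg hgd ⟨h0, ht.2⟩).1
        (h.energy_balance t ⟨h0, ht.2⟩)
      have h3 : ∫ s in Ioo 0 t, S.power s (u s) ≤ ∫ s in Ioo 0 S.T, ‖S.power s (u s)‖ :=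
        (le_abs_self _).trans ((norm_integral_le_integral_norm _).trans
          (setIntegral_mono_set (h.integrableOn_power hS).norm
            (Eventually.of_forall fun _ => norm_nonneg _)
            (Ioo_subset_Ioo_right ht.2).eventuallyLE))
      have h4 : 0 ≤ ∫ r in Ioo 0 t, S.Ψ ((Ioo 0 S.T).indicator g r) ∂(lineMeasure hT hu) :=
        integral_nonneg fun _ => hS.isGauge.nonneg _
      have h5 : 0 ≤ (jumpVariation S.finslerCost S.T u 0 t).toReal := ENNReal.toReal_nonneg
      have h6 := le_abs_self (S.E 0 (u 0))
      linarith
  have hΨ : ∀ t ∈ Icc 0 S.T, S.Ψ (u t) ≤ S.Ψ (u 0) + (gaugeVariation S.Ψ u 0 S.T).toReal := by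
    intro t ht
    have h1 : ENNReal.ofReal (S.Ψ (u t - u 0)) ≤ gaugeVariation S.Ψ u 0 S.T :=
      le_add_self.trans ((gaugeVariation_add_le S.Ψ u le_rfl ht.1).trans
        (gaugeVariation_mono S.Ψ u ht.1 ht.2))
    have h2 := (ENNReal.ofReal_le_iff_le_toReal h.finite_variation).1 h1
    linarith [hS.isGauge.sub_le (u t) (u 0)]
  obtain ⟨e, he, hsub⟩ := hS.exists_sublevel (S.Ψ (u 0) + (gaugeVariation S.Ψ u 0 S.T).toReal + C)
  exact ⟨e, he, fun t ht => hsub t ht _ (h.mem_domain t ht) (by linarith [hE t ht, hΨ t ht])⟩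

theorem jumpVariation_ne_top : jumpVariation S.finslerCost S.T u 0 S.T ≠ ∞ :=
  ((energy_balance_iff hS hu hg hgd ⟨hS.T_pos, le_rfl⟩).1
    (h.energy_balance S.T ⟨hS.T_pos, le_rfl⟩)).1

variable {e : ℝ} (he : 0 < e) (hmem : ∀ t ∈ Icc 0 S.T, u t ∈ S.sublevel e)
include he hmem

theorem jumpVariation_ne_top' {s t : ℝ} (hs : 0 ≤ s) (hst : s < t) (ht : t ≤ S.T) :
    jumpVariation S.finslerCost S.T u s t ≠ ∞ :=
  ne_top_of_le_ne_top (h.jumpVariation_ne_top hS hu hg hgd)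
    (hS.jumpVariation_finslerCost_le hu he hmem (fun _ => h.stable hS) hs hst ht)

/-- The energy balance on subintervals. -/
theorem energy_balance_sub {s t : ℝ} (hs : 0 ≤ s) (hst : s < t) (ht : t ≤ S.T) :
    (∫ r in Ioo s t, S.Ψ ((Ioo 0 S.T).indicator g r) ∂(lineMeasure hS.T_pos hu)) +
      (jumpVariation S.finslerCost S.T u s t).toReal + S.E t (u t) =
    S.E s (u s) + ∫ r in Ioo s t, S.power r (u r) := by
  have hT := hS.T_pos
  have ht' := ((energy_balance_iff hS hu hg hgd ⟨hs.trans_lt hst, ht⟩).1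
    (h.energy_balance t ⟨hs.trans_lt hst, ht⟩)).2
  rcases hs.eq_or_lt with rfl | hs0
  · exact ht'
  have hs' := ((energy_balance_iff hS hu hg hgd ⟨hs0, hst.le.trans ht⟩).1
    (h.energy_balance s ⟨hs0, hst.le.trans ht⟩)).2
  have hsplit : ∀ (μ : Measure ℝ) [NullSingletonClass μ] (f : ℝ → ℝ), IntegrableOn f (Ioo 0 S.T) μ →
      ∫ r in Ioo 0 t, f r ∂μ = (∫ r in Ioo 0 s, f r ∂μ) + ∫ r in Ioo s t, f r ∂μ := by
    intro μ _ f hf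
    rw [← setIntegral_congr_set (Ioo_ae_eq_Ioc (a := 0) (b := s)).symm,
      ← setIntegral_union (Set.disjoint_left.2 fun x hx hx' => not_lt.2 hx.2 hx'.1)
        measurableSet_Ioo (hf.mono_set fun r hr => ⟨hr.1, hr.2.trans_lt (hst.trans_le ht)⟩)
        (hf.mono_set fun r hr => ⟨hs0.trans hr.1, hr.2.trans_le ht⟩),
      Ioc_union_Ioo_eq_Ioo hs0.le hst]
  have hΨi := hS.isGauge.integrable_comp (integrable_indicator_density hT hu hg)
  rw [hsplit _ _ hΨi.integrableOn, hsplit _ _ (h.integrableOn_power hS),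
    hS.jumpVariation_finslerCost_split hu he hmem (fun _ => h.stable hS) le_rfl hs0 hst ht,
    ENNReal.toReal_add (h.jumpVariation_ne_top' hS hu hg hgd he hmem le_rfl hs0 (hst.le.trans ht))
      (h.jumpVariation_ne_top' hS hu hg hgd he hmem hs0.le hst ht)] at ht'
  linarith

/-- Discarding the nonnegative jump cost from the balance on (s, t) bounds the left energy quotient
by an average of the density of P minus Ψ(g), which converges at l-a.e. t. This is the hypothesis of
`ae_inclusion_of_left_quotient`. -/
theorem inclusionBV : S.InclusionBV hS.T_pos hu := by
  have hT := hS.T_pos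
  refine ⟨g, hg, hgd, ?_⟩
  rw [← lineMeasure_restrict, ae_restrict_iff' measurableSet_Ioo]
  set l := lineMeasure hT hu with hl
  have hl1 : volume ≤ l := volume_le_lineMeasure hT hu
  set G := (Ioo 0 S.T).indicator g with hG
  set p : ℝ → ℝ := (Ioo 0 S.T).indicator fun s => S.power s (u s) with hp
  have hpi : Integrable p :=
    (integrable_indicator_iff measurableSet_Ioo).2 (h.integrableOn_power hS)
  have hΨi : Integrable (fun t => S.Ψ (G t)) l :=
    hS.isGauge.integrable_comp (integrable_indicator_density hT hu hg)
  have hdp : Integrable (fun t => lebesgueDensity l t * p t) l :=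
    integrable_lebesgueDensity_mul hl1 hpi
  filter_upwards [hS.ae_inclusion_of_left_quotient hu he hmem hg hgd,
    ae_tendsto_inv_mul_integral hl1 (hdp.sub hΨi).locallyIntegrable] with t hincl hlim ht
  have hnb : (𝓝[<] t ⊓ 𝓟 (jumpSet S.T u)ᶜ).NeBot := neBot_left_jumpSet_compl hu hT t
  refine hincl ht (fun s => (l.real (Icc s t))⁻¹ *
    ∫ x in Ioo s t, (lebesgueDensity l x * p x - S.Ψ (G x)) ∂l)
    (𝓝[<] t ⊓ 𝓟 (jumpSet S.T u)ᶜ) inf_le_left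
    (hS.eventually_stable_left hu he hmem (fun _ => h.stable hS) ⟨ht.1, ht.2.le⟩) ?_ ?_
  · filter_upwards [mem_inf_of_left (Ioo_mem_nhdsLT ht.1)] with s hs
    refine mul_le_mul_of_nonneg_left ?_ (inv_nonneg.2 measureReal_nonneg)
    have h1 := h.energy_balance_sub hS hu hg hgd he hmem hs.1.le hs.2 ht.2.le
    have h2 : 0 ≤ (jumpVariation S.finslerCost S.T u s t).toReal := ENNReal.toReal_nonneg
    rw [integral_sub hdp.integrableOn hΨi.integrableOn,
      setIntegral_lebesgueDensity_mul hl1 _ measurableSet_Ioo,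
      setIntegral_congr_fun (g := fun r => S.power r (u r)) measurableSet_Ioo fun r hr =>
        indicator_of_mem (show r ∈ Ioo 0 S.T from ⟨hs.1.trans hr.1, hr.2.trans ht.2⟩)
          fun s => S.power s (u s)]
    linarith
  · have h1 := hlim.2.mono_left (inf_le_left (b := 𝓟 (jumpSet S.T u)ᶜ))
    have h2 : p t = S.power t (u t) := indicator_of_mem ht _
    rw [← h2]
    exact h1

theorem tendsto_integral_power_left {t : ℝ} (ht : t ∈ Ioc 0 S.T) :
    Tendsto (fun s => ∫ r in Ioo s t, S.power r (u r)) (𝓝[<] t) (𝓝 0) := by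
  obtain ⟨M, hM, hP, -⟩ := hS.exists_lipschitz e
  have h1 : Tendsto (fun s => M * (t - s)) (𝓝[<] t) (𝓝 0) := by
    have : Continuous fun s => M * (t - s) := by fun_prop
    simpa using (this.tendsto t).mono_left nhdsWithin_le_nhds
  refine squeeze_zero_norm' ?_ h1
  filter_upwards [Ioo_mem_nhdsLT ht.1] with s hs
  have h2 := norm_setIntegral_le_of_norm_le_const (μ := volume) (s := Ioo s t) (C := M)
    measure_Ioo_lt_top (f := fun r => S.power r (u r)) fun r hr => by
      have hr' : r ∈ Ioo 0 S.T := ⟨hs.1.trans hr.1, hr.2.trans_le ht.2⟩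
      exact hP r hr' _ (hmem r (Ioo_subset_Icc_self hr'))
  rwa [Real.volume_real_Ioo_of_le hs.2.le] at h2

theorem tendsto_integral_power_right {t : ℝ} (ht : t ∈ Ico 0 S.T) :
    Tendsto (fun s => ∫ r in Ioo t s, S.power r (u r)) (𝓝[>] t) (𝓝 0) := by
  obtain ⟨M, hM, hP, -⟩ := hS.exists_lipschitz e
  have h1 : Tendsto (fun s => M * (s - t)) (𝓝[>] t) (𝓝 0) := by
    have : Continuous fun s => M * (s - t) := by fun_prop
    simpa using (this.tendsto t).mono_left nhdsWithin_le_nhds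
  refine squeeze_zero_norm' ?_ h1
  filter_upwards [Ioo_mem_nhdsGT ht.2] with s hs
  have h2 := norm_setIntegral_le_of_norm_le_const (μ := volume) (s := Ioo t s) (C := M)
    measure_Ioo_lt_top (f := fun r => S.power r (u r)) fun r hr => by
      have hr' : r ∈ Ioo 0 S.T := ⟨ht.1.trans_lt hr.1, hr.2.trans hs.2⟩
      exact hP r hr' _ (hmem r (Ioo_subset_Icc_self hr'))
  rwa [Real.volume_real_Ioo_of_le hs.1.le] at h2

variable (hV : RadonNikodymProperty V)
include hV

omit h he hmem hg hgd in
theorem _root_.BalancedViscosity.RIS.finslerCost_toReal_eq {t : ℝ} (ht : t ∈ Icc 0 S.T) {x y : V}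
    (hfin : S.finslerCost t x y ≠ ∞) (hle : (S.finslerCost t x y).toReal ≤ S.E t x - S.E t y) :
    (S.finslerCost t x y).toReal = S.E t x - S.E t y := by
  refine le_antisymm hle ?_
  exact (ENNReal.ofReal_le_iff_le_toReal hfin).1 (hS.energy_sub_le_finslerCost hV ht x y)

/-- The balance on [s, t] contains the left half jump at t. As s increases to t along non-jump
times, the power integral vanishes and the energy converges to its value at the left limit, so the
cost is at most the energy drop; the static inequality gives equality. -/
theorem finslerCost_left {t : ℝ} (ht : t ∈ Ioc 0 S.T) :
    S.finslerCost t (leftLimit S.T u t) (u t) ≠ ∞ ∧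
      (S.finslerCost t (leftLimit S.T u t) (u t)).toReal =
        S.E t (leftLimit S.T u t) - S.E t (u t) := by
  have hle : ∀ s, S.finslerCost t (leftLimit S.T u t) (u t) ≤
      jumpVariation S.finslerCost S.T u s t := fun s => by
    rw [jumpVariation]; exact le_add_self.trans le_self_add
  have hfin := ne_top_of_le_ne_top
    (h.jumpVariation_ne_top' hS hu hg hgd he hmem le_rfl ht.1 ht.2) (hle 0)
  refine ⟨hfin, finslerCost_toReal_eq hS hV (Ioc_subset_Icc_self ht) hfin ?_⟩
  have hnb : (𝓝[<] t ⊓ 𝓟 (jumpSet S.T u)ᶜ).NeBot := neBot_left_jumpSet_compl hu hS.T_pos t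
  have hlim := ((hS.stable_tendsto_left hu he hmem (fun _ => h.stable hS) ht).2.sub_const
    (S.E t (u t))).add ((h.tendsto_integral_power_left hS hu hg hgd he hmem ht).mono_left
      (inf_le_left (b := 𝓟 (jumpSet S.T u)ᶜ)))
  rw [add_zero] at hlim
  refine ge_of_tendsto hlim ?_
  filter_upwards [mem_inf_of_left (Ioo_mem_nhdsLT ht.1)] with s hs
  have h1 := h.energy_balance_sub hS hu hg hgd he hmem hs.1.le hs.2 ht.2
  have h2 : 0 ≤ ∫ r in Ioo s t, S.Ψ ((Ioo 0 S.T).indicator g r) ∂(lineMeasure hS.T_pos hu) :=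
    integral_nonneg fun _ => hS.isGauge.nonneg _
  have h3 := ENNReal.toReal_mono
    (h.jumpVariation_ne_top' hS hu hg hgd he hmem hs.1.le hs.2 ht.2) (hle s)
  linarith

theorem finslerCost_right {t : ℝ} (ht : t ∈ Ico 0 S.T) :
    S.finslerCost t (u t) (rightLimit S.T u t) ≠ ∞ ∧
      (S.finslerCost t (u t) (rightLimit S.T u t)).toReal =
        S.E t (u t) - S.E t (rightLimit S.T u t) := by
  have hle : ∀ s, S.finslerCost t (u t) (rightLimit S.T u t) ≤
      jumpVariation S.finslerCost S.T u t s := fun s => by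
    rw [jumpVariation]; exact le_self_add.trans le_self_add
  have hfin := ne_top_of_le_ne_top
    (h.jumpVariation_ne_top' hS hu hg hgd he hmem ht.1 ht.2 le_rfl) (hle S.T)
  refine ⟨hfin, finslerCost_toReal_eq hS hV (Ico_subset_Icc_self ht) hfin ?_⟩
  have hnb : (𝓝[>] t ⊓ 𝓟 (jumpSet S.T u)ᶜ).NeBot := neBot_right_jumpSet_compl hu hS.T_pos t
  have hlim := ((hS.stable_tendsto_right hu he hmem (fun _ => h.stable hS) ht).2.const_sub
    (S.E t (u t))).add ((h.tendsto_integral_power_right hS hu hg hgd he hmem ht).mono_left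
      (inf_le_left (b := 𝓟 (jumpSet S.T u)ᶜ)))
  rw [add_zero] at hlim
  refine ge_of_tendsto hlim ?_
  filter_upwards [mem_inf_of_left (Ioo_mem_nhdsGT ht.2)] with s hs
  have h1 := h.energy_balance_sub hS hu hg hgd he hmem ht.1 hs.1 hs.2.le
  have h2 : 0 ≤ ∫ r in Ioo t s, S.Ψ ((Ioo 0 S.T).indicator g r) ∂(lineMeasure hS.T_pos hu) :=
    integral_nonneg fun _ => hS.isGauge.nonneg _
  have h3 := ENNReal.toReal_mono
    (h.jumpVariation_ne_top' hS hu hg hgd he hmem ht.1 hs.1 hs.2.le) (hle s)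
  linarith

theorem jumpConditions : S.JumpConditions u := by
  intro t htJ
  have hT := hS.T_pos
  have ht : t ∈ Icc 0 S.T := htJ.1
  have hl : S.finslerCost t (leftLimit S.T u t) (u t) ≠ ∞ ∧
      (S.finslerCost t (leftLimit S.T u t) (u t)).toReal =
        S.E t (leftLimit S.T u t) - S.E t (u t) := by
    -- At t = 0 the left limit is u 0 by convention, and the condition asks that staying at u 0 be
    -- free. The subdifferential may be empty there, so `finslerCost_self` is used with the finite
    -- cost of the right half jump; t = T is symmetric.
    rcases ht.1.eq_or_lt with rfl | h0
    · rw [leftLimit_zero hT, hS.finslerCost_self hV ht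
        (Or.inl (h.finslerCost_right hS hu hg hgd he hmem hV ⟨le_rfl, hT⟩).1)]
      simp
    · exact h.finslerCost_left hS hu hg hgd he hmem hV ⟨h0, ht.2⟩
  have hr : S.finslerCost t (u t) (rightLimit S.T u t) ≠ ∞ ∧
      (S.finslerCost t (u t) (rightLimit S.T u t)).toReal =
        S.E t (u t) - S.E t (rightLimit S.T u t) := by
    rcases ht.2.eq_or_lt with rfl | h0
    · rw [rightLimit_end hT, hS.finslerCost_self hV ht
        (Or.inr (h.finslerCost_left hS hu hg hgd he hmem hV ⟨hT, le_rfl⟩).1)]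
      simp
    · exact h.finslerCost_right hS hu hg hgd he hmem hV ⟨ht.1, h0⟩
  have htri := hS.finslerCost_triangle ht (leftLimit S.T u t) (u t) (rightLimit S.T u t)
  have hsum := ENNReal.add_ne_top.2 ⟨hl.1, hr.1⟩
  have hfin := ne_top_of_le_ne_top hsum htri
  have hm : (S.finslerCost t (leftLimit S.T u t) (rightLimit S.T u t)).toReal =
      S.E t (leftLimit S.T u t) - S.E t (rightLimit S.T u t) := by
    -- The triangle inequality bounds the direct cost by the sum of the half-jump costs, which is
    -- the total energy drop; this drop is also a lower bound, so equality holds throughout.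
    refine finslerCost_toReal_eq hS hV ht hfin ?_
    have h1 := ENNReal.toReal_mono hsum htri
    rw [ENNReal.toReal_add hl.1 hr.1, hl.2, hr.2] at h1
    linarith
  refine ⟨ereal_coe_eq_neg_iff.2 ⟨hl.1, by rw [hl.2, neg_sub]⟩,
    ereal_coe_eq_neg_iff.2 ⟨hr.1, by rw [hr.2, neg_sub]⟩,
    ereal_coe_eq_neg_iff.2 ⟨hfin, by rw [hm, neg_sub]⟩, ?_⟩
  rw [← ENNReal.toReal_eq_toReal_iff' hfin hsum, ENNReal.toReal_add hl.1 hr.1, hl.2, hr.2, hm]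
  ring

end IsBVSolution

end RIS

end

end BalancedViscosity

end

theorem mainTheorem11 {V : Type*} [NormedAddCommGroup V] [NormedSpace ℝ V] [CompleteSpace V]
    [TopologicalSpace.SeparableSpace V] (hV : BalancedViscosity.RadonNikodymProperty V)
    (S : BalancedViscosity.RIS V) (hS : S.Admissible)
    (u : ℝ → V) (hu : BoundedVariationOn u (Icc 0 S.T)) :
    (S.IsBVSolution u ↔
      ((∃ e > 0, ∀ t ∈ Icc 0 S.T, u t ∈ S.sublevel e) ∧
        S.InclusionBV hS.T_pos hu ∧ S.JumpConditions u)) ∧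
    (S.InclusionBV hS.T_pos hu → S.InclusionAE u) := by
  refine ⟨⟨fun h => ?_, ?_⟩, fun h => h.inclusionAE⟩
  · obtain ⟨g, hg, hgd⟩ := BalancedViscosity.exists_density hS.T_pos hu hV
    obtain ⟨e, he, hmem⟩ := h.exists_sublevel hS hu hg hgd
    exact ⟨⟨e, he, hmem⟩, h.inclusionBV hS hu hg hgd he hmem,
      h.jumpConditions hS hu hg hgd he hmem hV⟩
  · rintro ⟨⟨e, he, hmem⟩, hinc, hjc⟩
    exact BalancedViscosity.RIS.isBVSolution_of_inclusion hS hu he hmem hinc hjc
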